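/- Setting. Let $\Omega=(-\pi,\pi)^3$ and let $|\cdot|$, $\langle\cdot,\cdot\rangle$ be the norm and inner product of $L^2(\Omega)^3$. Let $\mathcal V$ be the set of real $2\pi$-periodic trigonometric polynomial vector fields on $\mathbb R^3$ that are divergence-free and have zero average over $\Omega$; let $H$ and $V$ be the closures of $\mathcal V$ in $L^2(\Omega)^3$ and $H^1(\Omega)^3$, and $V'$ the dual of $V$, with $V\subset H\subset V'$. For $u=\sum_{k\in\mathbb Z^3\setminus\{0\}}\hat u(k)e^{ik\cdot x}\in H$ and $\alpha,\sigma\ge 0$ put $$|u|_{\alpha,\sigma}=|A^\alpha e^{\sigma A^{1/2}}u|=\Big|\sum_{k\neq 0}|k|^{2\alpha}e^{\sigma|k|}\hat u(k)e^{ik\cdot x}\Big|\in[0,\infty],\qquad G_{\alpha,\sigma}=\{u\in H:|u|_{\alpha,\sigma}<\infty\},\qquad |A^\alpha u|=|u|_{\alpha,0},$$ and $\mathcal D(A^\alpha)=G_{\alpha,0}$ with the norm $|A^\alpha u|$. Let $\langle Au,v\rangle=\sum_i\langle\partial_iu,\partial_iv\rangle$ and $\langle B(u,v),w\rangle=b(u,v,w)=\int_\Omega((u\cdot\nabla)v)\cdot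 w\,dx$ for $u,v,w\in V$. Consider the Navier–Stokes equations (viscosity $1$) $$u'(t)+Au(t)+B(u(t),u(t))=f(t)\ \text{ in }V'\text{ on }(0,\infty),\qquad u(0)=u^0\in H,\qquad(\ast)$$ where $f\in L^\infty_{\rm loc}([0,\infty),H)$. A weak solution is a map $u:[0,\infty)\to H$ that is weakly continuous, lies in $L^2_{\rm loc}([0,\infty),V)$, has $u'\in L^{4/3}_{\rm loc}([0,\infty),V')$, and satisfies the equation tested with every $v\in V$, in the sense of distributions on $(0,\infty)$. It is a Leray–Hopf weak solution if moreover $\frac12|u(t)|^2+\int_{t_0}^t|\nabla u|^2d\tau\le\frac12|u(t_0)|^2+\int_{t_0}^t\langle f,u\rangle d\tau$ for $t_0=0$ and almost every $t_0>0$, and all $t\ge t_0$. Statement. There is an absolute constant $K>1$ such that, for all $\alpha\ge\frac12$, $\sigma\ge0$, $$|B(u,v)|_{\alpha,\sigma}\le K^\alpha|u|_{\alpha+1/2,\sigma}|v|_{\alpha+1/2,\sigma}\qquad\text{for all }u,v\in G_{\alpha+1/2,\sigma},\qquad(\ast\ast)$$ where in particular $B(u,v)\in H$. For every constant $K>1$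 with this property the following holds. Let $\delta\in(0,1)$, $\lambda\in(1-\delta,1]$, $\sigma\ge0$, $\alpha\ge\frac12$, and put $$C_0=\frac{\delta}{6K^\alpha},\quad C_1=\frac{2}{\sqrt3}\sqrt{\delta(\lambda-1+\delta)}\,C_0\quad\text{if }\sigma>0,\qquad C_0=\frac{\delta}{4K^\alpha},\quad C_1=\sqrt2\sqrt{\delta(\lambda-1+\delta)}\,C_0\quad\text{if }\sigma=0.$$ Suppose $u^0\in H$, $|A^\alpha u^0|\le C_0$, and $|f(t)|_{\alpha-1/2,\sigma}\le C_1e^{-\lambda t}$ for all $t\ge0$. Then there is a Leray–Hopf weak solution $u$ of $(\ast)$ with $u\in C([0,\infty),\mathcal D(A^\alpha))$; it is the only weak solution of $(\ast)$ in $C([0,\infty),\mathcal D(A^\alpha))$; and for all $t\ge t_*=6\sigma/\delta$, $$|u(t)|_{\alpha,\sigma}\le\sqrt2\,C_0e^{-(1-\delta)t},\qquad \int_t^{t+1}|u(\tau)|_{\alpha+1/2,\sigma}^2d\tau\le\frac{3C_0^2}{2(1-\delta)}e^{-2(1-\delta)t}.$$ -/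

import Mathlib

open MeasureTheory Set Filter Topology
open scoped ENNReal

noncomputable section

namespace NSE

/-- Euclidean three-space, both for positions and for vector values. -/
abbrev E3 : Type := EuclideanSpace ℝ (Fin 3)

/-- The periodicity cell `(-π, π)³` (period `L = 2π`). -/
def Omega : Set E3 := {x | ∀ i, x i ∈ Ioo (-Real.pi) Real.pi}

/-- Lebesgue measure on the periodicity cell. -/
def cellMeasure : Measure E3 := volume.restrict Omega

/-- `L²(Ω)³`, with `⟪u, v⟫ = ∫_Ω u · v dx`. -/
abbrev L2 : Type := Lp E3 2 cellMeasure

/-- The phase `k · x` for a wave vector `k ∈ ℤ³`. -/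
def phase (k : Fin 3 → ℤ) (x : E3) : ℝ := ∑ i, (k i : ℝ) * x i

/-- The partial derivative `∂v/∂xᵢ` of a vector field. -/
def partialDeriv (i : Fin 3) (v : E3 → E3) (x : E3) : E3 :=
  fderiv ℝ v x (EuclideanSpace.single i 1)

/-- Real `2π`-periodic trigonometric polynomial vector fields. -/
def TrigPoly : Submodule ℝ (E3 → E3) :=
  Submodule.span ℝ {w | ∃ (k : Fin 3 → ℤ) (a : E3),
    (w = fun x => Real.cos (phase k x) • a) ∨ (w = fun x => Real.sin (phase k x) • a)}

/-- `𝒱`: the trigonometric polynomial vector fields that are divergence-free and have zero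
average over `Ω`. -/
def TestField : Set (E3 → E3) :=
  {v | v ∈ TrigPoly ∧ (∀ x, ∑ i, (partialDeriv i v x) i = 0) ∧ ∫ x, v x ∂cellMeasure = 0}

/-- `H`, the closure of `𝒱` in `L²(Ω)³`.  (`𝒱` is a vector space; the span only bundles it.) -/
def H : Submodule ℝ L2 :=
  (Submodule.span ℝ {u : L2 | ∃ v ∈ TestField, u =ᵐ[cellMeasure] v}).topologicalClosure

/-- Pairs `(v, (∂₁v, ∂₂v, ∂₃v))` of a field and its first partial derivatives, with the Hilbert
norm `(|v|² + ∑ᵢ |∂ᵢv|²)^{1/2}` of `H¹(Ω)³`.  `H¹(Ω)³` is a closed subspace of this space through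
`v ↦ (v, ∇v)`. -/
abbrev H1Pair : Type := WithLp 2 (L2 × PiLp 2 (fun _ : Fin 3 => L2))

/-- `V`, the closure of `𝒱` in `H¹(Ω)³`; an element carries the field and its weak gradient, and
the norm is that of `H¹(Ω)³`. -/
def V : Submodule ℝ H1Pair :=
  (Submodule.span ℝ {p : H1Pair | ∃ v ∈ TestField, p.fst =ᵐ[cellMeasure] v ∧
    ∀ i, p.snd i =ᵐ[cellMeasure] partialDeriv i v}).topologicalClosure

/-- The field underlying an element of `V` (the embedding of `V` into `L²(Ω)³`). -/
def field (p : V) : L2 := (p : H1Pair).fst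

/-- The weak gradient of an element of `V`, as the family of its partial derivatives. -/
def grad (p : V) : PiLp 2 (fun _ : Fin 3 => L2) := (p : H1Pair).snd

/-- The dual space `V'`. -/
abbrev VDual : Type := V →L[ℝ] ℝ

/-- `b(u, v, w) = ∫_Ω ((u · ∇) v) · w dx`. -/
def trilinear (u v w : V) : ℝ :=
  ∫ x, inner ℝ (∑ i, ((field u : E3 → E3) x i) • (grad v i : E3 → E3) x)
    ((field w : E3 → E3) x) ∂cellMeasure

/-- The Fourier coefficient `û(k) = (2π)⁻³ ∫_Ω u(x) e^{-i k·x} dx ∈ ℂ³`. -/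
def fourierCoeffVec (u : L2) (k : Fin 3 → ℤ) : EuclideanSpace ℂ (Fin 3) :=
  WithLp.toLp 2 fun j => ((2 * Real.pi : ℝ) : ℂ)⁻¹ ^ 3 *
    ∫ x, (((u : E3 → E3) x j : ℝ) : ℂ) * Complex.exp (-(Complex.I * (phase k x : ℂ))) ∂cellMeasure

/-- The Euclidean length `|k|` of a wave vector. -/
def waveLength (k : Fin 3 → ℤ) : ℝ := Real.sqrt (∑ i, (k i : ℝ) ^ 2)

/-- The Gevrey norm `|u|_{α,σ} = |A^α e^{σ A^{1/2}} u| ∈ [0, ∞]`, i.e. the `L²(Ω)³` norm of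
`∑_{k ≠ 0} |k|^{2α} e^{σ|k|} û(k) e^{i k·x}`, computed by Parseval's identity on `Ω`
(of volume `(2π)³`); it is `∞` exactly when that series is not in `L²(Ω)³`. -/
def gevreyNorm (α σ : ℝ) (u : L2) : ℝ≥0∞ :=
  (ENNReal.ofReal ((2 * Real.pi) ^ 3) * ∑' k : {k : Fin 3 → ℤ // k ≠ 0},
    ENNReal.ofReal ((waveLength k ^ (2 * α) * Real.exp (σ * waveLength k) *
      ‖fourierCoeffVec u k‖) ^ 2)) ^ (1 / 2 : ℝ)

/-- `u ∈ C([0, ∞), 𝒟(A^α))`, where `𝒟(A^α) = {u ∈ H : |A^α u| < ∞}` with the norm `|A^α ·|`. -/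
def ContinuousInDomain (α : ℝ) (u : ℝ → H) : Prop :=
  (∀ t, 0 ≤ t → gevreyNorm α 0 (u t) < ⊤) ∧
  ∀ t, 0 ≤ t → Tendsto (fun s => gevreyNorm α 0 ((u s : L2) - (u t : L2))) (𝓝[Ici 0] t) (𝓝 0)

/-- `g ∈ L^p_loc([0, ∞), X)`. -/
def MemLpLoc {X : Type*} [NormedAddCommGroup X] (p : ℝ≥0∞) (g : ℝ → X) : Prop :=
  ∀ T : ℝ, 0 < T → MemLp g p (volume.restrict (Icc 0 T))

/-- `y' = z` in the sense of distributions on `(0, ∞)`. -/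
def HasDistribDeriv (y z : ℝ → ℝ) : Prop :=
  ∀ φ : ℝ → ℝ, ContDiff ℝ ((⊤ : ℕ∞) : WithTop ℕ∞) φ → HasCompactSupport φ → tsupport φ ⊆ Ioi 0 →
    ∫ t in Ioi (0 : ℝ), deriv φ t * y t = -∫ t in Ioi (0 : ℝ), φ t * z t

/-- `u : [0, ∞) → H` is a weak solution of `u' + Au + B(u,u) = f` in `V'` on `(0, ∞)`:
`u ∈ C([0,∞), H_w) ∩ L²_loc([0,∞), V)`, `u' ∈ L^{4/3}_loc([0,∞), V')`, and
`d/dt ⟨u, v⟩ + ⟪u, v⟫ + b(u, u, v) = ⟨f, v⟩` in the sense of distributions for all `v ∈ V`.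
Here `U t` is `u t` regarded as an element of `V`, for almost every `t`. -/
structure IsWeakSolution (f u : ℝ → H) (U : ℝ → V) : Prop where
  weakly_continuous : ∀ w : H, ContinuousOn (fun t => inner ℝ (u t) w) (Ici 0)
  field_eq : ∀ᵐ t ∂(volume.restrict (Ici (0 : ℝ))), field (U t) = (u t : L2)
  memLp_V : MemLpLoc 2 U
  memLp_deriv : ∃ u' : ℝ → VDual, MemLpLoc (4 / 3) u' ∧
    ∀ v : V, HasDistribDeriv (fun t => inner ℝ (u t : L2) (field v)) (fun t => u' t v)
  equation : ∀ v : V, HasDistribDeriv (fun t => inner ℝ (u t : L2) (field v))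
    (fun t => inner ℝ (f t : L2) (field v) - inner ℝ (grad (U t)) (grad v)
      - trilinear (U t) (U t) v)

/-- The energy inequality on `[t₀, t]` for all `t ≥ t₀`. -/
def EnergyInequality (f u : ℝ → H) (U : ℝ → V) (t₀ : ℝ) : Prop :=
  ∀ t, t₀ ≤ t → 1 / 2 * ‖u t‖ ^ 2 + ∫ τ in t₀..t, ‖grad (U τ)‖ ^ 2 ≤
    1 / 2 * ‖u t₀‖ ^ 2 + ∫ τ in t₀..t, inner ℝ (f τ) (u τ)

/-- Leray-Hopf weak solutions: weak solutions satisfying the energy inequality for `t₀ = 0` and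
for almost all `t₀ > 0`. -/
def IsLerayHopf (f u : ℝ → H) : Prop :=
  ∃ U : ℝ → V, IsWeakSolution f u U ∧ EnergyInequality f u U 0 ∧
    ∀ᵐ t₀ ∂(volume.restrict (Ioi (0 : ℝ))), EnergyInequality f u U t₀

/-- `K` is admissible in the bilinear estimate
`|B(u,v)|_{α,σ} ≤ K^α |u|_{α+1/2,σ} |v|_{α+1/2,σ}` for all `α ≥ 1/2`, `σ ≥ 0` and all
`u, v ∈ G_{α+1/2,σ}`.  Here `B(u,v) ∈ V'` is the functional `b(u,v,·)`, and the estimate includes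
that this functional is an element `w` of `H`. -/
def BilinearBound (K : ℝ) : Prop :=
  ∀ α σ : ℝ, 1 / 2 ≤ α → 0 ≤ σ → ∀ u v : V,
    gevreyNorm (α + 1 / 2) σ (field u) < ⊤ → gevreyNorm (α + 1 / 2) σ (field v) < ⊤ →
    ∃ w : H, (∀ z : V, inner ℝ (w : L2) (field z) = trilinear u v z) ∧
      gevreyNorm α σ w ≤ ENNReal.ofReal (K ^ α) *
        gevreyNorm (α + 1 / 2) σ (field u) * gevreyNorm (α + 1 / 2) σ (field v)

/-- The bound `C₀` on the initial data. -/
def C0 (K α δ σ : ℝ) : ℝ := if 0 < σ then δ / (6 * K ^ α) else δ / (4 * K ^ α)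

/-- The bound `C₁` on the force. -/
def C1 (K α δ lam σ : ℝ) : ℝ :=
  if 0 < σ then 2 / Real.sqrt 3 * Real.sqrt (δ * (lam - 1 + δ)) * C0 K α δ σ
  else Real.sqrt 2 * Real.sqrt (δ * (lam - 1 + δ)) * C0 K α δ σ

end NSE

end

noncomputable section

namespace NSE

/-! Everything is read off from Fourier coefficients. Put a_k = |k|^{2α} û(k). Then |A^α u| is
(2π)^{3/2} times the ℓ² norm of a, and because α ≥ 1/2 every admissible a in `ell` comes from an
element of `V` (`toV`). The unknown becomes a curve in `ell`, and the equation takes the mild form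
a(t) = e^{-tA} a(0) + A^{7/8} ∫₀ᵗ e^{-(t-s)A} (F(s) - β(a(s), a(s))) ds, with β(a, b) = A^{α-7/8}
B(A^{-α} a, A^{-α} b) and F = A^{α-7/8} f. The map β (`beta`) is bounded on `ell`, since its kernel
is controlled by the convergent sum ∑ |k|^{-7/2}; the heat semigroup pays for A^{7/8} with an
integrable singularity (`enorm_duh_le`, `tame_duh`).

Existence: β is composed with the radial retraction onto the ball |A^α u|² ≤ 2 C₀². The truncated
nonlinearity is bounded and globally Lipschitz, so in a supremum norm weighted by e^{-γt} with γ
large the mild equation is a contraction on all of [0, ∞). The contraction constant is the same for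
the full equation and for all Galerkin truncations (`contracting_mildMap`), hence the Galerkin
solutions converge strongly in `ell` at every time (`exists_isMild`) and no compactness argument is
needed.

A priori bound: for finitely many modes, e^{2μt} |u|²_{α,s(t)} may be differentiated with a Gevrey
index s(t) growing linearly (`energy_weighted`). Since |k| ≤ |k|², both the exponential factor and
the growth of s are charged to the dissipation. The bilinear estimate bounds the nonlinear term by
K^α |u|_{α,s} |u|²_{α+1/2,s}, which is absorbed as long as |u|²_{α,s} ≤ 2 C₀². With μ = 1 - δ and
s(t) = min(δt/6, σ) the outcome is e^{2(1-δ)t} |u|² ≤ (1 + 10/11) C₀² < 2 C₀², so by continuity the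
threshold is never reached (`first_exit`, `galerkin_growth`). The retraction therefore never acts
and the limit solves the true equation. The Gevrey bounds pass to the limit by lower semicontinuity
and Fatou, the energy balance by dominated convergence.

Uniqueness: a weak solution that is continuous in 𝒟(A^α) can be tested with single modes. This
yields the mild equation (`mild_of_isPrim`), and the contraction estimate applied on a bounded
interval identifies any two solutions (`eq_of_mild`).

The estimate (∗∗) itself comes from distributing |k|^{2α} e^{σ|k|} over the two factors of the
convolution and from ∑ |k|^{-4} < ∞ (`gwt_conv`, `gsum_convB_le`). -/

/-- Wave vectors. -/
abbrev Z3 : Type := Fin 3 → ℤ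

/-- Values of Fourier coefficients. -/
abbrev C3 : Type := EuclideanSpace ℂ (Fin 3)

/-! ### Fourier series and Parseval's identity on the cell -/

/-- The exponential `e^{i k·x}`. -/
def expPhase (k : Z3) (x : E3) : ℂ := Complex.exp (Complex.I * (phase k x : ℂ))

lemma continuous_phase (k : Z3) : Continuous (phase k) := by
  unfold phase; fun_prop

lemma continuous_expPhase (k : Z3) : Continuous (expPhase k) := by
  have := continuous_phase k
  unfold expPhase; fun_prop

lemma norm_expPhase (k : Z3) (x : E3) : ‖expPhase k x‖ = 1 := by
  rw [expPhase, mul_comm]; exact Complex.norm_exp_ofReal_mul_I _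

lemma phase_add (k l : Z3) (x : E3) : phase (k + l) x = phase k x + phase l x := by
  simp [phase, add_mul, Finset.sum_add_distrib]

lemma phase_neg (k : Z3) (x : E3) : phase (-k) x = -phase k x := by
  simp [phase]

lemma expPhase_add (k l : Z3) (x : E3) : expPhase (k + l) x = expPhase k x * expPhase l x := by
  rw [expPhase, phase_add, expPhase, expPhase, ← Complex.exp_add]; push_cast; ring_nf

lemma expPhase_zero (x : E3) : expPhase 0 x = 1 := by simp [expPhase, phase]

lemma conj_expPhase (k : Z3) (x : E3) :
    (starRingEnd ℂ) (expPhase k x) = expPhase (-k) x := by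
  rw [expPhase, expPhase, ← Complex.exp_conj, phase_neg]; simp

lemma expPhase_eq (k : Z3) (x : E3) : expPhase k x =
    (Real.cos (phase k x) : ℂ) + (Real.sin (phase k x) : ℂ) * Complex.I := by
  rw [expPhase, mul_comm, Complex.exp_mul_I]; push_cast; rfl

lemma integral_cell_prod (f : Fin 3 → ℝ → ℂ) :
    ∫ x : E3, ∏ i, f i (x i) ∂cellMeasure = ∏ i, ∫ t in Ioo (-Real.pi) Real.pi, f i t := by
  have hp := PiLp.volume_preserving_toLp (Fin 3)
  have he : MeasurableEmbedding (WithLp.toLp 2 : (Fin 3 → ℝ) → E3) :=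
    (MeasurableEquiv.toLp 2 (Fin 3 → ℝ)).measurableEmbedding
  have h1 := hp.setIntegral_preimage_emb he (fun x : E3 => ∏ i, f i (x i)) Omega
  rw [cellMeasure, ← h1]
  have h2 : (WithLp.toLp 2 : (Fin 3 → ℝ) → E3) ⁻¹' Omega
      = Set.univ.pi fun _ => Ioo (-Real.pi) Real.pi := by
    ext x; simp [Omega]
  rw [h2, volume_pi, Measure.restrict_pi_pi]
  exact integral_fintype_prod_eq_prod (μ := fun _ : Fin 3 => volume.restrict (Ioo (-Real.pi) Real.pi)) f

lemma integral_exp_int (n : ℤ) :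
    ∫ t in Ioo (-Real.pi) Real.pi, Complex.exp (Complex.I * ((n : ℝ) * t : ℝ)) =
      if n = 0 then ((2 * Real.pi : ℝ) : ℂ) else 0 := by
  have hpi : -Real.pi ≤ Real.pi := by linarith [Real.pi_pos]
  rw [← integral_Ioc_eq_integral_Ioo, ← intervalIntegral.integral_of_le hpi]
  split_ifs with h
  · subst h; simp; ring
  · have hc : (Complex.I * (n : ℂ)) ≠ 0 := by simp [h]
    have := integral_exp_mul_complex (a := -Real.pi) (b := Real.pi) hc
    have e : ∀ t : ℝ, Complex.exp (Complex.I * ((n : ℝ) * t : ℝ))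
        = Complex.exp (Complex.I * (n : ℂ) * t) := by
      intro t; push_cast; ring_nf
    simp_rw [e]
    rw [this]
    have : Complex.exp (Complex.I * n * (Real.pi : ℝ)) =
        Complex.exp (Complex.I * n * ((-Real.pi : ℝ) : ℂ)) := by
      rw [Complex.exp_eq_exp_iff_exists_int]
      exact ⟨n, by push_cast; ring⟩
    rw [this]; simp

lemma integral_expPhase (k : Z3) :
    ∫ x, expPhase k x ∂cellMeasure = if k = 0 then (((2 * Real.pi) ^ 3 : ℝ) : ℂ) else 0 := by
  have h : ∀ x, expPhase k x = ∏ i, Complex.exp (Complex.I * ((k i : ℝ) * x i : ℝ)) := by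
    intro x
    rw [expPhase, ← Complex.exp_sum, phase, Complex.ofReal_sum, Finset.mul_sum]
  simp_rw [h]
  rw [integral_cell_prod (fun i t => Complex.exp (Complex.I * ((k i : ℝ) * t : ℝ)))]
  simp_rw [integral_exp_int]
  split_ifs with h0
  · subst h0; simp
  · obtain ⟨i, hi⟩ := Function.ne_iff.mp h0
    exact Finset.prod_eq_zero (Finset.mem_univ i) (by simpa using hi)

instance : IsFiniteMeasure cellMeasure := by
  refine ⟨?_⟩
  have hb : Bornology.IsBounded Omega := by
    rw [isBounded_iff_forall_norm_le]
    refine ⟨Real.sqrt (∑ _i : Fin 3, Real.pi ^ 2), fun x hx => ?_⟩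
    rw [EuclideanSpace.norm_eq]
    refine Real.sqrt_le_sqrt (Finset.sum_le_sum fun i _ => ?_)
    rw [Real.norm_eq_abs, sq_abs]
    have := hx i
    exact sq_le_sq' this.1.le this.2.le
  rw [cellMeasure, Measure.restrict_apply_univ]
  exact hb.measure_lt_top

/-- The complex space `L²(Ω)`. -/
abbrev CL2 : Type := Lp ℂ 2 cellMeasure

lemma memLp_of_bound {E : Type*} [NormedAddCommGroup E] {f : E3 → E} (hf : Continuous f) (C : ℝ)
    (hC : ∀ x, ‖f x‖ ≤ C) [SecondCountableTopology E] : MemLp f 2 cellMeasure := by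
  borelize E
  exact MemLp.of_bound hf.aestronglyMeasurable C (Eventually.of_forall hC)

/-- The exponential `e^{i k·x}` as an element of `L²(Ω)`. -/
def expL2 (k : Z3) : CL2 :=
  (memLp_of_bound (continuous_expPhase k) 1 fun x => (norm_expPhase k x).le).toLp _

lemma expL2_coe (k : Z3) : (expL2 k : E3 → ℂ) =ᵐ[cellMeasure] expPhase k := MemLp.coeFn_toLp _

lemma two_pi_cube_pos : (0 : ℝ) < (2 * Real.pi) ^ 3 := by positivity

lemma inner_expL2 (k : Z3) (g : CL2) :
    inner ℂ (expL2 k) g = ∫ x, g x * expPhase (-k) x ∂cellMeasure := by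
  rw [L2.inner_def]
  refine integral_congr_ae ?_
  filter_upwards [expL2_coe k] with x hx
  rw [hx, ← conj_expPhase]; simp

lemma inner_expL2_expL2 (k l : Z3) :
    inner ℂ (expL2 k) (expL2 l) = if k = l then (((2 * Real.pi) ^ 3 : ℝ) : ℂ) else 0 := by
  rw [inner_expL2]
  have : ∫ x, (expL2 l : E3 → ℂ) x * expPhase (-k) x ∂cellMeasure
      = ∫ x, expPhase (l - k) x ∂cellMeasure := by
    refine integral_congr_ae ?_
    filter_upwards [expL2_coe l] with x hx
    rw [hx, ← expPhase_add, sub_eq_add_neg]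
  rw [this, integral_expPhase]
  simp [sub_eq_zero, eq_comm]

/-- The closure of the trigonometric polynomials in `L²(Ω)`. -/
def expClosure : Submodule ℂ CL2 := (Submodule.span ℂ (range expL2)).topologicalClosure

/-- Scalar Fourier coefficients. -/
def fcoeff (g : CL2) (k : Z3) : ℂ := (((2 * Real.pi) ^ 3 : ℝ) : ℂ)⁻¹ * inner ℂ (expL2 k) g

/-- Inside `expClosure` the normalised exponentials are orthonormal and total by definition, hence a
Hilbert basis. All fields in question are limits of trigonometric polynomials, so completeness of
the exponentials in the whole of L²(Ω) is never needed. -/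
lemma hasSum_fcoeff {g : CL2} (hg : g ∈ expClosure) :
    HasSum (fun k => fcoeff g k • expL2 k) g := by
  set s : ℝ := Real.sqrt ((2 * Real.pi) ^ 3) with hs
  have hs0 : 0 < s := Real.sqrt_pos.2 two_pi_cube_pos
  have hs2 : s * s = (2 * Real.pi) ^ 3 := Real.mul_self_sqrt two_pi_cube_pos.le
  have hmem : ∀ k, ((s : ℂ)⁻¹ • expL2 k) ∈ expClosure := fun k =>
    Submodule.smul_mem _ _ (Submodule.le_topologicalClosure _ (Submodule.subset_span ⟨k, rfl⟩))
  let v : Z3 → expClosure := fun k => ⟨(s : ℂ)⁻¹ • expL2 k, hmem k⟩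
  have hv : Orthonormal ℂ v := by
    rw [orthonormal_iff_ite]
    intro k l
    change inner ℂ ((s : ℂ)⁻¹ • expL2 k) ((s : ℂ)⁻¹ • expL2 l) = _
    rw [inner_smul_left, inner_smul_right, inner_expL2_expL2]
    split_ifs
    · rw [← hs2]; push_cast
      have : (s : ℂ) ≠ 0 := by exact_mod_cast hs0.ne'
      simp; field_simp
    · simp
  have : CompleteSpace expClosure :=
    (Submodule.isClosed_topologicalClosure _).completeSpace_coe
  have hspan : ⊤ ≤ (Submodule.span ℂ (range v)).topologicalClosure := by
    intro x _
    have hx : (x : CL2) ∈ closure ((Submodule.span ℂ (range expL2) : Submodule ℂ CL2) : Set CL2) := x.2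
    change x ∈ closure ((Submodule.span ℂ (range v) : Submodule ℂ expClosure) : Set expClosure)
    -- A closure taken in the subspace is the trace of the closure in L²(Ω), so density reduces to
    -- the definition of `expClosure`.
    rw [Topology.IsEmbedding.subtypeVal.closure_eq_preimage_closure_image]
    refine closure_mono ?_ hx
    intro y hy
    have hle : Submodule.span ℂ (range expL2) ≤
        (Submodule.span ℂ (range v)).map expClosure.subtype := by
      rw [Submodule.span_le]
      rintro _ ⟨k, rfl⟩
      refine ⟨(s : ℂ) • v k, Submodule.smul_mem _ _ (Submodule.subset_span ⟨k, rfl⟩), ?_⟩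
      have : (s : ℂ) ≠ 0 := by exact_mod_cast hs0.ne'
      simp [v, smul_smul, this]
    obtain ⟨z, hz, rfl⟩ := hle hy
    exact ⟨z, hz, rfl⟩
  have h := (HilbertBasis.mk hv hspan).hasSum_repr ⟨g, hg⟩
  have h2 := h.mapL expClosure.subtypeL
  convert! h2 using 2 with k
  rw [HilbertBasis.repr_apply_apply, HilbertBasis.coe_mk]
  change _ = ((inner ℂ ((s : ℂ)⁻¹ • expL2 k) g : ℂ)) • ((s : ℂ)⁻¹ • expL2 k)
  rw [smul_smul, inner_smul_left, fcoeff, ← hs2]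
  congr 1
  push_cast
  simp; ring

/-- A component of a real field, as a complex function. -/
def comp (j : Fin 3) : L2 →L[ℝ] CL2 :=
  (Complex.ofRealCLM.comp (EuclideanSpace.proj j : E3 →L[ℝ] ℝ)).compLpL 2 cellMeasure

lemma comp_coe (j : Fin 3) (u : L2) :
    (comp j u : E3 → ℂ) =ᵐ[cellMeasure] fun x => (((u : E3 → E3) x j : ℝ) : ℂ) := by
  filter_upwards [ContinuousLinearMap.coeFn_compLpL (𝕜 := ℝ) (p := 2) (μ := cellMeasure)
    (Complex.ofRealCLM.comp (EuclideanSpace.proj j : E3 →L[ℝ] ℝ)) u] with x hx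
  rw [comp, hx]; rfl

lemma fourierCoeffVec_apply (u : L2) (k : Z3) (j : Fin 3) :
    fourierCoeffVec u k j = fcoeff (comp j u) k := by
  rw [fcoeff, inner_expL2, fourierCoeffVec]
  simp only
  congr 1
  · push_cast; rw [inv_pow]
  · refine integral_congr_ae ?_
    filter_upwards [comp_coe j u] with x hx
    rw [hx, ← conj_expPhase, expPhase, ← Complex.exp_conj]
    simp

/-- Fourier coefficients as continuous linear maps. -/
def fourierCLM (k : Z3) : L2 →L[ℝ] C3 :=
  (PiLp.continuousLinearEquiv 2 ℝ (fun _ : Fin 3 => ℂ)).symm.toContinuousLinearMap.comp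
    (ContinuousLinearMap.pi fun j =>
      (((((2 * Real.pi) ^ 3 : ℝ) : ℂ)⁻¹ • innerSL ℂ (expL2 k) : CL2 →L[ℂ] ℂ).restrictScalars ℝ).comp
        (comp j))

lemma fourierCLM_apply (k : Z3) (u : L2) : fourierCLM k u = fourierCoeffVec u k := by
  ext j
  rw [fourierCoeffVec_apply]; rfl

lemma inner_C3 (a b : C3) :
    inner ℝ a b = ∑ j, ((starRingEnd ℂ (a j)) * b j).re := by
  rw [PiLp.inner_apply]
  refine Finset.sum_congr rfl fun j _ => ?_
  rw [Complex.inner, mul_comm]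

lemma inner_L2_eq (u w : L2) :
    inner ℝ u w = ∑ j, (inner ℂ (comp j u) (comp j w) : ℂ).re := by
  have h : ∀ j, (inner ℂ (comp j u) (comp j w) : ℂ)
      = ((∫ x, (u : E3 → E3) x j * (w : E3 → E3) x j ∂cellMeasure : ℝ) : ℂ) := by
    intro j
    rw [L2.inner_def, ← integral_complex_ofReal]
    refine integral_congr_ae ?_
    filter_upwards [comp_coe j u, comp_coe j w] with x hx hy
    rw [hx, hy]; simp [mul_comm]
  simp_rw [h, Complex.ofReal_re]
  rw [L2.inner_def, ← integral_finsetSum]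
  · refine integral_congr_ae (Eventually.of_forall fun x => ?_)
    simp [PiLp.inner_apply, mul_comm]
  · intro j _
    have := L2.integrable_inner (𝕜 := ℂ) (comp j u) (comp j w)
    refine (this.re).congr ?_
    filter_upwards [comp_coe j u, comp_coe j w] with x hx hy
    rw [hx, hy]; simp [mul_comm]

/-- The expansion of `f` is paired with `g` term by term, so only one of the two functions has to be
a limit of trigonometric polynomials. -/
lemma hasSum_inner_of_mem {f : CL2} (hf : f ∈ expClosure) (g : CL2) :
    HasSum (fun k => (((2 * Real.pi) ^ 3 : ℝ) : ℂ) * (starRingEnd ℂ (fcoeff f k) * fcoeff g k))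
      (inner ℂ f g) := by
  have h := (hasSum_fcoeff hf).mapL ((innerSL ℂ g))
  have h2 := h.map (starRingEnd ℂ : ℂ →+* ℂ).toAddMonoidHom (by exact Complex.continuous_conj)
  have hpi : (((2 * Real.pi) ^ 3 : ℝ) : ℂ) ≠ 0 := by exact_mod_cast two_pi_cube_pos.ne'
  convert h2 using 1
  · ext k
    simp only [Function.comp, innerSL_apply_apply]
    change _ = starRingEnd ℂ (inner ℂ g (fcoeff f k • expL2 k))
    rw [inner_conj_symm, inner_smul_left]
    rw [fcoeff, fcoeff, map_mul]
    field_simp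
  · change _ = starRingEnd ℂ (inner ℂ g f)
    rw [inner_conj_symm]

/-- The fields all of whose components are limits of trigonometric polynomials. -/
def trigClosure : Submodule ℝ L2 where
  carrier := {u | ∀ j, comp j u ∈ expClosure}
  add_mem' := fun ha hb j => by rw [map_add]; exact add_mem (ha j) (hb j)
  zero_mem' := fun j => by rw [map_zero]; exact zero_mem _
  smul_mem' := fun c a ha j => by
    rw [map_smul]
    exact (expClosure.restrictScalars ℝ).smul_mem c (ha j)

lemma mem_trigClosure {u : L2} : u ∈ trigClosure ↔ ∀ j, comp j u ∈ expClosure := Iff.rfl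

lemma isClosed_trigClosure : IsClosed (trigClosure : Set L2) := by
  have : (trigClosure : Set L2) = ⋂ j, (comp j) ⁻¹' (expClosure : Set CL2) := by
    ext u; simp [mem_trigClosure]
  rw [this]
  exact isClosed_iInter fun j =>
    (Submodule.isClosed_topologicalClosure _).preimage (comp j).continuous

/-- Parseval's identity. -/
lemma hasSum_inner_fourier {u : L2} (hu : u ∈ trigClosure) (w : L2) :
    HasSum (fun k => (2 * Real.pi) ^ 3 * inner ℝ (fourierCoeffVec u k) (fourierCoeffVec w k))
      (inner ℝ u w) := by
  rw [inner_L2_eq]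
  have h : HasSum (fun k => ∑ j, ((((2 * Real.pi) ^ 3 : ℝ) : ℂ) *
      (starRingEnd ℂ (fcoeff (comp j u) k) * fcoeff (comp j w) k)).re)
      (∑ j, (inner ℂ (comp j u) (comp j w) : ℂ).re) :=
    hasSum_sum fun j _ => Complex.hasSum_re (hasSum_inner_of_mem (hu j) (comp j w))
  convert h using 2 with k
  rw [inner_C3, Finset.mul_sum]
  refine Finset.sum_congr rfl fun j _ => ?_
  rw [fourierCoeffVec_apply, fourierCoeffVec_apply, Complex.re_ofReal_mul]

lemma hasSum_norm_sq_fourier {u : L2} (hu : u ∈ trigClosure) :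
    HasSum (fun k => (2 * Real.pi) ^ 3 * ‖fourierCoeffVec u k‖ ^ 2) (‖u‖ ^ 2) := by
  simpa [real_inner_self_eq_norm_sq] using hasSum_inner_fourier hu u

lemma eq_of_fourier_eq {u w : L2} (hu : u ∈ trigClosure) (hw : w ∈ trigClosure)
    (h : ∀ k, fourierCoeffVec u k = fourierCoeffVec w k) : u = w := by
  have := hasSum_norm_sq_fourier (trigClosure.sub_mem hu hw)
  have h0 : ∀ k, fourierCoeffVec (u - w) k = 0 := by
    intro k
    rw [← fourierCLM_apply, map_sub, fourierCLM_apply, fourierCLM_apply, h, sub_self]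
  simp only [h0, norm_zero] at this
  have h3 : HasSum (fun _ : Z3 => (0 : ℝ)) (‖u - w‖ ^ 2) := by simpa using this
  have := h3.unique hasSum_zero
  rw [← sub_eq_zero]
  simpa using this

instance : CompleteSpace V := (Submodule.isClosed_topologicalClosure _).completeSpace_coe

instance : CompleteSpace H := (Submodule.isClosed_topologicalClosure _).completeSpace_coe

/-! ### Trigonometric polynomial fields and their coefficients -/

/-- The bilinear product `k · c`. -/
def dotZ (k : Z3) (c : C3) : ℂ := ∑ i, (k i : ℂ) * c i

lemma continuous_dotZ (k : Z3) : Continuous (dotZ k) := by unfold dotZ; fun_prop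

lemma dotZ_add (k : Z3) (a b : C3) : dotZ k (a + b) = dotZ k a + dotZ k b := by
  simp [dotZ, mul_add, Finset.sum_add_distrib]

lemma dotZ_smul (k : Z3) (r : ℂ) (a : C3) : dotZ k (r • a) = r * dotZ k a := by
  simp only [dotZ, PiLp.smul_apply, smul_eq_mul, Finset.mul_sum]
  exact Finset.sum_congr rfl fun i _ => by ring

lemma dotZ_smul_real (k : Z3) (r : ℝ) (a : C3) : dotZ k (r • a) = r * dotZ k a := by
  simp only [dotZ, PiLp.smul_apply, Complex.real_smul, Finset.mul_sum]
  exact Finset.sum_congr rfl fun i _ => by ring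

lemma dotZ_zero (k : Z3) : dotZ k 0 = 0 := by simp [dotZ]

/-- Componentwise complex conjugation. -/
def conj3 (c : C3) : C3 := WithLp.toLp 2 fun i => starRingEnd ℂ (c i)

@[simp] lemma conj3_apply (c : C3) (i : Fin 3) : conj3 c i = starRingEnd ℂ (c i) := rfl

lemma continuous_conj3 : Continuous conj3 := by
  unfold conj3
  refine (PiLp.continuous_toLp 2 _).comp (continuous_pi fun i => ?_)
  exact Complex.continuous_conj.comp (by fun_prop)

lemma conj3_conj3 (c : C3) : conj3 (conj3 c) = c := by ext i; simp

lemma inner_conj3 (a b : C3) : inner ℝ (conj3 a) (conj3 b) = inner ℝ a b := by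
  rw [inner_C3, inner_C3]
  refine Finset.sum_congr rfl fun i _ => ?_
  simp

/-- Trigonometric polynomials. -/
def expSpan : Submodule ℂ (E3 → ℂ) := Submodule.span ℂ (range expPhase)

lemma expSpan_bounded {g : E3 → ℂ} (hg : g ∈ expSpan) :
    Continuous g ∧ ∃ C, ∀ x, ‖g x‖ ≤ C := by
  induction hg using Submodule.span_induction with
  | mem g hg =>
    obtain ⟨k, rfl⟩ := hg
    exact ⟨continuous_expPhase k, 1, fun x => (norm_expPhase k x).le⟩
  | zero => exact ⟨continuous_zero, 0, fun x => by simp⟩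
  | add f g _ _ hf hg =>
    obtain ⟨hf, C, hC⟩ := hf
    obtain ⟨hg, D, hD⟩ := hg
    exact ⟨hf.add hg, C + D, fun x => (norm_add_le _ _).trans (add_le_add (hC x) (hD x))⟩
  | smul a g _ hg =>
    obtain ⟨hg, D, hD⟩ := hg
    refine ⟨hg.const_smul a, ‖a‖ * D, fun x => ?_⟩
    rw [Pi.smul_apply, norm_smul]
    exact mul_le_mul_of_nonneg_left (hD x) (norm_nonneg _)

lemma expSpan_integrable {g : E3 → ℂ} (hg : g ∈ expSpan) (k : Z3) :
    Integrable (fun x => g x * expPhase k x) cellMeasure := by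
  obtain ⟨h1, C, hC⟩ := expSpan_bounded hg
  refine Integrable.of_bound (C := C)
    (h1.mul (continuous_expPhase k)).aestronglyMeasurable (Eventually.of_forall fun x => ?_)
  rw [norm_mul, norm_expPhase, mul_one]; exact hC x

lemma mem_expClosure_of_ae {g : E3 → ℂ} (hg : g ∈ expSpan) {U : CL2}
    (hU : (U : E3 → ℂ) =ᵐ[cellMeasure] g) : U ∈ expClosure := by
  have h : ∃ W ∈ Submodule.span ℂ (range expL2), (W : E3 → ℂ) =ᵐ[cellMeasure] g := by
    clear hU
    induction hg using Submodule.span_induction with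
    | mem g hg =>
      obtain ⟨k, rfl⟩ := hg
      exact ⟨expL2 k, Submodule.subset_span ⟨k, rfl⟩, expL2_coe k⟩
    | zero => exact ⟨0, zero_mem _, Lp.coeFn_zero _ _ _⟩
    | add f g _ _ hf hg =>
      obtain ⟨F, hF, hF'⟩ := hf
      obtain ⟨G, hG, hG'⟩ := hg
      exact ⟨F + G, add_mem hF hG, (Lp.coeFn_add F G).trans (hF'.add hG')⟩
    | smul a g _ hg =>
      obtain ⟨G, hG, hG'⟩ := hg
      exact ⟨a • G, Submodule.smul_mem _ a hG, (Lp.coeFn_smul a G).trans (hG'.const_smul a)⟩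
  obtain ⟨W, hW, hW'⟩ := h
  have : U = W := Lp.ext (hU.trans hW'.symm)
  rw [this]
  exact Submodule.le_topologicalClosure _ hW

/-- The real field `x ↦ Re (b e^{i k·x})`. -/
def modeField (k : Z3) (b : C3) (x : E3) : E3 := WithLp.toLp 2 fun j => (b j * expPhase k x).re

lemma modeField_apply (k : Z3) (b : C3) (x : E3) (j : Fin 3) :
    modeField k b x j = (b j * expPhase k x).re := rfl

lemma modeField_ofReal (k : Z3) (b : C3) (j : Fin 3) (x : E3) : ((modeField k b x j : ℝ) : ℂ) =
    b j / 2 * expPhase k x + starRingEnd ℂ (b j) / 2 * expPhase (-k) x := by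
  rw [modeField_apply, Complex.re_eq_add_conj, map_mul, conj_expPhase]; ring

lemma modeField_mem_expSpan (k : Z3) (b : C3) (j : Fin 3) :
    (fun x => ((modeField k b x j : ℝ) : ℂ)) ∈ expSpan := by
  have : (fun x => ((modeField k b x j : ℝ) : ℂ)) =
      (b j / 2) • expPhase k + (starRingEnd ℂ (b j) / 2) • expPhase (-k) := by
    ext x; rw [modeField_ofReal]; rfl
  rw [this]
  exact add_mem (Submodule.smul_mem _ _ (Submodule.subset_span ⟨k, rfl⟩))
    (Submodule.smul_mem _ _ (Submodule.subset_span ⟨-k, rfl⟩))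

lemma modeField_coeff (k : Z3) (b : C3) (j : Fin 3) (n : Z3) :
    ∫ x, ((modeField k b x j : ℝ) : ℂ) * expPhase (-n) x ∂cellMeasure =
      (((2 * Real.pi) ^ 3 : ℝ) : ℂ) * ((if n = k then b j / 2 else 0)
        + (if n = -k then starRingEnd ℂ (b j) / 2 else 0)) := by
  have h : ∀ x, ((modeField k b x j : ℝ) : ℂ) * expPhase (-n) x =
      b j / 2 * expPhase (k - n) x + starRingEnd ℂ (b j) / 2 * expPhase (-k - n) x := by
    intro x
    rw [modeField_ofReal, sub_eq_add_neg, sub_eq_add_neg, expPhase_add, expPhase_add]; ring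
  simp_rw [h]
  have hi : ∀ l, Integrable (expPhase l) cellMeasure := fun l =>
    Integrable.of_bound (C := 1) (continuous_expPhase l).aestronglyMeasurable
      (Eventually.of_forall fun x => (norm_expPhase l x).le)
  rw [integral_add ((hi _).const_mul _) ((hi _).const_mul _), integral_const_mul,
    integral_const_mul, integral_expPhase, integral_expPhase]
  have e1 : (k - n = 0) ↔ n = k := by rw [sub_eq_zero, eq_comm]
  have e2 : (-k - n = 0) ↔ n = -k := by rw [sub_eq_zero, eq_comm]
  simp only [e1, e2]
  split_ifs <;> ring

lemma hasFDerivAt_phase (k : Z3) (x : E3) :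
    HasFDerivAt (phase k) (∑ i, (k i : ℝ) • (EuclideanSpace.proj i : E3 →L[ℝ] ℝ)) x := by
  unfold phase
  refine HasFDerivAt.fun_sum fun i _ => ?_
  exact ((EuclideanSpace.proj i : E3 →L[ℝ] ℝ).hasFDerivAt).const_mul _

lemma modeField_eq (k : Z3) (b : C3) : modeField k b = fun x =>
    Real.cos (phase k x) • (WithLp.toLp 2 fun j => (b j).re : E3)
      - Real.sin (phase k x) • (WithLp.toLp 2 fun j => (b j).im : E3) := by
  ext x j
  rw [modeField_apply, expPhase_eq]
  simp [Complex.mul_re, -Complex.ofReal_cos, -Complex.ofReal_sin]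
  ring

lemma hasFDerivAt_modeField (k : Z3) (b : C3) (x : E3) :
    DifferentiableAt ℝ (modeField k b) x ∧
      ∀ i, partialDeriv i (modeField k b) x = modeField k ((Complex.I * (k i : ℂ)) • b) x := by
  have hp := hasFDerivAt_phase k x
  have h : HasFDerivAt (fun x => Real.cos (phase k x) • (WithLp.toLp 2 fun j => (b j).re : E3)
      - Real.sin (phase k x) • (WithLp.toLp 2 fun j => (b j).im : E3)) _ x := (hp.cos.smul_const (WithLp.toLp 2 fun j => (b j).re : E3)).sub
    (hp.sin.smul_const (WithLp.toLp 2 fun j => (b j).im : E3))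
  rw [modeField_eq]
  refine ⟨h.differentiableAt, fun i => ?_⟩
  rw [partialDeriv, HasFDerivAt.fderiv h, modeField_eq]
  ext j
  have e : (∑ l, (k l : ℝ) • (EuclideanSpace.proj l : E3 →L[ℝ] ℝ)) (EuclideanSpace.single i 1)
      = k i := by
    simp [EuclideanSpace.proj]
  simp [e, Complex.mul_re, Complex.mul_im]; ring

lemma modeField_mem_trigPoly (k : Z3) (b : C3) : modeField k b ∈ TrigPoly := by
  have : modeField k b = (fun x => Real.cos (phase k x) • (WithLp.toLp 2 fun j => (b j).re : E3))
      - (fun x => Real.sin (phase k x) • (WithLp.toLp 2 fun j => (b j).im : E3)) := by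
    rw [modeField_eq]; rfl
  rw [this]
  exact sub_mem (Submodule.subset_span ⟨k, _, Or.inl rfl⟩) (Submodule.subset_span ⟨k, _, Or.inr rfl⟩)

-- Both kinds of generators of `TrigPoly` are real parts Re(b e^{ik·x}), with b real for the cosine
-- and b in -iℝ³ for the sine. One kind of mode therefore suffices for inductions.
@[elab_as_elim]
lemma trigPoly_induction {p : (v : E3 → E3) → v ∈ TrigPoly → Prop}
    (hmode : ∀ k b, p (modeField k b) (modeField_mem_trigPoly k b)) (hz : p 0 (zero_mem _))
    (hadd : ∀ v w hv hw, p v hv → p w hw → p (v + w) (add_mem hv hw))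
    (hsmul : ∀ (r : ℝ) v hv, p v hv → p (r • v) (Submodule.smul_mem _ r hv))
    {v : E3 → E3} (hv : v ∈ TrigPoly) : p v hv := by
  have key : ∀ v (hv : v ∈ TrigPoly), p v hv := by
    intro v hv
    induction hv using Submodule.span_induction with
    | mem v hv =>
      have h : ∃ k b, modeField k b = v := by
        obtain ⟨k, a, rfl | rfl⟩ := hv
        · refine ⟨k, WithLp.toLp 2 fun j => (a j : ℂ), ?_⟩
          rw [modeField_eq]; ext x j; simp
        · refine ⟨k, WithLp.toLp 2 fun j => -Complex.I * (a j : ℂ), ?_⟩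
          rw [modeField_eq]; ext x j; simp
      obtain ⟨k, b, rfl⟩ := h
      exact hmode k b
    | zero => exact hz
    | add v w hv' hw' hv hw => exact hadd v w hv' hw' hv hw
    | smul r v hv' hv => exact hsmul r v hv' hv
  exact key v hv

/-- Trigonometric polynomial fields are differentiable, their components and those of their
derivatives are trigonometric polynomials, and differentiation multiplies coefficients. -/
lemma trigPoly_props {v : E3 → E3} (hv : v ∈ TrigPoly) :
    Differentiable ℝ v ∧ ∀ j, (fun x => ((v x j : ℝ) : ℂ)) ∈ expSpan ∧
      ∀ i, (fun x => ((partialDeriv i v x j : ℝ) : ℂ)) ∈ expSpan ∧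
        ∀ n, ∫ x, ((partialDeriv i v x j : ℝ) : ℂ) * expPhase (-n) x ∂cellMeasure =
          Complex.I * n i * ∫ x, ((v x j : ℝ) : ℂ) * expPhase (-n) x ∂cellMeasure := by
  induction hv using trigPoly_induction with
  | hmode k b =>
    have hd : ∀ i, partialDeriv i (modeField k b) = modeField k ((Complex.I * (k i : ℂ)) • b) :=
      fun i => funext fun x => (hasFDerivAt_modeField k b x).2 i
    refine ⟨fun x => (hasFDerivAt_modeField k b x).1, fun j => ⟨modeField_mem_expSpan k b j,
      fun i => ⟨?_, fun n => ?_⟩⟩⟩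
    · rw [hd]; exact modeField_mem_expSpan k _ j
    · rw [hd, modeField_coeff, modeField_coeff]
      by_cases h1 : n = k
      · by_cases h2 : n = -k
        -- The frequencies k and -k coincide only for k = 0, where both sides vanish.
        · have h0 : (k i : ℂ) = 0 := by
            have := congrFun (h1.symm.trans h2) i
            simp at this
            have : k i = 0 := by omega
            simp [this]
          subst h1; simp [h0]
        · subst h1; simp [h2]; ring
      · by_cases h2 : n = -k
        · subst h2; simp [h1]; ring
        · simp [h1, h2]
  | hz =>
    have hd : ∀ i, partialDeriv i (0 : E3 → E3) = 0 := fun i => by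
      ext x; simp [partialDeriv]
    refine ⟨differentiable_const (0 : E3), fun j => ⟨?_, fun i => ⟨?_, fun n => ?_⟩⟩⟩
    · simp; exact zero_mem _
    · rw [hd]; simp; exact zero_mem _
    · rw [hd]; simp
  | hadd v w _ _ hv hw =>
    obtain ⟨hv1, hv2⟩ := hv
    obtain ⟨hw1, hw2⟩ := hw
    have hd : ∀ i x, partialDeriv i (v + w) x = partialDeriv i v x + partialDeriv i w x := by
      intro i x
      rw [partialDeriv, fderiv_add (hv1 x) (hw1 x)]; rfl
    refine ⟨hv1.add hw1, fun j => ⟨?_, fun i => ⟨?_, fun n => ?_⟩⟩⟩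
    · convert add_mem (hv2 j).1 (hw2 j).1 using 1; ext x; simp
    · convert add_mem ((hv2 j).2 i).1 ((hw2 j).2 i).1 using 1; ext x; simp [hd]
    · simp only [hd, Pi.add_apply, PiLp.add_apply, Complex.ofReal_add, add_mul]
      rw [integral_add (expSpan_integrable ((hv2 j).2 i).1 _)
        (expSpan_integrable ((hw2 j).2 i).1 _), integral_add (expSpan_integrable (hv2 j).1 _)
        (expSpan_integrable (hw2 j).1 _), ((hv2 j).2 i).2, ((hw2 j).2 i).2]
      ring
  | hsmul r v _ hv =>
    obtain ⟨hv1, hv2⟩ := hv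
    have hd : ∀ i x, partialDeriv i (r • v) x = r • partialDeriv i v x := by
      intro i x
      rw [partialDeriv, fderiv_const_smul (hv1 x)]; rfl
    refine ⟨hv1.const_smul r, fun j => ⟨?_, fun i => ⟨?_, fun n => ?_⟩⟩⟩
    · convert Submodule.smul_mem _ (r : ℂ) (hv2 j).1 using 1; ext x; simp
    · convert Submodule.smul_mem _ (r : ℂ) ((hv2 j).2 i).1 using 1; ext x; simp [hd]
    · simp only [hd, Pi.smul_apply, PiLp.smul_apply, smul_eq_mul, Complex.ofReal_mul, mul_assoc]
      rw [integral_const_mul, integral_const_mul, ((hv2 j).2 i).2]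
      ring

lemma fourierCoeffVec_of_ae {u : L2} {v : E3 → E3} (h : (u : E3 → E3) =ᵐ[cellMeasure] v)
    (k : Z3) (j : Fin 3) : fourierCoeffVec u k j = (((2 * Real.pi) ^ 3 : ℝ) : ℂ)⁻¹ *
      ∫ x, ((v x j : ℝ) : ℂ) * expPhase (-k) x ∂cellMeasure := by
  rw [fourierCoeffVec_apply, fcoeff, inner_expL2]
  congr 1
  refine integral_congr_ae ?_
  filter_upwards [comp_coe j u, h] with x hx hx'
  rw [hx, hx']

lemma mem_trigClosure_of_ae {u : L2} {v : E3 → E3} (h : (u : E3 → E3) =ᵐ[cellMeasure] v)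
    (hv : ∀ j, (fun x => ((v x j : ℝ) : ℂ)) ∈ expSpan) : u ∈ trigClosure := by
  intro j
  refine mem_expClosure_of_ae (hv j) ?_
  filter_upwards [comp_coe j u, h] with x hx hx'
  rw [hx, hx']

lemma fourierCoeffVec_conj (u : L2) (k : Z3) :
    fourierCoeffVec u (-k) = conj3 (fourierCoeffVec u k) := by
  ext j
  rw [conj3_apply, fourierCoeffVec_of_ae (EventuallyEq.refl _ _),
    fourierCoeffVec_of_ae (EventuallyEq.refl _ _), map_mul, map_inv₀, Complex.conj_ofReal,
    ← integral_conj]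
  congr 2
  ext x
  rw [map_mul, Complex.conj_ofReal, conj_expPhase]

lemma fourier_add (u w : L2) (k : Z3) :
    fourierCoeffVec (u + w) k = fourierCoeffVec u k + fourierCoeffVec w k := by
  simp only [← fourierCLM_apply, map_add]

lemma fourier_sub (u w : L2) (k : Z3) :
    fourierCoeffVec (u - w) k = fourierCoeffVec u k - fourierCoeffVec w k := by
  simp only [← fourierCLM_apply, map_sub]

lemma fourier_smul (r : ℝ) (u : L2) (k : Z3) :
    fourierCoeffVec (r • u) k = r • fourierCoeffVec u k := by
  simp only [← fourierCLM_apply, map_smul]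

lemma fourier_zero (k : Z3) : fourierCoeffVec 0 k = 0 := by
  simp only [← fourierCLM_apply, map_zero]

lemma continuous_fourier (k : Z3) : Continuous fun u : L2 => fourierCoeffVec u k := by
  simp only [← fourierCLM_apply]; exact (fourierCLM k).continuous

/-- The average is, up to a factor, the coefficient at 0, and the divergence has coefficients i
k·û(k). -/
lemma testField_coeff {u : L2} {v : E3 → E3} (hv : v ∈ TestField)
    (h : (u : E3 → E3) =ᵐ[cellMeasure] v) :
    u ∈ trigClosure ∧ fourierCoeffVec u 0 = 0 ∧ ∀ k, dotZ k (fourierCoeffVec u k) = 0 := by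
  obtain ⟨h1, h2, h3⟩ := hv
  obtain ⟨hd, hp⟩ := trigPoly_props h1
  refine ⟨mem_trigClosure_of_ae h fun j => (hp j).1, ?_, fun k => ?_⟩
  · ext j
    rw [fourierCoeffVec_of_ae h]
    simp only [neg_zero, expPhase_zero, mul_one]
    rw [integral_complex_ofReal]
    have hint : Integrable v cellMeasure := by
      have hu : Integrable (u : E3 → E3) cellMeasure := (Lp.memLp u).integrable (by norm_num)
      exact hu.congr h
    have := (EuclideanSpace.proj j : E3 →L[ℝ] ℝ).integral_comp_comm hint
    simp only [PiLp.proj_apply] at this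
    rw [this, h3]; simp
  · have e : ∑ i, Complex.I * k i * ∫ x, ((v x i : ℝ) : ℂ) * expPhase (-k) x ∂cellMeasure = 0 := by
      simp_rw [← fun i => ((hp i).2 i).2 k]
      rw [← integral_finsetSum _ fun i _ => expSpan_integrable ((hp i).2 i).1 _]
      rw [← integral_zero E3 ℂ]
      congr 1
      ext x
      rw [← Finset.sum_mul, ← Complex.ofReal_sum, h2]; simp
    have e2 : dotZ k (fourierCoeffVec u k) = (((2 * Real.pi) ^ 3 : ℝ) : ℂ)⁻¹ * (-Complex.I) *
        ∑ i, Complex.I * k i * ∫ x, ((v x i : ℝ) : ℂ) * expPhase (-k) x ∂cellMeasure := by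
      rw [dotZ, Finset.mul_sum]
      refine Finset.sum_congr rfl fun i _ => ?_
      rw [fourierCoeffVec_of_ae h]
      linear_combination ((((2 * Real.pi) ^ 3 : ℝ) : ℂ)⁻¹ * k i *
        (∫ x, ((v x i : ℝ) : ℂ) * expPhase (-k) x ∂cellMeasure)) * Complex.I_mul_I
    rw [e2, e, mul_zero]

/-! ### Coefficients of elements of `H` and `V` -/

/-- Fields with divergence-free coefficients and zero mean. -/
def solenoidal : Submodule ℝ L2 where
  carrier := {u | u ∈ trigClosure ∧ fourierCoeffVec u 0 = 0 ∧ ∀ k, dotZ k (fourierCoeffVec u k) = 0}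
  add_mem' := fun ⟨a1, a2, a3⟩ ⟨b1, b2, b3⟩ => ⟨add_mem a1 b1, by rw [fourier_add, a2, b2, add_zero],
    fun k => by rw [fourier_add, dotZ_add, a3, b3, add_zero]⟩
  zero_mem' := ⟨zero_mem _, fourier_zero 0, fun k => by rw [fourier_zero, dotZ_zero]⟩
  smul_mem' := fun c a ⟨a1, a2, a3⟩ => ⟨Submodule.smul_mem _ c a1,
    by rw [fourier_smul, a2, smul_zero],
    fun k => by rw [fourier_smul, dotZ_smul_real, a3, mul_zero]⟩

lemma isClosed_solenoidal : IsClosed (solenoidal : Set L2) := by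
  have : (solenoidal : Set L2) = (trigClosure : Set L2) ∩ ({u | fourierCoeffVec u 0 = 0} ∩
      ⋂ k, {u | dotZ k (fourierCoeffVec u k) = 0}) := by
    ext u; simp [solenoidal]
  rw [this]
  refine isClosed_trigClosure.inter ((isClosed_eq (continuous_fourier 0) continuous_const).inter
    (isClosed_iInter fun k => isClosed_eq ((continuous_dotZ k).comp (continuous_fourier k))
      continuous_const))

/-- Closed linear conditions survive the closure of the test fields. The reverse inclusion is not
needed: elements with prescribed coefficients are later produced inside `V` by `synthV`. -/
lemma H_le_solenoidal : H ≤ solenoidal := by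
  refine Submodule.topologicalClosure_minimal _ (Submodule.span_le.2 ?_) isClosed_solenoidal
  rintro u ⟨v, hv, h⟩
  exact testField_coeff hv h

lemma field_mem_H (p : V) : field p ∈ H := by
  have hc : Continuous fun p : H1Pair => p.fst := by fun_prop
  have h : (Submodule.span ℝ {p : H1Pair | ∃ v ∈ TestField, p.fst =ᵐ[cellMeasure] v ∧
      ∀ i, p.snd i =ᵐ[cellMeasure] partialDeriv i v}) ≤ H.comap (WithLp.fstₗ 2 ℝ L2
        (PiLp 2 (fun _ : Fin 3 => L2))) := by
    rw [Submodule.span_le]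
    rintro p ⟨v, hv, h, -⟩
    exact Submodule.le_topologicalClosure _ (Submodule.subset_span ⟨v, hv, h⟩)
  have hcl : IsClosed ((H.comap (WithLp.fstₗ 2 ℝ L2
        (PiLp 2 (fun _ : Fin 3 => L2)))) : Set H1Pair) :=
    (Submodule.isClosed_topologicalClosure _).preimage hc
  exact Submodule.topologicalClosure_minimal _ h hcl p.2

/-- Pairs in which the second member is the gradient of the first. -/
def gradPairs : Submodule ℝ H1Pair where
  carrier := {p | ∀ i, p.snd i ∈ trigClosure ∧ ∀ k,
    fourierCoeffVec (p.snd i) k = (Complex.I * k i) • fourierCoeffVec p.fst k}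
  add_mem' := fun {a b} ha hb i => ⟨by
    change a.snd i + b.snd i ∈ _; exact add_mem (ha i).1 (hb i).1, fun k => by
      change fourierCoeffVec (a.snd i + b.snd i) k = _ • fourierCoeffVec (a.fst + b.fst) k
      rw [fourier_add, fourier_add, (ha i).2, (hb i).2, smul_add]⟩
  zero_mem' := fun i => ⟨zero_mem _, fun k => by
    change fourierCoeffVec 0 k = _ • fourierCoeffVec 0 k
    rw [fourier_zero, smul_zero]⟩
  smul_mem' := fun c a ha i => ⟨Submodule.smul_mem _ c (ha i).1, fun k => by
    change fourierCoeffVec (c • a.snd i) k = _ • fourierCoeffVec (c • a.fst) k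
    rw [fourier_smul, fourier_smul, (ha i).2, smul_comm]⟩

lemma isClosed_gradPairs : IsClosed (gradPairs : Set H1Pair) := by
  have : (gradPairs : Set H1Pair) = ⋂ i, ((fun p : H1Pair => p.snd i) ⁻¹' (trigClosure : Set L2) ∩
      ⋂ k : Z3, {p : H1Pair | fourierCoeffVec (p.snd i) k
        = (Complex.I * k i) • fourierCoeffVec p.fst k}) := by
    ext p; simp [gradPairs]
  have hs : ∀ i, Continuous (fun p : H1Pair => p.snd i) := fun i => by fun_prop
  have hf : Continuous (fun p : H1Pair => p.fst) := by fun_prop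
  rw [this]
  exact isClosed_iInter fun i => (isClosed_trigClosure.preimage (hs i)).inter
    (isClosed_iInter fun k => isClosed_eq ((continuous_fourier k).comp (hs i))
      (((continuous_fourier k).comp hf).const_smul (Complex.I * (k i : ℂ))))

lemma V_le_gradPairs : V ≤ gradPairs := by
  refine Submodule.topologicalClosure_minimal _ (Submodule.span_le.2 ?_) isClosed_gradPairs
  rintro p ⟨v, ⟨hv, -, -⟩, h, h'⟩ i
  obtain ⟨hd, hp⟩ := trigPoly_props hv
  refine ⟨mem_trigClosure_of_ae (h' i) fun j => ((hp j).2 i).1, fun k => ?_⟩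
  ext j
  rw [PiLp.smul_apply, smul_eq_mul, fourierCoeffVec_of_ae (h' i), fourierCoeffVec_of_ae h,
    ((hp j).2 i).2]
  ring

/-- Admissible sequences of Fourier coefficients: zero mean, divergence-free, real. -/
structure Adm (c : Z3 → C3) : Prop where
  zero : c 0 = 0
  div : ∀ k, dotZ k (c k) = 0
  conj : ∀ k, c (-k) = conj3 (c k)

lemma adm_of_mem_H {u : L2} (hu : u ∈ H) : Adm (fourierCoeffVec u) :=
  ⟨(H_le_solenoidal hu).2.1, (H_le_solenoidal hu).2.2, fourierCoeffVec_conj u⟩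

lemma mem_trigClosure_of_mem_H {u : L2} (hu : u ∈ H) : u ∈ trigClosure := (H_le_solenoidal hu).1

lemma grad_mem_trigClosure (p : V) (i : Fin 3) : grad p i ∈ trigClosure :=
  (V_le_gradPairs p.2 i).1

lemma fourier_grad (p : V) (i : Fin 3) (k : Z3) :
    fourierCoeffVec (grad p i) k = (Complex.I * k i) • fourierCoeffVec (field p) k :=
  (V_le_gradPairs p.2 i).2 k

/-! ### Single modes as test fields -/

lemma modeField_testField {k : Z3} (hk : k ≠ 0) {b : C3} (hb : dotZ k b = 0) :
    modeField k b ∈ TestField := by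
  refine ⟨modeField_mem_trigPoly k b, fun x => ?_, ?_⟩
  · simp only [(hasFDerivAt_modeField k b x).2, modeField_apply]
    rw [← Complex.re_sum, ← Finset.sum_mul]
    have : ∑ i, ((Complex.I * (k i : ℂ)) • b) i = Complex.I * dotZ k b := by
      simp [dotZ, Finset.mul_sum, mul_assoc]
    rw [this, hb]; simp
  · have hint : Integrable (modeField k b) cellMeasure := by
      have hd : Differentiable ℝ (modeField k b) := fun x => (hasFDerivAt_modeField k b x).1
      refine Integrable.of_bound (C := Real.sqrt (∑ j, ‖b j‖ ^ 2))
        hd.continuous.aestronglyMeasurable (Eventually.of_forall fun x => ?_)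
      rw [EuclideanSpace.norm_eq]
      refine Real.sqrt_le_sqrt (Finset.sum_le_sum fun j _ => ?_)
      gcongr
      rw [modeField_apply, Real.norm_eq_abs]
      refine (Complex.abs_re_le_norm _).trans ?_
      rw [norm_mul, norm_expPhase, mul_one]
    ext j
    have := (EuclideanSpace.proj j : E3 →L[ℝ] ℝ).integral_comp_comm hint
    simp only [PiLp.proj_apply] at this
    rw [← this]
    have h := modeField_coeff k b j 0
    simp only [neg_zero, expPhase_zero, mul_one] at h
    rw [integral_complex_ofReal] at h
    have hk' : (0 : Z3) ≠ -k := fun h => hk (neg_eq_zero.1 h.symm)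
    rw [if_neg hk.symm, if_neg hk'] at h
    simpa using h

lemma re_sum_mul_conj (a b : C3) : (∑ j, b j * starRingEnd ℂ (a j)).re = inner ℝ a b := by
  rw [inner_C3, Complex.re_sum]
  exact Finset.sum_congr rfl fun j _ => by rw [mul_comm]

/-- Pairing with Re(b e^{ik·x}) reads off one coefficient. Integrability of `G` is enough, which
matters for (u·∇)v: it is only in L¹ when u and v are merely in `V`. -/
lemma integral_inner_modeField {G : E3 → E3} (hG : Integrable G cellMeasure) (k : Z3) (b g : C3)
    (hg : ∀ j, (((2 * Real.pi) ^ 3 : ℝ) : ℂ) * g j =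
      ∫ x, ((G x j : ℝ) : ℂ) * expPhase (-k) x ∂cellMeasure) :
    ∫ x, inner ℝ (G x) (modeField k b x) ∂cellMeasure = (2 * Real.pi) ^ 3 * inner ℝ g b := by
  have hint : ∀ j, Integrable (fun x => ((G x j : ℝ) : ℂ) * expPhase k x) cellMeasure := by
    intro j
    have h1 : Integrable (fun x => ((G x j : ℝ) : ℂ)) cellMeasure :=
      (Complex.ofRealCLM.comp (EuclideanSpace.proj j : E3 →L[ℝ] ℝ)).integrable_comp hG
    refine h1.mul_bdd (c := 1) (continuous_expPhase k).aestronglyMeasurable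
      (Eventually.of_forall fun x => (norm_expPhase k x).le)
  have h1 : ∀ x, inner ℝ (G x) (modeField k b x) =
      RCLike.re (∑ j, b j * (((G x j : ℝ) : ℂ) * expPhase k x)) := by
    intro x
    rw [PiLp.inner_apply, map_sum]
    refine Finset.sum_congr rfl fun j _ => ?_
    rw [modeField_apply]
    change (b j * expPhase k x).re * G x j = (b j * (((G x j : ℝ) : ℂ) * expPhase k x)).re
    rw [show b j * (((G x j : ℝ) : ℂ) * expPhase k x) = ((G x j : ℝ) : ℂ) * (b j * expPhase k x) by
      ring, Complex.re_ofReal_mul, mul_comm]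
  simp_rw [h1]
  rw [integral_re (integrable_finsetSum _ fun j _ => (hint j).const_mul _),
    integral_finsetSum _ fun j _ => (hint j).const_mul _]
  have h2 : ∀ j, ∫ x, b j * (((G x j : ℝ) : ℂ) * expPhase k x) ∂cellMeasure =
      (((2 * Real.pi) ^ 3 : ℝ) : ℂ) * (b j * starRingEnd ℂ (g j)) := by
    intro j
    have : ∫ x, ((G x j : ℝ) : ℂ) * expPhase k x ∂cellMeasure =
        starRingEnd ℂ (∫ x, ((G x j : ℝ) : ℂ) * expPhase (-k) x ∂cellMeasure) := by
      rw [← integral_conj]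
      congr 1; ext x
      rw [map_mul, Complex.conj_ofReal, conj_expPhase, neg_neg]
    rw [integral_const_mul, this, ← hg, map_mul, Complex.conj_ofReal]; ring
  simp_rw [h2]
  rw [← Finset.mul_sum]
  change (_ * _ : ℂ).re = _
  rw [Complex.re_ofReal_mul, re_sum_mul_conj]

lemma two_pi_cube_ne_zero : (((2 * Real.pi) ^ 3 : ℝ) : ℂ) ≠ 0 := by
  exact_mod_cast two_pi_cube_pos.ne'

lemma inner_of_ae_modeField (u : L2) {z : L2} {k : Z3} {b : C3}
    (hz : (z : E3 → E3) =ᵐ[cellMeasure] modeField k b) :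
    inner ℝ u z = (2 * Real.pi) ^ 3 * inner ℝ (fourierCoeffVec u k) b := by
  have hu : Integrable (u : E3 → E3) cellMeasure := (Lp.memLp u).integrable (by norm_num)
  rw [L2.inner_def, ← integral_inner_modeField hu k b]
  · refine integral_congr_ae ?_
    filter_upwards [hz] with x hx
    rw [hx]
  · intro j
    rw [fourierCoeffVec_of_ae (EventuallyEq.refl _ _), mul_inv_cancel_left₀ two_pi_cube_ne_zero]

lemma fourier_of_ae_modeField {z : L2} {k : Z3} {b : C3}
    (hz : (z : E3 → E3) =ᵐ[cellMeasure] modeField k b) (n : Z3) :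
    fourierCoeffVec z n = (if n = k then (2 : ℝ)⁻¹ • b else 0)
      + (if n = -k then (2 : ℝ)⁻¹ • conj3 b else 0) := by
  ext j
  rw [fourierCoeffVec_of_ae hz, modeField_coeff, inv_mul_cancel_left₀ two_pi_cube_ne_zero]
  rw [PiLp.add_apply]
  congr 1
  · split_ifs
    · simp; ring
    · simp
  · split_ifs
    · simp; ring
    · simp

lemma exists_modeV {k : Z3} (hk : k ≠ 0) {b : C3} (hb : dotZ k b = 0) :
    ∃ z : V, (field z : E3 → E3) =ᵐ[cellMeasure] modeField k b ∧
      ∀ i, (grad z i : E3 → E3) =ᵐ[cellMeasure] modeField k ((Complex.I * (k i : ℂ)) • b) := by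
  have hv := modeField_testField hk hb
  have hm : ∀ b', MemLp (modeField k b') 2 cellMeasure := by
    intro b'
    have hd : Differentiable ℝ (modeField k b') := fun x => (hasFDerivAt_modeField k b' x).1
    refine memLp_of_bound hd.continuous (Real.sqrt (∑ j, ‖b' j‖ ^ 2)) fun x => ?_
    rw [EuclideanSpace.norm_eq]
    refine Real.sqrt_le_sqrt (Finset.sum_le_sum fun j _ => ?_)
    gcongr
    rw [modeField_apply, Real.norm_eq_abs]
    refine (Complex.abs_re_le_norm _).trans ?_
    rw [norm_mul, norm_expPhase, mul_one]
  let p : H1Pair := WithLp.toLp 2 ((hm b).toLp _,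
    WithLp.toLp 2 fun i => (hm ((Complex.I * (k i : ℂ)) • b)).toLp _)
  have h1 : p.fst =ᵐ[cellMeasure] modeField k b := MemLp.coeFn_toLp (hm b)
  have h2 : ∀ i, p.snd i =ᵐ[cellMeasure] modeField k ((Complex.I * (k i : ℂ)) • b) :=
    fun i => MemLp.coeFn_toLp (hm _)
  refine ⟨⟨p, Submodule.le_topologicalClosure _ (Submodule.subset_span
    ⟨modeField k b, hv, h1, fun i => (h2 i).trans (EventuallyEq.of_eq ?_)⟩)⟩, h1, h2⟩
  ext1 x
  rw [(hasFDerivAt_modeField k b x).2]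

/-- A divergence-free mode as an element of `V`. -/
def modeV {k : Z3} (hk : k ≠ 0) {b : C3} (hb : dotZ k b = 0) : V := (exists_modeV hk hb).choose

lemma field_modeV {k : Z3} (hk : k ≠ 0) {b : C3} (hb : dotZ k b = 0) :
    (field (modeV hk hb) : E3 → E3) =ᵐ[cellMeasure] modeField k b :=
  (exists_modeV hk hb).choose_spec.1

lemma grad_modeV {k : Z3} (hk : k ≠ 0) {b : C3} (hb : dotZ k b = 0) (i : Fin 3) :
    (grad (modeV hk hb) i : E3 → E3) =ᵐ[cellMeasure] modeField k ((Complex.I * (k i : ℂ)) • b) :=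
  (exists_modeV hk hb).choose_spec.2 i

lemma inner_field_modeV (u : L2) {k : Z3} (hk : k ≠ 0) {b : C3} (hb : dotZ k b = 0) :
    inner ℝ u (field (modeV hk hb)) = (2 * Real.pi) ^ 3 * inner ℝ (fourierCoeffVec u k) b :=
  inner_of_ae_modeField u (field_modeV hk hb)

lemma waveLength_sq (k : Z3) : waveLength k ^ 2 = ∑ i, (k i : ℝ) ^ 2 :=
  Real.sq_sqrt (Finset.sum_nonneg fun _ _ => sq_nonneg _)

lemma waveLength_nonneg (k : Z3) : 0 ≤ waveLength k := Real.sqrt_nonneg _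

lemma inner_I_smul (r : ℝ) (a b : C3) :
    inner ℝ ((Complex.I * (r : ℂ)) • a) ((Complex.I * (r : ℂ)) • b) = r ^ 2 * inner ℝ a b := by
  rw [inner_C3, inner_C3, Finset.mul_sum]
  refine Finset.sum_congr rfl fun j _ => ?_
  have : starRingEnd ℂ (((Complex.I * (r : ℂ)) • a) j) * ((Complex.I * (r : ℂ)) • b) j =
      ((r ^ 2 : ℝ) : ℂ) * (starRingEnd ℂ (a j) * b j) := by
    simp only [PiLp.smul_apply, smul_eq_mul, map_mul, Complex.conj_I, Complex.conj_ofReal]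
    push_cast
    linear_combination (-(r : ℂ) ^ 2 * starRingEnd ℂ (a j) * b j) * Complex.I_mul_I
  rw [this, Complex.re_ofReal_mul]

lemma inner_grad_modeV (p : V) {k : Z3} (hk : k ≠ 0) {b : C3} (hb : dotZ k b = 0) :
    inner ℝ (grad p) (grad (modeV hk hb)) =
      (2 * Real.pi) ^ 3 * (waveLength k ^ 2 * inner ℝ (fourierCoeffVec (field p) k) b) := by
  rw [PiLp.inner_apply, waveLength_sq, Finset.sum_mul, Finset.mul_sum]
  refine Finset.sum_congr rfl fun i _ => ?_
  rw [inner_of_ae_modeField _ (grad_modeV hk hb i), fourier_grad]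
  rw [← Complex.ofReal_intCast, inner_I_smul]

lemma inner_V (p q : V) : inner ℝ p q = inner ℝ (field p) (field q) + inner ℝ (grad p) (grad q) := by
  rw [Submodule.coe_inner, WithLp.prod_inner_apply]; rfl

lemma hasSum_inner_field (p q : V) : HasSum (fun k => (2 * Real.pi) ^ 3 *
    inner ℝ (fourierCoeffVec (field p) k) (fourierCoeffVec (field q) k))
    (inner ℝ (field p) (field q)) :=
  hasSum_inner_fourier (mem_trigClosure_of_mem_H (field_mem_H p)) _

lemma hasSum_inner_grad (p q : V) : HasSum (fun k => (2 * Real.pi) ^ 3 *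
    (waveLength k ^ 2 * inner ℝ (fourierCoeffVec (field p) k) (fourierCoeffVec (field q) k)))
    (inner ℝ (grad p) (grad q)) := by
  rw [PiLp.inner_apply]
  have := hasSum_sum (s := Finset.univ) fun i _ =>
    hasSum_inner_fourier (grad_mem_trigClosure p i) (grad q i)
  convert this using 2 with k
  rw [waveLength_sq, Finset.sum_mul, Finset.mul_sum]
  refine Finset.sum_congr rfl fun i _ => ?_
  rw [fourier_grad, fourier_grad, ← Complex.ofReal_intCast, inner_I_smul]

/-! ### The space of square-summable coefficients -/

/-- Square-summable sequences of Fourier coefficients. -/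
abbrev ell : Type := lp (fun _ : Z3 => C3) 2

lemma memlp_iff {c : Z3 → C3} : Memℓp c 2 ↔ Summable fun k => ‖c k‖ ^ 2 := by
  rw [memℓp_gen_iff (by norm_num)]; simp

lemma ell_summable (a : ell) : Summable fun k => ‖a k‖ ^ 2 := memlp_iff.1 (lp.memℓp a)

lemma ell_hasSum (a : ell) : HasSum (fun k => ‖a k‖ ^ 2) (‖a‖ ^ 2) := by
  have h := lp.hasSum_inner (𝕜 := ℝ) a a
  simpa [real_inner_self_eq_norm_sq] using h

lemma ell_sum_le (a : ell) (s : Finset Z3) : ∑ k ∈ s, ‖a k‖ ^ 2 ≤ ‖a‖ ^ 2 :=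
  sum_le_hasSum s (fun _ _ => sq_nonneg _) (ell_hasSum a)

lemma ell_norm_apply_le (a : ell) (k : Z3) : ‖a k‖ ≤ ‖a‖ := lp.norm_apply_le_norm (by norm_num) a k

lemma ell_norm_le {a : ell} {C : ℝ} (hC : 0 ≤ C) (h : ∀ s : Finset Z3, ∑ k ∈ s, ‖a k‖ ^ 2 ≤ C ^ 2) :
    ‖a‖ ≤ C := by
  refine le_of_sq_le_sq ?_ hC
  exact hasSum_le_of_sum_le (ell_hasSum a) h

lemma continuous_ell_apply (k : Z3) : Continuous fun a : ell => a k :=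
  (lp.evalCLM ℝ (fun _ : Z3 => C3) 2 k).continuous

/-- A square-summable sequence as an element of `ell`. -/
def ellOf (c : Z3 → C3) (h : Summable fun k => ‖c k‖ ^ 2) : ell := ⟨c, memlp_iff.2 h⟩

@[simp] lemma ellOf_apply (c : Z3 → C3) (h) (k : Z3) : ellOf c h k = c k := rfl

/-- Pointwise multiplication by a bounded sequence of scalars. -/
def diag (w : Z3 → ℝ) (C : ℝ) (hw : ∀ k, |w k| ≤ C) : ell →L[ℝ] ell :=
  have hb : ∀ (a : ell) k, ‖w k • a k‖ ^ 2 ≤ C ^ 2 * ‖a k‖ ^ 2 := fun a k => by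
    rw [norm_smul, mul_pow, Real.norm_eq_abs]
    have := pow_le_pow_left₀ (abs_nonneg _) (hw k) 2
    gcongr
  have hs : ∀ a : ell, Summable fun k => ‖w k • a k‖ ^ 2 := fun a =>
    Summable.of_nonneg_of_le (fun _ => sq_nonneg _) (hb a) ((ell_summable a).mul_left _)
  LinearMap.mkContinuous
    { toFun := fun a => ellOf (fun k => w k • a k) (hs a)
      map_add' := fun a b => by ext1; funext k; exact smul_add _ _ _
      map_smul' := fun r a => by
        ext1; funext k
        change w k • (r • a k) = r • (w k • a k)
        exact smul_comm _ _ _ } |C| (fun a => by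
        refine ell_norm_le (by positivity) fun s => ?_
        refine (Finset.sum_le_sum fun k _ => hb a k).trans ?_
        rw [← Finset.mul_sum, mul_pow, sq_abs]
        exact mul_le_mul_of_nonneg_left (ell_sum_le a s) (sq_nonneg _))

@[simp] lemma diag_apply (w : Z3 → ℝ) (C : ℝ) (hw : ∀ k, |w k| ≤ C) (a : ell) (k : Z3) :
    diag w C hw a k = w k • a k := rfl

/-! ### Analysis and synthesis in `V` by weighted coefficients -/

/-- The weight `(1 + |k|²)^{1/2}`. -/
def bessel (k : Z3) : ℝ := Real.sqrt (1 + waveLength k ^ 2)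

lemma bessel_pos (k : Z3) : 0 < bessel k := Real.sqrt_pos.2 (by positivity)

lemma bessel_sq (k : Z3) : bessel k ^ 2 = 1 + waveLength k ^ 2 := Real.sq_sqrt (by positivity)

lemma bessel_neg (k : Z3) : bessel (-k) = bessel k := by simp [bessel, waveLength]

lemma hasSum_inner_V (p q : V) : HasSum (fun k => (2 * Real.pi) ^ 3 *
    inner ℝ (bessel k • fourierCoeffVec (field p) k) (bessel k • fourierCoeffVec (field q) k))
    (inner ℝ p q) := by
  rw [inner_V]
  convert (hasSum_inner_field p q).add (hasSum_inner_grad p q) using 2 with k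
  rw [real_inner_smul_left, real_inner_smul_right]
  linear_combination ((2 * Real.pi) ^ 3 * inner ℝ (fourierCoeffVec (field p) k)
    (fourierCoeffVec (field q) k)) * bessel_sq k

lemma field_add (p q : V) : field (p + q) = field p + field q := rfl
lemma field_smul (r : ℝ) (p : V) : field (r • p) = r • field p := rfl

lemma summable_fourierV (p : V) :
    Summable fun k => ‖bessel k • fourierCoeffVec (field p) k‖ ^ 2 := by
  have := (hasSum_inner_V p p).summable
  simp only [real_inner_self_eq_norm_sq] at this
  rwa [summable_mul_left_iff two_pi_cube_pos.ne'] at this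

/-- The weighted coefficients of an element of `V`. -/
def fourierV : V →L[ℝ] ell :=
  LinearMap.mkContinuous
    { toFun := fun p => ellOf (fun k => bessel k • fourierCoeffVec (field p) k) (summable_fourierV p)
      map_add' := fun p q => by
        ext1; funext k
        change bessel k • fourierCoeffVec (field (p + q)) k = _
        rw [field_add, fourier_add, smul_add]; rfl
      map_smul' := fun r p => by
        ext1; funext k
        change bessel k • fourierCoeffVec (field (r • p)) k = _
        rw [field_smul, fourier_smul, smul_comm]; rfl } (Real.sqrt (((2 * Real.pi) ^ 3)⁻¹)) (fun p => by
      refine ell_norm_le (by positivity) fun s => ?_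
      rw [mul_pow, Real.sq_sqrt (by positivity), ← div_eq_inv_mul, le_div_iff₀ two_pi_cube_pos]
      have := hasSum_inner_V p p
      simp only [real_inner_self_eq_norm_sq] at this
      have := sum_le_hasSum s (fun k _ => by positivity) this
      rwa [← Finset.mul_sum, mul_comm] at this)

@[simp] lemma fourierV_apply (p : V) (k : Z3) :
    fourierV p k = bessel k • fourierCoeffVec (field p) k := rfl

/-- Synthesis of an element of `V` from weighted coefficients. -/
def synthV : ell →L[ℝ] V :=
  ContinuousLinearMap.adjoint (𝕜 := ℝ) (E := V) (F := ell) (((2 * Real.pi) ^ 3) • fourierV)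

lemma inner_synthV (d : ell) (p : V) :
    inner ℝ (synthV d) p = (2 * Real.pi) ^ 3 * inner ℝ d (fourierV p) := by
  have h1 : inner ℝ (synthV d) p = inner ℝ d ((((2 * Real.pi) ^ 3) • fourierV) p) :=
    ContinuousLinearMap.adjoint_inner_left (𝕜 := ℝ) (E := V) (F := ell) _ p d
  have h2 : (((2 * Real.pi) ^ 3) • fourierV) p = ((2 * Real.pi) ^ 3) • fourierV p := rfl
  rw [h1, h2, real_inner_smul_right]

/-- A real mode has the coefficients b/2 at k and its conjugate at -k. By reality of `d` the two
contributions are equal, so the halves add up to one. -/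
lemma tsum_inner_modeV {d : Z3 → C3} (hd : Adm d) {k : Z3} (hk : k ≠ 0) {b : C3}
    (hb : dotZ k b = 0) (w : Z3 → ℝ) (hw : w (-k) = w k) :
    ∑' l, inner ℝ (d l) (w l • fourierCoeffVec (field (modeV hk hb)) l) =
      w k * inner ℝ (d k) b := by
  have hne : k ≠ -k := by
    intro h
    apply hk
    funext i
    have := congrFun h i
    simp only [Pi.neg_apply] at this
    simp; omega
  rw [tsum_eq_sum (s := {k, -k}), Finset.sum_pair hne]
  · rw [fourier_of_ae_modeField (field_modeV hk hb), fourier_of_ae_modeField (field_modeV hk hb),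
      if_pos rfl, if_neg hne, if_neg hne.symm, if_pos rfl, hd.conj, hw]
    simp only [add_zero, zero_add, real_inner_smul_right, inner_conj3]
    ring
  · intro l hl
    simp only [Finset.mem_insert, Finset.mem_singleton, not_or] at hl
    rw [fourier_of_ae_modeField (field_modeV hk hb), if_neg hl.1, if_neg hl.2]
    simp

/-- The difference a - b is itself an allowed test vector. -/
lemma eq_of_inner_eq {k : Z3} {a b : C3} (ha : dotZ k a = 0) (hb : dotZ k b = 0)
    (h : ∀ c, dotZ k c = 0 → inner ℝ a c = inner ℝ b c) : a = b := by
  have hc : dotZ k (a - b) = 0 := by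
    rw [sub_eq_add_neg, dotZ_add, ← neg_one_smul ℂ b, dotZ_smul, ha, hb]; simp
  have := h _ hc
  rw [← sub_eq_zero, ← inner_sub_left, inner_self_eq_zero] at this
  exact sub_eq_zero.1 this

/-- The pairing of `synthV d` with a mode is computed twice, from the inner product of `V` and from
the adjoint. Defining synthesis as an adjoint places the result in `V` at once, without summing a
series there. -/
lemma fourier_synthV {d : ell} (hd : Adm d) (k : Z3) :
    fourierCoeffVec (field (synthV d)) k = (bessel k)⁻¹ • d k := by
  by_cases hk : k = 0
  · subst hk
    rw [hd.zero, (adm_of_mem_H (field_mem_H _)).zero]; simp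
  · refine eq_of_inner_eq (k := k) ((adm_of_mem_H (field_mem_H _)).div k) ?_ fun b hb => ?_
    · simp only [dotZ_smul_real, hd.div, mul_zero]
    · have h1 : inner ℝ (synthV d) (modeV hk hb) = (2 * Real.pi) ^ 3 * ((1 + waveLength k ^ 2) *
          inner ℝ (fourierCoeffVec (field (synthV d)) k) b) := by
        rw [inner_V, inner_field_modeV, inner_grad_modeV]; ring
      have h2 : inner ℝ (synthV d) (modeV hk hb) =
          (2 * Real.pi) ^ 3 * (bessel k * inner ℝ (d k) b) := by
        rw [inner_synthV, lp.inner_eq_tsum]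
        simp only [fourierV_apply]
        rw [tsum_inner_modeV hd hk hb bessel (bessel_neg k)]
      rw [h1, ← bessel_sq] at h2
      have hb0 := (bessel_pos k).ne'
      have hp0 := two_pi_cube_pos.ne'
      simp only [real_inner_smul_left]
      field_simp at h2 ⊢
      linarith

/-! ### Convolution and the trilinear form -/

lemma hasSum_of_eq {ι α : Type*} [AddCommMonoid α] [TopologicalSpace α] {f g : ι → α} {a : α}
    (h : HasSum f a) (e : ∀ j, g j = f j) : HasSum g a := by
  rwa [show g = f from funext e]

/-- The functional F ↦ ∫ F g e^{-ik·x} is continuous on L²(Ω), with the conjugate of g e^{-ik·x} as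
Riesz representative. Applied to the expansion of `f` it produces the convolution. -/
lemma hasSum_fcoeff_mul {f : CL2} (hf : f ∈ expClosure) (g : CL2) (k : Z3) :
    HasSum (fun j => fcoeff f j * fcoeff g (k - j))
      ((((2 * Real.pi) ^ 3 : ℝ) : ℂ)⁻¹ * ∫ x, f x * g x * expPhase (-k) x ∂cellMeasure) := by
  have hm : MemLp (fun x => starRingEnd ℂ (g x * expPhase (-k) x)) 2 cellMeasure := by
    refine MemLp.of_le (Lp.memLp g) ?_ (Eventually.of_forall fun x => ?_)
    · exact Complex.continuous_conj.comp_aestronglyMeasurable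
        ((Lp.memLp g).aestronglyMeasurable.mul (continuous_expPhase _).aestronglyMeasurable)
    · rw [RCLike.norm_conj, norm_mul, norm_expPhase, mul_one]
  have hin : ∀ F : CL2, inner ℂ (hm.toLp _) F = ∫ x, F x * g x * expPhase (-k) x ∂cellMeasure := by
    intro F
    rw [L2.inner_def]
    refine integral_congr_ae ?_
    filter_upwards [hm.coeFn_toLp] with x hx
    rw [hx]
    simp; ring
  have h := ((hasSum_fcoeff hf).mapL (innerSL ℂ (hm.toLp _))).mul_left
    ((((2 * Real.pi) ^ 3 : ℝ) : ℂ)⁻¹)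
  simp only [innerSL_apply_apply, inner_smul_right] at h
  rw [hin f] at h
  refine hasSum_of_eq h fun j => ?_
  rw [hin]
  have hfg : fcoeff g (k - j) = (((2 * Real.pi) ^ 3 : ℝ) : ℂ)⁻¹ *
      ∫ x, g x * expPhase (-(k - j)) x ∂cellMeasure := by rw [fcoeff, inner_expL2]
  have : ∫ x, (expL2 j : E3 → ℂ) x * g x * expPhase (-k) x ∂cellMeasure =
      ∫ x, g x * expPhase (-(k - j)) x ∂cellMeasure := by
    refine integral_congr_ae ?_
    filter_upwards [expL2_coe j] with x hx
    rw [hx, show -(k - j) = j + -k by ring, expPhase_add]; ring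
  rw [hfg, this]; ring

lemma hasSum_C3 {ι : Type*} {f : ι → C3} {a : C3} (h : ∀ m, HasSum (fun j => f j m) (a m)) :
    HasSum f a := by
  have h1 : HasSum (fun j => (WithLp.ofLp (f j) : Fin 3 → ℂ)) (WithLp.ofLp a) :=
    Pi.hasSum.2 h
  exact h1.mapL (PiLp.continuousLinearEquiv 2 ℂ (fun _ : Fin 3 => ℂ)).symm.toContinuousLinearMap

/-- The Fourier coefficients of `(u · ∇) v` in terms of those of `u` and `v`. -/
def convN (c d : Z3 → C3) (k : Z3) : C3 :=
  ∑' j, (Complex.I * dotZ (k - j) (c j)) • d (k - j)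

/-- The field `(u · ∇) v`. -/
def advect (u v : V) (x : E3) : E3 :=
  ∑ i, ((field u : E3 → E3) x i) • (grad v i : E3 → E3) x

lemma memLp_apply (u : L2) (i : Fin 3) : MemLp (fun x => (u : E3 → E3) x i) 2 cellMeasure :=
  (EuclideanSpace.proj i : E3 →L[ℝ] ℝ).comp_memLp u

lemma integrable_advect_summand (u w : L2) (i : Fin 3) :
    Integrable (fun x => ((u : E3 → E3) x i) • (w : E3 → E3) x) cellMeasure :=
  memLp_one_iff_integrable.1 ((Lp.memLp w).smul (memLp_apply u i))

lemma integrable_advect (u v : V) : Integrable (advect u v) cellMeasure := by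
  unfold advect
  exact integrable_finsetSum _ fun i _ => integrable_advect_summand _ _ i

/-- Summing the scalar convolutions of uᵢ and ∂ᵢv over i assembles the factor i(k-j)·û(j).
Convergence is part of the claim, since the `tsum` in `convN` would otherwise only have its default
value. -/
lemma advect_coeff (u v : V) (k : Z3) : ∃ g : C3,
    HasSum (fun j => (Complex.I * dotZ (k - j) (fourierCoeffVec (field u) j)) •
      fourierCoeffVec (field v) (k - j)) g ∧
    ∀ m, (((2 * Real.pi) ^ 3 : ℝ) : ℂ) * g m =
      ∫ x, ((advect u v x m : ℝ) : ℂ) * expPhase (-k) x ∂cellMeasure := by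
  refine ⟨WithLp.toLp 2 fun m => (((2 * Real.pi) ^ 3 : ℝ) : ℂ)⁻¹ *
    ∫ x, ((advect u v x m : ℝ) : ℂ) * expPhase (-k) x ∂cellMeasure, hasSum_C3 fun m => ?_,
    fun m => mul_inv_cancel_left₀ two_pi_cube_ne_zero _⟩
  have hint : ∀ i, Integrable (fun x => (((field u : E3 → E3) x i : ℝ) : ℂ) *
      (((grad v i : E3 → E3) x m : ℝ) : ℂ) * expPhase (-k) x) cellMeasure := by
    intro i
    have h1 := (Complex.ofRealCLM.comp (EuclideanSpace.proj m : E3 →L[ℝ] ℝ)).integrable_comp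
      (integrable_advect_summand (field u) (grad v i) i)
    have h2 := h1.mul_bdd (c := 1) (continuous_expPhase (-k)).aestronglyMeasurable
      (Eventually.of_forall fun x => (norm_expPhase (-k) x).le)
    refine h2.congr (Eventually.of_forall fun x => ?_)
    simp
  have h := hasSum_sum (s := Finset.univ) fun i _ =>
    hasSum_fcoeff_mul (mem_trigClosure_of_mem_H (field_mem_H u) i) (comp m (grad v i)) k
  have hval : (((2 * Real.pi) ^ 3 : ℝ) : ℂ)⁻¹ *
      ∫ x, ((advect u v x m : ℝ) : ℂ) * expPhase (-k) x ∂cellMeasure =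
      ∑ i, (((2 * Real.pi) ^ 3 : ℝ) : ℂ)⁻¹ * ∫ x, (comp i (field u) : E3 → ℂ) x *
        (comp m (grad v i) : E3 → ℂ) x * expPhase (-k) x ∂cellMeasure := by
    rw [← Finset.mul_sum]
    congr 1
    have : ∀ i, ∫ x, (comp i (field u) : E3 → ℂ) x * (comp m (grad v i) : E3 → ℂ) x *
        expPhase (-k) x ∂cellMeasure = ∫ x, (((field u : E3 → E3) x i : ℝ) : ℂ) *
      (((grad v i : E3 → E3) x m : ℝ) : ℂ) * expPhase (-k) x ∂cellMeasure := by
      intro i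
      refine integral_congr_ae ?_
      filter_upwards [comp_coe i (field u), comp_coe m (grad v i)] with x h1 h2
      rw [h1, h2]
    simp_rw [this]
    rw [← integral_finsetSum _ fun i _ => hint i]
    refine integral_congr_ae (Eventually.of_forall fun x => ?_)
    simp only
    rw [← Finset.sum_mul]
    congr 1
    simp [advect]
  · change HasSum _ ((((2 * Real.pi) ^ 3 : ℝ) : ℂ)⁻¹ *
      ∫ x, ((advect u v x m : ℝ) : ℂ) * expPhase (-k) x ∂cellMeasure)
    rw [hval]
    refine hasSum_of_eq h fun j => ?_
    rw [PiLp.smul_apply, smul_eq_mul, dotZ, Finset.mul_sum, Finset.sum_mul]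
    refine Finset.sum_congr rfl fun i _ => ?_
    rw [← fourierCoeffVec_apply, ← fourierCoeffVec_apply, fourier_grad, PiLp.smul_apply, smul_eq_mul]
    ring

lemma convN_eq (u v : V) (k : Z3) (m : Fin 3) : (((2 * Real.pi) ^ 3 : ℝ) : ℂ) *
    convN (fourierCoeffVec (field u)) (fourierCoeffVec (field v)) k m =
      ∫ x, ((advect u v x m : ℝ) : ℂ) * expPhase (-k) x ∂cellMeasure := by
  obtain ⟨g, hg, hg'⟩ := advect_coeff u v k
  rw [← hg', convN, hg.tsum_eq]

lemma trilinear_modeV (u v : V) {k : Z3} (hk : k ≠ 0) {b : C3} (hb : dotZ k b = 0) :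
    trilinear u v (modeV hk hb) = (2 * Real.pi) ^ 3 *
      inner ℝ (convN (fourierCoeffVec (field u)) (fourierCoeffVec (field v)) k) b := by
  rw [← integral_inner_modeField (integrable_advect u v) k b _ (convN_eq u v k), trilinear]
  refine integral_congr_ae ?_
  filter_upwards [field_modeV hk hb] with x hx
  rw [hx]; rfl

/-! ### The Leray projection -/

/-- A wave vector as a complex vector. -/
def waveC (k : Z3) : C3 := WithLp.toLp 2 fun i => (k i : ℂ)

/-- The Leray projection on Fourier coefficients of index `k`. -/
def leray (k : Z3) (c : C3) : C3 := c - (dotZ k c / (waveLength k ^ 2 : ℝ)) • waveC k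

lemma dotZ_waveC (k : Z3) : dotZ k (waveC k) = ((waveLength k ^ 2 : ℝ) : ℂ) := by
  rw [waveLength_sq, dotZ, Complex.ofReal_sum]
  refine Finset.sum_congr rfl fun i _ => ?_
  simp [waveC, sq]

lemma waveLength_pos {k : Z3} (hk : k ≠ 0) : 0 < waveLength k := by
  refine Real.sqrt_pos.2 ?_
  obtain ⟨i, hi⟩ := Function.ne_iff.mp hk
  have h0 : (k i : ℝ) ≠ 0 := by exact_mod_cast hi
  have : 0 < (k i : ℝ) ^ 2 := by positivity
  exact lt_of_lt_of_le this (Finset.single_le_sum (f := fun i => (k i : ℝ) ^ 2)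
    (fun _ _ => sq_nonneg _) (Finset.mem_univ i))

lemma dotZ_sub (k : Z3) (a b : C3) : dotZ k (a - b) = dotZ k a - dotZ k b := by
  simp [dotZ, mul_sub, Finset.sum_sub_distrib]

lemma dotZ_leray (k : Z3) (c : C3) : dotZ k (leray k c) = 0 := by
  by_cases hk : k = 0
  · subst hk; simp [dotZ]
  · have : ((waveLength k ^ 2 : ℝ) : ℂ) ≠ 0 := by
      exact_mod_cast (pow_pos (waveLength_pos hk) 2).ne'
    rw [leray, dotZ_sub, dotZ_smul, dotZ_waveC, div_mul_cancel₀ _ this, sub_self]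

lemma inner_smul_waveC (k : Z3) (r : ℂ) {b : C3} (hb : dotZ k b = 0) :
    inner ℝ (r • waveC k) b = 0 := by
  rw [inner_C3, ← Complex.re_sum]
  have : ∑ j, starRingEnd ℂ ((r • waveC k) j) * b j = starRingEnd ℂ r * dotZ k b := by
    rw [dotZ, Finset.mul_sum]
    refine Finset.sum_congr rfl fun i _ => ?_
    simp [waveC]; ring
  rw [this, hb]; simp

/-- The removed part is a multiple of the wave vector, invisible to divergence-free directions. This
is how the pressure disappears. -/
lemma inner_leray (k : Z3) (c : C3) {b : C3} (hb : dotZ k b = 0) :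
    inner ℝ (leray k c) b = inner ℝ c b := by
  rw [leray, inner_sub_left, inner_smul_waveC k _ hb, sub_zero]

lemma norm_leray_le (k : Z3) (c : C3) : ‖leray k c‖ ≤ ‖c‖ := by
  have h : ‖leray k c‖ * ‖leray k c‖ ≤ ‖c‖ * ‖leray k c‖ := by
    rw [← real_inner_self_eq_norm_mul_norm, inner_leray k c (dotZ_leray k c)]
    exact real_inner_le_norm _ _
  by_cases h0 : ‖leray k c‖ = 0
  · rw [h0]; positivity
  · exact le_of_mul_le_mul_right h (lt_of_le_of_ne (norm_nonneg _) (Ne.symm h0))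

lemma leray_add (k : Z3) (a b : C3) : leray k (a + b) = leray k a + leray k b := by
  rw [leray, leray, leray, dotZ_add, add_div, add_smul]; abel

lemma leray_smul (k : Z3) (r : ℝ) (a : C3) : leray k (r • a) = r • leray k a := by
  rw [leray, leray, dotZ_smul_real, smul_sub, mul_div_assoc, mul_smul]
  congr 1

lemma conj3_add (a b : C3) : conj3 (a + b) = conj3 a + conj3 b := by ext i; simp

lemma conj3_smul (r : ℂ) (a : C3) : conj3 (r • a) = starRingEnd ℂ r • conj3 a := by ext i; simp

lemma conj3_smul_real (r : ℝ) (a : C3) : conj3 (r • a) = r • conj3 a := by ext i; simp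

lemma dotZ_neg_conj3 (k : Z3) (a : C3) : dotZ (-k) (conj3 a) = -starRingEnd ℂ (dotZ k a) := by
  simp [dotZ]

lemma waveLength_neg (k : Z3) : waveLength (-k) = waveLength k := by simp [waveLength]

lemma leray_conj (k : Z3) (c : C3) : leray (-k) (conj3 c) = conj3 (leray k c) := by
  ext i
  simp only [leray, PiLp.sub_apply, conj3_apply, PiLp.smul_apply, smul_eq_mul, map_sub, map_mul,
    dotZ_neg_conj3, waveLength_neg, map_div₀, Complex.conj_ofReal, waveC]
  simp
  ring

lemma eq_leray {k : Z3} {w n : C3} (hw : dotZ k w = 0)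
    (h : ∀ b, dotZ k b = 0 → inner ℝ w b = inner ℝ n b) : w = leray k n :=
  eq_of_inner_eq hw (dotZ_leray k n) fun c hc => by rw [h c hc, inner_leray k n hc]

/-- The projected convolution: coefficients of `B(u, v)`. -/
def convB (c d : Z3 → C3) (k : Z3) : C3 := if k = 0 then 0 else leray k (convN c d k)

lemma convN_conj {c d : Z3 → C3} (hc : ∀ k, c (-k) = conj3 (c k)) (hd : ∀ k, d (-k) = conj3 (d k))
    (k : Z3) : convN c d (-k) = conj3 (convN c d k) := by
  have h1 : conj3 (convN c d k) =
      ∑' j, conj3 ((Complex.I * dotZ (k - j) (c j)) • d (k - j)) := by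
    let e : C3 ≃L[ℝ] C3 :=
      { toFun := conj3, invFun := conj3, left_inv := conj3_conj3, right_inv := conj3_conj3
        map_add' := conj3_add, map_smul' := conj3_smul_real
        continuous_toFun := continuous_conj3, continuous_invFun := continuous_conj3 }
    exact e.map_tsum
  rw [h1, convN, ← (Equiv.neg Z3).tsum_eq]
  congr 1; funext j
  rw [Equiv.neg_apply, show -k - -j = -(k - j) by ring, hc, hd, dotZ_neg_conj3, conj3_smul]
  simp

lemma adm_convB {c d : Z3 → C3} (hc : ∀ k, c (-k) = conj3 (c k)) (hd : ∀ k, d (-k) = conj3 (d k)) :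
    Adm (convB c d) := by
  refine ⟨if_pos rfl, fun k => ?_, fun k => ?_⟩
  · unfold convB; split_ifs
    · exact dotZ_zero k
    · exact dotZ_leray _ _
  · unfold convB
    by_cases h : k = 0
    · subst h; simp; ext i; simp
    · rw [if_neg h, if_neg (neg_ne_zero.2 h), convN_conj hc hd, leray_conj]

/-- The element of `H` representing `B(u, v)` has coefficients `convB`. -/
lemma fourier_of_trilinear {u v : V} {w : H}
    (hw : ∀ z : V, inner ℝ (w : L2) (field z) = trilinear u v z) (k : Z3) :
    fourierCoeffVec w k =
      convB (fourierCoeffVec (field u)) (fourierCoeffVec (field v)) k := by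
  have ha := adm_of_mem_H w.2
  unfold convB; split_ifs with hk
  · rw [hk, ha.zero]
  · refine eq_leray (ha.div k) fun b hb => ?_
    have h := hw (modeV hk hb)
    rw [inner_field_modeV, trilinear_modeV] at h
    exact mul_left_cancel₀ two_pi_cube_pos.ne' h

/-- The partial sums converge in L², hence in measure, hence almost everywhere along a sequence of
finite sets; each partial sum obeys the bound pointwise. -/
lemma ae_bound_of_summable {g : CL2} (hg : g ∈ expClosure) (hs : Summable fun k => ‖fcoeff g k‖) :
    ∀ᵐ x ∂cellMeasure, ‖g x‖ ≤ ∑' k, ‖fcoeff g k‖ := by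
  have h := hasSum_fcoeff hg
  have hm : TendstoInMeasure cellMeasure
      (fun s : Finset Z3 => ((∑ k ∈ s, fcoeff g k • expL2 k : CL2) : E3 → ℂ)) atTop g :=
    tendstoInMeasure_of_tendsto_Lp h
  obtain ⟨ns, -, hns⟩ := hm.exists_seq_tendsto_ae'
  have hb : ∀ s : Finset Z3, ∀ᵐ x ∂cellMeasure,
      ‖((∑ k ∈ s, fcoeff g k • expL2 k : CL2) : E3 → ℂ) x‖ ≤ ∑' k, ‖fcoeff g k‖ := by
    intro s
    have h1 : ∀ᵐ x ∂cellMeasure, ((∑ k ∈ s, fcoeff g k • expL2 k : CL2) : E3 → ℂ) x =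
        ∑ k ∈ s, fcoeff g k * expPhase k x := by
      induction s using Finset.induction_on with
      | empty =>
        filter_upwards [Lp.coeFn_zero ℂ 2 cellMeasure] with x hx
        simpa using hx
      | insert a s ha ih =>
        rw [Finset.sum_insert ha]
        filter_upwards [ih, Lp.coeFn_add (fcoeff g a • expL2 a) (∑ k ∈ s, fcoeff g k • expL2 k),
          Lp.coeFn_smul (fcoeff g a) (expL2 a), expL2_coe a] with x h1 h2 h3 h4
        rw [h2, Pi.add_apply, h3, Pi.smul_apply, h4, h1, Finset.sum_insert ha, smul_eq_mul]
    filter_upwards [h1] with x hx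
    rw [hx]
    refine (norm_sum_le _ _).trans ?_
    simp only [norm_mul, norm_expPhase, mul_one]
    exact hs.sum_le_tsum s fun _ _ => norm_nonneg _
  filter_upwards [hns, ae_all_iff.2 fun n => hb (ns n)] with x h1 h2
  exact le_of_tendsto h1.norm (Eventually.of_forall h2)

/-- If the Fourier series of `u` converges absolutely, `b(u, v, ·)` is represented in `H`. -/
lemma exists_repr_trilinear {u : V} (hs : Summable fun k => ‖fourierCoeffVec (field u) k‖) (v : V) :
    ∃ w : H, ∀ z : V, inner ℝ (w : L2) (field z) = trilinear u v z := by
  have hb : ∀ i, ∃ C, ∀ᵐ x ∂cellMeasure, ‖(field u : E3 → E3) x i‖ ≤ C := by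
    intro i
    refine ⟨∑' k, ‖fcoeff (comp i (field u)) k‖, ?_⟩
    have h1 : Summable fun k => ‖fcoeff (comp i (field u)) k‖ := by
      refine Summable.of_nonneg_of_le (fun _ => norm_nonneg _) (fun k => ?_) hs
      rw [← fourierCoeffVec_apply]
      exact PiLp.norm_apply_le _ i
    filter_upwards [ae_bound_of_summable (mem_trigClosure_of_mem_H (field_mem_H u) i) h1,
      comp_coe i (field u)] with x h2 h3
    rw [h3, Complex.norm_real] at h2
    exact h2
  have hG : MemLp (advect u v) 2 cellMeasure := by
    unfold advect
    refine memLp_finsetSum _ fun i _ => ?_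
    obtain ⟨C, hC⟩ := hb i
    refine MemLp.of_le_mul (c := C) (Lp.memLp (grad v i))
      (integrable_advect_summand _ _ _).aestronglyMeasurable ?_
    filter_upwards [hC] with x hx
    rw [norm_smul]
    exact mul_le_mul_of_nonneg_right hx (norm_nonneg _)
  -- A bounded u makes (u·∇)v square-integrable; test fields lie in `H`, so they see only its
  -- projection to `H`.
  refine ⟨H.orthogonalProjectionOnto (hG.toLp _), fun z => ?_⟩
  have h := Submodule.inner_orthogonalProjectionOnto_eq_of_mem_right (𝕜 := ℝ)
    (⟨field z, field_mem_H z⟩ : H) (hG.toLp _)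
  refine (show _ = _ from h).trans ?_
  rw [L2.inner_def, trilinear]
  refine integral_congr_ae ?_
  filter_upwards [hG.coeFn_toLp] with x hx
  rw [hx]; rfl

/-! ### Weights -/

/-- The weight `|k|^s`, extended by zero at `k = 0`. -/
def wt (s : ℝ) (k : Z3) : ℝ := if k = 0 then 0 else waveLength k ^ s

lemma one_le_waveLength {k : Z3} (hk : k ≠ 0) : 1 ≤ waveLength k := by
  have h := waveLength_pos hk
  have h2 : (0 : ℝ) < ∑ i, (k i : ℝ) ^ 2 := by rw [← waveLength_sq]; positivity
  have h3 : (0 : ℤ) < ∑ i, (k i) ^ 2 := by exact_mod_cast h2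
  have h4 : (1 : ℝ) ≤ ∑ i, (k i : ℝ) ^ 2 := by exact_mod_cast h3
  rw [← waveLength_sq] at h4
  nlinarith

lemma wt_zero_right (s : ℝ) : wt s 0 = 0 := if_pos rfl

lemma wt_of_ne (s : ℝ) {k : Z3} (hk : k ≠ 0) : wt s k = waveLength k ^ s := if_neg hk

lemma wt_nonneg (s : ℝ) (k : Z3) : 0 ≤ wt s k := by
  unfold wt; split_ifs
  · exact le_rfl
  · exact Real.rpow_nonneg (waveLength_nonneg k) s

lemma wt_mul (s t : ℝ) (k : Z3) : wt s k * wt t k = wt (s + t) k := by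
  by_cases hk : k = 0
  · subst hk; simp [wt_zero_right]
  · rw [wt_of_ne s hk, wt_of_ne t hk, wt_of_ne _ hk, Real.rpow_add (waveLength_pos hk)]

lemma wt_zero_left {k : Z3} (hk : k ≠ 0) : wt 0 k = 1 := by rw [wt_of_ne 0 hk, Real.rpow_zero]

lemma wt_mono {s t : ℝ} (h : s ≤ t) (k : Z3) : wt s k ≤ wt t k := by
  by_cases hk : k = 0
  · subst hk; simp [wt_zero_right]
  · rw [wt_of_ne s hk, wt_of_ne t hk]
    exact Real.rpow_le_rpow_of_exponent_le (one_le_waveLength hk) h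

lemma wt_le_one {s : ℝ} (h : s ≤ 0) (k : Z3) : wt s k ≤ 1 := by
  by_cases hk : k = 0
  · subst hk; simp [wt_zero_right]
  · exact (wt_mono h k).trans (wt_zero_left hk).le

lemma wt_neg (s : ℝ) (k : Z3) : wt s (-k) = wt s k := by
  unfold wt; rw [waveLength_neg]; simp

lemma wt_one (k : Z3) : wt 1 k = waveLength k := by
  by_cases hk : k = 0
  · subst hk; simp [wt_zero_right, waveLength]
  · rw [wt_of_ne 1 hk, Real.rpow_one]

lemma wt_two (k : Z3) : wt 2 k = waveLength k ^ 2 := by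
  rw [show (2 : ℝ) = 1 + 1 by norm_num, ← wt_mul, wt_one, sq]

lemma wt_sq (s : ℝ) (k : Z3) : wt s k ^ 2 = wt (2 * s) k := by rw [sq, wt_mul, two_mul]

/-- A wave vector as a real vector. -/
def waveR (k : Z3) : E3 := WithLp.toLp 2 fun i => (k i : ℝ)

lemma norm_waveR (k : Z3) : ‖waveR k‖ = waveLength k := by
  rw [EuclideanSpace.norm_eq, waveLength]
  simp [waveR]

lemma waveR_add (k l : Z3) : waveR (k + l) = waveR k + waveR l := by
  ext i; simp [waveR]

lemma waveLength_add_le (k l : Z3) : waveLength (k + l) ≤ waveLength k + waveLength l := by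
  rw [← norm_waveR, ← norm_waveR, ← norm_waveR, waveR_add]; exact norm_add_le _ _

lemma norm_dotZ_le (k : Z3) (c : C3) : ‖dotZ k c‖ ≤ waveLength k * ‖c‖ := by
  have h : ‖dotZ k c‖ ≤ ∑ i, |(k i : ℝ)| * ‖c i‖ := by
    refine (norm_sum_le _ _).trans (Finset.sum_le_sum fun i _ => ?_)
    rw [norm_mul, Complex.norm_intCast]
  refine h.trans ?_
  refine le_of_sq_le_sq ?_ (mul_nonneg (waveLength_nonneg k) (norm_nonneg c))
  refine (Finset.sum_mul_sq_le_sq_mul_sq _ _ _).trans (le_of_eq ?_)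
  rw [mul_pow, waveLength_sq, EuclideanSpace.norm_sq_eq]
  simp

/-- The wave vectors form a lattice of rank 3, for which the threshold for summing powers of the
norm is the rank. -/
lemma summable_wt {s : ℝ} (hs : s < -3) : Summable fun k => wt s k := by
  let b := (EuclideanSpace.basisFun (Fin 3) ℝ).toBasis
  let L : Submodule ℤ E3 := Submodule.span ℤ (range b)
  have hrank : Module.finrank ℤ L = 3 := by
    rw [ZLattice.rank ℝ]; simp
  have hL : ∀ k, waveR k ∈ L := by
    intro k
    have : waveR k = ∑ i, (k i) • b i := by
      ext j
      simp [b, waveR, Pi.single_apply]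
    rw [this]
    exact Submodule.sum_mem _ fun i _ => Submodule.smul_mem _ _ (Submodule.subset_span ⟨i, rfl⟩)
  have h := ZLattice.summable_norm_rpow L s (by rw [hrank]; exact_mod_cast hs)
  have hinj : Function.Injective fun k : Z3 => (⟨waveR k, hL k⟩ : L) := by
    intro k l hkl
    have h1 : waveR k = waveR l := congrArg Subtype.val hkl
    funext i
    have := congrArg (fun v : E3 => v i) h1
    simpa [waveR] using this
  refine Summable.of_nonneg_of_le (wt_nonneg s) (fun k => ?_) (h.comp_injective hinj)
  change wt s k ≤ ‖waveR k‖ ^ s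
  rw [norm_waveR]
  unfold wt; split_ifs
  · exact Real.rpow_nonneg (waveLength_nonneg k) s
  · exact le_rfl

/-! ### Convolution estimates -/

lemma ENNReal_tsum_mul_sq_le {ι : Type*} (f g : ι → ℝ≥0∞) :
    (∑' i, f i * g i) ^ 2 ≤ (∑' i, f i ^ 2) * ∑' i, g i ^ 2 := by
  have h : ∑' i, f i * g i ≤ ((∑' i, f i ^ 2) * ∑' i, g i ^ 2) ^ (1 / 2 : ℝ) := by
    rw [ENNReal.tsum_eq_iSup_sum]
    refine iSup_le fun s => ?_
    have := ENNReal.inner_le_Lp_mul_Lq s f g Real.HolderConjugate.two_two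
    refine this.trans ?_
    rw [ENNReal.mul_rpow_of_nonneg _ _ (by norm_num)]
    simp only [ENNReal.rpow_two]
    gcongr <;> exact ENNReal.sum_le_tsum s
  calc (∑' i, f i * g i) ^ 2 ≤ (((∑' i, f i ^ 2) * ∑' i, g i ^ 2) ^ (1 / 2 : ℝ)) ^ 2 := by gcongr
    _ = _ := by
      rw [← ENNReal.rpow_natCast, ← ENNReal.rpow_mul]; norm_num

/-- Cauchy–Schwarz with the kernel kept next to `B`. After exchanging the sums, the kernel is summed
over j with the difference l = k - j fixed, so decay in the output frequency k helps. -/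
lemma conv_le_of_col {κ : Z3 → Z3 → ℝ≥0∞} {S : ℝ≥0∞} (hκ : ∀ l, ∑' j, κ (j + l) j ^ 2 ≤ S)
    (A B : Z3 → ℝ≥0∞) : ∑' k, (∑' j, κ k j * A j * B (k - j)) ^ 2 ≤
      S * (∑' k, A k ^ 2) * ∑' k, B k ^ 2 := by
  have h1 : ∀ k, (∑' j, κ k j * A j * B (k - j)) ^ 2 ≤
      (∑' j, A j ^ 2) * ∑' j, (κ k j * B (k - j)) ^ 2 := fun k => by
    refine le_trans (le_of_eq ?_) (ENNReal_tsum_mul_sq_le _ _)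
    congr 2; funext j; ring
  calc _ ≤ ∑' k, (∑' j, A j ^ 2) * ∑' j, (κ k j * B (k - j)) ^ 2 := ENNReal.tsum_le_tsum h1
    _ = (∑' j, A j ^ 2) * ∑' j, ∑' k, (κ k j * B (k - j)) ^ 2 := by
      rw [ENNReal.tsum_mul_left, ENNReal.tsum_comm]
    _ = (∑' j, A j ^ 2) * ∑' j, ∑' l, (κ (j + l) j * B l) ^ 2 := by
      congr 2; funext j
      rw [← (Equiv.addLeft j).tsum_eq]
      congr 1; funext l
      simp
    _ = (∑' j, A j ^ 2) * ∑' l, B l ^ 2 * ∑' j, κ (j + l) j ^ 2 := by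
      rw [ENNReal.tsum_comm]
      congr 2; funext l
      rw [← ENNReal.tsum_mul_left]
      congr 1; funext j; ring
    _ ≤ (∑' j, A j ^ 2) * ∑' l, B l ^ 2 * S := by
      gcongr with l; exact hκ l
    _ = _ := by rw [ENNReal.tsum_mul_right]; ring

/-- Here the kernel is split off alone by Cauchy–Schwarz, so it is summed over j with the output
frequency k fixed. -/
lemma conv_le_of_row {κ : Z3 → Z3 → ℝ≥0∞} {S : ℝ≥0∞} (hκ : ∀ k, ∑' j, κ k j ^ 2 ≤ S)
    (A B : Z3 → ℝ≥0∞) : ∑' k, (∑' j, κ k j * A j * B (k - j)) ^ 2 ≤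
      S * (∑' k, A k ^ 2) * ∑' k, B k ^ 2 := by
  have h1 : ∀ k, (∑' j, κ k j * A j * B (k - j)) ^ 2 ≤
      S * ∑' j, (A j * B (k - j)) ^ 2 := fun k => by
    refine le_trans (le_trans (le_of_eq ?_) (ENNReal_tsum_mul_sq_le (κ k) _))
      (mul_le_mul_left (hκ k) _)
    congr 2; funext j; ring
  calc _ ≤ ∑' k, S * ∑' j, (A j * B (k - j)) ^ 2 := ENNReal.tsum_le_tsum h1
    _ = S * ∑' j, ∑' k, (A j * B (k - j)) ^ 2 := by
      rw [ENNReal.tsum_mul_left, ENNReal.tsum_comm]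
    _ = S * ∑' j, A j ^ 2 * ∑' l, B l ^ 2 := by
      congr 2; funext j
      rw [← (Equiv.addLeft j).tsum_eq, ← ENNReal.tsum_mul_left]
      congr 1; funext l
      simp [mul_pow]
    _ = _ := by rw [ENNReal.tsum_mul_right, mul_assoc]

lemma enorm_eq_ofReal (x : C3) : ‖x‖ₑ = ENNReal.ofReal ‖x‖ := (ofReal_norm x).symm

/-- The Leray projection is a contraction and |(k-j)·c_j| ≤ |k-j| |c_j|, so estimates for B reduce
to an inequality between weights. It is required only for nonzero k, j and k - j, because the
remaining terms vanish. -/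
lemma enorm_convB_le {c d : Z3 → C3} (hc : c 0 = 0) {W w₁ w₂ : Z3 → ℝ} {κ : Z3 → Z3 → ℝ}
    (hW : ∀ k, 0 ≤ W k) (h1 : ∀ k, 0 ≤ w₁ k) (hκ : ∀ k j, 0 ≤ κ k j)
    (h : ∀ k j, k ≠ 0 → j ≠ 0 → k - j ≠ 0 →
      W k * waveLength (k - j) ≤ κ k j * w₁ j * w₂ (k - j)) (k : Z3) :
    ENNReal.ofReal (W k) * ‖convB c d k‖ₑ ≤ ∑' j, ENNReal.ofReal (κ k j) *
      (ENNReal.ofReal (w₁ j) * ‖c j‖ₑ) * (ENNReal.ofReal (w₂ (k - j)) * ‖d (k - j)‖ₑ) := by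
  unfold convB; split_ifs with hk
  · simp
  · have h2 : ‖leray k (convN c d k)‖ₑ ≤
        ∑' j, ‖(Complex.I * dotZ (k - j) (c j)) • d (k - j)‖ₑ := by
      refine le_trans ?_ enorm_tsum_le_tsum_enorm
      rw [enorm_eq_ofReal, enorm_eq_ofReal]
      exact ENNReal.ofReal_le_ofReal (norm_leray_le _ _)
    refine (mul_le_mul_right h2 _).trans ?_
    rw [← ENNReal.tsum_mul_left]
    refine ENNReal.tsum_le_tsum fun j => ?_
    by_cases hj : j = 0
    · subst hj; simp [hc, dotZ]
    by_cases hl : k - j = 0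
    · rw [hl]; simp [dotZ]
    rw [enorm_eq_ofReal, enorm_eq_ofReal, enorm_eq_ofReal, ← ENNReal.ofReal_mul (hW k),
      ← ENNReal.ofReal_mul (h1 j), ← ENNReal.ofReal_mul (hκ k j),
      ← ENNReal.ofReal_mul' (norm_nonneg _), ← ENNReal.ofReal_mul (mul_nonneg (hκ k j)
        (mul_nonneg (h1 j) (norm_nonneg _)))]
    refine ENNReal.ofReal_le_ofReal ?_
    rw [norm_smul, norm_mul, Complex.norm_I, one_mul]
    calc W k * (‖dotZ (k - j) (c j)‖ * ‖d (k - j)‖)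
        ≤ W k * (waveLength (k - j) * ‖c j‖ * ‖d (k - j)‖) := by
          gcongr
          · exact hW k
          · exact norm_dotZ_le _ _
      _ = (W k * waveLength (k - j)) * (‖c j‖ * ‖d (k - j)‖) := by ring
      _ ≤ (κ k j * w₁ j * w₂ (k - j)) * (‖c j‖ * ‖d (k - j)‖) :=
          mul_le_mul_of_nonneg_right (h k j hk hj hl) (by positivity)
      _ = _ := by ring

lemma rpow_add_le {x y p : ℝ} (hx : 0 ≤ x) (hy : 0 ≤ y) (hp : 0 ≤ p) :
    (x + y) ^ p ≤ 2 ^ p * (x ^ p + y ^ p) := by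
  have hm : x + y ≤ 2 * max x y := by
    linarith [le_max_left x y, le_max_right x y]
  have h1 : (x + y) ^ p ≤ (2 * max x y) ^ p := Real.rpow_le_rpow (by positivity) hm hp
  rw [Real.mul_rpow (by norm_num) (by positivity)] at h1
  refine h1.trans (mul_le_mul_of_nonneg_left ?_ (by positivity))
  rcases max_cases x y with ⟨h, -⟩ | ⟨h, -⟩ <;> rw [h]
  · linarith [Real.rpow_nonneg hy p]
  · linarith [Real.rpow_nonneg hx p]

lemma wt_add_le {p : ℝ} (hp : 0 ≤ p) {k j : Z3} (hk : k ≠ 0) (hj : j ≠ 0) (hl : k - j ≠ 0) :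
    wt p k ≤ 2 ^ p * (wt p j + wt p (k - j)) := by
  rw [wt_of_ne p hk, wt_of_ne p hj, wt_of_ne p hl]
  refine le_trans (Real.rpow_le_rpow (waveLength_nonneg k) ?_ hp)
    (rpow_add_le (waveLength_nonneg j) (waveLength_nonneg (k - j)) hp)
  simpa using waveLength_add_le j (k - j)

/-- For nonpositive exponents both factors are largest at the shorter of the two vectors, so the
product is at most the power p + q of that vector. -/
lemma wt_young (p q : ℝ) (hp : p ≤ 0) (hq : q ≤ 0) (k l : Z3) :
    wt p k * wt q l ≤ wt (p + q) k + wt (p + q) l := by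
  by_cases hk : k = 0
  · subst hk; simp [wt_zero_right, wt_nonneg]
  by_cases hl : l = 0
  · subst hl; simp [wt_zero_right, wt_nonneg]
  rcases le_total (waveLength k) (waveLength l) with h | h
  · have : wt q l ≤ wt q k := by
      rw [wt_of_ne q hk, wt_of_ne q hl]
      exact Real.rpow_le_rpow_of_nonpos (waveLength_pos hk) h hq
    calc wt p k * wt q l ≤ wt p k * wt q k := mul_le_mul_of_nonneg_left this (wt_nonneg _ _)
      _ = wt (p + q) k := wt_mul _ _ _
      _ ≤ _ := le_add_of_nonneg_right (wt_nonneg _ _)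
  · have : wt p k ≤ wt p l := by
      rw [wt_of_ne p hk, wt_of_ne p hl]
      exact Real.rpow_le_rpow_of_nonpos (waveLength_pos hl) h hp
    calc wt p k * wt q l ≤ wt p l * wt q l := mul_le_mul_of_nonneg_right this (wt_nonneg _ _)
      _ = wt (p + q) l := wt_mul _ _ _
      _ ≤ _ := le_add_of_nonneg_left (wt_nonneg _ _)

/-- The Gevrey weight `|k|^{2α} e^{σ|k|}`. -/
def gwt (α σ : ℝ) (k : Z3) : ℝ := wt (2 * α) k * Real.exp (σ * waveLength k)

lemma gwt_nonneg (α σ : ℝ) (k : Z3) : 0 ≤ gwt α σ k := mul_nonneg (wt_nonneg _ _) (Real.exp_nonneg _)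

/-- The square of the Gevrey norm of a sequence of coefficients, up to normalization. -/
def gsum (α σ : ℝ) (c : Z3 → C3) : ℝ≥0∞ := ∑' k, (ENNReal.ofReal (gwt α σ k) * ‖c k‖ₑ) ^ 2

lemma gevreyNorm_eq (α σ : ℝ) (u : L2) : gevreyNorm α σ u =
    (ENNReal.ofReal ((2 * Real.pi) ^ 3) * gsum α σ (fourierCoeffVec u)) ^ (1 / 2 : ℝ) := by
  rw [gevreyNorm, gsum]
  congr 2
  have h := tsum_subtype {k : Z3 | k ≠ 0}
    (fun k => (ENNReal.ofReal (gwt α σ k) * ‖fourierCoeffVec u k‖ₑ) ^ 2)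
  have h2 : ∀ k, ({k : Z3 | k ≠ 0}).indicator
      (fun k => (ENNReal.ofReal (gwt α σ k) * ‖fourierCoeffVec u k‖ₑ) ^ 2) k =
      (ENNReal.ofReal (gwt α σ k) * ‖fourierCoeffVec u k‖ₑ) ^ 2 := by
    intro k
    by_cases hk : k = 0
    · subst hk; simp [gwt, wt_zero_right]
    · rw [indicator_of_mem (by exact hk)]
  simp only [h2] at h
  rw [← h]
  refine tsum_congr fun k => ?_
  rw [gwt, wt_of_ne _ k.2, enorm_eq_ofReal, ← ENNReal.ofReal_mul
    (mul_nonneg (Real.rpow_nonneg (waveLength_nonneg _) _) (Real.exp_nonneg _)),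
    ← ENNReal.ofReal_pow (by have := waveLength_nonneg k; positivity)]

lemma gevreyNorm_sq (α σ : ℝ) (u : L2) : gevreyNorm α σ u ^ 2 =
    ENNReal.ofReal ((2 * Real.pi) ^ 3) * gsum α σ (fourierCoeffVec u) := by
  rw [gevreyNorm_eq, ← ENNReal.rpow_natCast, ← ENNReal.rpow_mul]; norm_num

lemma ENNReal_le_of_sq_le_sq {x y : ℝ≥0∞} (h : x ^ 2 ≤ y ^ 2) : x ≤ y := by
  by_contra hxy
  exact absurd h (not_le.2 (ENNReal.pow_lt_pow_left two_ne_zero (not_le.1 hxy)))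

lemma gsum_lt_top_iff (α σ : ℝ) (u : L2) :
    gevreyNorm α σ u < ⊤ ↔ gsum α σ (fourierCoeffVec u) < ⊤ := by
  have h0 : ENNReal.ofReal ((2 * Real.pi) ^ 3) ≠ 0 := by
    simpa using two_pi_cube_pos
  constructor
  · intro h
    have h1 : gevreyNorm α σ u ^ 2 < ⊤ := ENNReal.pow_lt_top h
    rw [gevreyNorm_sq] at h1
    by_contra h2
    rw [not_lt, top_le_iff] at h2
    rw [h2, ENNReal.mul_top h0] at h1
    exact lt_irrefl _ h1
  · intro h
    rw [gevreyNorm_eq]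
    exact ENNReal.rpow_lt_top_of_nonneg (by norm_num) (ENNReal.mul_lt_top ENNReal.ofReal_lt_top h).ne

lemma two_rpow_two_mul (α : ℝ) : (2 : ℝ) ^ (2 * α) = 4 ^ α := by
  rw [Real.rpow_mul (by norm_num)]; norm_num

lemma exp_wave_le {σ : ℝ} (hσ : 0 ≤ σ) (k j : Z3) : Real.exp (σ * waveLength k) ≤
    Real.exp (σ * waveLength j) * Real.exp (σ * waveLength (k - j)) := by
  rw [← Real.exp_add, ← mul_add]
  refine Real.exp_le_exp.2 (mul_le_mul_of_nonneg_left ?_ hσ)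
  simpa using waveLength_add_le j (k - j)

/-- With l = k - j, |k|^{2α} is split into |j|^{2α} + |l|^{2α} at the cost 4^α, and the exponential
is submultiplicative. In the first term the derivative is paid by |l| ≤ |l|^{2α}, leaving
|j|^{-1}|l|^{-1} relative to the stronger norms; in the second l uses its full weight and 1 ≤
|j|^{-2}|j|^{2α+1}. Both steps need 2α ≥ 1. -/
lemma gwt_conv {α σ : ℝ} (hα : 1 / 2 ≤ α) (hσ : 0 ≤ σ) {k j : Z3} (hk : k ≠ 0) (hj : j ≠ 0)
    (hl : k - j ≠ 0) : gwt α σ k * waveLength (k - j) ≤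
      (4 ^ α * (wt (-1) j * wt (-1) (k - j) + wt (-2) j)) * gwt (α + 1 / 2) σ j
        * gwt (α + 1 / 2) σ (k - j) := by
  set l := k - j with hldef
  have e1 : wt (-1) j * wt (2 * (α + 1 / 2)) j = wt (2 * α) j := by rw [wt_mul]; congr 1; ring
  have e2 : wt (-1) l * wt (2 * (α + 1 / 2)) l = wt (2 * α) l := by rw [wt_mul]; congr 1; ring
  have e3 : wt (2 * α) l * wt 1 l = wt (2 * (α + 1 / 2)) l := by rw [wt_mul]; congr 1; ring
  have e4 : 1 ≤ wt (-2) j * wt (2 * (α + 1 / 2)) j := by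
    calc (1 : ℝ) = wt 0 j := (wt_zero_left hj).symm
      _ ≤ wt (-2 + 2 * (α + 1 / 2)) j := wt_mono (by linarith) j
      _ = _ := (wt_mul _ _ _).symm
  have h1 := wt_add_le (p := 2 * α) (by linarith) hk hj hl
  rw [two_rpow_two_mul] at h1
  have h2 := exp_wave_le hσ k j
  have h3 : wt 1 l ≤ wt (2 * α) l := wt_mono (by linarith) l
  have key : wt (2 * α) k * wt 1 l ≤ 4 ^ α * (wt (-1) j * wt (-1) l + wt (-2) j) *
      wt (2 * (α + 1 / 2)) j * wt (2 * (α + 1 / 2)) l := by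
    have e5 : 4 ^ α * (wt (-1) j * wt (-1) l + wt (-2) j) *
      wt (2 * (α + 1 / 2)) j * wt (2 * (α + 1 / 2)) l = 4 ^ α * (wt (2 * α) j * wt (2 * α) l
        + (wt (-2) j * wt (2 * (α + 1 / 2)) j) * wt (2 * (α + 1 / 2)) l) := by
      rw [← e1, ← e2]; ring
    rw [e5]
    have h4 : (0 : ℝ) ≤ 4 ^ α := by positivity
    calc wt (2 * α) k * wt 1 l ≤ 4 ^ α * (wt (2 * α) j + wt (2 * α) l) * wt 1 l :=
          mul_le_mul_of_nonneg_right h1 (wt_nonneg _ _)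
      _ = 4 ^ α * (wt (2 * α) j * wt 1 l + wt (2 * (α + 1 / 2)) l) := by rw [← e3]; ring
      _ ≤ _ := by
          refine mul_le_mul_of_nonneg_left (add_le_add ?_ ?_) h4
          · exact mul_le_mul_of_nonneg_left h3 (wt_nonneg _ _)
          · exact le_mul_of_one_le_left (wt_nonneg _ _) e4
  rw [← wt_one l, gwt, gwt, gwt]
  calc wt (2 * α) k * Real.exp (σ * waveLength k) * wt 1 l
      = (wt (2 * α) k * wt 1 l) * Real.exp (σ * waveLength k) := by ring
    _ ≤ (4 ^ α * (wt (-1) j * wt (-1) l + wt (-2) j) *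
      wt (2 * (α + 1 / 2)) j * wt (2 * (α + 1 / 2)) l) *
        (Real.exp (σ * waveLength j) * Real.exp (σ * waveLength l)) := by
        refine mul_le_mul key h2 (Real.exp_nonneg _) ?_
        have := wt_nonneg (-1) j; have := wt_nonneg (-1) l; have := wt_nonneg (-2) j
        have := wt_nonneg (2 * (α + 1 / 2)) j; have := wt_nonneg (2 * (α + 1 / 2)) l
        positivity
    _ = _ := by ring

/-- The lattice sum `∑ |k|^s`. -/
def latticeSum (s : ℝ) : ℝ := ∑' k, wt s k

lemma latticeSum_nonneg (s : ℝ) : 0 ≤ latticeSum s := tsum_nonneg (wt_nonneg s)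

lemma ofReal_latticeSum {s : ℝ} (hs : s < -3) :
    ∑' k, ENNReal.ofReal (wt s k) = ENNReal.ofReal (latticeSum s) :=
  (ENNReal.ofReal_tsum_of_nonneg (wt_nonneg s) (summable_wt hs)).symm

lemma ofReal_latticeSum_add {s : ℝ} (hs : s < -3) (l : Z3) :
    ∑' j, ENNReal.ofReal (wt s (j + l)) = ENNReal.ofReal (latticeSum s) := by
  rw [← ofReal_latticeSum hs, ← (Equiv.addRight l).tsum_eq fun k => ENNReal.ofReal (wt s k)]; rfl

lemma ofReal_latticeSum_sub {s : ℝ} (hs : s < -3) (k : Z3) :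
    ∑' j, ENNReal.ofReal (wt s (k - j)) = ENNReal.ofReal (latticeSum s) := by
  rw [← ofReal_latticeSum hs, ← (Equiv.subLeft k).tsum_eq fun k => ENNReal.ofReal (wt s k)]; rfl

/-- The squared kernel is at most 2·16^α times three copies of |·|^{-4}, evaluated at j or k - j.
Its sum over j is therefore finite and independent of k. -/
lemma gsum_convB_le {α σ : ℝ} (hα : 1 / 2 ≤ α) (hσ : 0 ≤ σ) {c d : Z3 → C3} (hc : c 0 = 0) :
    gsum α σ (convB c d) ≤ ENNReal.ofReal ((4 ^ α) ^ 2 * (6 * latticeSum (-4))) *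
      gsum (α + 1 / 2) σ c * gsum (α + 1 / 2) σ d := by
  have hκ0 : ∀ k j : Z3, 0 ≤ 4 ^ α * (wt (-1) j * wt (-1) (k - j) + wt (-2) j) := fun k j => by
    have := wt_nonneg (-1) j; have := wt_nonneg (-1) (k - j); have := wt_nonneg (-2) j
    positivity
  have h1 := fun k => enorm_convB_le (c := c) (d := d) hc (gwt_nonneg α σ) (gwt_nonneg (α + 1 / 2) σ)
    hκ0 (fun k j hk hj hl => gwt_conv hα hσ hk hj hl) k
  refine (ENNReal.tsum_le_tsum fun k => pow_le_pow_left' (h1 k) 2).trans ?_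
  refine conv_le_of_row (fun k => ?_) (fun k => ENNReal.ofReal (gwt (α + 1 / 2) σ k) * ‖c k‖ₑ)
    (fun k => ENNReal.ofReal (gwt (α + 1 / 2) σ k) * ‖d k‖ₑ)
  have h2 : ∀ j, ENNReal.ofReal (4 ^ α * (wt (-1) j * wt (-1) (k - j) + wt (-2) j)) ^ 2 ≤
      ENNReal.ofReal ((4 ^ α) ^ 2 * 2) * (ENNReal.ofReal (wt (-4) j) + ENNReal.ofReal (wt (-4) (k - j))
        + ENNReal.ofReal (wt (-4) j)) := by
    intro j
    rw [← ENNReal.ofReal_pow (hκ0 k j), ← ENNReal.ofReal_add (wt_nonneg _ _) (wt_nonneg _ _),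
      ← ENNReal.ofReal_add (add_nonneg (wt_nonneg _ _) (wt_nonneg _ _)) (wt_nonneg _ _),
      ← ENNReal.ofReal_mul (by positivity)]
    refine ENNReal.ofReal_le_ofReal ?_
    have e1 : wt (-2) j ^ 2 = wt (-4) j := by rw [wt_sq]; norm_num
    have e2 : (wt (-1) j * wt (-1) (k - j)) ^ 2 ≤ wt (-4) j + wt (-4) (k - j) := by
      rw [mul_pow, wt_sq, wt_sq]
      refine (wt_young _ _ (by norm_num) (by norm_num) _ _).trans (le_of_eq ?_)
      norm_num
    rw [mul_pow, mul_assoc]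
    refine mul_le_mul_of_nonneg_left ?_ (by positivity)
    nlinarith [sq_nonneg (wt (-1) j * wt (-1) (k - j) - wt (-2) j)]
  refine (ENNReal.tsum_le_tsum h2).trans (le_of_eq ?_)
  rw [ENNReal.tsum_mul_left, ENNReal.tsum_add, ENNReal.tsum_add, ofReal_latticeSum (by norm_num),
    ofReal_latticeSum_sub (by norm_num), ← ENNReal.ofReal_add, ← ENNReal.ofReal_add,
    ← ENNReal.ofReal_mul (by positivity)]
  · congr 1; ring
  all_goals have := latticeSum_nonneg (-4); positivity

/-! ### The bilinear estimate -/

lemma gsum_term (α σ : ℝ) (c : Z3 → C3) (k : Z3) :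
    (ENNReal.ofReal (gwt α σ k) * ‖c k‖ₑ) ^ 2 = ENNReal.ofReal ((gwt α σ k * ‖c k‖) ^ 2) := by
  rw [enorm_eq_ofReal, ← ENNReal.ofReal_mul (gwt_nonneg _ _ _),
    ENNReal.ofReal_pow (mul_nonneg (gwt_nonneg _ _ _) (norm_nonneg _))]

lemma gsum_eq_ofReal {α σ : ℝ} {c : Z3 → C3} (h : Summable fun k => (gwt α σ k * ‖c k‖) ^ 2) :
    gsum α σ c = ENNReal.ofReal (∑' k, (gwt α σ k * ‖c k‖) ^ 2) := by
  rw [ENNReal.ofReal_tsum_of_nonneg (fun _ => sq_nonneg _) h, gsum]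
  exact tsum_congr fun k => gsum_term α σ c k

lemma summable_of_gsum {α σ : ℝ} {c : Z3 → C3} (h : gsum α σ c < ⊤) :
    Summable fun k => (gwt α σ k * ‖c k‖) ^ 2 := by
  have h1 := ENNReal.summable_toReal h.ne
  refine h1.congr fun k => ?_
  rw [gsum_term, ENNReal.toReal_ofReal (sq_nonneg _)]

lemma wt_le_gwt {s α σ : ℝ} (hs : s ≤ 2 * α) (hσ : 0 ≤ σ) (k : Z3) : wt s k ≤ gwt α σ k := by
  refine (wt_mono hs k).trans (le_mul_of_one_le_right (wt_nonneg _ _) ?_)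
  exact Real.one_le_exp (mul_nonneg hσ (waveLength_nonneg k))

/-- Write |c_k| as |k|^{-2} times |k|²|c_k|: both factors are square-summable, the first because ∑
|k|^{-4} converges. -/
lemma summable_norm_of_gsum {α σ : ℝ} (hα : 1 ≤ α) (hσ : 0 ≤ σ) {c : Z3 → C3} (hc : c 0 = 0)
    (h : gsum α σ c < ⊤) : Summable fun k => ‖c k‖ := by
  refine Summable.of_nonneg_of_le (fun _ => norm_nonneg _) (fun k => ?_)
    ((summable_wt (s := -4) (by norm_num)).add (summable_of_gsum h))
  by_cases hk : k = 0
  · subst hk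
    rw [hc, norm_zero]; simp [wt_zero_right]
  · have h1 : wt (-2) k * wt 2 k = 1 := by rw [wt_mul]; simpa using wt_zero_left hk
    have h2 : wt (-2) k ^ 2 = wt (-4) k := by rw [wt_sq]; norm_num
    have h3 : wt 2 k * ‖c k‖ ≤ gwt α σ k * ‖c k‖ :=
      mul_le_mul_of_nonneg_right (wt_le_gwt (by linarith) hσ k) (norm_nonneg _)
    have h4 : ‖c k‖ = wt (-2) k * (wt 2 k * ‖c k‖) := by rw [← mul_assoc, h1, one_mul]
    have h5 : 0 ≤ wt 2 k * ‖c k‖ := mul_nonneg (wt_nonneg _ _) (norm_nonneg _)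
    rw [← h2]
    nlinarith [sq_nonneg (wt (-2) k - wt 2 k * ‖c k‖), wt_nonneg (-2) k]

lemma fourier_field_zero (p : V) : fourierCoeffVec (field p) 0 = 0 :=
  (adm_of_mem_H (field_mem_H p)).zero

lemma exists_bilinearBound : ∃ K : ℝ, 1 < K ∧ BilinearBound K := by
  -- The numerical constant must be hidden in K^α. As M ≥ 1 and 2α ≥ 1, (M^α)² ≥ M; the factor 4 in
  -- K supplies the 4^α from splitting the weight.
  set M : ℝ := max 1 (((2 * Real.pi) ^ 3)⁻¹ * (6 * latticeSum (-4)))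
  have hM : 1 ≤ M := le_max_left _ _
  refine ⟨4 * M, by linarith, fun α σ hα hσ u v hu hv => ?_⟩
  rw [gsum_lt_top_iff] at hu hv
  obtain ⟨w, hw⟩ := exists_repr_trilinear
    (summable_norm_of_gsum (by linarith) hσ (fourier_field_zero u) hu) v
  refine ⟨w, hw, ENNReal_le_of_sq_le_sq ?_⟩
  have hwc : fourierCoeffVec w = convB (fourierCoeffVec (field u)) (fourierCoeffVec (field v)) :=
    funext (fourier_of_trilinear hw)
  rw [mul_pow, mul_pow, gevreyNorm_sq, gevreyNorm_sq, gevreyNorm_sq, hwc]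
  have h := gsum_convB_le hα hσ (d := fourierCoeffVec (field v)) (fourier_field_zero u)
  have hp := two_pi_cube_pos
  refine (mul_le_mul_right h _).trans ?_
  rw [← ENNReal.ofReal_pow (by positivity)]
  have key : ENNReal.ofReal ((2 * Real.pi) ^ 3) *
      ENNReal.ofReal ((4 ^ α) ^ 2 * (6 * latticeSum (-4))) ≤ ENNReal.ofReal (((4 * M) ^ α) ^ 2) *
        ENNReal.ofReal ((2 * Real.pi) ^ 3) * ENNReal.ofReal ((2 * Real.pi) ^ 3) := by
    rw [← ENNReal.ofReal_mul hp.le, ← ENNReal.ofReal_mul (by positivity),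
      ← ENNReal.ofReal_mul (by positivity)]
    refine ENNReal.ofReal_le_ofReal ?_
    rw [Real.mul_rpow (by norm_num) (by linarith), mul_pow]
    have h1 : M ≤ (M ^ α) ^ 2 := by
      rw [← Real.rpow_natCast, ← Real.rpow_mul (by linarith)]
      refine Real.self_le_rpow_of_one_le hM ?_
      push_cast; linarith
    have h2 : 6 * latticeSum (-4) ≤ M * (2 * Real.pi) ^ 3 := by
      have : ((2 * Real.pi) ^ 3)⁻¹ * (6 * latticeSum (-4)) ≤ M := le_max_right _ _
      rwa [inv_mul_le_iff₀ hp, mul_comm _ M] at this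
    have h3 : 6 * latticeSum (-4) ≤ (M ^ α) ^ 2 * (2 * Real.pi) ^ 3 :=
      h2.trans (mul_le_mul_of_nonneg_right h1 hp.le)
    have h4 : (0 : ℝ) ≤ (2 * Real.pi) ^ 3 * (4 ^ α) ^ 2 := by positivity
    nlinarith [mul_le_mul_of_nonneg_left h3 h4]
  calc _ = (ENNReal.ofReal ((2 * Real.pi) ^ 3) * ENNReal.ofReal ((4 ^ α) ^ 2 * (6 * latticeSum (-4))))
        * (gsum (α + 1 / 2) σ (fourierCoeffVec (field u)) *
          gsum (α + 1 / 2) σ (fourierCoeffVec (field v))) := by ring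
    _ ≤ _ := mul_le_mul_left key _
    _ = _ := by ring

/-! ### The rescaled bilinear map -/

/-- Pointwise multiplication of a sequence by a power of the wave length. -/
def scale (s : ℝ) (a : Z3 → C3) (k : Z3) : C3 := wt s k • a k

lemma scale_zero_right (s : ℝ) (a : Z3 → C3) : scale s a 0 = 0 := by simp [scale, wt_zero_right]

lemma scale_scale (s t : ℝ) (a : Z3 → C3) : scale s (scale t a) = scale (s + t) a := by
  funext k; rw [scale, scale, scale, smul_smul, wt_mul]

lemma scale_zero_left {a : Z3 → C3} (ha : a 0 = 0) : scale 0 a = a := by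
  funext k
  by_cases hk : k = 0
  · rw [hk, ha, scale_zero_right]
  · rw [scale, wt_zero_left hk, one_smul]

lemma scale_add (s : ℝ) (a b : Z3 → C3) : scale s (a + b) = scale s a + scale s b := by
  funext k; exact smul_add _ _ _

lemma scale_smul (s r : ℝ) (a : Z3 → C3) : scale s (r • a) = r • scale s a := by
  funext k; exact smul_comm (wt s k) r (a k)

lemma Adm.scale {a : Z3 → C3} (ha : Adm a) (s : ℝ) : Adm (scale s a) := by
  refine ⟨scale_zero_right s a, fun k => ?_, fun k => ?_⟩
  · rw [NSE.scale, dotZ_smul_real, ha.div, mul_zero]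
  · rw [NSE.scale, NSE.scale, wt_neg, ha.conj, conj3_smul_real]

/-- Absolute convergence of the convolution, without which the `tsum` in `convN` need not be
additive in either argument. -/
lemma summable_convN {c d : Z3 → C3} (hc : Summable fun k => ‖c k‖ ^ 2)
    (hd : Summable fun k => (waveLength k * ‖d k‖) ^ 2) (k : Z3) :
    Summable fun j => (Complex.I * dotZ (k - j) (c j)) • d (k - j) := by
  have h2 : Summable fun j => (waveLength (k - j) * ‖d (k - j)‖) ^ 2 :=
    hd.comp_injective (Equiv.subLeft k).injective
  refine Summable.of_norm (Summable.of_nonneg_of_le (fun _ => norm_nonneg _) (fun j => ?_)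
    (hc.add h2))
  rw [norm_smul, norm_mul, Complex.norm_I, one_mul]
  have h3 : ‖dotZ (k - j) (c j)‖ * ‖d (k - j)‖ ≤ ‖c j‖ * (waveLength (k - j) * ‖d (k - j)‖) := by
    calc _ ≤ (waveLength (k - j) * ‖c j‖) * ‖d (k - j)‖ :=
          mul_le_mul_of_nonneg_right (norm_dotZ_le _ _) (norm_nonneg _)
      _ = _ := by ring
  refine h3.trans ?_
  have := mul_nonneg (waveLength_nonneg (k - j)) (norm_nonneg (d (k - j)))
  nlinarith [sq_nonneg (‖c j‖ - waveLength (k - j) * ‖d (k - j)‖), norm_nonneg (c j)]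

lemma convB_add_left {c c' d : Z3 → C3} (hc : Summable fun k => ‖c k‖ ^ 2)
    (hc' : Summable fun k => ‖c' k‖ ^ 2) (hd : Summable fun k => (waveLength k * ‖d k‖) ^ 2) :
    convB (c + c') d = convB c d + convB c' d := by
  funext k
  rw [Pi.add_apply]; unfold convB; split_ifs with hk
  · simp
  · rw [← leray_add]; congr 1
    rw [convN, convN, convN, ← (summable_convN hc hd k).tsum_add (summable_convN hc' hd k)]
    congr 1; funext j
    rw [Pi.add_apply, dotZ_add, mul_add, add_smul]

lemma convB_add_right {c d d' : Z3 → C3} (hc : Summable fun k => ‖c k‖ ^ 2)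
    (hd : Summable fun k => (waveLength k * ‖d k‖) ^ 2)
    (hd' : Summable fun k => (waveLength k * ‖d' k‖) ^ 2) :
    convB c (d + d') = convB c d + convB c d' := by
  funext k
  rw [Pi.add_apply]; unfold convB; split_ifs with hk
  · simp
  · rw [← leray_add]; congr 1
    rw [convN, convN, convN, ← (summable_convN hc hd k).tsum_add (summable_convN hc hd' k)]
    congr 1; funext j
    rw [Pi.add_apply, smul_add]

lemma convB_smul_left (r : ℝ) (c d : Z3 → C3) : convB (r • c) d = r • convB c d := by
  funext k
  rw [Pi.smul_apply]; unfold convB; split_ifs with hk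
  · simp
  · rw [← leray_smul]; congr 1
    rw [convN, convN, ← tsum_const_smul'']
    congr 1; funext j
    rw [Pi.smul_apply, dotZ_smul_real, ← mul_assoc, mul_comm Complex.I, mul_assoc, mul_smul,
      Complex.coe_smul]

lemma convB_smul_right (r : ℝ) (c d : Z3 → C3) : convB c (r • d) = r • convB c d := by
  funext k
  rw [Pi.smul_apply]; unfold convB; split_ifs with hk
  · simp
  · rw [← leray_smul]; congr 1
    rw [convN, convN, ← tsum_const_smul'']
    congr 1; funext j
    rw [Pi.smul_apply, smul_comm]

lemma summable_scale {α : ℝ} (hα : 1 / 2 ≤ α) (a : ell) :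
    (Summable fun k => ‖scale (-2 * α) a k‖ ^ 2) ∧
      Summable fun k => (waveLength k * ‖scale (-2 * α) a k‖) ^ 2 := by
  have h1 : ∀ k, waveLength k * ‖scale (-2 * α) a k‖ ≤ ‖a k‖ := fun k => by
    rw [scale, norm_smul, Real.norm_of_nonneg (wt_nonneg _ _), ← mul_assoc, ← wt_one, wt_mul]
    exact mul_le_of_le_one_left (norm_nonneg _) (wt_le_one (by linarith) k)
  have h2 : ∀ k, ‖scale (-2 * α) a k‖ ≤ ‖a k‖ := fun k => by
    rw [scale, norm_smul, Real.norm_of_nonneg (wt_nonneg _ _)]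
    exact mul_le_of_le_one_left (norm_nonneg _) (wt_le_one (by linarith) k)
  constructor
  · refine Summable.of_nonneg_of_le (fun _ => sq_nonneg _) (fun k => ?_) (ell_summable a)
    exact pow_le_pow_left₀ (norm_nonneg _) (h2 k) 2
  · refine Summable.of_nonneg_of_le (fun _ => sq_nonneg _) (fun k => ?_) (ell_summable a)
    exact pow_le_pow_left₀ (mul_nonneg (waveLength_nonneg k) (norm_nonneg _)) (h1 k) 2

/-- The coefficients of `A^{α-7/8} B(A^{-α} a, A^{-α} b)`. -/
def betaSeq (α : ℝ) (a b : Z3 → C3) : Z3 → C3 :=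
  scale (2 * α - 7 / 4) (convB (scale (-2 * α) a) (scale (-2 * α) b))

/-- The output weight is |k|^{-3/4}|k|^{2α-1}; the second factor is split over j and k - j, one
derivative being paid by the second argument. The leftover kernel |k|^{-3/4}|j|^{-1} has square of
total degree -7/2 < -3. With A^{α-θ} in place of A^{α-7/8} the degree would be -4θ, so θ > 3/4 is
needed here, while the heat semigroup requires θ < 1. -/
lemma wt_beta {α : ℝ} (hα : 1 / 2 ≤ α) {k j : Z3} (hk : k ≠ 0) (hj : j ≠ 0) (hl : k - j ≠ 0) :
    wt (2 * α - 7 / 4) k * waveLength (k - j) ≤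
      (4 ^ α * (wt (-3 / 4) k * wt (-1) j)) * wt (2 * α) j * wt (2 * α) (k - j) := by
  set l := k - j
  have h1 := wt_add_le (p := 2 * α - 1) (by linarith) hk hj hl
  have e0 : wt (2 * α - 7 / 4) k = wt (-3 / 4) k * wt (2 * α - 1) k := by rw [wt_mul]; congr 1; ring
  have e1 : wt (2 * α - 1) j = wt (-1) j * wt (2 * α) j := by rw [wt_mul]; congr 1; ring
  have e2 : wt (2 * α - 1) l * wt 1 l = wt (2 * α) l := by rw [wt_mul]; congr 1; ring
  have h2 : wt 1 l ≤ wt (2 * α) l := wt_mono (by linarith) l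
  have h3 : 1 ≤ wt (2 * α - 1) j := by
    exact (wt_zero_left hj).symm.le.trans (wt_mono (by linarith) j)
  have h4 : (2 : ℝ) ^ (2 * α - 1) * 2 = 4 ^ α := by
    rw [← two_rpow_two_mul, Real.rpow_sub_one (by norm_num)]; ring
  rw [← wt_one l, e0]
  calc wt (-3 / 4) k * wt (2 * α - 1) k * wt 1 l
      ≤ wt (-3 / 4) k * (2 ^ (2 * α - 1) * (wt (2 * α - 1) j + wt (2 * α - 1) l)) * wt 1 l := by
        gcongr
        · exact wt_nonneg _ _
        · exact wt_nonneg _ _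
    _ = wt (-3 / 4) k * 2 ^ (2 * α - 1) * (wt (2 * α - 1) j * wt 1 l + wt (2 * α) l) := by
        rw [← e2]; ring
    _ ≤ wt (-3 / 4) k * 2 ^ (2 * α - 1) * (wt (2 * α - 1) j * wt (2 * α) l
          + wt (2 * α - 1) j * wt (2 * α) l) := by
        refine mul_le_mul_of_nonneg_left (add_le_add ?_ ?_)
          (mul_nonneg (wt_nonneg _ _) (by positivity))
        · exact mul_le_mul_of_nonneg_left h2 (wt_nonneg _ _)
        · exact le_mul_of_one_le_left (wt_nonneg _ _) h3
    _ = _ := by rw [e1, ← h4]; ring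

/-- The bound for the rescaled bilinear map. -/
def betaBound (α : ℝ) : ℝ := Real.sqrt ((4 ^ α) ^ 2 * (2 * latticeSum (-7 / 2)))

lemma tsum_enorm_betaSeq {α : ℝ} (hα : 1 / 2 ≤ α) (a b : Z3 → C3) :
    ∑' k, ‖betaSeq α a b k‖ₑ ^ 2 ≤ ENNReal.ofReal ((4 ^ α) ^ 2 * (2 * latticeSum (-7 / 2))) *
      (∑' k, ‖a k‖ₑ ^ 2) * ∑' k, ‖b k‖ₑ ^ 2 := by
  have hκ0 : ∀ k j : Z3, 0 ≤ 4 ^ α * (wt (-3 / 4) k * wt (-1) j) := fun k j => by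
    have := wt_nonneg (-1) j; have := wt_nonneg (-3 / 4) k
    positivity
  have h1 := fun k => enorm_convB_le (c := scale (-2 * α) a) (d := scale (-2 * α) b)
    (scale_zero_right _ _) (wt_nonneg (2 * α - 7 / 4)) (wt_nonneg (2 * α))
    hκ0 (fun k j hk hj hl => wt_beta hα hk hj hl) k
  have h0 : ∀ (a : Z3 → C3) k, ENNReal.ofReal (wt (2 * α) k) * ‖scale (-2 * α) a k‖ₑ ≤ ‖a k‖ₑ := by
    intro a k
    rw [enorm_eq_ofReal, enorm_eq_ofReal, ← ENNReal.ofReal_mul (wt_nonneg _ _), scale, norm_smul,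
      Real.norm_of_nonneg (wt_nonneg _ _), ← mul_assoc, wt_mul]
    refine ENNReal.ofReal_le_ofReal (mul_le_of_le_one_left (norm_nonneg _) (wt_le_one (by linarith) k))
  have h2 : ∀ k, ‖betaSeq α a b k‖ₑ ≤ ∑' j, ENNReal.ofReal (4 ^ α * (wt (-3 / 4) k * wt (-1) j)) *
      ‖a j‖ₑ * ‖b (k - j)‖ₑ := by
    intro k
    rw [betaSeq, scale, enorm_smul, Real.enorm_of_nonneg (wt_nonneg _ _)]
    refine (h1 k).trans (ENNReal.tsum_le_tsum fun j => ?_)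
    gcongr
    · exact h0 a j
    · exact h0 b (k - j)
  refine (ENNReal.tsum_le_tsum fun k => pow_le_pow_left' (h2 k) 2).trans ?_
  refine conv_le_of_col (fun l => ?_) (fun k => ‖a k‖ₑ) (fun k => ‖b k‖ₑ)
  have h3 : ∀ j, ENNReal.ofReal (4 ^ α * (wt (-3 / 4) (j + l) * wt (-1) j)) ^ 2 ≤
      ENNReal.ofReal ((4 ^ α) ^ 2) * (ENNReal.ofReal (wt (-7 / 2) (j + l)) +
        ENNReal.ofReal (wt (-7 / 2) j)) := by
    intro j
    rw [← ENNReal.ofReal_pow (hκ0 _ j), ← ENNReal.ofReal_add (wt_nonneg _ _) (wt_nonneg _ _),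
      ← ENNReal.ofReal_mul (by positivity)]
    refine ENNReal.ofReal_le_ofReal ?_
    rw [mul_pow, mul_pow, wt_sq, wt_sq]
    refine mul_le_mul_of_nonneg_left ((wt_young _ _ (by norm_num) (by norm_num) _ _).trans
      (le_of_eq ?_)) (by positivity)
    norm_num
  refine (ENNReal.tsum_le_tsum h3).trans (le_of_eq ?_)
  rw [ENNReal.tsum_mul_left, ENNReal.tsum_add, ofReal_latticeSum (by norm_num),
    ofReal_latticeSum_add (by norm_num), ← ENNReal.ofReal_add, ← ENNReal.ofReal_mul (by positivity)]
  · congr 1; ring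
  all_goals exact latticeSum_nonneg _

lemma ell_tsum_enorm (a : ell) : ∑' k, ‖a k‖ₑ ^ 2 = ENNReal.ofReal (‖a‖ ^ 2) := by
  rw [← (ell_hasSum a).tsum_eq, ENNReal.ofReal_tsum_of_nonneg (fun _ => sq_nonneg _) (ell_summable a)]
  refine tsum_congr fun k => ?_
  rw [enorm_eq_ofReal, ENNReal.ofReal_pow (norm_nonneg _)]

lemma summable_of_tsum_enorm {c : Z3 → C3} (h : ∑' k, ‖c k‖ₑ ^ 2 ≠ ⊤) :
    Summable fun k => ‖c k‖ ^ 2 := by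
  refine (ENNReal.summable_toReal h).congr fun k => ?_
  rw [ENNReal.toReal_pow, toReal_enorm]

lemma summable_betaSeq {α : ℝ} (hα : 1 / 2 ≤ α) (a b : ell) :
    Summable fun k => ‖betaSeq α a b k‖ ^ 2 := by
  refine summable_of_tsum_enorm (ne_top_of_le_ne_top ?_ (tsum_enorm_betaSeq hα a b))
  rw [ell_tsum_enorm, ell_tsum_enorm]
  exact (ENNReal.mul_lt_top (ENNReal.mul_lt_top ENNReal.ofReal_lt_top ENNReal.ofReal_lt_top)
    ENNReal.ofReal_lt_top).ne

/-- The rescaled bilinear map `A^{α-7/8} B(A^{-α} ·, A^{-α} ·)` on square-summable sequences. -/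
def beta {α : ℝ} (hα : 1 / 2 ≤ α) : ell →L[ℝ] ell →L[ℝ] ell :=
  LinearMap.mkContinuous₂ (LinearMap.mk₂ ℝ
    (fun a b : ell => ellOf (betaSeq α a b) (summable_betaSeq hα a b))
    (fun a a' b => by
      ext1
      change betaSeq α ((a : Z3 → C3) + a') b = betaSeq α a b + betaSeq α a' b
      rw [betaSeq, scale_add, convB_add_left (summable_scale hα a).1 (summable_scale hα a').1
        (summable_scale hα b).2, scale_add]; rfl)
    (fun r a b => by
      ext1
      change betaSeq α (r • (a : Z3 → C3)) b = r • betaSeq α a b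
      rw [betaSeq, scale_smul, convB_smul_left, scale_smul]; rfl)
    (fun a b b' => by
      ext1
      change betaSeq α a ((b : Z3 → C3) + b') = betaSeq α a b + betaSeq α a b'
      rw [betaSeq, scale_add, convB_add_right (summable_scale hα a).1 (summable_scale hα b).2
        (summable_scale hα b').2, scale_add]; rfl)
    (fun r a b => by
      ext1
      change betaSeq α a (r • (b : Z3 → C3)) = r • betaSeq α a b
      rw [betaSeq, scale_smul, convB_smul_right, scale_smul]; rfl))
    (betaBound α) (fun a b => by
      have h := tsum_enorm_betaSeq hα a b
      have h2 := ell_tsum_enorm (ellOf (betaSeq α a b) (summable_betaSeq hα a b))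
      simp only [ellOf_apply] at h2
      rw [h2, ell_tsum_enorm, ell_tsum_enorm, ← ENNReal.ofReal_mul, ← ENNReal.ofReal_mul,
        ENNReal.ofReal_le_ofReal_iff] at h
      · refine le_of_sq_le_sq ?_ (by unfold betaBound; positivity)
        rw [mul_pow, mul_pow, betaBound, Real.sq_sqrt]
        · exact h
        all_goals have := latticeSum_nonneg (-7 / 2); positivity
      all_goals have := latticeSum_nonneg (-7 / 2); positivity)

@[simp] lemma beta_apply {α : ℝ} (hα : 1 / 2 ≤ α) (a b : ell) (k : Z3) :
    beta hα a b k = betaSeq α a b k := rfl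

lemma adm_betaSeq (α : ℝ) {a b : Z3 → C3} (ha : Adm a) (hb : Adm b) : Adm (betaSeq α a b) :=
  (adm_convB (ha.scale _).conj (hb.scale _).conj).scale _

/-! ### Primitives -/

/-- `x` is the primitive of the integrable function `z` on `[a, b]`. -/
def IsPrim (x z : ℝ → ℝ) (a b : ℝ) : Prop :=
  IntervalIntegrable z volume a b ∧ ∀ t ∈ Icc a b, x t = x a + ∫ s in a..t, z s

lemma IsPrim.ae_hasDerivAt_aux {z : ℝ → ℝ} {a b : ℝ} (hz : IntervalIntegrable z volume a b) (c : ℝ)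
    (hab : a ≤ b) :
    AbsolutelyContinuousOnInterval (fun t => c + ∫ s in a..t, z s) a b ∧
      ∀ᵐ t, t ∈ uIoc a b → deriv (fun t => c + ∫ s in a..t, z s) t = z t := by
  constructor
  · have h1 := hz.absolutelyContinuousOnInterval_intervalIntegral (c := a) (by simp)
    have h2 : AbsolutelyContinuousOnInterval (fun _ : ℝ => c) a b :=
      LipschitzOnWith.absolutelyContinuousOnInterval (K := 0)
        ((LipschitzWith.const c).lipschitzOnWith)
    exact h2.add h1
  · have h := hz.ae_hasDerivAt_integral
    filter_upwards [h] with t ht hmem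
    have h3 := ht (uIoc_subset_uIcc hmem) a (by simp)
    exact (h3.const_add c).deriv

/-- Both factors agree on [a, b] with absolutely continuous functions, for which integration by
parts holds. Primitives replace classical derivatives because the force is only measurable in time.
-/
lemma IsPrim.mul {x z y w : ℝ → ℝ} {a b : ℝ} (hab : a ≤ b) (hx : IsPrim x z a b)
    (hy : IsPrim y w a b) : IsPrim (fun t => x t * y t) (fun t => z t * y t + x t * w t) a b := by
  have hX := IsPrim.ae_hasDerivAt_aux hx.1 (x a) hab
  have hY := IsPrim.ae_hasDerivAt_aux hy.1 (y a) hab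
  have hcX := hX.1.continuousOn
  have hcY := hY.1.continuousOn
  rw [uIcc_of_le hab] at hcX hcY
  have hcx : ContinuousOn x (Icc a b) := hcX.congr hx.2
  have hcy : ContinuousOn y (Icc a b) := hcY.congr hy.2
  rw [← uIcc_of_le hab] at hcx hcy
  refine ⟨(hx.1.mul_continuousOn hcy).add (hy.1.continuousOn_mul hcx), fun t ht => ?_⟩
  have hsub : uIcc a t ⊆ uIcc a b := by
    rw [uIcc_of_le ht.1, uIcc_of_le hab]; exact Icc_subset_Icc_right ht.2
  have hsub' : uIoc a t ⊆ uIoc a b := by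
    rw [uIoc_of_le ht.1, uIoc_of_le hab]; exact Ioc_subset_Ioc_right ht.2
  have h := (hX.1.mono hsub).integral_deriv_mul_eq_sub (hY.1.mono hsub)
  have ha := hx.2 t ht
  have hb := hy.2 t ht
  have h2 : ∫ s in a..t, (z s * y s + x s * w s) = ∫ s in a..t,
      deriv (fun t => x a + ∫ s in a..t, z s) s * (y a + ∫ r in a..s, w r) +
        (x a + ∫ r in a..s, z r) * deriv (fun t => y a + ∫ s in a..t, w s) s := by
    refine intervalIntegral.integral_congr_ae ?_
    filter_upwards [hX.2, hY.2] with s h1 h2 hs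
    have hs' : s ∈ Icc a b := by
      rw [← uIcc_of_le hab]; exact uIoc_subset_uIcc (hsub' hs)
    rw [h1 (hsub' hs), h2 (hsub' hs), ← hx.2 s hs', ← hy.2 s hs']
  rw [h2, h, ← ha, ← hb]
  simp

lemma isPrim_of_hasDerivAt {x z : ℝ → ℝ} {a b : ℝ} (h : ∀ t, HasDerivAt x (z t) t)
    (hz : Continuous z) : IsPrim x z a b := by
  refine ⟨hz.intervalIntegrable _ _, fun t _ => ?_⟩
  rw [intervalIntegral.integral_eq_sub_of_hasDerivAt (fun s _ => h s) (hz.intervalIntegrable _ _)]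
  ring

lemma IsPrim.sum {ι : Type*} {s : Finset ι} {x z : ι → ℝ → ℝ} {a b : ℝ}
    (hab : a ≤ b) (h : ∀ i ∈ s, IsPrim (x i) (z i) a b) :
    IsPrim (fun t => ∑ i ∈ s, x i t) (fun t => ∑ i ∈ s, z i t) a b := by
  refine ⟨?_, fun t ht => ?_⟩
  · have := IntervalIntegrable.sum s fun i hi => (h i hi).1
    simpa [Finset.sum_fn] using this
  · rw [intervalIntegral.integral_finsetSum, ← Finset.sum_add_distrib]
    · exact Finset.sum_congr rfl fun i hi => (h i hi).2 t ht
    · intro i hi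
      refine (h i hi).1.mono_set ?_
      rw [uIcc_of_le ht.1, uIcc_of_le hab]; exact Icc_subset_Icc_right ht.2

lemma IsPrim.congr {x z x' z' : ℝ → ℝ} {a b : ℝ} (h : IsPrim x z a b)
    (hx : ∀ t ∈ Icc a b, x' t = x t) (hz : ∀ t ∈ Icc a b, z' t = z t) (hab : a ≤ b) :
    IsPrim x' z' a b := by
  refine ⟨h.1.congr ?_, fun t ht => ?_⟩
  · intro t ht
    rw [uIoc_of_le hab] at ht
    exact (hz t (Ioc_subset_Icc_self ht)).symm
  · rw [hx t ht, hx a ⟨le_rfl, hab⟩, h.2 t ht]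
    congr 1
    refine intervalIntegral.integral_congr fun s hs => ?_
    rw [uIcc_of_le ht.1] at hs
    exact (hz s ⟨hs.1, hs.2.trans ht.2⟩).symm

lemma IsPrim.sub_interval {x z : ℝ → ℝ} {a b a' b' : ℝ} (h : IsPrim x z a b) (h1 : a ≤ a')
    (h2 : a' ≤ b') (h3 : b' ≤ b) : IsPrim x z a' b' := by
  have hi : ∀ t ∈ Icc a b, IntervalIntegrable z volume a t := fun t ht => by
    refine h.1.mono_set ?_
    rw [uIcc_of_le ht.1, uIcc_of_le (ht.1.trans ht.2)]; exact Icc_subset_Icc_right ht.2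
  have ha' : a' ∈ Icc a b := ⟨h1, h2.trans h3⟩
  refine ⟨(hi a' ha').symm.trans (hi b' ⟨h1.trans h2, h3⟩), fun t ht => ?_⟩
  have ht' : t ∈ Icc a b := ⟨h1.trans ht.1, ht.2.trans h3⟩
  rw [h.2 t ht', h.2 a' ha', add_assoc, intervalIntegral.integral_add_adjacent_intervals
    (hi a' ha') ((hi a' ha').symm.trans (hi t ht'))]

lemma IsPrim.eq_integral {x z : ℝ → ℝ} {a b : ℝ} (h : IsPrim x z a b) (hab : a ≤ b) :
    x b = x a + ∫ s in a..b, z s := h.2 b ⟨hab, le_rfl⟩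

/-- Variation of constants: x is e^{-mt} times the primitive of e^{mt} g, and the product rule gives
its derivative. -/
lemma IsPrim.of_mild {x g : ℝ → ℝ} {m T : ℝ} (hT : 0 ≤ T) (hg : IntervalIntegrable g volume 0 T)
    (h : ∀ t ∈ Icc 0 T, x t = Real.exp (-(m * t)) * x 0 +
      ∫ s in (0 : ℝ)..t, Real.exp (-(m * (t - s))) * g s) :
    IsPrim x (fun t => g t - m * x t) 0 T := by
  have h1 : IsPrim (fun t => Real.exp (-(m * t))) (fun t => -m * Real.exp (-(m * t))) 0 T := by
    refine isPrim_of_hasDerivAt (fun t => ?_) (by fun_prop)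
    have h := ((hasDerivAt_id t).const_mul m).neg.exp
    simpa [mul_comm] using h
  have h2 : IsPrim (fun t => x 0 + ∫ s in (0 : ℝ)..t, Real.exp (m * s) * g s)
      (fun t => Real.exp (m * t) * g t) 0 T :=
    ⟨hg.continuousOn_mul (by fun_prop), fun t _ => by simp⟩
  have he : ∀ t, Real.exp (-(m * t)) * (x 0 + ∫ s in (0 : ℝ)..t, Real.exp (m * s) * g s) =
      Real.exp (-(m * t)) * x 0 + ∫ s in (0 : ℝ)..t, Real.exp (-(m * (t - s))) * g s := by
    intro t
    rw [mul_add, ← intervalIntegral.integral_const_mul]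
    congr 2; funext s
    rw [← mul_assoc, ← Real.exp_add]; congr 2; ring
  refine (h1.mul hT h2).congr (fun t ht => ?_) (fun t ht => ?_) hT
  · rw [h t ht, he]
  · rw [mul_assoc, he, ← h t ht, ← mul_assoc, ← Real.exp_add]
    simp; ring

/-- The integrating factor e^{mt} removes the linear term; this is the converse passage to Duhamel's
formula. -/
lemma IsPrim.mild {x g : ℝ → ℝ} {m T : ℝ} (hT : 0 ≤ T)
    (h : IsPrim x (fun t => g t - m * x t) 0 T) :
    ∀ t ∈ Icc 0 T, x t = Real.exp (-(m * t)) * x 0 +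
      ∫ s in (0 : ℝ)..t, Real.exp (-(m * (t - s))) * g s := by
  intro t ht
  have h1 : IsPrim (fun t => Real.exp (m * t)) (fun t => m * Real.exp (m * t)) 0 T := by
    refine isPrim_of_hasDerivAt (fun t => ?_) (by fun_prop)
    have h := ((hasDerivAt_id t).const_mul m).exp
    simpa [mul_comm] using h
  have h2 := (h1.mul hT h).2 t ht
  have h3 : ∫ s in (0 : ℝ)..t, (m * Real.exp (m * s) * x s + Real.exp (m * s) * (g s - m * x s)) =
      ∫ s in (0 : ℝ)..t, Real.exp (m * s) * g s := by
    congr 1; funext s; ring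
  simp only [mul_zero, Real.exp_zero, one_mul] at h2
  rw [h3] at h2
  have h4 : ∫ s in (0 : ℝ)..t, Real.exp (-(m * (t - s))) * g s =
      Real.exp (-(m * t)) * ∫ s in (0 : ℝ)..t, Real.exp (m * s) * g s := by
    rw [← intervalIntegral.integral_const_mul]
    congr 1; funext s
    rw [← mul_assoc, ← Real.exp_add]; congr 2; ring
  rw [h4, ← mul_add, ← h2, ← mul_assoc, ← Real.exp_add]
  simp

/-! ### Smoothing by the heat semigroup -/

lemma rpow_le_exp {y p : ℝ} (hy : 0 ≤ y) (hp0 : 0 ≤ p) (hp : p ≤ 1) : y ^ p ≤ Real.exp y := by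
  rcases le_total y 1 with h | h
  · exact (Real.rpow_le_one hy h hp0).trans (Real.one_le_exp hy)
  · calc y ^ p ≤ y ^ (1 : ℝ) := Real.rpow_le_rpow_of_exponent_le h hp
      _ = y := Real.rpow_one y
      _ ≤ y + 1 := by linarith
      _ ≤ Real.exp y := Real.add_one_le_exp y

/-- The Duhamel integral with a gain of `7/4` derivatives. -/
def duh (ψ : ℝ → Z3 → C3) (t : ℝ) (k : Z3) : C3 :=
  wt (7 / 4) k • ∫ s in (0 : ℝ)..t, Real.exp (-(waveLength k ^ 2 * (t - s))) • ψ s k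

lemma duh_zero_right (ψ : ℝ → Z3 → C3) (t : ℝ) : duh ψ t 0 = 0 := by simp [duh, wt_zero_right]

lemma lintegral_sq_le {μ : Measure ℝ} {f g : ℝ → ℝ≥0∞} (hf : AEMeasurable f μ)
    (hg : AEMeasurable g μ) : (∫⁻ s, f s * g s ∂μ) ^ 2 ≤ (∫⁻ s, f s ^ 2 ∂μ) * ∫⁻ s, g s ^ 2 ∂μ := by
  have h := ENNReal.lintegral_mul_le_Lp_mul_Lq μ Real.HolderConjugate.two_two hf hg
  simp only [ENNReal.rpow_two, Pi.mul_apply] at h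
  refine (pow_le_pow_left' h 2).trans (le_of_eq ?_)
  rw [mul_pow, ← ENNReal.rpow_natCast, ← ENNReal.rpow_natCast, ← ENNReal.rpow_mul,
    ← ENNReal.rpow_mul]
  norm_num

lemma lintegral_exp_le {m t : ℝ} (hm : 0 < m) (ht : 0 ≤ t) :
    ∫⁻ s in Ioo 0 t, ENNReal.ofReal (Real.exp (-(m * (t - s)))) ≤ ENNReal.ofReal m⁻¹ := by
  have hc : Continuous fun s => Real.exp (-(m * (t - s))) := by fun_prop
  rw [restrict_Ioo_eq_restrict_Ioc, ← ofReal_integral_eq_lintegral_ofReal]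
  · refine ENNReal.ofReal_le_ofReal ?_
    rw [← intervalIntegral.integral_of_le ht]
    have hd : ∀ s, HasDerivAt (fun s => m⁻¹ * Real.exp (-(m * (t - s))))
        (Real.exp (-(m * (t - s)))) s := by
      intro s
      have h1 : HasDerivAt (fun s => -(m * (t - s))) m s := by
        have := ((hasDerivAt_id s).sub_const t).const_mul m
        rw [mul_one] at this
        refine this.congr_of_eventuallyEq (Eventually.of_forall fun s => ?_)
        simp only [id]; ring
      have h2 := h1.exp.const_mul m⁻¹
      have h3 : m⁻¹ * (Real.exp (-(m * (t - s))) * m) = Real.exp (-(m * (t - s))) := by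
        field_simp
      rwa [h3] at h2
    rw [intervalIntegral.integral_eq_sub_of_hasDerivAt (fun s _ => hd s)
      (hc.intervalIntegrable _ _)]
    have : 0 < m⁻¹ * Real.exp (-(m * (t - 0))) := by positivity
    simp at this ⊢
    linarith
  · exact (hc.integrableOn_Icc).mono_set Ioc_subset_Icc_self
  · exact Eventually.of_forall fun s => Real.exp_nonneg _

/-- The powers of |k| add up to 1/4 + 7/2 - 2 = 7/4, that is (|k|²)^{7/8}, and y^{7/8} ≤ e^y at y =
|k|² r. -/
lemma wt_mul_exp_le {k : Z3} (hk : k ≠ 0) {r : ℝ} (hr : 0 < r) :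
    wt (1 / 4) k * wt (7 / 4) k ^ 2 * ((waveLength k ^ 2)⁻¹ * Real.exp (-(waveLength k ^ 2 * r))) ≤
      r ^ (-(7 / 8) : ℝ) := by
  have hw := waveLength_pos hk
  have h1 : (waveLength k ^ 2)⁻¹ = wt (-2) k := by
    rw [wt_of_ne _ hk, Real.rpow_neg hw.le, Real.rpow_two]
  have h2 : wt (1 / 4) k * wt (7 / 4) k ^ 2 * wt (-2) k = (waveLength k ^ 2) ^ (7 / 8 : ℝ) := by
    rw [wt_sq, wt_mul, wt_mul, wt_of_ne _ hk, ← Real.rpow_natCast, ← Real.rpow_mul hw.le]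
    norm_num
  have h3 := rpow_le_exp (y := waveLength k ^ 2 * r) (p := 7 / 8) (by positivity) (by norm_num)
    (by norm_num)
  rw [Real.mul_rpow (by positivity) hr.le] at h3
  rw [h1, ← mul_assoc, h2, Real.exp_neg, Real.rpow_neg hr.le, ← div_eq_mul_inv,
    div_le_iff₀ (Real.exp_pos _), inv_mul_eq_div, le_div_iff₀ (by positivity)]
  exact h3

/-- Cauchy–Schwarz in time with half of the exponential in each factor: one factor integrates to at
most |k|^{-2}, the other retains |ψ|². The bound is per mode, so no integration of `ell`-valued
functions is needed; the surplus weight |k|^{1/4} will control tails. -/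
lemma enorm_duh_le {ψ : ℝ → Z3 → C3} {t : ℝ} (ht : 0 ≤ t) (k : Z3)
    (hm : AEStronglyMeasurable (fun s => ψ s k) (volume.restrict (Ioo 0 t))) :
    ENNReal.ofReal (wt (1 / 4) k) * ‖duh ψ t k‖ₑ ^ 2 ≤
      ∫⁻ s in Ioo 0 t, ENNReal.ofReal ((t - s) ^ (-(7 / 8) : ℝ)) * ‖ψ s k‖ₑ ^ 2 := by
  by_cases hk : k = 0
  · subst hk; simp [wt_zero_right]
  set m := waveLength k ^ 2 with hm'
  have hmpos : 0 < m := pow_pos (waveLength_pos hk) 2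
  have hme : AEMeasurable (fun s => ‖ψ s k‖ₑ) (volume.restrict (Ioo 0 t)) := hm.enorm
  have h1 : ‖∫ s in (0 : ℝ)..t, Real.exp (-(m * (t - s))) • ψ s k‖ₑ ≤
      ∫⁻ s in Ioo 0 t, ENNReal.ofReal (Real.exp (-(m * (t - s)) / 2)) *
        (ENNReal.ofReal (Real.exp (-(m * (t - s)) / 2)) * ‖ψ s k‖ₑ) := by
    rw [intervalIntegral.integral_of_le ht, restrict_Ioo_eq_restrict_Ioc]
    refine (enorm_integral_le_lintegral_enorm _).trans (le_of_eq ?_)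
    refine lintegral_congr fun s => ?_
    rw [enorm_smul, Real.enorm_of_nonneg (Real.exp_nonneg _), ← mul_assoc,
      ← ENNReal.ofReal_mul (Real.exp_nonneg _), ← Real.exp_add, add_halves]
  have h2 := lintegral_sq_le (μ := volume.restrict (Ioo 0 t))
    (f := fun s => ENNReal.ofReal (Real.exp (-(m * (t - s)) / 2)))
    (g := fun s => ENNReal.ofReal (Real.exp (-(m * (t - s)) / 2)) * ‖ψ s k‖ₑ)
    (Measurable.aemeasurable (by fun_prop)) ((Measurable.aemeasurable (by fun_prop)).mul hme)
  have h3 : ∀ s, ENNReal.ofReal (Real.exp (-(m * (t - s)) / 2)) ^ 2 =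
      ENNReal.ofReal (Real.exp (-(m * (t - s)))) := fun s => by
    rw [← ENNReal.ofReal_pow (Real.exp_nonneg _), sq, ← Real.exp_add, add_halves]
  simp only [mul_pow, h3] at h2
  rw [duh, enorm_smul, mul_pow, Real.enorm_of_nonneg (wt_nonneg _ _)]
  calc _ ≤ ENNReal.ofReal (wt (1 / 4) k) * (ENNReal.ofReal (wt (7 / 4) k) ^ 2 *
        (ENNReal.ofReal m⁻¹ * ∫⁻ s in Ioo 0 t,
          ENNReal.ofReal (Real.exp (-(m * (t - s)))) * ‖ψ s k‖ₑ ^ 2)) := by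
        gcongr
        exact ((pow_le_pow_left' h1 2).trans h2).trans
          (mul_le_mul_left (lintegral_exp_le hmpos ht) _)
    _ = ∫⁻ s in Ioo 0 t, ENNReal.ofReal (wt (1 / 4) k * wt (7 / 4) k ^ 2 *
          (m⁻¹ * Real.exp (-(m * (t - s))))) * ‖ψ s k‖ₑ ^ 2 := by
        rw [← ENNReal.ofReal_pow (wt_nonneg _ _), ← mul_assoc, ← mul_assoc,
          ← ENNReal.ofReal_mul (wt_nonneg _ _), ← ENNReal.ofReal_mul (mul_nonneg (wt_nonneg _ _)
          (sq_nonneg _)), ← lintegral_const_mul']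
        · refine lintegral_congr fun s => ?_
          rw [← mul_assoc, ← ENNReal.ofReal_mul, mul_assoc _ m⁻¹]
          exact mul_nonneg (mul_nonneg (wt_nonneg _ _) (sq_nonneg _)) (by positivity)
        · exact ENNReal.ofReal_ne_top
    _ ≤ _ := by
        refine setLIntegral_mono_ae' measurableSet_Ioo (Eventually.of_forall fun s hs => ?_)
        gcongr
        exact wt_mul_exp_le hk (sub_pos.2 hs.2)

/-- The constant in the smoothing estimate for growth rate `γ`. -/
def duhConst (γ : ℝ) : ℝ := (1 / (2 * γ)) ^ (1 / 8 : ℝ) * Real.Gamma (1 / 8)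

lemma duhConst_nonneg {γ : ℝ} (hγ : 0 < γ) : 0 ≤ duhConst γ :=
  mul_nonneg (by positivity) (Real.Gamma_pos_of_pos (by norm_num)).le

lemma tendsto_duhConst : Tendsto duhConst atTop (𝓝 0) := by
  have h1 : Tendsto (fun γ : ℝ => 1 / (2 * γ)) atTop (𝓝 0) := by
    have := (tendsto_id.const_mul_atTop (r := (2 : ℝ)) (by norm_num)).inv_tendsto_atTop
    exact this.congr fun γ => (one_div _).symm
  have h2 := (h1.rpow_const (p := 1 / 8) (Or.inr (by norm_num))).mul_const (Real.Gamma (1 / 8))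
  rwa [Real.zero_rpow (by norm_num), zero_mul] at h2

lemma lintegral_rpow_exp {γ : ℝ} (hγ : 0 < γ) :
    ∫⁻ r in Ioi (0 : ℝ), ENNReal.ofReal (r ^ (-(7 / 8) : ℝ) * Real.exp (-(2 * γ * r))) =
      ENNReal.ofReal (duhConst γ) := by
  have h := Real.integral_rpow_mul_exp_neg_mul_Ioi (a := 1 / 8) (r := 2 * γ) (by norm_num)
    (by positivity)
  rw [show (1 / 8 : ℝ) - 1 = -(7 / 8) by norm_num] at h
  have hpos : 0 < duhConst γ :=
    mul_pos (by positivity) (Real.Gamma_pos_of_pos (by norm_num))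
  rw [← ofReal_integral_eq_lintegral_ofReal, h]
  · rfl
  -- Integrability follows from the value: the integral of a non-integrable function would be zero,
  -- but `duhConst` is positive.
  · by_contra hi
    rw [integral_undef hi] at h
    exact hpos.ne h
  · filter_upwards [self_mem_ae_restrict measurableSet_Ioi] with r hr
    have : (0 : ℝ) < r := hr
    positivity

/-! ### Uniform tail bounds and convergence in `ell` -/

/-- A bound for the sequence `c` in a space of sequences with slightly more decay than `ell`. -/
def Tame (C : ℝ) (c : Z3 → C3) : Prop :=
  c 0 = 0 ∧ ∀ s : Finset Z3, ∑ k ∈ s, wt (1 / 4) k * ‖c k‖ ^ 2 ≤ C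

lemma Tame.of_tsum {C : ℝ} (hC : 0 ≤ C) {c : Z3 → C3} (h0 : c 0 = 0)
    (h : ∑' k, ENNReal.ofReal (wt (1 / 4) k) * ‖c k‖ₑ ^ 2 ≤ ENNReal.ofReal C) : Tame C c := by
  refine ⟨h0, fun s => ?_⟩
  have h1 := (ENNReal.sum_le_tsum s).trans h
  have h2 : ∀ k, ENNReal.ofReal (wt (1 / 4) k) * ‖c k‖ₑ ^ 2 =
      ENNReal.ofReal (wt (1 / 4) k * ‖c k‖ ^ 2) := fun k => by
    rw [ENNReal.ofReal_mul (wt_nonneg _ _), enorm_eq_ofReal, ENNReal.ofReal_pow (norm_nonneg _)]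
  simp only [h2] at h1
  rw [← ENNReal.ofReal_sum_of_nonneg fun k _ => mul_nonneg (wt_nonneg _ _) (sq_nonneg _)] at h1
  exact (ENNReal.ofReal_le_ofReal_iff hC).1 h1

lemma norm_sq_le_wt_mul {c : Z3 → C3} (h0 : c 0 = 0) (k : Z3) :
    ‖c k‖ ^ 2 ≤ wt (1 / 4) k * ‖c k‖ ^ 2 := by
  by_cases hk : k = 0
  · subst hk; simp [h0]
  · exact le_mul_of_one_le_left (sq_nonneg _)
      ((wt_zero_left hk).symm.le.trans (wt_mono (by norm_num) k))

lemma Tame.nonneg {C : ℝ} {c : Z3 → C3} (h : Tame C c) : 0 ≤ C := by simpa using h.2 ∅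

lemma Tame.sum_le {C : ℝ} {c : Z3 → C3} (h : Tame C c) (s : Finset Z3) :
    ∑ k ∈ s, ‖c k‖ ^ 2 ≤ C :=
  (Finset.sum_le_sum fun k _ => norm_sq_le_wt_mul h.1 k).trans (h.2 s)

lemma Tame.summable {C : ℝ} {c : Z3 → C3} (h : Tame C c) : Summable fun k => ‖c k‖ ^ 2 :=
  summable_of_sum_le (fun _ => sq_nonneg _) h.sum_le

lemma Tame.mono {C C' : ℝ} {c : Z3 → C3} (h : Tame C c) (hC : C ≤ C') : Tame C' c :=
  ⟨h.1, fun s => (h.2 s).trans hC⟩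

lemma Tame.sub {C C' : ℝ} {c c' : Z3 → C3} (h : Tame C c) (h' : Tame C' c') :
    Tame (2 * C + 2 * C') (c - c') := by
  refine ⟨by simp [h.1, h'.1], fun s => ?_⟩
  calc _ ≤ ∑ k ∈ s, (2 * (wt (1 / 4) k * ‖c k‖ ^ 2) + 2 * (wt (1 / 4) k * ‖c' k‖ ^ 2)) := by
        refine Finset.sum_le_sum fun k _ => ?_
        have h1 : ‖(c - c') k‖ ≤ ‖c k‖ + ‖c' k‖ := norm_sub_le _ _
        have h2 : ‖(c - c') k‖ ^ 2 ≤ 2 * ‖c k‖ ^ 2 + 2 * ‖c' k‖ ^ 2 := by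
          have := pow_le_pow_left₀ (norm_nonneg _) h1 2
          nlinarith [sq_nonneg (‖c k‖ - ‖c' k‖)]
        have := mul_le_mul_of_nonneg_left h2 (wt_nonneg (1 / 4) k)
        linarith
    _ ≤ _ := by
        rw [Finset.sum_add_distrib, ← Finset.mul_sum, ← Finset.mul_sum]
        linarith [h.2 s, h'.2 s]

/-- Sum the bound per mode over k and write e^{γs} = e^{γt} e^{-γ(t-s)}. What remains is ∫ r^{-7/8}
e^{-2γr} dr, a Gamma integral that tends to 0 as γ grows; this is the source of the contraction. -/
lemma tame_duh {ψ : ℝ → ell} {t Q γ : ℝ} (ht : 0 ≤ t) (hγ : 0 < γ)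
    (hm : ∀ k, AEStronglyMeasurable (fun s => ψ s k) (volume.restrict (Ioo 0 t)))
    (hb : ∀ s ∈ Ioo 0 t, ‖ψ s‖ ≤ Q * Real.exp (γ * s)) :
    Tame ((Q * Real.exp (γ * t)) ^ 2 * duhConst γ) (duh (fun s => ψ s) t) := by
  have hG := duhConst_nonneg hγ
  refine Tame.of_tsum (by positivity) (duh_zero_right _ _) ?_
  refine (ENNReal.tsum_le_tsum fun k => enorm_duh_le ht k (hm k)).trans ?_
  rw [← lintegral_tsum]
  swap
  · intro k
    exact (Measurable.aemeasurable (by fun_prop)).mul ((hm k).enorm.pow_const 2)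
  simp only [ENNReal.tsum_mul_left, ell_tsum_enorm]
  calc _ ≤ ∫⁻ s in Ioo 0 t, ENNReal.ofReal ((Q * Real.exp (γ * t)) ^ 2) *
        ENNReal.ofReal ((t - s) ^ (-(7 / 8) : ℝ) * Real.exp (-(2 * γ * (t - s)))) := by
        refine setLIntegral_mono_ae' measurableSet_Ioo (Eventually.of_forall fun s hs => ?_)
        have hr : 0 < t - s := sub_pos.2 hs.2
        rw [← ENNReal.ofReal_mul (by positivity), ← ENNReal.ofReal_mul (by positivity)]
        refine ENNReal.ofReal_le_ofReal ?_
        have h1 := pow_le_pow_left₀ (norm_nonneg _) (hb s hs) 2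
        have h2 : (Q * Real.exp (γ * s)) ^ 2 =
            (Q * Real.exp (γ * t)) ^ 2 * Real.exp (-(2 * γ * (t - s))) := by
          have : Real.exp (γ * s) ^ 2 = Real.exp (γ * t) ^ 2 * Real.exp (-(2 * γ * (t - s))) := by
            rw [sq, sq, ← Real.exp_add, ← Real.exp_add, ← Real.exp_add]; congr 1; ring
          rw [mul_pow, mul_pow, this]; ring
        rw [h2] at h1
        calc _ ≤ (t - s) ^ (-(7 / 8) : ℝ) * ((Q * Real.exp (γ * t)) ^ 2 *
              Real.exp (-(2 * γ * (t - s)))) := by gcongr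
          _ = _ := by ring
    _ = ENNReal.ofReal ((Q * Real.exp (γ * t)) ^ 2) * ∫⁻ s in Ioo 0 t,
        ENNReal.ofReal ((t - s) ^ (-(7 / 8) : ℝ) * Real.exp (-(2 * γ * (t - s)))) :=
        lintegral_const_mul' _ _ ENNReal.ofReal_ne_top
    _ ≤ _ := by
        rw [ENNReal.ofReal_mul (by positivity)]
        refine mul_le_mul_right ?_ _
        rw [← lintegral_rpow_exp hγ, ← lintegral_indicator measurableSet_Ioo,
          ← lintegral_indicator measurableSet_Ioi, ← lintegral_sub_left_eq_self _ t]
        refine lintegral_mono fun s => ?_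
        by_cases hs : t - s ∈ Ioo 0 t
        · rw [indicator_of_mem hs, indicator_of_mem (show s ∈ Ioi 0 from ?_)]
          · simp
          · have := hs.2; simp at this; exact this
        · rw [indicator_of_notMem hs]; exact zero_le

lemma tendsto_wt_cofinite {s : ℝ} (hs : s < 0) : Tendsto (wt s) cofinite (𝓝 0) := by
  have h1 := (summable_wt (s := -4) (by norm_num)).tendsto_cofinite_zero
  have h2 := h1.rpow_const (p := s / (-4)) (Or.inr (by linarith [div_pos_of_neg_of_neg hs (by norm_num : (-4 : ℝ) < 0)]))
  rw [Real.zero_rpow (div_pos_of_neg_of_neg hs (by norm_num)).ne'] at h2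
  refine h2.congr fun k => ?_
  by_cases hk : k = 0
  · subst hk
    rw [wt_zero_right, wt_zero_right, Real.zero_rpow (div_pos_of_neg_of_neg hs (by norm_num)).ne']
  · rw [wt_of_ne _ hk, wt_of_ne _ hk, ← Real.rpow_mul (waveLength_nonneg k)]
    congr 1; ring

lemma Tame.norm_sq_le {C ε : ℝ} {d : ell} (h : Tame C d) (F : Finset Z3) (hε : 0 ≤ ε)
    (hF : ∀ k ∉ F, wt (-(1 / 4)) k ≤ ε) : ‖d‖ ^ 2 ≤ ∑ k ∈ F, ‖d k‖ ^ 2 + ε * C := by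
  classical
  refine hasSum_le_of_sum_le (ell_hasSum d) fun s => ?_
  rw [← Finset.sum_inter_add_sum_sdiff s F]
  refine add_le_add (Finset.sum_le_sum_of_subset_of_nonneg Finset.inter_subset_right
    fun _ _ _ => sq_nonneg _) ?_
  calc ∑ k ∈ s \ F, ‖d k‖ ^ 2 ≤ ∑ k ∈ s \ F, ε * (wt (1 / 4) k * ‖d k‖ ^ 2) := by
        refine Finset.sum_le_sum fun k hk => ?_
        by_cases hk0 : k = 0
        · subst hk0; simp [h.1]
        · have h1 : wt (-(1 / 4)) k * wt (1 / 4) k = 1 := by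
            rw [wt_mul]; simpa using wt_zero_left hk0
          have h2 := hF k (Finset.mem_sdiff.1 hk).2
          calc ‖d k‖ ^ 2 = wt (-(1 / 4)) k * (wt (1 / 4) k * ‖d k‖ ^ 2) := by
                rw [← mul_assoc, h1, one_mul]
            _ ≤ _ := mul_le_mul_of_nonneg_right h2 (mul_nonneg (wt_nonneg _ _) (sq_nonneg _))
    _ ≤ _ := by
        rw [← Finset.mul_sum]
        exact mul_le_mul_of_nonneg_left (h.2 _) hε

/-- Coordinatewise convergence together with a uniform tail bound gives convergence. -/
lemma tendsto_ell_of_tame {X : Type*} {l : Filter X} {h : X → ell} {a : ell} {C : ℝ}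
    (hC : ∀ᶠ x in l, Tame C (h x)) (ha : Tame C a)
    (hc : ∀ k, Tendsto (fun x => h x k) l (𝓝 (a k))) : Tendsto h l (𝓝 a) := by
  rw [tendsto_iff_norm_sub_tendsto_zero]
  have hC0 := ha.nonneg
  have h2 : Tendsto (fun x => ‖h x - a‖ ^ 2) l (𝓝 0) := by
    rw [Metric.tendsto_nhds]
    intro η hη
    set ε := η / (2 * (2 * C + 2 * C) + 1) with hεd
    have hε : 0 < ε := by positivity
    have hfin : {k | ¬ wt (-(1 / 4)) k < ε}.Finite :=
      (tendsto_wt_cofinite (s := -(1 / 4)) (by norm_num)).eventually (gt_mem_nhds hε)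
    have hs : Tendsto (fun x => ∑ k ∈ hfin.toFinset, ‖h x k - a k‖ ^ 2) l (𝓝 0) := by
      have : Tendsto (fun x => ∑ k ∈ hfin.toFinset, ‖h x k - a k‖ ^ 2) l
          (𝓝 (∑ k ∈ hfin.toFinset, ‖a k - a k‖ ^ 2)) :=
        tendsto_finsetSum _ fun k _ => (((hc k).sub_const (a k)).norm).pow 2
      simpa using this
    filter_upwards [hC, hs.eventually (gt_mem_nhds (half_pos hη))] with x hx hx2
    have h3 : Tame (2 * C + 2 * C) (h x - a : ell) := hx.sub ha
    have h4 := h3.norm_sq_le hfin.toFinset hε.le (fun k hk => by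
      simp only [Finite.mem_toFinset, mem_setOf_eq, not_not] at hk; exact hk.le)
    have h5 : ε * (2 * C + 2 * C) ≤ η / 2 := by
      rw [hεd, div_mul_eq_mul_div, div_le_iff₀ (by positivity)]
      nlinarith
    rw [Real.dist_eq, sub_zero, abs_of_nonneg (sq_nonneg _)]
    have h6 : ∑ k ∈ hfin.toFinset, ‖(h x - a : ell) k‖ ^ 2 =
      ∑ k ∈ hfin.toFinset, ‖h x k - a k‖ ^ 2 := rfl
    linarith
  have h3 := h2.sqrt
  simpa [Real.sqrt_sq (norm_nonneg _)] using h3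

/-! ### Mild solutions of the truncated equation -/

/-- A sequence as an element of `ell` (zero if it is not square-summable). -/
def toEll (c : Z3 → C3) : ell := by
  classical exact if h : Summable fun k => ‖c k‖ ^ 2 then ellOf c h else 0

lemma toEll_apply {c : Z3 → C3} (h : Summable fun k => ‖c k‖ ^ 2) (k : Z3) : toEll c k = c k := by
  rw [toEll, dif_pos h]; rfl

lemma coe_toEll {c : Z3 → C3} (h : Summable fun k => ‖c k‖ ^ 2) : (toEll c : Z3 → C3) = c :=
  funext (toEll_apply h)

/-- A map into `ell` with measurable coordinates and at most exponential growth. -/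
structure Growth (ψ : ℝ → ell) (Q γ : ℝ) : Prop where
  meas : ∀ T k, AEStronglyMeasurable (fun s => ψ s k) (volume.restrict (Icc 0 T))
  bound : ∀ s, 0 ≤ s → ‖ψ s‖ ≤ Q * Real.exp (γ * s)

lemma Growth.intervalIntegrable {ψ : ℝ → ell} {Q γ : ℝ} (h : Growth ψ Q γ) (k : Z3) {T : ℝ}
    (hT : 0 ≤ T) : IntervalIntegrable (fun s => ψ s k) volume 0 T := by
  rw [intervalIntegrable_iff_integrableOn_Icc_of_le hT]
  have hc : Continuous fun s => Q * Real.exp (γ * s) := by fun_prop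
  refine Integrable.mono' (hc.integrableOn_Icc) (h.meas T k) ?_
  filter_upwards [self_mem_ae_restrict measurableSet_Icc] with s hs
  exact (ell_norm_apply_le _ k).trans (h.bound s hs.1)

/-- With the t-dependent exponential pulled out, an ordinary primitive remains, whose continuity in
t is standard. -/
lemma duh_eq (ψ : ℝ → Z3 → C3) (t : ℝ) (k : Z3) : duh ψ t k =
    (wt (7 / 4) k * Real.exp (-(waveLength k ^ 2 * t))) •
      ∫ s in (0 : ℝ)..t, Real.exp (waveLength k ^ 2 * s) • ψ s k := by
  rw [duh, mul_smul]
  congr 1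
  rw [← intervalIntegral.integral_smul]
  congr 1; funext s
  rw [smul_smul, ← Real.exp_add]; congr 2; ring

lemma Growth.continuousOn_duh {ψ : ℝ → ell} {Q γ : ℝ} (h : Growth ψ Q γ) (k : Z3) :
    ContinuousOn (fun t => duh (fun s => ψ s) t k) (Ici 0) := by
  simp only [duh_eq]
  have he : Continuous fun t => wt (7 / 4) k * Real.exp (-(waveLength k ^ 2 * t)) := by fun_prop
  refine ContinuousOn.smul he.continuousOn fun t ht => ?_
  have ht' : (0 : ℝ) ≤ t := ht
  have hi : IntervalIntegrable (fun s => Real.exp (waveLength k ^ 2 * s) • ψ s k) volume 0 (t + 1) :=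
    (h.intervalIntegrable k (by linarith)).continuousOn_smul (by fun_prop)
  have hc := intervalIntegral.continuousOn_primitive_interval' hi left_mem_uIcc
  rw [uIcc_of_le (by linarith)] at hc
  refine (hc t ⟨ht', by linarith⟩).mono_of_mem_nhdsWithin ?_
  rw [← Ici_inter_Iic]
  exact inter_mem self_mem_nhdsWithin (mem_nhdsWithin_of_mem_nhds (Iic_mem_nhds (by linarith)))

lemma Growth.tame {ψ : ℝ → ell} {Q γ t : ℝ} (h : Growth ψ Q γ) (hγ : 0 < γ) (ht : 0 ≤ t) :
    Tame ((Q * Real.exp (γ * t)) ^ 2 * duhConst γ) (duh (fun s => ψ s) t) :=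
  tame_duh ht hγ (fun k => (h.meas t k).mono_measure
    (Measure.restrict_mono Ioo_subset_Icc_self le_rfl)) fun s hs => h.bound s hs.1.le

lemma Growth.nonneg {ψ : ℝ → ell} {Q γ : ℝ} (h : Growth ψ Q γ) : 0 ≤ Q := by
  have := (norm_nonneg _).trans (h.bound 0 le_rfl)
  simpa using this

lemma Growth.norm_duh_le {ψ : ℝ → ell} {Q γ t : ℝ} (h : Growth ψ Q γ) (hγ : 0 < γ) (ht : 0 ≤ t) :
    ‖toEll (duh (fun s => ψ s) t)‖ ≤ Q * Real.exp (γ * t) * Real.sqrt (duhConst γ) := by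
  have hQ := h.nonneg
  have ht := h.tame hγ ht
  refine ell_norm_le (by positivity) fun s => ?_
  simp only [toEll_apply ht.summable]
  rw [mul_pow, Real.sq_sqrt (duhConst_nonneg hγ)]
  exact ht.sum_le s

/-- Each coordinate is continuous, and the `Tame` bound is uniform for times up to t + 1, which
upgrades this to norm continuity. -/
lemma Growth.continuous_duh {ψ : ℝ → ell} {Q γ : ℝ} (h : Growth ψ Q γ) (hγ : 0 < γ) :
    ContinuousOn (fun t => toEll (duh (fun s => ψ s) t)) (Ici 0) := by
  intro t ht
  have ht' : (0 : ℝ) ≤ t := ht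
  have hQ := h.nonneg
  have hG := duhConst_nonneg hγ
  have hmono : ∀ s, 0 ≤ s → s ≤ t + 1 →
      Tame ((Q * Real.exp (γ * (t + 1))) ^ 2 * duhConst γ) (toEll (duh (fun s => ψ s) s)) := by
    intro s hs hst
    rw [coe_toEll (h.tame hγ hs).summable]
    refine (h.tame hγ hs).mono ?_
    gcongr
  refine tendsto_ell_of_tame (C := (Q * Real.exp (γ * (t + 1))) ^ 2 * duhConst γ) ?_
    (hmono t ht' (by linarith)) fun k => ?_
  · filter_upwards [self_mem_nhdsWithin, mem_nhdsWithin_of_mem_nhds (Iic_mem_nhds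
      (show t < t + 1 by linarith))] with s hs hst
    exact hmono s hs hst
  · have := h.continuousOn_duh k t ht
    rw [toEll_apply (h.tame hγ ht').summable]
    refine Tendsto.congr' ?_ this
    filter_upwards [self_mem_nhdsWithin] with s hs
    rw [toEll_apply (h.tame hγ hs).summable]

lemma Growth.sub {ψ ψ' : ℝ → ell} {Q Q' D γ : ℝ} (h : Growth ψ Q γ) (h' : Growth ψ' Q' γ)
    (hD : ∀ s, 0 ≤ s → ‖ψ s - ψ' s‖ ≤ D * Real.exp (γ * s)) :
    Growth (fun s => ψ s - ψ' s) D γ :=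
  ⟨fun T k => (h.meas T k).sub (h'.meas T k), hD⟩

lemma Growth.duh_sub {ψ ψ' : ℝ → ell} {Q Q' γ t : ℝ} (h : Growth ψ Q γ) (h' : Growth ψ' Q' γ)
    (ht : 0 ≤ t) : duh (fun s => (ψ s - ψ' s : ell)) t =
      duh (fun s => ψ s) t - duh (fun s => ψ' s) t := by
  funext k
  rw [Pi.sub_apply, duh, duh, duh, ← smul_sub, ← intervalIntegral.integral_sub]
  · congr 2; funext s; rw [← smul_sub]; rfl
  · exact (h.intervalIntegrable k ht).continuousOn_smul (by fun_prop)
  · exact (h'.intervalIntegrable k ht).continuousOn_smul (by fun_prop)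

lemma toEll_sub {c d : Z3 → C3} (hc : Summable fun k => ‖c k‖ ^ 2) (hd : Summable fun k => ‖d k‖ ^ 2) :
    toEll c - toEll d = toEll (c - d) := by
  have h1 : c - d = ((ellOf c hc - ellOf d hd : ell) : Z3 → C3) := rfl
  have h2 : Summable fun k => ‖(c - d) k‖ ^ 2 := by rw [h1]; exact ell_summable _
  ext1; funext k
  rw [toEll_apply h2]
  change toEll c k - toEll d k = _
  rw [toEll_apply hc, toEll_apply hd]; rfl

lemma tendsto_ell_of_dominated {X : Type*} {l : Filter X} {h : X → ell} {a : ell} {g : Z3 → ℝ}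
    (hg : Summable g) (hb : ∀ᶠ x in l, ∀ k, ‖h x k - a k‖ ^ 2 ≤ g k)
    (hc : ∀ k, Tendsto (fun x => h x k) l (𝓝 (a k))) : Tendsto h l (𝓝 a) := by
  rw [tendsto_iff_norm_sub_tendsto_zero]
  have h1 : Tendsto (fun x => ∑' k, ‖h x k - a k‖ ^ 2) l (𝓝 (∑' k : Z3, (0 : ℝ))) := by
    refine tendsto_tsum_of_dominated_convergence hg (fun k => ?_) ?_
    · have := (((hc k).sub_const (a k)).norm).pow 2
      simpa using this
    · filter_upwards [hb] with x hx k
      rw [Real.norm_of_nonneg (sq_nonneg _)]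
      exact hx k
  have h2 : ∀ x, ∑' k, ‖h x k - a k‖ ^ 2 = ‖h x - a‖ ^ 2 := fun x => (ell_hasSum (h x - a)).tsum_eq
  simp only [h2, tsum_zero] at h1
  have h3 := h1.sqrt
  simpa [Real.sqrt_sq (norm_nonneg _)] using h3

lemma exp_neg_le_one {m t : ℝ} (hm : 0 ≤ m) (ht : 0 ≤ t) : Real.exp (-(m * t)) ≤ 1 :=
  Real.exp_le_one_iff.2 (neg_nonpos.2 (mul_nonneg hm ht))

/-- The heat semigroup on `ell`, extended by the identity to negative times. -/
def heat (t : ℝ) : ell →L[ℝ] ell :=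
  diag (fun k => Real.exp (-(waveLength k ^ 2 * max t 0))) 1 fun k => by
    rw [abs_of_nonneg (Real.exp_nonneg _)]
    exact exp_neg_le_one (sq_nonneg _) (le_max_right _ _)

lemma heat_apply {t : ℝ} (ht : 0 ≤ t) (a : ell) (k : Z3) :
    heat t a k = Real.exp (-(waveLength k ^ 2 * t)) • a k := by
  rw [heat, diag_apply, max_eq_left ht]

lemma norm_diag_le {w : Z3 → ℝ} (hw : ∀ k, |w k| ≤ 1) (a : ell) : ‖diag w 1 hw a‖ ≤ ‖a‖ := by
  refine ell_norm_le (norm_nonneg _) fun s => (Finset.sum_le_sum fun k _ => ?_).trans (ell_sum_le a s)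
  rw [diag_apply, norm_smul]
  exact pow_le_pow_left₀ (by positivity) (mul_le_of_le_one_left (norm_nonneg _) (hw k)) 2

lemma norm_heat_le (t : ℝ) (a : ell) : ‖heat t a‖ ≤ ‖a‖ := norm_diag_le _ a

lemma continuous_heat (a : ell) : Continuous fun t => heat t a := by
  refine continuous_iff_continuousAt.2 fun t => ?_
  refine tendsto_ell_of_dominated ((ell_summable a).mul_left 4) (Eventually.of_forall fun s k => ?_)
    fun k => ?_
  · have h1 : ∀ r, ‖heat r a k‖ ≤ ‖a k‖ := fun r => by
      rw [heat, diag_apply, norm_smul, Real.norm_of_nonneg (Real.exp_nonneg _)]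
      exact mul_le_of_le_one_left (norm_nonneg _) (exp_neg_le_one (sq_nonneg _) (le_max_right _ _))
    have h2 := (norm_sub_le (heat s a k) (heat t a k)).trans (add_le_add (h1 s) (h1 t))
    have := pow_le_pow_left₀ (norm_nonneg _) h2 2
    nlinarith
  · have : Continuous fun t => heat t a k := by
      simp only [heat, diag_apply]
      fun_prop
    exact this.tendsto t

open Classical in
/-- The Fourier cut-off to the modes in `J`. -/
def cut (J : Set Z3) : ell →L[ℝ] ell :=
  diag (fun k => if k ∈ J then 1 else 0) 1 fun k => by split_ifs <;> simp

open Classical in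
lemma cut_apply (J : Set Z3) (a : ell) (k : Z3) : cut J a k = if k ∈ J then a k else 0 := by
  rw [cut, diag_apply]; split_ifs <;> simp

lemma norm_cut_le (J : Set Z3) (a : ell) : ‖cut J a‖ ≤ ‖a‖ := norm_diag_le _ a

lemma cut_univ (a : ell) : cut univ a = a := by
  ext1; funext k; rw [cut_apply, if_pos (mem_univ k)]

/-- Radial retraction to the ball of radius `R`. -/
def retract (R : ℝ) (x : ell) : ell := (R / max R ‖x‖) • x

lemma norm_retract_le {R : ℝ} (hR : 0 < R) (x : ell) : ‖retract R x‖ ≤ R := by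
  have hm : 0 < max R ‖x‖ := lt_max_of_lt_left hR
  rw [retract, norm_smul, Real.norm_of_nonneg (by positivity), div_mul_eq_mul_div, div_le_iff₀ hm]
  exact mul_le_mul_of_nonneg_left (le_max_right _ _) hR.le

lemma retract_of_le {R : ℝ} (hR : 0 < R) {x : ell} (hx : ‖x‖ ≤ R) : retract R x = x := by
  rw [retract, max_eq_left hx, div_self hR.ne', one_smul]

/-- One copy of ‖x - y‖ comes from moving the point with the factor fixed, one from the change of
the factor. The optimal constant is not needed. -/
lemma norm_retract_sub_le {R : ℝ} (hR : 0 < R) (x y : ell) :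
    ‖retract R x - retract R y‖ ≤ 2 * ‖x - y‖ := by
  have hx : 0 < max R ‖x‖ := lt_max_of_lt_left hR
  have hy : 0 < max R ‖y‖ := lt_max_of_lt_left hR
  have h1 : retract R x - retract R y =
      (R / max R ‖x‖) • (x - y) + (R / max R ‖x‖ - R / max R ‖y‖) • y := by
    rw [retract, retract, smul_sub, sub_smul]; abel
  have h2 : R / max R ‖x‖ ≤ 1 := (div_le_one hx).2 (le_max_left _ _)
  have h3 : |R / max R ‖x‖ - R / max R ‖y‖| * ‖y‖ ≤ ‖x - y‖ := by
    have e : R / max R ‖x‖ - R / max R ‖y‖ =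
        (R / max R ‖x‖) * ((max R ‖y‖ - max R ‖x‖) / max R ‖y‖) := by field_simp
    rw [e, abs_mul, abs_of_pos (div_pos hR hx), abs_div, abs_of_pos hy]
    have h4 : |max R ‖y‖ - max R ‖x‖| ≤ ‖x - y‖ := by
      refine (abs_max_sub_max_le_max _ _ _ _).trans ?_
      rw [sub_self, abs_zero, max_eq_right (abs_nonneg _), norm_sub_rev]
      exact abs_norm_sub_norm_le y x
    have h5 : |max R ‖y‖ - max R ‖x‖| / max R ‖y‖ * ‖y‖ ≤ ‖x - y‖ := by
      rw [div_mul_eq_mul_div, div_le_iff₀ hy]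
      exact mul_le_mul h4 (le_max_right _ _) (norm_nonneg _) (norm_nonneg _)
    calc _ = (R / max R ‖x‖) * (|max R ‖y‖ - max R ‖x‖| / max R ‖y‖ * ‖y‖) := by ring
      _ ≤ 1 * ‖x - y‖ := mul_le_mul h2 h5 (by positivity) zero_le_one
      _ = _ := one_mul _
  rw [h1]
  refine (norm_add_le _ _).trans ?_
  rw [norm_smul, norm_smul, Real.norm_of_nonneg (div_nonneg hR.le hx.le), Real.norm_eq_abs]
  have := mul_le_mul_of_nonneg_right h2 (norm_nonneg (x - y))
  linarith

lemma betaBound_nonneg (α : ℝ) : 0 ≤ betaBound α := Real.sqrt_nonneg _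

lemma norm_beta_le {α : ℝ} (hα : 1 / 2 ≤ α) (a b : ell) :
    ‖beta hα a b‖ ≤ betaBound α * ‖a‖ * ‖b‖ :=
  (LinearMap.mkContinuous₂_norm_le' _ _ |> fun h => (beta hα).le_of_opNorm₂_le_of_le
    (h.trans (max_eq_left (betaBound_nonneg α)).le) le_rfl le_rfl)

/-- The truncated nonlinearity. -/
def nonlin {α : ℝ} (hα : 1 / 2 ≤ α) (R : ℝ) (x : ell) : ell := beta hα (retract R x) (retract R x)

lemma norm_nonlin_le {α : ℝ} (hα : 1 / 2 ≤ α) {R : ℝ} (hR : 0 < R) (x : ell) :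
    ‖nonlin hα R x‖ ≤ betaBound α * R ^ 2 := by
  have := betaBound_nonneg α
  refine (norm_beta_le hα _ _).trans ?_
  have := norm_retract_le hR x
  rw [sq, ← mul_assoc]
  gcongr

lemma norm_nonlin_sub_le {α : ℝ} (hα : 1 / 2 ≤ α) {R : ℝ} (hR : 0 < R) (x y : ell) :
    ‖nonlin hα R x - nonlin hα R y‖ ≤ 4 * betaBound α * R * ‖x - y‖ := by
  have hb := betaBound_nonneg α
  have h : nonlin hα R x - nonlin hα R y = beta hα (retract R x - retract R y) (retract R x)
      + beta hα (retract R y) (retract R x - retract R y) := by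
    simp only [nonlin, map_sub, ContinuousLinearMap.sub_apply]; abel
  rw [h]
  have h1 := norm_beta_le hα (retract R x - retract R y) (retract R x)
  have h2 := norm_beta_le hα (retract R y) (retract R x - retract R y)
  have hx := norm_retract_le hR x
  have hy := norm_retract_le hR y
  have hs := norm_retract_sub_le hR x y
  have h3 : betaBound α * ‖retract R x - retract R y‖ * ‖retract R x‖ ≤
      betaBound α * (2 * ‖x - y‖) * R := by gcongr
  have h4 : betaBound α * ‖retract R y‖ * ‖retract R x - retract R y‖ ≤
      betaBound α * R * (2 * ‖x - y‖) := by gcongr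
  refine (norm_add_le _ _).trans ((add_le_add (h1.trans h3) (h2.trans h4)).trans (le_of_eq ?_))
  ring

lemma continuous_nonlin {α : ℝ} (hα : 1 / 2 ≤ α) {R : ℝ} (hR : 0 < R) : Continuous (nonlin hα R) := by
  have hb := betaBound_nonneg α
  have : LipschitzWith ⟨4 * betaBound α * R, by positivity⟩ (nonlin hα R) :=
    LipschitzWith.of_dist_le_mul fun x y => by
      rw [dist_eq_norm, dist_eq_norm]; exact norm_nonlin_sub_le hα hR x y
  exact this.continuous

lemma Adm.smul {a : Z3 → C3} (ha : Adm a) (r : ℝ) : Adm (r • a) := by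
  refine ⟨by simp [ha.zero], fun k => ?_, fun k => ?_⟩
  · rw [Pi.smul_apply, dotZ_smul_real, ha.div, mul_zero]
  · rw [Pi.smul_apply, Pi.smul_apply, ha.conj, conj3_smul_real]

lemma Adm.add {a b : Z3 → C3} (ha : Adm a) (hb : Adm b) : Adm (a + b) := by
  refine ⟨by simp [ha.zero, hb.zero], fun k => ?_, fun k => ?_⟩
  · rw [Pi.add_apply, dotZ_add, ha.div, hb.div, add_zero]
  · rw [Pi.add_apply, Pi.add_apply, ha.conj, hb.conj, conj3_add]

lemma Adm.sub {a b : Z3 → C3} (ha : Adm a) (hb : Adm b) : Adm (a - b) := by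
  rw [sub_eq_add_neg, ← neg_one_smul ℝ b]; exact ha.add (hb.smul _)

lemma Adm.mul {a : Z3 → C3} (ha : Adm a) {w : Z3 → ℝ} (hw : ∀ k, w (-k) = w k) :
    Adm (fun k => w k • a k) := by
  refine ⟨by simp [ha.zero], fun k => ?_, fun k => ?_⟩
  · rw [dotZ_smul_real, ha.div, mul_zero]
  · rw [hw, ha.conj, conj3_smul_real]

lemma adm_zero : Adm (0 : Z3 → C3) := by
  refine ⟨rfl, fun k => dotZ_zero k, fun k => ?_⟩
  ext i; simp

lemma isClosed_adm : IsClosed {a : ell | Adm a} := by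
  have : {a : ell | Adm a} = {a : ell | a 0 = 0} ∩ ((⋂ k, {a : ell | dotZ k (a k) = 0}) ∩
      ⋂ k, {a : ell | a (-k) = conj3 (a k)}) := by
    ext a
    simp only [mem_setOf_eq, mem_inter_iff, mem_iInter]
    exact ⟨fun h => ⟨h.zero, h.div, h.conj⟩, fun h => ⟨h.1, h.2.1, h.2.2⟩⟩
  rw [this]
  refine (isClosed_eq (continuous_ell_apply 0) continuous_const).inter
    (IsClosed.inter (isClosed_iInter fun k => ?_) (isClosed_iInter fun k => ?_))
  · exact isClosed_eq ((continuous_dotZ k).comp (continuous_ell_apply k)) continuous_const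
  · exact isClosed_eq (continuous_ell_apply _) (continuous_conj3.comp (continuous_ell_apply k))

lemma adm_nonlin {α : ℝ} (hα : 1 / 2 ≤ α) (R : ℝ) {x : ell} (hx : Adm x) : Adm (nonlin hα R x) :=
  adm_betaSeq α (hx.smul _) (hx.smul _)

lemma dotZ_integral (k : Z3) (f : ℝ → C3) (hf : ∀ s, dotZ k (f s) = 0) (t : ℝ)
    (hi : IntervalIntegrable f volume 0 t) : dotZ k (∫ s in (0 : ℝ)..t, f s) = 0 := by
  let L : C3 →L[ℝ] ℂ :=
    { toFun := dotZ k
      map_add' := dotZ_add k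
      map_smul' := fun r a => by simpa using dotZ_smul_real k r a
      cont := continuous_dotZ k }
  have h := L.intervalIntegral_comp_comm hi
  change _ = dotZ k _ at h
  rw [← h]
  have : ∀ s, L (f s) = 0 := hf
  simp [this]

lemma conj3_integral (f : ℝ → C3) (t : ℝ) :
    conj3 (∫ s in (0 : ℝ)..t, f s) = ∫ s in (0 : ℝ)..t, conj3 (f s) := by
  let e : C3 ≃L[ℝ] C3 :=
    { toFun := conj3, invFun := conj3, left_inv := conj3_conj3, right_inv := conj3_conj3
      map_add' := conj3_add, map_smul' := conj3_smul_real
      continuous_toFun := continuous_conj3, continuous_invFun := continuous_conj3 }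
  have h : ∀ s : Set ℝ, e (∫ x in s, f x) = ∫ x in s, e (f x) := fun s =>
    (e.integral_comp_comm f).symm
  change e _ = ∫ s in (0 : ℝ)..t, e (f s)
  rw [intervalIntegral, intervalIntegral, map_sub, h, h]

lemma Growth.adm_duh {ψ : ℝ → ell} {Q γ t : ℝ} (h : Growth ψ Q γ) (ha : ∀ s, Adm (ψ s))
    (ht : 0 ≤ t) : Adm (duh (fun s => ψ s) t) := by
  refine ⟨duh_zero_right _ _, fun k => ?_, fun k => ?_⟩
  · rw [duh, dotZ_smul_real, dotZ_integral, mul_zero]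
    · intro s; rw [dotZ_smul_real, (ha s).div, mul_zero]
    · exact (h.intervalIntegrable k ht).continuousOn_smul (by fun_prop)
  · rw [duh, duh, conj3_smul_real, conj3_integral, wt_neg, waveLength_neg]
    congr 2; funext s
    rw [(ha s).conj, conj3_smul_real]

/-! ### The fixed point -/

open scoped BoundedContinuousFunction NNReal

/-- The function of time represented by a weighted bounded continuous function. -/
def unweight (γ : ℝ) (b : ℝ≥0 →ᵇ ell) (t : ℝ) : ell :=
  Real.exp (γ * max t 0) • b (Real.toNNReal t)

lemma continuous_unweight (γ : ℝ) (b : ℝ≥0 →ᵇ ell) : Continuous (unweight γ b) := by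
  have h1 : Continuous fun t : ℝ => b (Real.toNNReal t) := b.continuous.comp continuous_real_toNNReal
  have h2 : Continuous fun t : ℝ => Real.exp (γ * max t 0) := by fun_prop
  exact h2.smul h1

lemma norm_unweight_sub_le (γ : ℝ) (b b' : ℝ≥0 →ᵇ ell) {t : ℝ} (ht : 0 ≤ t) :
    ‖unweight γ b t - unweight γ b' t‖ ≤ dist b b' * Real.exp (γ * t) := by
  rw [unweight, unweight, ← smul_sub, norm_smul, Real.norm_of_nonneg (Real.exp_nonneg _),
    max_eq_left ht, mul_comm, ← dist_eq_norm]
  exact mul_le_mul_of_nonneg_right (BoundedContinuousFunction.dist_coe_le_dist _) (Real.exp_nonneg _)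

/-- The truncated nonlinearity is bounded, so the growth constant is independent of the curve `a`.
-/
lemma Growth.sub_nonlin {α : ℝ} (hα : 1 / 2 ≤ α) {R : ℝ} (hR : 0 < R) {F : ℝ → ell} {M γ : ℝ}
    (hF : Growth F M 0) (hγ : 0 < γ) {a : ℝ → ell} (ha : ContinuousOn a (Ici 0)) :
    Growth (fun s => F s - nonlin hα R (a s)) (M + betaBound α * R ^ 2) γ := by
  refine ⟨fun T k => (hF.meas T k).sub ?_, fun s hs => ?_⟩
  · have h1 : ContinuousOn (fun s => nonlin hα R (a s) k) (Ici 0) :=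
      ((continuous_ell_apply k).comp (continuous_nonlin hα hR)).comp_continuousOn ha
    exact (h1.mono Icc_subset_Ici_self).aestronglyMeasurable measurableSet_Icc
  · have h0 := hF.nonneg
    have hb := betaBound_nonneg α
    have h1 : ‖F s‖ ≤ M := by simpa using hF.bound s hs
    refine (norm_sub_le _ _).trans ((add_le_add h1 (norm_nonlin_le hα hR _)).trans ?_)
    exact le_mul_of_one_le_right (by positivity) (Real.one_le_exp (by positivity))

/-- `a` solves the mild form of the truncated equation on the modes in `J`. -/
structure IsMild {α : ℝ} (hα : 1 / 2 ≤ α) (R : ℝ) (F : ℝ → ell) (a₀ : ell) (J : Set Z3)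
    (a : ℝ → ell) : Prop where
  continuous : Continuous a
  adm : ∀ t, Adm (a t)
  eq_zero : ∀ t, ∀ k ∉ J, a t k = 0
  eq : ∀ t, 0 ≤ t → ∀ k ∈ J, a t k = Real.exp (-(waveLength k ^ 2 * t)) • a₀ k +
    duh (fun s => (F s - nonlin hα R (a s) : ell)) t k

section FixedPoint

variable {α : ℝ} (hα : 1 / 2 ≤ α) {R M γ : ℝ} (hR : 0 < R) (hγ : 0 < γ) {F : ℝ → ell}
  (hF : Growth F M 0) (a₀ : ell)

/-- The mild right-hand side for the history `b`. -/
def mildRhs (R γ : ℝ) (F : ℝ → ell) (b : ℝ≥0 →ᵇ ell) (t : ℝ) : ell :=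
  heat t a₀ + toEll (duh (fun s => (F s - nonlin hα R (unweight γ b s) : ell)) t)

include hR hγ hF in
lemma norm_mildRhs_le (b : ℝ≥0 →ᵇ ell) {t : ℝ} (ht : 0 ≤ t) :
    ‖mildRhs hα a₀ R γ F b t‖ ≤
      (‖a₀‖ + (M + betaBound α * R ^ 2) * Real.sqrt (duhConst γ)) * Real.exp (γ * t) := by
  have hG := hF.sub_nonlin hα hR hγ (continuous_unweight γ b).continuousOn
  have h1 := hG.norm_duh_le hγ ht
  have h2 : ‖a₀‖ ≤ ‖a₀‖ * Real.exp (γ * t) :=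
    le_mul_of_one_le_right (norm_nonneg _) (Real.one_le_exp (by positivity))
  refine (norm_add_le _ _).trans ((add_le_add ((norm_heat_le t a₀).trans h2) h1).trans (le_of_eq ?_))
  ring

include hR hγ hF in
lemma continuous_mildRhs (b : ℝ≥0 →ᵇ ell) :
    Continuous fun t : ℝ≥0 => mildRhs hα a₀ R γ F b t := by
  have hG := hF.sub_nonlin hα hR hγ (continuous_unweight γ b).continuousOn
  have h1 := hG.continuous_duh hγ
  have h2 : Continuous fun t : ℝ≥0 =>
      toEll (duh (fun s => (F s - nonlin hα R (unweight γ b s) : ell)) t) :=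
    h1.comp_continuous NNReal.continuous_coe fun t => t.coe_nonneg
  exact ((continuous_heat a₀).comp NNReal.continuous_coe).add h2

lemma norm_weight_cut_le (J : Set Z3) {t C : ℝ} {x : ell} (h : ‖x‖ ≤ C * Real.exp (γ * t)) :
    ‖Real.exp (-(γ * t)) • cut J x‖ ≤ C := by
  rw [norm_smul, Real.norm_of_nonneg (Real.exp_nonneg _), Real.exp_neg, inv_mul_le_iff₀ (Real.exp_pos _),
    mul_comm]
  exact (norm_cut_le J x).trans h

/-- The fixed point map. -/
def mildMap (J : Set Z3) (b : ℝ≥0 →ᵇ ell) : ℝ≥0 →ᵇ ell :=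
  BoundedContinuousFunction.ofNormedAddCommGroup
    (fun t => Real.exp (-(γ * t)) • cut J (mildRhs hα a₀ R γ F b t))
    ((by fun_prop : Continuous fun t : ℝ≥0 => Real.exp (-(γ * t))).smul
      ((cut J).continuous.comp (continuous_mildRhs hα hR hγ hF a₀ b)))
    (‖a₀‖ + (M + betaBound α * R ^ 2) * Real.sqrt (duhConst γ))
    (fun t => norm_weight_cut_le J (norm_mildRhs_le hα hR hγ hF a₀ b t.coe_nonneg))

lemma mildMap_apply (J : Set Z3) (b : ℝ≥0 →ᵇ ell) (t : ℝ≥0) : mildMap hα hR hγ hF a₀ J b t =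
    Real.exp (-(γ * t)) • cut J (mildRhs hα a₀ R γ F b t) := rfl

include hR hγ hF in
lemma norm_mildRhs_sub_le (b b' : ℝ≥0 →ᵇ ell) {t : ℝ} (ht : 0 ≤ t) :
    ‖mildRhs hα a₀ R γ F b t - mildRhs hα a₀ R γ F b' t‖ ≤
      4 * betaBound α * R * Real.sqrt (duhConst γ) * dist b b' * Real.exp (γ * t) := by
  have hG := hF.sub_nonlin hα hR hγ (continuous_unweight γ b).continuousOn
  have hG' := hF.sub_nonlin hα hR hγ (continuous_unweight γ b').continuousOn
  have hb := betaBound_nonneg α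
  have hD : ∀ s, 0 ≤ s → ‖(F s - nonlin hα R (unweight γ b s)) - (F s - nonlin hα R (unweight γ b' s))‖
      ≤ (4 * betaBound α * R * dist b b') * Real.exp (γ * s) := by
    intro s hs
    rw [sub_sub_sub_cancel_left, norm_sub_rev, mul_assoc _ (dist b b')]
    exact (norm_nonlin_sub_le hα hR _ _).trans
      (mul_le_mul_of_nonneg_left (norm_unweight_sub_le γ b b' hs) (by positivity))
  have h1 := (hG.sub hG' hD).norm_duh_le hγ ht
  rw [hG.duh_sub hG' ht, ← toEll_sub (hG.tame hγ ht).summable (hG'.tame hγ ht).summable] at h1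
  rw [mildRhs, mildRhs, add_sub_add_left_eq_sub]
  refine h1.trans (le_of_eq ?_)
  ring

lemma dist_mildMap_le (J : Set Z3) (b b' : ℝ≥0 →ᵇ ell) :
    dist (mildMap hα hR hγ hF a₀ J b) (mildMap hα hR hγ hF a₀ J b') ≤
      4 * betaBound α * R * Real.sqrt (duhConst γ) * dist b b' := by
  have hb := betaBound_nonneg α
  refine (BoundedContinuousFunction.dist_le (by positivity)).2 fun t => ?_
  rw [mildMap_apply, mildMap_apply, dist_eq_norm, ← smul_sub, ← map_sub]
  exact norm_weight_cut_le J (norm_mildRhs_sub_le hα hR hγ hF a₀ b b' t.coe_nonneg)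

/-- One γ serves every set `J` of modes, so the full equation and all Galerkin equations are fixed
point problems in the same space with the same constant, and their fixed points can be compared. -/
lemma contracting_mildMap (h : 4 * betaBound α * R * Real.sqrt (duhConst γ) ≤ 1 / 2) (J : Set Z3) :
    ContractingWith (1 / 2) (mildMap hα hR hγ hF a₀ J) := by
  refine ⟨by rw [← NNReal.coe_lt_coe]; norm_num, LipschitzWith.of_dist_le_mul fun b b' => ?_⟩
  refine (dist_mildMap_le hα hR hγ hF a₀ J b b').trans ?_
  push_cast
  exact mul_le_mul_of_nonneg_right h dist_nonneg

lemma adm_cut {J : Set Z3} (hJ : ∀ k, -k ∈ J ↔ k ∈ J) {a : ell} (ha : Adm a) : Adm (cut J a) := by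
  classical
  have : (cut J a : Z3 → C3) = fun k => (if k ∈ J then (1 : ℝ) else 0) • a k := by
    funext k; rw [cut_apply]; split_ifs <;> simp
  rw [this]
  exact ha.mul fun k => by simp only [hJ]

lemma adm_heat {a : ell} (ha : Adm a) (t : ℝ) : Adm (heat t a) :=
  ha.mul fun k => by rw [waveLength_neg]

lemma adm_mildMap {J : Set Z3} (hJ : ∀ k, -k ∈ J ↔ k ∈ J) (hFa : ∀ s, Adm (F s)) (ha₀ : Adm a₀)
    {b : ℝ≥0 →ᵇ ell} (hb : ∀ t, Adm (b t)) (t : ℝ≥0) : Adm (mildMap hα hR hγ hF a₀ J b t) := by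
  rw [mildMap_apply]
  refine Adm.smul (adm_cut hJ ?_) _
  have hG := hF.sub_nonlin hα hR hγ (continuous_unweight γ b).continuousOn
  refine (adm_heat ha₀ _).add ?_
  have h1 := hG.adm_duh (fun s => (hFa s).sub (adm_nonlin hα R ((hb _).smul _))) t.coe_nonneg
  rw [← coe_toEll (hG.tame hγ t.coe_nonneg).summable] at h1
  exact h1

lemma isMild_of_isFixedPt {J : Set Z3} {b : ℝ≥0 →ᵇ ell} (hb : ∀ t, Adm (b t))
    (hfix : mildMap hα hR hγ hF a₀ J b = b) : IsMild hα R F a₀ J (unweight γ b) := by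
  have hG := hF.sub_nonlin hα hR hγ (continuous_unweight γ b).continuousOn
  have h1 : ∀ t, unweight γ b t = cut J (mildRhs hα a₀ R γ F b (max t 0)) := by
    intro t
    rw [unweight]
    conv_lhs => rw [← hfix]
    rw [mildMap_apply, Real.coe_toNNReal', smul_smul, ← Real.exp_add]
    simp
  refine ⟨continuous_unweight γ b, fun t => (hb _).smul _, fun t k hk => ?_, fun t ht k hk => ?_⟩
  · rw [h1, cut_apply, if_neg hk]
  · conv_lhs => rw [h1, cut_apply, if_pos hk, max_eq_left ht]
    change heat t a₀ k + toEll _ k = _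
    rw [heat_apply ht, toEll_apply (hG.tame hγ ht).summable]

lemma exists_fixed (h : 4 * betaBound α * R * Real.sqrt (duhConst γ) ≤ 1 / 2) {J : Set Z3}
    (hJ : ∀ k, -k ∈ J ↔ k ∈ J) (hFa : ∀ s, Adm (F s)) (ha₀ : Adm a₀) :
    ∃ b : ℝ≥0 →ᵇ ell, (∀ t, Adm (b t)) ∧ mildMap hα hR hγ hF a₀ J b = b := by
  have hc := contracting_mildMap hα hR hγ hF a₀ h J
  refine ⟨hc.fixedPoint, ?_, hc.fixedPoint_isFixedPt⟩
  have hcl : IsClosed {b : ℝ≥0 →ᵇ ell | ∀ t, Adm (b t)} := by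
    have : {b : ℝ≥0 →ᵇ ell | ∀ t, Adm (b t)} = ⋂ t : ℝ≥0, {b | b t ∈ {a : ell | Adm a}} := by
      ext b; simp
    rw [this]
    exact isClosed_iInter fun t => isClosed_adm.preimage ((BoundedContinuousFunction.lipschitz_eval_const t).continuous)
  -- The map preserves the closed set of admissible curves, which contains the starting point 0 of
  -- the iteration.
  refine hcl.mem_of_tendsto (hc.tendsto_iterate_fixedPoint 0) (Eventually.of_forall fun n => ?_)
  induction n with
  | zero => exact fun t => adm_zero
  | succ n ih =>
    rw [Function.iterate_succ_apply']
    exact fun t => adm_mildMap hα hR hγ hF a₀ hJ hFa ha₀ ih t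

/-! ### Galerkin cut-offs and their convergence -/

/-- The wave vectors of length at most `n`. -/
def waveBall (n : ℕ) : Set Z3 := {k | waveLength k ≤ n}

lemma waveBall_neg (n : ℕ) (k : Z3) : -k ∈ waveBall n ↔ k ∈ waveBall n := by
  simp [waveBall, waveLength_neg]

lemma finite_waveBall (n : ℕ) : (waveBall n).Finite := by
  have h1 : {k | ¬ wt (-1) k < ((n : ℝ) + 1)⁻¹}.Finite :=
    (tendsto_wt_cofinite (s := -1) (by norm_num)).eventually (gt_mem_nhds (by positivity))
  refine (h1.union (finite_singleton (0 : Z3))).subset fun k hk => ?_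
  by_cases h0 : k = 0
  · exact Or.inr h0
  · left
    have hk' : waveLength k ≤ n := hk
    simp only [mem_setOf_eq, not_lt]
    rw [wt_of_ne _ h0, Real.rpow_neg_one]
    exact inv_anti₀ (waveLength_pos h0) (by linarith)

/-- The extra weight |k|^{1/4} turns the tail beyond n into a rate depending on `d` only through
`C`. -/
lemma Tame.norm_sub_cut_le {C : ℝ} {d : ell} (h : Tame C d) {n : ℕ} (hn : 1 ≤ n) :
    ‖d - cut (waveBall n) d‖ ≤ Real.sqrt ((n : ℝ) ^ (-(1 / 4) : ℝ) * C) := by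
  have hC := h.nonneg
  have hn0 : (0 : ℝ) < n := by exact_mod_cast hn
  refine ell_norm_le (Real.sqrt_nonneg _) fun s => ?_
  rw [Real.sq_sqrt (by positivity)]
  calc ∑ k ∈ s, ‖(d - cut (waveBall n) d : ell) k‖ ^ 2
      ≤ ∑ k ∈ s, (n : ℝ) ^ (-(1 / 4) : ℝ) * (wt (1 / 4) k * ‖d k‖ ^ 2) := by
        refine Finset.sum_le_sum fun k _ => ?_
        change ‖d k - cut (waveBall n) d k‖ ^ 2 ≤ _
        have hpos : 0 ≤ (n : ℝ) ^ (-(1 / 4) : ℝ) * (wt (1 / 4) k * ‖d k‖ ^ 2) := by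
          have := wt_nonneg (1 / 4) k
          positivity
        rw [cut_apply]; split_ifs with hk
        · simpa using hpos
        · rw [sub_zero]
          by_cases h0 : k = 0
          · subst h0; simp [h.1]
          · have hk' : (n : ℝ) ≤ waveLength k := (not_le.1 hk).le
            have h1 : wt (-(1 / 4)) k * wt (1 / 4) k = 1 := by
              rw [wt_mul]; simpa using wt_zero_left h0
            have h2 : wt (-(1 / 4)) k ≤ (n : ℝ) ^ (-(1 / 4) : ℝ) := by
              rw [wt_of_ne _ h0]
              exact Real.rpow_le_rpow_of_nonpos hn0 hk' (by norm_num)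
            calc ‖d k‖ ^ 2 = wt (-(1 / 4)) k * (wt (1 / 4) k * ‖d k‖ ^ 2) := by
                  rw [← mul_assoc, h1, one_mul]
              _ ≤ _ := mul_le_mul_of_nonneg_right h2 (mul_nonneg (wt_nonneg _ _) (sq_nonneg _))
    _ ≤ _ := by
        rw [← Finset.mul_sum]
        exact mul_le_mul_of_nonneg_left (h.2 s) (by positivity)

lemma tendsto_cut (a : ell) : Tendsto (fun n => cut (waveBall n) a) atTop (𝓝 a) := by
  refine tendsto_ell_of_dominated (ell_summable a) (Eventually.of_forall fun n k => ?_) fun k => ?_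
  · rw [cut_apply]; split_ifs
    · simp
    · simp
  · refine tendsto_const_nhds.congr' ?_
    obtain ⟨N, hN⟩ := exists_nat_ge (waveLength k)
    filter_upwards [eventually_ge_atTop N] with n hn
    rw [cut_apply, if_pos]
    have : (N : ℝ) ≤ n := by exact_mod_cast hn
    exact hN.trans this

/-- The bound does not involve `b`: the initial part is cut directly and the Duhamel part has a
uniform `Tame` constant because the nonlinearity is truncated. Uniformly close contractions have
close fixed points. -/
lemma dist_mildMap_cut_le {n : ℕ} (hn : 1 ≤ n) (b : ℝ≥0 →ᵇ ell) :
    dist (mildMap hα hR hγ hF a₀ univ b) (mildMap hα hR hγ hF a₀ (waveBall n) b) ≤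
      ‖a₀ - cut (waveBall n) a₀‖ + Real.sqrt ((n : ℝ) ^ (-(1 / 4) : ℝ) *
        ((M + betaBound α * R ^ 2) ^ 2 * duhConst γ)) := by
  have hb := betaBound_nonneg α
  have hG := hF.sub_nonlin hα hR hγ (continuous_unweight γ b).continuousOn
  refine (BoundedContinuousFunction.dist_le (by positivity)).2 fun t => ?_
  have hQ := hG.nonneg
  have ht := hG.tame hγ t.coe_nonneg
  have he : 1 ≤ Real.exp (γ * t) := Real.one_le_exp (by positivity)
  rw [mildMap_apply, mildMap_apply, dist_eq_norm, ← smul_sub, norm_smul,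
    Real.norm_of_nonneg (Real.exp_nonneg _), Real.exp_neg, inv_mul_le_iff₀ (Real.exp_pos _), cut_univ]
  have h1 : mildRhs hα a₀ R γ F b t - cut (waveBall n) (mildRhs hα a₀ R γ F b t) =
      heat t (a₀ - cut (waveBall n) a₀) +
      (toEll (duh (fun s => (F s - nonlin hα R (unweight γ b s) : ell)) t) - cut (waveBall n)
        (toEll (duh (fun s => (F s - nonlin hα R (unweight γ b s) : ell)) t))) := by
    have hcomm : heat t (cut (waveBall n) a₀) = cut (waveBall n) (heat t a₀) := by
      ext1; funext k
      rw [heat_apply t.coe_nonneg, cut_apply, cut_apply, heat_apply t.coe_nonneg]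
      split_ifs <;> simp
    rw [mildRhs, map_add, map_sub, hcomm]; abel
  rw [h1]
  have ht' : Tame ((M + betaBound α * R ^ 2) ^ 2 * duhConst γ * Real.exp (γ * t) ^ 2)
      (toEll (duh (fun s => (F s - nonlin hα R (unweight γ b s) : ell)) t) : ell) := by
    rw [coe_toEll ht.summable]
    exact ht.mono (by rw [mul_pow]; linarith [le_refl (0 : ℝ)])
  have h2 := ht'.norm_sub_cut_le hn
  rw [← mul_assoc, Real.sqrt_mul' _ (sq_nonneg _), Real.sqrt_sq (Real.exp_nonneg _)] at h2
  refine (norm_add_le _ _).trans ?_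
  rw [mul_add, mul_comm _ (Real.sqrt _)]
  refine add_le_add ((norm_heat_le _ _).trans ?_) h2
  exact le_mul_of_one_le_left (norm_nonneg _) he

end FixedPoint

lemma exists_isMild {α : ℝ} (hα : 1 / 2 ≤ α) {R M : ℝ} (hR : 0 < R) {F : ℝ → ell}
    (hF : Growth F M 0) (hFa : ∀ s, Adm (F s)) {a₀ : ell} (ha₀ : Adm a₀) :
    ∃ (a : ℝ → ell) (A : ℕ → ℝ → ell), IsMild hα R F a₀ univ a ∧
      (∀ n, IsMild hα R F a₀ (waveBall n) (A n)) ∧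
      ∀ t, Tendsto (fun n => A n t) atTop (𝓝 (a t)) := by
  obtain ⟨γ, hγ, hγ2⟩ : ∃ γ : ℝ, 0 < γ ∧ 4 * betaBound α * R * Real.sqrt (duhConst γ) ≤ 1 / 2 := by
    have h1 := (tendsto_duhConst.sqrt).const_mul (4 * betaBound α * R)
    rw [Real.sqrt_zero, mul_zero] at h1
    obtain ⟨γ, h2, h3⟩ := ((h1.eventually (gt_mem_nhds (show (0 : ℝ) < 1 / 2 by norm_num))).and
      (eventually_gt_atTop 0)).exists
    exact ⟨γ, h3, h2.le⟩
  obtain ⟨b, hb, hfix⟩ := exists_fixed hα hR hγ hF a₀ hγ2 (J := univ) (by simp) hFa ha₀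
  choose B hB hBfix using fun n => exists_fixed hα hR hγ hF a₀ hγ2 (waveBall_neg n) hFa ha₀
  refine ⟨unweight γ b, fun n => unweight γ (B n), isMild_of_isFixedPt hα hR hγ hF a₀ hb hfix,
    fun n => isMild_of_isFixedPt hα hR hγ hF a₀ (hB n) (hBfix n), fun t => ?_⟩
  have hconv : Tendsto B atTop (𝓝 b) := by
    rw [tendsto_iff_dist_tendsto_zero]
    have h1 : Tendsto (fun n : ℕ => (‖a₀ - cut (waveBall n) a₀‖ + Real.sqrt ((n : ℝ) ^ (-(1 / 4) : ℝ) *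
        ((M + betaBound α * R ^ 2) ^ 2 * duhConst γ))) / (1 - (1 / 2 : ℝ≥0))) atTop (𝓝 0) := by
      have e1 : Tendsto (fun n => ‖a₀ - cut (waveBall n) a₀‖) atTop (𝓝 0) := by
        have := ((tendsto_cut a₀).const_sub a₀).norm
        simpa using this
      have e2 : Tendsto (fun n : ℕ => (n : ℝ) ^ (-(1 / 4) : ℝ)) atTop (𝓝 0) :=
        (tendsto_rpow_neg_atTop (by norm_num)).comp tendsto_natCast_atTop_atTop
      have e3 := (e1.add (e2.mul_const ((M + betaBound α * R ^ 2) ^ 2 * duhConst γ)).sqrt).div_const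
        (1 - ((1 / 2 : ℝ≥0) : ℝ))
      simpa using e3
    refine squeeze_zero' (Eventually.of_forall fun _ => dist_nonneg) ?_ h1
    filter_upwards [eventually_ge_atTop 1] with n hn
    rw [dist_comm]
    exact (contracting_mildMap hα hR hγ hF a₀ hγ2 univ).dist_fixedPoint_fixedPoint_of_dist_le'
      _ hfix (hBfix n) fun z => dist_mildMap_cut_le hα hR hγ hF a₀ hn z
  have h2 : Tendsto (fun n => (B n) (Real.toNNReal t)) atTop (𝓝 (b (Real.toNNReal t))) :=
    ((BoundedContinuousFunction.lipschitz_eval_const (Real.toNNReal t)).continuous.tendsto b).comp hconv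
  exact h2.const_smul _

/-! ### The equation for the Fourier coefficients -/

/-- The factor by which `retract` multiplies. -/
def retractFactor (R : ℝ) (x : ell) : ℝ := R / max R ‖x‖

/-- By bilinearity the truncation merely multiplies the true nonlinearity by the square of a scalar
in [0, 1]. Hence energy estimates for B apply to the truncated equation unchanged. -/
lemma scale_nonlin {α : ℝ} (hα : 1 / 2 ≤ α) (R : ℝ) (x : ell) (k : Z3) :
    wt (7 / 4 - 2 * α) k • nonlin hα R x k =
      retractFactor R x ^ 2 • convB (scale (-2 * α) x) (scale (-2 * α) x) k := by
  have h0 : ∀ c d : Z3 → C3, convB c d 0 = 0 := fun c d => if_pos rfl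
  have h1 : (nonlin hα R x : Z3 → C3) =
      betaSeq α (retractFactor R x • (x : Z3 → C3)) (retractFactor R x • (x : Z3 → C3)) := rfl
  rw [h1, betaSeq, scale_smul, convB_smul_left, convB_smul_right, smul_smul, ← sq]
  change scale _ (scale _ _) k = _
  rw [scale_scale, show 7 / 4 - 2 * α + (2 * α - 7 / 4) = 0 by ring, scale_zero_left]
  · rfl
  · simp [h0]

/-- Multiplying by |k|^{-2α} undoes the rescaling. Each coordinate, tested with a fixed vector,
satisfies a scalar Duhamel formula with rate |k|², so `IsPrim.of_mild` applies. -/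
lemma IsMild.isPrim {α : ℝ} {hα : 1 / 2 ≤ α} {R M : ℝ} (hR : 0 < R) {F : ℝ → ell}
    (hF : Growth F M 0) {a₀ : ell} {J : Set Z3} {a : ℝ → ell} (h : IsMild hα R F a₀ J a) {k : Z3}
    (hk : k ∈ J) (b : C3) {T : ℝ} (hT : 0 ≤ T) :
    IsPrim (fun t => inner ℝ b (scale (-2 * α) (a t) k))
      (fun t => inner ℝ b (scale (7 / 4 - 2 * α) (F t) k - retractFactor R (a t) ^ 2 •
        convB (scale (-2 * α) (a t)) (scale (-2 * α) (a t)) k) -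
        waveLength k ^ 2 * inner ℝ b (scale (-2 * α) (a t) k)) 0 T := by
  have hG := hF.sub_nonlin hα hR one_pos h.continuous.continuousOn
  have hrw : ∀ t, scale (7 / 4 - 2 * α) (F t) k - retractFactor R (a t) ^ 2 •
      convB (scale (-2 * α) (a t)) (scale (-2 * α) (a t)) k =
      wt (7 / 4 - 2 * α) k • (F t - nonlin hα R (a t) : ell) k := by
    intro t
    rw [← scale_nonlin hα, scale, ← smul_sub]; rfl
  simp only [hrw]
  have hi := hG.intervalIntegrable k hT
  let L : C3 →L[ℝ] ℝ := wt (7 / 4 - 2 * α) k • innerSL ℝ b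
  have hL : ∀ x, L x = inner ℝ b (wt (7 / 4 - 2 * α) k • x) := fun x => by
    rw [real_inner_smul_right]; rfl
  refine IsPrim.of_mild hT ?_ fun t ht => ?_
  · simp only [← hL]
    rw [intervalIntegrable_iff] at hi ⊢
    exact L.integrable_comp hi
  · have h0 : a 0 k = a₀ k := by
      rw [h.eq 0 le_rfl k hk, duh]; simp
    have hi' : IntervalIntegrable (fun s => Real.exp (-(waveLength k ^ 2 * (t - s))) •
        (F s - nonlin hα R (a s) : ell) k) volume 0 t :=
      (hG.intervalIntegrable k ht.1).continuousOn_smul (by fun_prop)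
    have hint := L.intervalIntegral_comp_comm hi'
    have hexp : ∀ s, L (Real.exp (-(waveLength k ^ 2 * (t - s))) • (F s - nonlin hα R (a s) : ell) k)
        = Real.exp (-(waveLength k ^ 2 * (t - s))) *
          inner ℝ b (wt (7 / 4 - 2 * α) k • (F s - nonlin hα R (a s) : ell) k) := by
      intro s; rw [map_smul, hL]; rfl
    simp only [hexp] at hint
    have hw : ∀ x : C3, wt (-2 * α) k • wt (7 / 4) k • x = wt (7 / 4 - 2 * α) k • x := fun x => by
      rw [smul_smul, wt_mul]; congr 2; ring
    rw [hint, hL, scale, scale, h0, h.eq t ht.1 k hk, smul_add, inner_add_right, duh, hw,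
      smul_comm (wt (-2 * α) k), real_inner_smul_right _ _ (Real.exp _)]

/-- Expand in a real orthonormal basis and apply the scalar product rule to each component. -/
lemma isPrim_norm_sq {x z : ℝ → C3} {a b : ℝ} (hab : a ≤ b)
    (h : ∀ e, IsPrim (fun t => inner ℝ e (x t)) (fun t => inner ℝ e (z t)) a b) :
    IsPrim (fun t => ‖x t‖ ^ 2) (fun t => 2 * inner ℝ (x t) (z t)) a b := by
  let B := stdOrthonormalBasis ℝ C3
  have h1 : IsPrim (fun t => ∑ i, inner ℝ (B i) (x t) * inner ℝ (B i) (x t))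
      (fun t => ∑ i, (inner ℝ (B i) (z t) * inner ℝ (B i) (x t) +
        inner ℝ (B i) (x t) * inner ℝ (B i) (z t))) a b :=
    IsPrim.sum hab fun i _ => (h (B i)).mul hab (h (B i))
  refine h1.congr (fun t _ => ?_) (fun t _ => ?_) hab
  · rw [← real_inner_self_eq_norm_sq, ← B.sum_inner_mul_inner]
    exact Finset.sum_congr rfl fun i _ => by rw [real_inner_comm]
  · rw [← B.sum_inner_mul_inner, Finset.mul_sum]
    exact Finset.sum_congr rfl fun i _ => by rw [real_inner_comm (x t)]; ring

/-! ### Weighted energy inequality for finitely many modes -/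

/-- The square of the Gevrey norm restricted to the modes in `J`. -/
def ysum (α σ : ℝ) (J : Finset Z3) (c : Z3 → C3) : ℝ :=
  (2 * Real.pi) ^ 3 * ∑ k ∈ J, (gwt α σ k * ‖c k‖) ^ 2

lemma ysum_nonneg (α σ : ℝ) (J : Finset Z3) (c : Z3 → C3) : 0 ≤ ysum α σ J c :=
  mul_nonneg two_pi_cube_pos.le (Finset.sum_nonneg fun _ _ => sq_nonneg _)

lemma gwt_sq_add_half (α σ : ℝ) (k : Z3) :
    gwt (α + 1 / 2) σ k ^ 2 = waveLength k ^ 2 * gwt α σ k ^ 2 := by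
  rw [gwt, gwt, mul_pow, mul_pow, ← mul_assoc, ← wt_two, wt_sq, wt_sq, wt_mul]
  congr 2; ring

lemma gwt_sq_sub_half (α σ : ℝ) {k : Z3} (hk : k ≠ 0) :
    gwt α σ k ^ 2 = waveLength k ^ 2 * gwt (α - 1 / 2) σ k ^ 2 := by
  rw [← gwt_sq_add_half, sub_add_cancel]

lemma hasDerivAt_weight (α μ σ η a : ℝ) (k : Z3) (t : ℝ) :
    HasDerivAt (fun t => Real.exp (2 * μ * t) * gwt α (σ + η * (t - a)) k ^ 2)
      ((2 * μ + 2 * η * waveLength k) * (Real.exp (2 * μ * t) * gwt α (σ + η * (t - a)) k ^ 2)) t := by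
  have h1 : ∀ t, Real.exp (2 * μ * t) * gwt α (σ + η * (t - a)) k ^ 2 =
      wt (2 * α) k ^ 2 * Real.exp (2 * μ * t + 2 * ((σ + η * (t - a)) * waveLength k)) := by
    intro t
    rw [gwt, mul_pow, ← Real.exp_nat_mul, Real.exp_add]
    push_cast; ring
  simp only [h1]
  have h2 : HasDerivAt (fun t => 2 * μ * t + 2 * ((σ + η * (t - a)) * waveLength k))
      (2 * μ + 2 * η * waveLength k) t := by
    have e1 := (hasDerivAt_id t).const_mul (2 * μ)
    have e2 := ((((hasDerivAt_id t).sub_const a).const_mul η).const_add σ).mul_const (waveLength k)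
    have e3 := e1.add (e2.const_mul 2)
    exact e3.congr_deriv (by ring)
  exact (h2.exp.const_mul (wt (2 * α) k ^ 2)).congr_deriv (by ring)

/-- As 1 ≤ |k| ≤ |k|², both μ (exponential weight) and η (speed of the Gevrey index) are charged to
the dissipation. Young's inequality with ε gives the force half a power of A less and its partner
half a power more. -/
lemma energy_term_le {α σ μ η ε : ℝ} (hμ : 0 ≤ μ) (hη : 0 ≤ η) (hε : 0 < ε) {k : Z3} (hk : k ≠ 0)
    (c φ : C3) : (2 * μ + 2 * η * waveLength k) * (gwt α σ k ^ 2 * ‖c‖ ^ 2) +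
      gwt α σ k ^ 2 * (2 * (inner ℝ c φ - waveLength k ^ 2 * ‖c‖ ^ 2)) ≤
      (2 * μ + 2 * η + 2 * ε - 2) * (gwt (α + 1 / 2) σ k * ‖c‖) ^ 2 +
        (2 * ε)⁻¹ * (gwt (α - 1 / 2) σ k * ‖φ‖) ^ 2 := by
  set m := waveLength k ^ 2
  set q := gwt (α - 1 / 2) σ k ^ 2
  have h1 := one_le_waveLength hk
  have hm : waveLength k ≤ m := by
    simp only [m]; nlinarith
  have hm1 : 1 ≤ m := h1.trans hm
  have hq : 0 ≤ q := sq_nonneg _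
  have hc : 0 ≤ ‖c‖ ^ 2 := sq_nonneg _
  rw [mul_pow, mul_pow, gwt_sq_add_half, gwt_sq_sub_half α σ hk]
  change (2 * μ + 2 * η * waveLength k) * (m * q * ‖c‖ ^ 2) + m * q * (2 * (inner ℝ c φ - m * ‖c‖ ^ 2)) ≤
    (2 * μ + 2 * η + 2 * ε - 2) * (m * (m * q) * ‖c‖ ^ 2) + (2 * ε)⁻¹ * (q * ‖φ‖ ^ 2)
  have h2 : (2 * μ + 2 * η * waveLength k) * (m * q * ‖c‖ ^ 2) ≤
      (2 * μ * m + 2 * η * m) * (m * q * ‖c‖ ^ 2) := by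
    refine mul_le_mul_of_nonneg_right ?_ (by positivity)
    have : 2 * μ * 1 ≤ 2 * μ * m := mul_le_mul_of_nonneg_left hm1 (by linarith)
    have : 2 * η * waveLength k ≤ 2 * η * m := mul_le_mul_of_nonneg_left hm (by linarith)
    linarith
  have h3 : 2 * (m * inner ℝ c φ) ≤ 2 * ε * (m * m * ‖c‖ ^ 2) + (2 * ε)⁻¹ * ‖φ‖ ^ 2 := by
    have h4 : m * inner ℝ c φ ≤ m * (‖c‖ * ‖φ‖) :=
      mul_le_mul_of_nonneg_left (real_inner_le_norm c φ) (by positivity)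
    have h5 : 2 * ((m * ‖c‖) * ‖φ‖) ≤ 2 * ε * (m * ‖c‖) ^ 2 + (2 * ε)⁻¹ * ‖φ‖ ^ 2 := by
      have h6 : 0 ≤ (2 * ε)⁻¹ * (2 * ε * (m * ‖c‖) - ‖φ‖) ^ 2 := by positivity
      have h7 : (2 * ε)⁻¹ * (2 * ε * (m * ‖c‖) - ‖φ‖) ^ 2 =
          2 * ε * (m * ‖c‖) ^ 2 - 2 * ((m * ‖c‖) * ‖φ‖) + (2 * ε)⁻¹ * ‖φ‖ ^ 2 := by
        field_simp; ring
      linarith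
    nlinarith
  have h8 := mul_le_mul_of_nonneg_left h3 hq
  nlinarith

/-- Integrate the bounds per mode over [a, b]. The constant `p` is the fraction of the dissipation
consumed by the nonlinearity `g`; the coefficient of the integral on the left is what μ, η, ε and p
leave of it. -/
lemma energy_weighted {α μ σ η ε p a b : ℝ} {J : Finset Z3} {c φ g : ℝ → Z3 → C3} {Φ : ℝ → ℝ}
    (hab : a ≤ b) (hμ : 0 ≤ μ) (hη : 0 ≤ η) (hε : 0 < ε) (hJ : ∀ k ∈ J, k ≠ 0)
    (hc : ∀ k ∈ J, ContinuousOn (fun t => c t k) (Icc a b))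
    (hprim : ∀ k ∈ J, ∀ e, IsPrim (fun t => inner ℝ e (c t k))
      (fun t => inner ℝ e (φ t k - g t k - waveLength k ^ 2 • c t k)) a b)
    (hg : ∀ t ∈ Icc a b, |(2 * Real.pi) ^ 3 * ∑ k ∈ J, gwt α (σ + η * (t - a)) k ^ 2 *
      inner ℝ (c t k) (g t k)| ≤ p * ysum (α + 1 / 2) (σ + η * (t - a)) J (c t))
    (hφ : ∀ t ∈ Icc a b, ysum (α - 1 / 2) (σ + η * (t - a)) J (φ t) ≤ Φ t)
    (hΦ : ContinuousOn Φ (Icc a b)) :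
    Real.exp (2 * μ * b) * ysum α (σ + η * (b - a)) J (c b) +
      (2 * (1 - μ) - 2 * η - 2 * ε - 2 * p) *
        ∫ t in a..b, Real.exp (2 * μ * t) * ysum (α + 1 / 2) (σ + η * (t - a)) J (c t) ≤
    Real.exp (2 * μ * a) * ysum α σ J (c a) +
      (2 * ε)⁻¹ * ∫ t in a..b, Real.exp (2 * μ * t) * Φ t := by
  set P : ℝ := (2 * Real.pi) ^ 3
  have hP : 0 < P := two_pi_cube_pos
  have h1 : IsPrim (fun t => ∑ k ∈ J, (Real.exp (2 * μ * t) * gwt α (σ + η * (t - a)) k ^ 2) *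
      ‖c t k‖ ^ 2) (fun t => ∑ k ∈ J, (((2 * μ + 2 * η * waveLength k) *
        (Real.exp (2 * μ * t) * gwt α (σ + η * (t - a)) k ^ 2)) * ‖c t k‖ ^ 2 +
        (Real.exp (2 * μ * t) * gwt α (σ + η * (t - a)) k ^ 2) * (2 * inner ℝ (c t k)
          (φ t k - g t k - waveLength k ^ 2 • c t k)))) a b := by
    refine IsPrim.sum hab fun k hk => IsPrim.mul hab (isPrim_of_hasDerivAt
      (hasDerivAt_weight α μ σ η a k) ?_) (isPrim_norm_sq hab (hprim k hk))
    unfold gwt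
    fun_prop
  have hz : ContinuousOn (fun t => Real.exp (2 * μ * t) *
      ysum (α + 1 / 2) (σ + η * (t - a)) J (c t)) (Icc a b) := by
    unfold ysum gwt
    refine ContinuousOn.mul (by fun_prop) (continuousOn_const.mul (continuousOn_finsetSum _
      fun k hk => ContinuousOn.pow (ContinuousOn.mul (by fun_prop) (hc k hk).norm) 2))
  have hpt : ∀ t ∈ Icc a b, P * (∑ k ∈ J, (((2 * μ + 2 * η * waveLength k) *
        (Real.exp (2 * μ * t) * gwt α (σ + η * (t - a)) k ^ 2)) * ‖c t k‖ ^ 2 +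
        (Real.exp (2 * μ * t) * gwt α (σ + η * (t - a)) k ^ 2) * (2 * inner ℝ (c t k)
          (φ t k - g t k - waveLength k ^ 2 • c t k)))) ≤
      -(2 * (1 - μ) - 2 * η - 2 * ε - 2 * p) * (Real.exp (2 * μ * t) *
        ysum (α + 1 / 2) (σ + η * (t - a)) J (c t)) + (2 * ε)⁻¹ * (Real.exp (2 * μ * t) * Φ t) := by
    intro t ht
    set s := σ + η * (t - a)
    set E := Real.exp (2 * μ * t)
    have hE : 0 < E := Real.exp_pos _
    have e1 : P * (∑ k ∈ J, (((2 * μ + 2 * η * waveLength k) *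
        (E * gwt α s k ^ 2)) * ‖c t k‖ ^ 2 + (E * gwt α s k ^ 2) * (2 * inner ℝ (c t k)
          (φ t k - g t k - waveLength k ^ 2 • c t k)))) =
        E * (P * ∑ k ∈ J, ((2 * μ + 2 * η * waveLength k) * (gwt α s k ^ 2 * ‖c t k‖ ^ 2) +
          gwt α s k ^ 2 * (2 * (inner ℝ (c t k) (φ t k) - waveLength k ^ 2 * ‖c t k‖ ^ 2)))
          - 2 * (P * ∑ k ∈ J, gwt α s k ^ 2 * inner ℝ (c t k) (g t k))) := by
      rw [← mul_assoc 2 P, mul_comm 2 P, mul_assoc P 2, Finset.mul_sum _ _ (2 : ℝ), ← mul_sub,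
        ← Finset.sum_sub_distrib, ← mul_assoc, mul_comm E P, mul_assoc, Finset.mul_sum _ _ E]
      congr 1
      refine Finset.sum_congr rfl fun k _ => ?_
      rw [inner_sub_right, inner_sub_right, real_inner_smul_right, real_inner_self_eq_norm_sq]
      ring
    have e2 : P * ∑ k ∈ J, ((2 * μ + 2 * η * waveLength k) * (gwt α s k ^ 2 * ‖c t k‖ ^ 2) +
          gwt α s k ^ 2 * (2 * (inner ℝ (c t k) (φ t k) - waveLength k ^ 2 * ‖c t k‖ ^ 2))) ≤
        (2 * μ + 2 * η + 2 * ε - 2) * ysum (α + 1 / 2) s J (c t) +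
          (2 * ε)⁻¹ * ysum (α - 1 / 2) s J (φ t) := by
      have := Finset.sum_le_sum fun k (hk : k ∈ J) =>
        energy_term_le (α := α) (σ := s) hμ hη hε (hJ k hk) (c t k) (φ t k)
      have h2 := mul_le_mul_of_nonneg_left this hP.le
      refine h2.trans (le_of_eq ?_)
      rw [Finset.sum_add_distrib, ← Finset.mul_sum, ← Finset.mul_sum]
      simp only [ysum]; ring
    have e3 := (abs_le.1 (hg t ht)).1
    have e4 := mul_le_mul_of_nonneg_left (hφ t ht) (inv_nonneg.2 (by linarith : 0 ≤ 2 * ε))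
    rw [e1]
    calc _ ≤ E * ((2 * μ + 2 * η + 2 * ε - 2) * ysum (α + 1 / 2) s J (c t) + (2 * ε)⁻¹ * Φ t
          + 2 * (p * ysum (α + 1 / 2) s J (c t))) := by
          refine mul_le_mul_of_nonneg_left ?_ hE.le
          linarith
      _ = _ := by ring
  have hI := h1.eq_integral hab
  have hzi : IntervalIntegrable (fun t => Real.exp (2 * μ * t) *
      ysum (α + 1 / 2) (σ + η * (t - a)) J (c t)) volume a b := by
    rw [← uIcc_of_le hab] at hz; exact hz.intervalIntegrable
  have hΦi : IntervalIntegrable (fun t => Real.exp (2 * μ * t) * Φ t) volume a b := by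
    rw [← uIcc_of_le hab] at hΦ
    exact (ContinuousOn.mul (by fun_prop) hΦ).intervalIntegrable
  have hmono := intervalIntegral.integral_mono_on hab (h1.1.const_mul P)
    ((hzi.const_mul (-(2 * (1 - μ) - 2 * η - 2 * ε - 2 * p))).add (hΦi.const_mul (2 * ε)⁻¹)) hpt
  rw [intervalIntegral.integral_add (hzi.const_mul _) (hΦi.const_mul _),
    intervalIntegral.integral_const_mul, intervalIntegral.integral_const_mul,
    intervalIntegral.integral_const_mul] at hmono
  have hy : ∀ t, Real.exp (2 * μ * t) * ysum α (σ + η * (t - a)) J (c t) =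
      P * ∑ k ∈ J, (Real.exp (2 * μ * t) * gwt α (σ + η * (t - a)) k ^ 2) * ‖c t k‖ ^ 2 := by
    intro t
    rw [ysum, ← mul_assoc, mul_comm _ P, mul_assoc P, Finset.mul_sum]
    congr 1
    refine Finset.sum_congr rfl fun k _ => ?_
    rw [mul_pow]; ring
  have hya := hy a
  rw [sub_self, mul_zero, add_zero] at hya
  rw [hy b, hya, hI]
  rw [sub_self, mul_zero, add_zero, mul_add]
  linarith

/-! ### The trilinear form on finitely many modes -/

lemma ysum_eq_gsum {α σ : ℝ} {J : Finset Z3} {c : Z3 → C3} (hc : ∀ k ∉ J, c k = 0) :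
    gsum α σ c = ENNReal.ofReal (∑ k ∈ J, (gwt α σ k * ‖c k‖) ^ 2) := by
  rw [gsum, tsum_eq_sum (s := J)]
  · rw [ENNReal.ofReal_sum_of_nonneg fun _ _ => sq_nonneg _]
    exact Finset.sum_congr rfl fun k _ => gsum_term α σ c k
  · intro k hk
    rw [hc k hk]; simp

lemma gevreyNorm_of_finite {α σ : ℝ} {J : Finset Z3} {u : L2}
    (hc : ∀ k ∉ J, fourierCoeffVec u k = 0) :
    gevreyNorm α σ u = ENNReal.ofReal (Real.sqrt (ysum α σ J (fourierCoeffVec u))) := by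
  rw [gevreyNorm_eq, ysum_eq_gsum hc, ← ENNReal.ofReal_mul two_pi_cube_pos.le, Real.sqrt_eq_rpow]
  exact ENNReal.ofReal_rpow_of_nonneg (ysum_nonneg _ _ _ _) (by norm_num)

lemma ysum_le_of_gevreyNorm {α σ C : ℝ} (hC : 0 ≤ C) (J : Finset Z3) {u : L2}
    (h : gevreyNorm α σ u ≤ ENNReal.ofReal C) : ysum α σ J (fourierCoeffVec u) ≤ C ^ 2 := by
  have h1 := pow_le_pow_left' h 2
  rw [gevreyNorm_sq, ← ENNReal.ofReal_pow hC] at h1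
  have h2 : ENNReal.ofReal (ysum α σ J (fourierCoeffVec u)) ≤
      ENNReal.ofReal ((2 * Real.pi) ^ 3) * gsum α σ (fourierCoeffVec u) := by
    rw [ysum, ENNReal.ofReal_mul two_pi_cube_pos.le, ENNReal.ofReal_sum_of_nonneg fun _ _ => sq_nonneg _]
    refine mul_le_mul_right ?_ _
    simp only [← gsum_term]
    exact ENNReal.sum_le_tsum J
  exact (ENNReal.ofReal_le_ofReal_iff (by positivity)).1 (h2.trans h1)

lemma abs_sum_mul_inner_le {α σ : ℝ} (J : Finset Z3) (c d : Z3 → C3) :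
    |(2 * Real.pi) ^ 3 * ∑ k ∈ J, gwt α σ k ^ 2 * inner ℝ (c k) (d k)| ≤
      Real.sqrt (ysum α σ J c) * Real.sqrt (ysum α σ J d) := by
  have hP := two_pi_cube_pos
  rw [abs_mul, abs_of_pos hP, ysum, ysum, Real.sqrt_mul hP.le, Real.sqrt_mul hP.le]
  have h1 : |∑ k ∈ J, gwt α σ k ^ 2 * inner ℝ (c k) (d k)| ≤
      ∑ k ∈ J, (gwt α σ k * ‖c k‖) * (gwt α σ k * ‖d k‖) := by
    refine (Finset.abs_sum_le_sum_abs _ _).trans (Finset.sum_le_sum fun k _ => ?_)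
    rw [abs_mul, abs_of_nonneg (sq_nonneg _)]
    calc _ ≤ gwt α σ k ^ 2 * (‖c k‖ * ‖d k‖) :=
          mul_le_mul_of_nonneg_left (abs_real_inner_le_norm _ _) (sq_nonneg _)
      _ = _ := by ring
  have h2 := Real.sum_mul_le_sqrt_mul_sqrt J (fun k => gwt α σ k * ‖c k‖) fun k => gwt α σ k * ‖d k‖
  calc _ ≤ (2 * Real.pi) ^ 3 * (Real.sqrt (∑ k ∈ J, (gwt α σ k * ‖c k‖) ^ 2) *
        Real.sqrt (∑ k ∈ J, (gwt α σ k * ‖d k‖) ^ 2)) := mul_le_mul_of_nonneg_left (h1.trans h2) hP.le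
    _ = (Real.sqrt ((2 * Real.pi) ^ 3) * Real.sqrt ((2 * Real.pi) ^ 3)) * (Real.sqrt (∑ k ∈ J, (gwt α σ k * ‖c k‖) ^ 2) *
        Real.sqrt (∑ k ∈ J, (gwt α σ k * ‖d k‖) ^ 2)) := by rw [Real.mul_self_sqrt hP.le]
    _ = _ := by ring

/-- A field with finitely many modes has finite Gevrey norms, so the bilinear estimate applies to
it. B(p, p) also has modes outside `J`, but discarding them only decreases its norm; Cauchy–Schwarz
finishes. -/
lemma nonlinear_energy_le {K : ℝ} (hK1 : 1 < K) (hK : BilinearBound K) {α σ : ℝ} (hα : 1 / 2 ≤ α)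
    (hσ : 0 ≤ σ) {J : Finset Z3} {p : V} (hp : ∀ k ∉ J, fourierCoeffVec (field p) k = 0) :
    |(2 * Real.pi) ^ 3 * ∑ k ∈ J, gwt α σ k ^ 2 * inner ℝ (fourierCoeffVec (field p) k)
      (convB (fourierCoeffVec (field p)) (fourierCoeffVec (field p)) k)| ≤
      K ^ α * Real.sqrt (ysum α σ J (fourierCoeffVec (field p))) *
        ysum (α + 1 / 2) σ J (fourierCoeffVec (field p)) := by
  have hfin := gevreyNorm_of_finite (α := α + 1 / 2) (σ := σ) hp
  have hlt : gevreyNorm (α + 1 / 2) σ (field p) < ⊤ := by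
    rw [hfin]; exact ENNReal.ofReal_lt_top
  obtain ⟨w, hw, hb⟩ := hK α σ hα hσ p p hlt hlt
  have hz := ysum_nonneg (α + 1 / 2) σ J (fourierCoeffVec (field p))
  have hKα : 0 ≤ K ^ α := Real.rpow_nonneg (by linarith) _
  rw [hfin, ← ENNReal.ofReal_mul hKα, ← ENNReal.ofReal_mul (by positivity), mul_assoc,
    Real.mul_self_sqrt hz] at hb
  have h1 := ysum_le_of_gevreyNorm (by positivity) J hb
  have hwc : fourierCoeffVec w = convB (fourierCoeffVec (field p)) (fourierCoeffVec (field p)) :=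
    funext (fourier_of_trilinear hw)
  rw [hwc] at h1
  refine (abs_sum_mul_inner_le J _ _).trans ?_
  have h2 := Real.sqrt_le_sqrt h1
  rw [Real.sqrt_sq (by positivity)] at h2
  calc _ ≤ Real.sqrt (ysum α σ J (fourierCoeffVec (field p))) *
        (K ^ α * ysum (α + 1 / 2) σ J (fourierCoeffVec (field p))) := by gcongr
    _ = _ := by ring

/-- This is b(u, u, u) = 0 on coefficients. The projection drops out since c is divergence-free. For
fixed j the reflection k ↦ j - k changes the sign of each term, by reality of c and j·c_j = 0, so
the sum over k equals its negative. -/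
lemma sum_inner_convB_eq_zero {J : Finset Z3} {c : Z3 → C3} (hc : Adm c) (hJ : ∀ k ∉ J, c k = 0) :
    ∑ k ∈ J, inner ℝ (c k) (convB c c k) = 0 := by
  have h1 : ∀ k, inner ℝ (c k) (convB c c k) =
      ∑ j ∈ J, inner ℝ (c k) ((Complex.I * dotZ (k - j) (c j)) • c (k - j)) := by
    intro k
    by_cases hk : k = 0
    · subst hk; simp [hc.zero]
    · rw [convB, if_neg hk, real_inner_comm, inner_leray k _ (hc.div k), convN, tsum_eq_sum (s := J),
        real_inner_comm, inner_sum]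
      intro j hj
      rw [hJ j hj, dotZ_zero]; simp
  simp only [h1]
  rw [Finset.sum_comm]
  refine Finset.sum_eq_zero fun j _ => ?_
  set T : Z3 → ℝ := fun k => inner ℝ (c k) ((Complex.I * dotZ (k - j) (c j)) • c (k - j)) with hT
  have h2 : ∑ k ∈ J, T k = ∑' k, T k := (tsum_eq_sum fun k hk => by simp [hT, hJ k hk]).symm
  have h3 : ∀ k, T (j - k) = -T k := by
    intro k
    have e1 : dotZ (j - k - j) (c j) = -dotZ (k - j) (c j) := by
      have : ∀ l, dotZ (l - j) (c j) = dotZ l (c j) := fun l => by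
        have hj := hc.div j
        simp only [dotZ, Pi.sub_apply, Int.cast_sub, sub_mul, Finset.sum_sub_distrib] at hj ⊢
        rw [hj, sub_zero]
      rw [show j - k - j = -k by ring, this k]
      simp [dotZ]
    have e2 : c (j - k) = conj3 (c (k - j)) := by rw [← hc.conj, neg_sub]
    have e3 : c (j - k - j) = conj3 (c k) := by rw [← hc.conj]; congr 1; ring
    simp only [hT]
    rw [e1, e2, e3, inner_C3, inner_C3, ← Finset.sum_neg_distrib]
    refine Finset.sum_congr rfl fun i _ => ?_
    simp only [conj3_apply, PiLp.smul_apply, smul_eq_mul, Complex.conj_conj, ← Complex.neg_re]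
    congr 1; ring
  have h4 : ∑' k, T k = -∑' k, T k := by
    conv_lhs => rw [← (Equiv.subLeft j).tsum_eq]
    simp only [Equiv.subLeft_apply, h3, tsum_neg]
  rw [h2]; linarith

/-! ### Elements of `V` with prescribed rescaled coefficients -/

/-- The embedding of 𝒟(A^α) into `V`, which is where α ≥ 1/2 enters. -/
lemma abs_bessel_wt_le {α : ℝ} (hα : 1 / 2 ≤ α) (k : Z3) : |bessel k * wt (-2 * α) k| ≤ 2 := by
  rw [abs_of_nonneg (mul_nonneg (bessel_pos k).le (wt_nonneg _ _))]
  by_cases hk : k = 0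
  · subst hk; simp [wt_zero_right]
  · have h1 := one_le_waveLength hk
    have h2 : bessel k ≤ 2 * waveLength k := by
      refine Real.sqrt_le_iff.2 ⟨by linarith, ?_⟩
      nlinarith
    calc _ ≤ 2 * waveLength k * wt (-2 * α) k := mul_le_mul_of_nonneg_right h2 (wt_nonneg _ _)
      _ = 2 * wt (1 + -2 * α) k := by rw [← wt_mul, wt_one]; ring
      _ ≤ 2 * 1 := by
          refine mul_le_mul_of_nonneg_left (wt_le_one (by linarith) k) (by norm_num)
      _ = 2 := by norm_num

/-- The element of `V` with coefficients `|k|^{-2α} a_k`. -/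
def toV {α : ℝ} (hα : 1 / 2 ≤ α) : ell →L[ℝ] V :=
  synthV.comp (diag (fun k => bessel k * wt (-2 * α) k) 2 (abs_bessel_wt_le hα))

lemma fourier_toV {α : ℝ} (hα : 1 / 2 ≤ α) {a : ell} (ha : Adm a) :
    fourierCoeffVec (field (toV hα a)) = scale (-2 * α) a := by
  funext k
  have h : Adm (diag (fun k => bessel k * wt (-2 * α) k) 2 (abs_bessel_wt_le hα) a) :=
    ha.mul fun k => by rw [bessel_neg, wt_neg]
  have h2 := fourier_synthV h k
  rw [diag_apply, smul_smul, inv_mul_cancel_left₀ (bessel_pos k).ne'] at h2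
  exact h2

/-! ### The data of the problem -/

lemma adm_toEll {c : Z3 → C3} (hc : Adm c) : Adm (toEll c) := by
  by_cases h : Summable fun k => ‖c k‖ ^ 2
  · rw [coe_toEll h]; exact hc
  · rw [toEll, dif_neg h]; exact adm_zero

/-- The rescaled initial value. -/
def initSeq (α : ℝ) (u₀ : H) : ell := toEll (scale (2 * α) (fourierCoeffVec u₀))

/-- The rescaled force. -/
def forceSeq (α : ℝ) (f : ℝ → H) (t : ℝ) : ell := toEll (scale (2 * α - 7 / 4) (fourierCoeffVec (f t)))

lemma adm_initSeq (α : ℝ) (u₀ : H) : Adm (initSeq α u₀) :=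
  adm_toEll ((adm_of_mem_H u₀.2).scale _)

lemma adm_forceSeq (α : ℝ) (f : ℝ → H) (t : ℝ) : Adm (forceSeq α f t) :=
  adm_toEll ((adm_of_mem_H (f t).2).scale _)

lemma scale_summable {s α σ : ℝ} (hs : s ≤ 2 * α) (hσ : 0 ≤ σ) {u : L2}
    (h : gevreyNorm α σ u < ⊤) : Summable fun k => ‖scale s (fourierCoeffVec u) k‖ ^ 2 := by
  rw [gsum_lt_top_iff] at h
  refine Summable.of_nonneg_of_le (fun _ => sq_nonneg _) (fun k => ?_) (summable_of_gsum h)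
  rw [scale, norm_smul, Real.norm_of_nonneg (wt_nonneg _ _)]
  exact pow_le_pow_left₀ (mul_nonneg (wt_nonneg _ _) (norm_nonneg _))
    (mul_le_mul_of_nonneg_right (wt_le_gwt hs hσ k) (norm_nonneg _)) 2

lemma norm_toEll_scale_le {s α σ C : ℝ} (hs : s ≤ 2 * α) (hσ : 0 ≤ σ) (hC : 0 ≤ C) {u : L2}
    (h : gevreyNorm α σ u ≤ ENNReal.ofReal C) :
    (2 * Real.pi) ^ 3 * ‖toEll (scale s (fourierCoeffVec u))‖ ^ 2 ≤ C ^ 2 := by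
  have hP := two_pi_cube_pos
  have hsum := scale_summable hs hσ (h.trans_lt ENNReal.ofReal_lt_top)
  rw [← le_div_iff₀' hP]
  refine hasSum_le_of_sum_le (ell_hasSum _) fun J => ?_
  rw [le_div_iff₀' hP]
  refine le_trans (mul_le_mul_of_nonneg_left (Finset.sum_le_sum fun k _ => ?_) hP.le)
    (ysum_le_of_gevreyNorm hC J h)
  rw [toEll_apply hsum, scale, norm_smul, Real.norm_of_nonneg (wt_nonneg _ _)]
  exact pow_le_pow_left₀ (mul_nonneg (wt_nonneg _ _) (norm_nonneg _))
    (mul_le_mul_of_nonneg_right (wt_le_gwt hs hσ k) (norm_nonneg _)) 2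

/-- The hypotheses of the theorem. -/
structure Setting (K δ lam σ α : ℝ) (u₀ : H) (f : ℝ → H) : Prop where
  one_lt : 1 < K
  bound : BilinearBound K
  δ_pos : 0 < δ
  δ_lt : δ < 1
  lt_lam : 1 - δ < lam
  lam_le : lam ≤ 1
  σ_nonneg : 0 ≤ σ
  le_α : 1 / 2 ≤ α
  memLp : MemLpLoc ⊤ f
  init_le : gevreyNorm α 0 u₀ ≤ ENNReal.ofReal (C0 K α δ σ)
  force_le : ∀ t : ℝ, 0 ≤ t → gevreyNorm (α - 1 / 2) σ (f t) ≤
    ENNReal.ofReal (C1 K α δ lam σ * Real.exp (-lam * t))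

namespace Setting

variable {K δ lam σ α : ℝ} {u₀ : H} {f : ℝ → H}

lemma rpow_pos (S : Setting K δ lam σ α u₀ f) : 0 < K ^ α :=
  Real.rpow_pos_of_pos (by linarith [S.one_lt]) _

lemma C0_pos (S : Setting K δ lam σ α u₀ f) : 0 < C0 K α δ σ := by
  have := S.rpow_pos; have := S.δ_pos
  unfold C0; split_ifs <;> positivity

lemma sqrt_two_le : Real.sqrt 2 ≤ 1.415 := Real.sqrt_le_iff.2 (by norm_num)

/-- The share of the dissipation used by the nonlinearity on the ball |u|² ≤ 2 C₀². The larger value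
of C₀ gives √2/4 < 0.36. -/
lemma small (S : Setting K δ lam σ α u₀ f) : K ^ α * (Real.sqrt 2 * C0 K α δ σ) ≤ 9 / 25 * δ := by
  have h := S.rpow_pos; have := S.δ_pos
  have e : K ^ α * C0 K α δ σ ≤ δ / 4 := by
    unfold C0; split_ifs
    · rw [mul_div_assoc', div_le_div_iff₀ (by positivity) (by norm_num)]; nlinarith [mul_pos h S.δ_pos]
    · rw [mul_div_assoc', div_le_div_iff₀ (by positivity) (by norm_num)]; nlinarith [mul_pos h S.δ_pos]
  have h2 := sqrt_two_le
  calc _ = Real.sqrt 2 * (K ^ α * C0 K α δ σ) := by ring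
    _ ≤ 1.415 * (δ / 4) := mul_le_mul h2 e (mul_nonneg h.le S.C0_pos.le) (by norm_num)
    _ ≤ _ := by linarith

/-- Now √2/6 < 0.24; the smaller C₀ leaves room for a Gevrey index growing at speed δ/6. -/
lemma small_of_pos (S : Setting K δ lam σ α u₀ f) (hσ : 0 < σ) :
    K ^ α * (Real.sqrt 2 * C0 K α δ σ) ≤ 6 / 25 * δ := by
  have h := S.rpow_pos; have := S.δ_pos
  have e : K ^ α * C0 K α δ σ = δ / 6 := by
    unfold C0; rw [if_pos hσ]; field_simp
  have h2 := sqrt_two_le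
  calc _ = Real.sqrt 2 * (K ^ α * C0 K α δ σ) := by ring
    _ ≤ 1.415 * (δ / 6) := by rw [e]; gcongr
    _ ≤ _ := by linarith

lemma C1_nonneg (S : Setting K δ lam σ α u₀ f) : 0 ≤ C1 K α δ lam σ := by
  have := S.C0_pos
  unfold C1; split_ifs <;> positivity

lemma C1_sq_le (S : Setting K δ lam σ α u₀ f) :
    C1 K α δ lam σ ^ 2 ≤ 2 * δ * (lam - 1 + δ) * C0 K α δ σ ^ 2 := by
  have h0 := S.C0_pos
  have h1 : 0 ≤ δ * (lam - 1 + δ) := mul_nonneg S.δ_pos.le (by linarith [S.lt_lam])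
  have h2 : 0 ≤ δ * (lam - 1 + δ) * C0 K α δ σ ^ 2 := by positivity
  unfold C1; split_ifs
  · rw [mul_pow, mul_pow, div_pow, Real.sq_sqrt h1, Real.sq_sqrt (by norm_num)]
    nlinarith
  · rw [mul_pow, mul_pow, Real.sq_sqrt h1, Real.sq_sqrt (by norm_num)]
    nlinarith

lemma force_bound (S : Setting K δ lam σ α u₀ f) {t : ℝ} (ht : 0 ≤ t) (J : Finset Z3) {s : ℝ}
    (hs : s ≤ σ) : ysum (α - 1 / 2) s J (fourierCoeffVec (f t)) ≤
      C1 K α δ lam σ ^ 2 * Real.exp (-2 * lam * t) := by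
  have h := ysum_le_of_gevreyNorm (mul_nonneg S.C1_nonneg (Real.exp_nonneg _)) J (S.force_le t ht)
  rw [mul_pow, ← Real.exp_nat_mul] at h
  refine le_trans ?_ (h.trans (le_of_eq ?_))
  · refine mul_le_mul_of_nonneg_left (Finset.sum_le_sum fun k _ => ?_) two_pi_cube_pos.le
    refine pow_le_pow_left₀ (mul_nonneg (gwt_nonneg _ _ _) (norm_nonneg _)) ?_ 2
    refine mul_le_mul_of_nonneg_right ?_ (norm_nonneg _)
    unfold gwt
    have := waveLength_nonneg k; have := wt_nonneg (2 * (α - 1 / 2)) k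
    gcongr
  · congr 2; push_cast; ring

lemma one_le_two_pi_cube : 1 ≤ (2 * Real.pi) ^ 3 :=
  one_le_pow₀ (by linarith [Real.pi_gt_three])

lemma force_summable (S : Setting K δ lam σ α u₀ f) {t : ℝ} (ht : 0 ≤ t) :
    Summable fun k => ‖scale (2 * α - 7 / 4) (fourierCoeffVec (f t)) k‖ ^ 2 :=
  scale_summable (by linarith) S.σ_nonneg ((S.force_le t ht).trans_lt ENNReal.ofReal_lt_top)

lemma growth (S : Setting K δ lam σ α u₀ f) : Growth (forceSeq α f) (C1 K α δ lam σ) 0 := by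
  refine ⟨fun T k => ?_, fun t ht => ?_⟩
  · rcases le_or_gt T 0 with hT | hT
    -- For T ≤ 0 the interval [0, T] lies in {0}, a null set, and the local integrability hypothesis
    -- says nothing.
    · have : AEStronglyMeasurable (fun s => forceSeq α f s k) (volume.restrict ({0} : Set ℝ)) := by
        rw [Measure.restrict_eq_zero.2 (by simp)]; exact aestronglyMeasurable_zero_measure _
      refine this.mono_measure (Measure.restrict_mono (fun x hx => ?_) le_rfl)
      exact le_antisymm (hx.2.trans hT) hx.1
    · have h1 := (S.memLp T hT).aestronglyMeasurable
      have h0 : Continuous fun v : H => fourierCoeffVec (v : L2) k :=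
        (continuous_fourier k).comp continuous_subtype_val
      have h2 : Continuous fun v : H => wt (2 * α - 7 / 4) k • fourierCoeffVec (v : L2) k :=
        h0.const_smul (wt (2 * α - 7 / 4) k)
      refine (h2.comp_aestronglyMeasurable h1).congr ?_
      filter_upwards [self_mem_ae_restrict measurableSet_Icc] with t ht
      rw [forceSeq, toEll_apply (S.force_summable ht.1)]; rfl
  · have h := norm_toEll_scale_le (s := 2 * α - 7 / 4) (by linarith) S.σ_nonneg
      (mul_nonneg S.C1_nonneg (Real.exp_nonneg _)) (S.force_le t ht)
    rw [zero_mul, Real.exp_zero, mul_one]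
    refine le_of_sq_le_sq ?_ S.C1_nonneg
    have h1 : Real.exp (-lam * t) ≤ 1 := by
      rw [neg_mul]; exact exp_neg_le_one (by linarith [S.lt_lam, S.δ_lt]) ht
    have h2 : (C1 K α δ lam σ * Real.exp (-lam * t)) ^ 2 ≤ C1 K α δ lam σ ^ 2 :=
      pow_le_pow_left₀ (mul_nonneg S.C1_nonneg (Real.exp_nonneg _))
        (mul_le_of_le_one_right S.C1_nonneg h1) 2
    refine le_trans ?_ (h.trans h2)
    exact le_mul_of_one_le_left (sq_nonneg _) one_le_two_pi_cube

lemma scale_forceSeq (S : Setting K δ lam σ α u₀ f) {t : ℝ} (ht : 0 ≤ t) :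
    scale (7 / 4 - 2 * α) (forceSeq α f t) = fourierCoeffVec (f t) := by
  rw [forceSeq, coe_toEll (S.force_summable ht), scale_scale,
    show 7 / 4 - 2 * α + (2 * α - 7 / 4) = 0 by ring, scale_zero_left]
  exact (adm_of_mem_H (f t).2).zero

lemma init_summable (S : Setting K δ lam σ α u₀ f) :
    Summable fun k => ‖scale (2 * α) (fourierCoeffVec (u₀ : L2)) k‖ ^ 2 :=
  scale_summable le_rfl le_rfl (S.init_le.trans_lt ENNReal.ofReal_lt_top)

end Setting

/-- The truncation radius. -/
def radius (K α δ σ : ℝ) : ℝ := Real.sqrt 2 * C0 K α δ σ / Real.sqrt ((2 * Real.pi) ^ 3)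

namespace Setting

variable {K δ lam σ α : ℝ} {u₀ : H} {f : ℝ → H}

lemma radius_pos (S : Setting K δ lam σ α u₀ f) : 0 < radius K α δ σ := by
  have := S.C0_pos; have := two_pi_cube_pos
  unfold radius; positivity

/-- The truncation radius in `ell` corresponds to |A^α u|² = 2 C₀², the threshold of the continuity
argument. -/
lemma radius_sq (K α δ σ : ℝ) : (2 * Real.pi) ^ 3 * radius K α δ σ ^ 2 = 2 * C0 K α δ σ ^ 2 := by
  have := two_pi_cube_pos
  rw [radius, div_pow, Real.sq_sqrt this.le, mul_pow (Real.sqrt 2),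
    Real.sq_sqrt (by norm_num : (0 : ℝ) ≤ 2)]
  field_simp

end Setting

lemma retractFactor_nonneg {R : ℝ} (hR : 0 < R) (x : ell) : 0 ≤ retractFactor R x :=
  div_nonneg hR.le (le_max_of_le_left hR.le)

lemma retractFactor_le_one {R : ℝ} (hR : 0 < R) (x : ell) : retractFactor R x ≤ 1 :=
  (div_le_one (lt_max_of_lt_left hR)).2 (le_max_left _ _)

lemma retractFactor_of_le {R : ℝ} (hR : 0 < R) {x : ell} (h : ‖x‖ ≤ R) : retractFactor R x = 1 := by
  rw [retractFactor, max_eq_left h, div_self hR.ne']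

/-- The nonzero wave vectors of length at most `n`. -/
def waveFin (n : ℕ) : Finset Z3 := (finite_waveBall n).toFinset.erase 0

lemma waveFin_ne {n : ℕ} {k : Z3} (h : k ∈ waveFin n) : k ≠ 0 := (Finset.mem_erase.1 h).1

lemma waveFin_mem {n : ℕ} {k : Z3} (h : k ∈ waveFin n) : k ∈ waveBall n := by
  simpa using (Finset.mem_erase.1 h).2

lemma IsMild.coef_eq_zero {α : ℝ} {hα : 1 / 2 ≤ α} {R : ℝ} {F : ℝ → ell} {a₀ : ell} {n : ℕ}
    {a : ℝ → ell} (h : IsMild hα R F a₀ (waveBall n) a) (t : ℝ) {k : Z3} (hk : k ∉ waveFin n) :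
    a t k = 0 := by
  by_cases h0 : k = 0
  · rw [h0]; exact (h.adm t).zero
  · refine h.eq_zero t k fun hm => hk ?_
    exact Finset.mem_erase.2 ⟨h0, by simpa using hm⟩

/-- At the first time when Y reaches B, the bound Y ≤ B has held up to that time, so the hypothesis
gives Y ≤ q < B there, a contradiction. -/
lemma first_exit {Y : ℝ → ℝ} {q B : ℝ} (hY : ContinuousOn Y (Ici 0)) (h0 : Y 0 ≤ q) (hq : q < B)
    (h : ∀ t, 0 ≤ t → (∀ s ∈ Icc 0 t, Y s ≤ B) → Y t ≤ q) : ∀ t, 0 ≤ t → Y t ≤ q := by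
  intro t ht
  by_cases hS : ∃ s ∈ Icc 0 t, B ≤ Y s
  · exfalso
    have hcl : IsCompact (Icc 0 t ∩ Y ⁻¹' Ici B) := by
      refine isCompact_Icc.of_isClosed_subset ?_ inter_subset_left
      exact (hY.mono Icc_subset_Ici_self).preimage_isClosed_of_isClosed isClosed_Icc isClosed_Ici
    obtain ⟨s, hs, hB⟩ := hS
    obtain ⟨t₁, ⟨ht₁, ht₁B⟩, hmin⟩ := hcl.exists_isLeast ⟨s, hs, hB⟩
    obtain ⟨r, hr, hrB⟩ := intermediate_value_Icc ht₁.1 (hY.mono Icc_subset_Ici_self)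
      (show B ∈ Icc (Y 0) (Y t₁) from ⟨(h0.trans hq.le), ht₁B⟩)
    have hrt : t₁ ≤ r := hmin ⟨⟨hr.1, hr.2.trans ht₁.2⟩, hrB.ge⟩
    have hr1 : r = t₁ := le_antisymm hr.2 hrt
    have h1 := h t₁ ht₁.1 fun s hs => by
      rcases eq_or_lt_of_le hs.2 with e | e
      · rw [e, ← hr1, hrB]
      · by_contra hc
        exact absurd (hmin ⟨⟨hs.1, hs.2.trans ht₁.2⟩, (not_le.1 hc).le⟩) (not_le.2 e)
    rw [← hr1, hrB] at h1
    linarith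
  · push Not at hS
    exact h t ht fun s hs => (hS s hs).le

lemma integral_exp_neg {ν a b : ℝ} (hν : ν ≠ 0) : ∫ t in a..b, Real.exp (-2 * ν * t) =
    (Real.exp (-2 * ν * a) - Real.exp (-2 * ν * b)) / (2 * ν) := by
  have hd : ∀ t, HasDerivAt (fun t => -(2 * ν)⁻¹ * Real.exp (-2 * ν * t)) (Real.exp (-2 * ν * t)) t := by
    intro t
    have h1 := ((hasDerivAt_id t).const_mul (-2 * ν)).exp.const_mul (-(2 * ν)⁻¹)
    refine h1.congr_deriv ?_
    simp only [id, mul_one]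
    field_simp
  rw [intervalIntegral.integral_eq_sub_of_hasDerivAt (fun t _ => hd t)
    (Continuous.intervalIntegrable (by fun_prop) _ _)]
  field_simp; ring

/-! ### Uniform bounds for the Galerkin approximations -/

namespace Setting

variable {K δ lam σ α : ℝ} {u₀ : H} {f : ℝ → H}

/-- The rate of the Gevrey index and the final energy constant. -/
lemma energy (S : Setting K δ lam σ α u₀ f) {n : ℕ} {A : ℝ → ell}
    (hA : IsMild S.le_α (radius K α δ σ) (forceSeq α f) (initSeq α u₀) (waveBall n) A)
    {μ s η a b : ℝ} (ha : 0 ≤ a) (hab : a ≤ b) (hμ : 0 ≤ μ) (hη : 0 ≤ η) (hs : 0 ≤ s)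
    (hsσ : s + η * (b - a) ≤ σ)
    (hy : ∀ t ∈ Icc a b, ysum α (s + η * (t - a)) (waveFin n) (scale (-2 * α) (A t)) ≤
      2 * C0 K α δ σ ^ 2) :
    Real.exp (2 * μ * b) * ysum α (s + η * (b - a)) (waveFin n) (scale (-2 * α) (A b)) +
      (2 * (1 - μ) - 2 * η - 11 / 10 * δ - 2 * (K ^ α * (Real.sqrt 2 * C0 K α δ σ))) *
        ∫ t in a..b, Real.exp (2 * μ * t) *
          ysum (α + 1 / 2) (s + η * (t - a)) (waveFin n) (scale (-2 * α) (A t)) ≤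
    Real.exp (2 * μ * a) * ysum α s (waveFin n) (scale (-2 * α) (A a)) +
      (11 / 10 * δ)⁻¹ * (C1 K α δ lam σ ^ 2 * ∫ t in a..b, Real.exp (-2 * (lam - μ) * t)) := by
  have hR := S.radius_pos
  have hb : 0 ≤ b := ha.trans hab
  have hle : ∀ t ∈ Icc a b, s + η * (t - a) ≤ σ := fun t ht => by
    have := mul_le_mul_of_nonneg_left (sub_le_sub_right ht.2 a) hη
    linarith
  have hge : ∀ t ∈ Icc a b, 0 ≤ s + η * (t - a) := fun t ht => by
    have := mul_nonneg hη (sub_nonneg.2 ht.1)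
    linarith
  have hC : 0 ≤ Real.sqrt 2 * C0 K α δ σ := mul_nonneg (Real.sqrt_nonneg _) S.C0_pos.le
  -- The choice of ε balances two needs: for μ = 1 - δ the force contributes at most (δ/(2ε)) C₀² =
  -- (10/11) C₀², strictly below C₀², while 2δ - 2ε = (9/10)δ still covers the nonlinearity and the
  -- growth of the index.
  have h := energy_weighted (α := α) (μ := μ) (σ := s) (η := η) (ε := 11 / 20 * δ)
    (p := K ^ α * (Real.sqrt 2 * C0 K α δ σ)) (a := a) (b := b) (J := waveFin n)
    (c := fun t => scale (-2 * α) (A t)) (φ := fun t => scale (7 / 4 - 2 * α) (forceSeq α f t))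
    (g := fun t k => retractFactor (radius K α δ σ) (A t) ^ 2 •
      convB (scale (-2 * α) (A t)) (scale (-2 * α) (A t)) k)
    (Φ := fun t => C1 K α δ lam σ ^ 2 * Real.exp (-2 * lam * t))
    hab hμ hη (by linarith [S.δ_pos]) (fun k hk => waveFin_ne hk) ?_ ?_ ?_ ?_ (by fun_prop)
  · have e1 : ∫ t in a..b, Real.exp (2 * μ * t) * (C1 K α δ lam σ ^ 2 * Real.exp (-2 * lam * t)) =
        C1 K α δ lam σ ^ 2 * ∫ t in a..b, Real.exp (-2 * (lam - μ) * t) := by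
      rw [← intervalIntegral.integral_const_mul]
      congr 1; funext t
      rw [mul_left_comm, ← Real.exp_add]; congr 2; ring
    rw [e1, show 2 * (11 / 20 * δ) = 11 / 10 * δ by ring] at h
    exact h
  · intro k _
    exact (((continuous_ell_apply k).comp hA.continuous).const_smul (wt (-2 * α) k)).continuousOn
  · intro k hk e
    refine ((hA.isPrim hR S.growth (waveFin_mem hk) e hb).sub_interval ha hab le_rfl).congr
      (fun t _ => rfl) (fun t _ => ?_) hab
    rw [← real_inner_smul_right, ← inner_sub_right]
  · intro t ht
    have hA' := hA.adm t
    have hsupp : ∀ k ∉ waveFin n, fourierCoeffVec (field (toV S.le_α (A t))) k = 0 := fun k hk => by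
      rw [fourier_toV S.le_α hA', scale, hA.coef_eq_zero t hk, smul_zero]
    have h1 := nonlinear_energy_le S.one_lt S.bound S.le_α (hge t ht) hsupp
    rw [fourier_toV S.le_α hA'] at h1
    have h2 : Real.sqrt (ysum α (s + η * (t - a)) (waveFin n) (scale (-2 * α) (A t))) ≤
        Real.sqrt 2 * C0 K α δ σ := by
      refine Real.sqrt_le_iff.2 ⟨hC, (hy t ht).trans (le_of_eq ?_)⟩
      rw [mul_pow, Real.sq_sqrt (by norm_num)]
    have h3 := retractFactor_nonneg hR (A t)
    -- The retraction can only shrink the nonlinear term.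
    have h4 : retractFactor (radius K α δ σ) (A t) ^ 2 ≤ 1 :=
      pow_le_one₀ h3 (retractFactor_le_one hR (A t))
    have hz := ysum_nonneg (α + 1 / 2) (s + η * (t - a)) (waveFin n) (scale (-2 * α) (A t))
    calc _ = retractFactor (radius K α δ σ) (A t) ^ 2 * |(2 * Real.pi) ^ 3 * ∑ k ∈ waveFin n,
          gwt α (s + η * (t - a)) k ^ 2 * inner ℝ (scale (-2 * α) (A t) k)
            (convB (scale (-2 * α) (A t)) (scale (-2 * α) (A t)) k)| := by
          have e : (2 * Real.pi) ^ 3 * ∑ k ∈ waveFin n, gwt α (s + η * (t - a)) k ^ 2 *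
              inner ℝ (scale (-2 * α) (A t) k) (retractFactor (radius K α δ σ) (A t) ^ 2 •
                convB (scale (-2 * α) (A t)) (scale (-2 * α) (A t)) k) =
              retractFactor (radius K α δ σ) (A t) ^ 2 * ((2 * Real.pi) ^ 3 * ∑ k ∈ waveFin n,
                gwt α (s + η * (t - a)) k ^ 2 * inner ℝ (scale (-2 * α) (A t) k)
                  (convB (scale (-2 * α) (A t)) (scale (-2 * α) (A t)) k)) := by
            simp only [real_inner_smul_right, Finset.mul_sum]
            exact Finset.sum_congr rfl fun k _ => by ring
          rw [e, abs_mul, abs_of_nonneg (sq_nonneg (retractFactor (radius K α δ σ) (A t)))]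
      _ ≤ 1 * |(2 * Real.pi) ^ 3 * ∑ k ∈ waveFin n,
          gwt α (s + η * (t - a)) k ^ 2 * inner ℝ (scale (-2 * α) (A t) k)
            (convB (scale (-2 * α) (A t)) (scale (-2 * α) (A t)) k)| :=
          mul_le_mul_of_nonneg_right h4 (abs_nonneg _)
      _ ≤ _ := by
          rw [one_mul]
          refine h1.trans (mul_le_mul_of_nonneg_right ?_ hz)
          exact mul_le_mul_of_nonneg_left h2 S.rpow_pos.le
  · intro t ht
    rw [S.scale_forceSeq (ha.trans ht.1)]
    exact S.force_bound (ha.trans ht.1) _ (hle t ht)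

/-- With μ = 1 - δ the remaining dissipation is (9/10)δ - 2η - 2p ≥ 0, with p = K^α √2 C₀, and is
dropped. The force is left as a difference of exponentials at the endpoints, so that estimates on
adjacent intervals telescope. -/
lemma energy_growth (S : Setting K δ lam σ α u₀ f) {n : ℕ} {A : ℝ → ell}
    (hA : IsMild S.le_α (radius K α δ σ) (forceSeq α f) (initSeq α u₀) (waveBall n) A)
    {s η a b : ℝ} (ha : 0 ≤ a) (hab : a ≤ b) (hη : 0 ≤ η) (hs : 0 ≤ s)
    (hsσ : s + η * (b - a) ≤ σ) (hη2 : η + K ^ α * (Real.sqrt 2 * C0 K α δ σ) ≤ 9 / 20 * δ)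
    (hy : ∀ t ∈ Icc a b, ysum α (s + η * (t - a)) (waveFin n) (scale (-2 * α) (A t)) ≤
      2 * C0 K α δ σ ^ 2) :
    Real.exp (2 * (1 - δ) * b) * ysum α (s + η * (b - a)) (waveFin n) (scale (-2 * α) (A b)) ≤
    Real.exp (2 * (1 - δ) * a) * ysum α s (waveFin n) (scale (-2 * α) (A a)) +
      10 / 11 * C0 K α δ σ ^ 2 * (Real.exp (-2 * (lam - (1 - δ)) * a) -
        Real.exp (-2 * (lam - (1 - δ)) * b)) := by
  have hν : 0 < lam - (1 - δ) := sub_pos.2 S.lt_lam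
  have h := S.energy hA ha hab (μ := 1 - δ) (by linarith [S.δ_lt]) hη hs hsσ hy
  have h1 : 0 ≤ ∫ t in a..b, Real.exp (2 * (1 - δ) * t) *
      ysum (α + 1 / 2) (s + η * (t - a)) (waveFin n) (scale (-2 * α) (A t)) :=
    intervalIntegral.integral_nonneg hab fun t _ =>
      mul_nonneg (Real.exp_nonneg _) (ysum_nonneg _ _ _ _)
  have h2 := mul_nonneg (show 0 ≤ 2 * (1 - (1 - δ)) - 2 * η - 11 / 10 * δ -
    2 * (K ^ α * (Real.sqrt 2 * C0 K α δ σ)) by linarith) h1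
  rw [integral_exp_neg hν.ne'] at h
  have hE : 0 ≤ Real.exp (-2 * (lam - (1 - δ)) * a) - Real.exp (-2 * (lam - (1 - δ)) * b) := by
    rw [sub_nonneg]
    refine Real.exp_le_exp.2 ?_
    nlinarith
  have h3 : (11 / 10 * δ)⁻¹ * (C1 K α δ lam σ ^ 2 * ((Real.exp (-2 * (lam - (1 - δ)) * a) -
      Real.exp (-2 * (lam - (1 - δ)) * b)) / (2 * (lam - (1 - δ))))) ≤
      10 / 11 * C0 K α δ σ ^ 2 * (Real.exp (-2 * (lam - (1 - δ)) * a) -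
        Real.exp (-2 * (lam - (1 - δ)) * b)) := by
    have hδ := S.δ_pos
    have h4 : C1 K α δ lam σ ^ 2 ≤ 2 * δ * (lam - (1 - δ)) * C0 K α δ σ ^ 2 := by
      have := S.C1_sq_le
      rwa [show lam - 1 + δ = lam - (1 - δ) by ring] at this
    calc _ ≤ (11 / 10 * δ)⁻¹ * ((2 * δ * (lam - (1 - δ)) * C0 K α δ σ ^ 2) *
          ((Real.exp (-2 * (lam - (1 - δ)) * a) -
            Real.exp (-2 * (lam - (1 - δ)) * b)) / (2 * (lam - (1 - δ))))) := by gcongr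
      _ = _ := by field_simp
  linarith

lemma init_ysum (S : Setting K δ lam σ α u₀ f) {n : ℕ} {A : ℝ → ell}
    (hA : IsMild S.le_α (radius K α δ σ) (forceSeq α f) (initSeq α u₀) (waveBall n) A) :
    ysum α 0 (waveFin n) (scale (-2 * α) (A 0)) ≤ C0 K α δ σ ^ 2 := by
  have h := ysum_le_of_gevreyNorm S.C0_pos.le (waveFin n) S.init_le
  refine le_trans (le_of_eq ?_) h
  unfold ysum
  congr 1
  refine Finset.sum_congr rfl fun k hk => ?_
  have h0 : A 0 k = initSeq α u₀ k := by
    rw [hA.eq 0 le_rfl k (waveFin_mem hk), duh]; simp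
  rw [scale, h0, initSeq, toEll_apply S.init_summable, scale, smul_smul, wt_mul,
    show -2 * α + 2 * α = 0 by ring, wt_zero_left (waveFin_ne hk), one_smul]

/-- The Gevrey index at time `t`. -/
def index (δ σ t : ℝ) : ℝ := min (δ / 6 * t) σ

/-- As long as the weighted quantity stays below 2 C₀², `energy_growth` gives C₀² from the initial
value plus at most (10/11) C₀² from the force. Since 21/11 < 2, `first_exit` closes the argument. -/
lemma galerkin_growth (S : Setting K δ lam σ α u₀ f) {n : ℕ} {A : ℝ → ell}
    (hA : IsMild S.le_α (radius K α δ σ) (forceSeq α f) (initSeq α u₀) (waveBall n) A) :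
    ∀ t, 0 ≤ t → Real.exp (2 * (1 - δ) * t) *
      ysum α (index δ σ t) (waveFin n) (scale (-2 * α) (A t)) ≤ 21 / 11 * C0 K α δ σ ^ 2 := by
  have hC := pow_pos S.C0_pos 2
  have hδ := S.δ_pos
  have hσ := S.σ_nonneg
  have hi0 : index δ σ 0 = 0 := by rw [index, mul_zero, min_eq_left hσ]
  refine first_exit (B := 2 * C0 K α δ σ ^ 2) ?_ ?_ (by linarith) fun t ht hle => ?_
  · have hc : ∀ k, Continuous fun t => scale (-2 * α) (A t) k := fun k =>
      ((continuous_ell_apply k).comp hA.continuous).const_smul (wt (-2 * α) k)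
    unfold ysum gwt index
    refine ContinuousOn.mul (by fun_prop) (continuousOn_const.mul (continuousOn_finsetSum _
      fun k hk => ContinuousOn.pow (ContinuousOn.mul (by fun_prop) (hc k).norm.continuousOn) 2))
  · rw [hi0, mul_zero, Real.exp_zero, one_mul]
    linarith [S.init_ysum hA]
  · have hle' : ∀ s ∈ Icc 0 t, ysum α (index δ σ s) (waveFin n) (scale (-2 * α) (A s)) ≤
        2 * C0 K α δ σ ^ 2 := fun s hs => by
      refine le_trans ?_ (hle s hs)
      refine le_mul_of_one_le_left (ysum_nonneg _ _ _ _) (Real.one_le_exp ?_)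
      exact mul_nonneg (by linarith [S.δ_lt]) hs.1
    have hinit := S.init_ysum hA
    have hend : ∀ r, 0 ≤ Real.exp (-2 * (lam - (1 - δ)) * r) := fun r => Real.exp_nonneg _
    -- For σ = 0 the index stays 0 and the larger C₀ is affordable. For σ > 0 the growth phase costs
    -- δ/6, and 1/6 + 6/25 < 9/20.
    rcases eq_or_lt_of_le hσ with h0 | hpos
    · have hi : ∀ s, 0 ≤ s → index δ σ s = 0 + 0 * (s - 0) := fun s hs => by
        rw [index, ← h0, min_eq_right (by positivity)]; ring
      have h := S.energy_growth hA (s := 0) (η := 0) le_rfl ht le_rfl le_rfl (by simpa using hσ)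
        (by linarith [S.small]) fun s hs => by rw [← hi s hs.1]; exact hle' s hs
      rw [← hi t ht, mul_zero, Real.exp_zero, one_mul, mul_zero, Real.exp_zero] at h
      nlinarith [hend t]
    · have hsm := S.small_of_pos hpos
      rcases le_total t (6 * σ / δ) with h1 | h1
      · have hi : ∀ s ∈ Icc 0 t, index δ σ s = 0 + δ / 6 * (s - 0) := fun s hs => by
          have h2 : s * δ ≤ 6 * σ := (le_div_iff₀ hδ).1 (hs.2.trans h1)
          rw [index, min_eq_left (by linarith)]; ring
        have h := S.energy_growth hA (s := 0) (η := δ / 6) le_rfl ht (by positivity) le_rfl (by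
          rw [← hi t ⟨ht, le_rfl⟩]; exact min_le_right _ _) (by linarith) fun s hs => by
            rw [← hi s hs]; exact hle' s hs
        rw [← hi t ⟨ht, le_rfl⟩, mul_zero, Real.exp_zero, one_mul, mul_zero, Real.exp_zero] at h
        nlinarith [hend t]
      -- After the index has reached σ it is frozen (η = 0). The two phases are joined at τ, where
      -- the exponential terms of the force cancel.
      · set τ := 6 * σ / δ with hτ
        have hτ0 : 0 ≤ τ := by positivity
        have hτσ : δ / 6 * τ = σ := by rw [hτ]; field_simp
        have hi : ∀ s ∈ Icc 0 τ, index δ σ s = 0 + δ / 6 * (s - 0) := fun s hs => by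
          have h2 : δ / 6 * s ≤ δ / 6 * τ := mul_le_mul_of_nonneg_left hs.2 (by positivity)
          rw [index, min_eq_left (by linarith)]; ring
        have hi2 : ∀ s, τ ≤ s → index δ σ s = σ + 0 * (s - τ) := fun s hs => by
          have h2 : δ / 6 * τ ≤ δ / 6 * s := mul_le_mul_of_nonneg_left hs (by positivity)
          rw [index, min_eq_right (by linarith)]; ring
        have h := S.energy_growth hA (s := 0) (η := δ / 6) le_rfl hτ0 (by positivity) le_rfl (by
          rw [← hi τ ⟨hτ0, le_rfl⟩]; exact min_le_right _ _) (by linarith) fun s hs => by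
            rw [← hi s hs]; exact hle' s ⟨hs.1, hs.2.trans h1⟩
        rw [zero_add, sub_zero, hτσ, mul_zero, Real.exp_zero, one_mul, mul_zero, Real.exp_zero] at h
        have h' := S.energy_growth hA (s := σ) (η := 0) hτ0 h1 le_rfl hσ (by simp)
          (by linarith) fun s hs => by
            rw [← hi2 s hs.1]; exact hle' s ⟨hτ0.trans hs.1, hs.2⟩
        rw [← hi2 t h1] at h'
        nlinarith [hend t]

lemma ysum_mono {s s' : ℝ} (h : s ≤ s') (α : ℝ) (J : Finset Z3) (c : Z3 → C3) :
    ysum α s J c ≤ ysum α s' J c := by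
  refine mul_le_mul_of_nonneg_left (Finset.sum_le_sum fun k _ => ?_) two_pi_cube_pos.le
  refine pow_le_pow_left₀ (mul_nonneg (gwt_nonneg _ _ _) (norm_nonneg _)) ?_ 2
  refine mul_le_mul_of_nonneg_right ?_ (norm_nonneg _)
  unfold gwt
  have := waveLength_nonneg k; have := wt_nonneg (2 * α) k
  gcongr

/-- Gevrey weights with nonnegative index and the factor e^{2(1-δ)t} are at least those at index 0
and time 0, so the growth bound keeps the solution inside the truncation ball. -/
lemma galerkin_norm_le (S : Setting K δ lam σ α u₀ f) {n : ℕ} {A : ℝ → ell}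
    (hA : IsMild S.le_α (radius K α δ σ) (forceSeq α f) (initSeq α u₀) (waveBall n) A)
    {t : ℝ} (ht : 0 ≤ t) : ‖A t‖ ≤ radius K α δ σ := by
  have hP := two_pi_cube_pos
  have hδ := S.δ_pos
  have h1 := S.galerkin_growth hA t ht
  have h2 : ysum α 0 (waveFin n) (scale (-2 * α) (A t)) ≤ 2 * C0 K α δ σ ^ 2 := by
    refine (ysum_mono (s' := index δ σ t) (le_min (by positivity) S.σ_nonneg) _ _ _).trans ?_
    have h3 : 1 ≤ Real.exp (2 * (1 - δ) * t) := Real.one_le_exp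
      (mul_nonneg (by linarith [S.δ_lt]) ht)
    have h4 := ysum_nonneg α (index δ σ t) (waveFin n) (scale (-2 * α) (A t))
    nlinarith [sq_nonneg (C0 K α δ σ)]
  refine le_of_sq_le_sq ?_ S.radius_pos.le
  rw [← radius_sq] at h2
  have h5 := le_of_mul_le_mul_left h2 hP
  refine le_trans (hasSum_le_of_sum_le (ell_hasSum _) fun J => ?_) h5
  have h6 : ∑ k ∈ J, ‖A t k‖ ^ 2 ≤ ∑' k, ‖A t k‖ ^ 2 :=
    (ell_summable (A t)).sum_le_tsum J fun _ _ => sq_nonneg _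
  rw [tsum_eq_sum (s := waveFin n) fun k hk => by simp [hA.coef_eq_zero t hk]] at h6
  refine h6.trans (le_of_eq (Finset.sum_congr rfl fun k hk => ?_))
  rw [scale, norm_smul, Real.norm_of_nonneg (wt_nonneg _ _), ← mul_assoc, gwt, zero_mul, Real.exp_zero,
    mul_one, wt_mul, show 2 * α + -2 * α = 0 by ring, wt_zero_left (waveFin_ne hk), one_mul]

lemma galerkin_gevrey (S : Setting K δ lam σ α u₀ f) {n : ℕ} {A : ℝ → ell}
    (hA : IsMild S.le_α (radius K α δ σ) (forceSeq α f) (initSeq α u₀) (waveBall n) A)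
    {t : ℝ} (ht : 6 * σ / δ ≤ t) : ysum α σ (waveFin n) (scale (-2 * α) (A t)) ≤
      21 / 11 * C0 K α δ σ ^ 2 * Real.exp (-2 * (1 - δ) * t) := by
  have hδ := S.δ_pos
  have ht0 : 0 ≤ t := le_trans (by have := S.σ_nonneg; positivity) ht
  have h1 := S.galerkin_growth hA t ht0
  have h2 : 6 * σ ≤ t * δ := (div_le_iff₀ hδ).1 ht
  rw [index, min_eq_right (by linarith)] at h1
  rw [show -2 * (1 - δ) * t = -(2 * (1 - δ) * t) by ring, Real.exp_neg, ← div_eq_mul_inv,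
    le_div_iff₀' (Real.exp_pos _)]
  exact h1

lemma galerkin_integral (S : Setting K δ lam σ α u₀ f) {n : ℕ} {A : ℝ → ell}
    (hA : IsMild S.le_α (radius K α δ σ) (forceSeq α f) (initSeq α u₀) (waveBall n) A)
    {t : ℝ} (ht : 6 * σ / δ ≤ t) :
    ∫ τ in t..(t + 1), ysum (α + 1 / 2) σ (waveFin n) (scale (-2 * α) (A τ)) ≤
      3 * C0 K α δ σ ^ 2 / (2 * (1 - δ)) * Real.exp (-2 * (1 - δ) * t) := by
  have hδ := S.δ_pos
  have hδ1 := S.δ_lt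
  have hlam : 0 < lam := by linarith [S.lt_lam]
  have hC := pow_pos S.C0_pos 2
  have ht0 : 0 ≤ t := le_trans (by have := S.σ_nonneg; positivity) ht
  have hexp : ∀ r, t ≤ r → Real.exp (-2 * (1 - δ) * r) ≤ 1 := fun r hr => by
    rw [show -2 * (1 - δ) * r = -(2 * (1 - δ) * r) by ring]
    exact exp_neg_le_one (by linarith) (ht0.trans hr)
  -- With μ = 0 the dissipation is retained with coefficient at least 2 - (11/10 + 18/25)δ ≥ 2(1 -
  -- δ). The right-hand side is at most (21/11 + 10/11) C₀² ≤ 3 C₀² times the exponential at t.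
  have h := S.energy hA (μ := 0) (s := σ) (η := 0) ht0 (by linarith : t ≤ t + 1) le_rfl le_rfl
    S.σ_nonneg (by simp) fun r hr => by
      have h1 := S.galerkin_gevrey hA (ht.trans hr.1)
      have h2 := hexp r hr.1
      rw [zero_mul, add_zero]
      nlinarith
  simp only [mul_zero, zero_mul, Real.exp_zero, one_mul, add_zero, sub_zero] at h
  rw [integral_exp_neg hlam.ne'] at h
  set Z := ∫ τ in t..(t + 1), ysum (α + 1 / 2) σ (waveFin n) (scale (-2 * α) (A τ)) with hZ
  have hZ0 : 0 ≤ Z := intervalIntegral.integral_nonneg (by linarith) fun τ _ => ysum_nonneg _ _ _ _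
  have hy0 := ysum_nonneg α σ (waveFin n) (scale (-2 * α) (A (t + 1)))
  have h1 := S.galerkin_gevrey hA ht
  have h2 : 2 * (1 - δ) * Z ≤ (2 * 1 - 11 / 10 * δ - 2 * (K ^ α * (Real.sqrt 2 * C0 K α δ σ))) * Z := by
    refine mul_le_mul_of_nonneg_right ?_ hZ0
    linarith [S.small]
  have h3 : (11 / 10 * δ)⁻¹ * (C1 K α δ lam σ ^ 2 *
      ((Real.exp (-2 * lam * t) - Real.exp (-2 * lam * (t + 1))) / (2 * lam))) ≤
      10 / 11 * C0 K α δ σ ^ 2 * Real.exp (-2 * (1 - δ) * t) := by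
    have h4 : C1 K α δ lam σ ^ 2 ≤ 2 * δ * lam * C0 K α δ σ ^ 2 := by
      refine S.C1_sq_le.trans ?_
      gcongr
      linarith
    have h5 : Real.exp (-2 * lam * t) - Real.exp (-2 * lam * (t + 1)) ≤
        Real.exp (-2 * (1 - δ) * t) := by
      have := Real.exp_nonneg (-2 * lam * (t + 1))
      have : Real.exp (-2 * lam * t) ≤ Real.exp (-2 * (1 - δ) * t) := by
        refine Real.exp_le_exp.2 ?_
        nlinarith [S.lt_lam]
      linarith
    calc _ ≤ (11 / 10 * δ)⁻¹ * ((2 * δ * lam * C0 K α δ σ ^ 2) *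
          (Real.exp (-2 * (1 - δ) * t) / (2 * lam))) := by
          have h6 : 0 ≤ Real.exp (-2 * lam * t) - Real.exp (-2 * lam * (t + 1)) := by
            rw [sub_nonneg]; refine Real.exp_le_exp.2 ?_; nlinarith
          gcongr
      _ = _ := by field_simp
  rw [div_mul_eq_mul_div, le_div_iff₀ (by linarith)]
  nlinarith [Real.exp_nonneg (-2 * (1 - δ) * t)]

end Setting

/-! ### Passage to the limit -/

/-- A sum of nonnegative continuous functions of single coordinates; infinite values are allowed, so
norms stronger than that of `ell` are covered. -/
lemma lowerSemicontinuous_gsum (α' s p : ℝ) :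
    LowerSemicontinuous fun x : ell => ENNReal.ofReal ((2 * Real.pi) ^ 3) * gsum α' s (scale p x) := by
  have h1 : LowerSemicontinuous fun x : ell => ∑' k, ENNReal.ofReal ((2 * Real.pi) ^ 3) *
      ENNReal.ofReal ((gwt α' s k * ‖scale p x k‖) ^ 2) := by
    refine lowerSemicontinuous_tsum fun k => Continuous.lowerSemicontinuous ?_
    have h0 : Continuous fun x : ell => scale p x k := (continuous_ell_apply k).const_smul (wt p k)
    have h2 : Continuous fun x : ell => ENNReal.ofReal ((gwt α' s k * ‖scale p x k‖) ^ 2) :=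
      ENNReal.continuous_ofReal.comp ((continuous_const.mul h0.norm).pow 2)
    exact ENNReal.continuous_const_mul ENNReal.ofReal_ne_top |>.comp h2
  refine cast (congrArg _ (funext fun x => ?_)) h1
  rw [ENNReal.tsum_mul_left, gsum]
  simp only [gsum_term]

lemma gevreyNorm_toV_sq {α : ℝ} (hα : 1 / 2 ≤ α) (α' s : ℝ) {x : ell} (hx : Adm x) :
    gevreyNorm α' s (field (toV hα x)) ^ 2 =
      ENNReal.ofReal ((2 * Real.pi) ^ 3) * gsum α' s (scale (-2 * α) x) := by
  rw [gevreyNorm_sq, fourier_toV hα hx]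

/-- The weights |k|^{2α} and |k|^{-2α} cancel. Continuity in 𝒟(A^α) is thus continuity in `ell`. -/
lemma gevreyNorm_toV {α : ℝ} (hα : 1 / 2 ≤ α) {x : ell} (hx : Adm x) :
    gevreyNorm α 0 (field (toV hα x)) = ENNReal.ofReal (Real.sqrt ((2 * Real.pi) ^ 3) * ‖x‖) := by
  have h1 : ∀ k, (gwt α 0 k * ‖scale (-2 * α) x k‖) ^ 2 = ‖x k‖ ^ 2 := fun k => by
    by_cases hk : k = 0
    · rw [hk, hx.zero, scale_zero_right]; simp
    · rw [scale, norm_smul, Real.norm_of_nonneg (wt_nonneg _ _), ← mul_assoc, gwt, zero_mul,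
        Real.exp_zero, mul_one, wt_mul, show 2 * α + -2 * α = 0 by ring, wt_zero_left hk, one_mul]
  have h2 : gsum α 0 (scale (-2 * α) x) = ENNReal.ofReal (‖x‖ ^ 2) := by
    rw [gsum_eq_ofReal (by simpa only [h1] using ell_summable x)]
    simp only [h1]
    rw [(ell_hasSum x).tsum_eq]
  have h3 : gevreyNorm α 0 (field (toV hα x)) ^ 2 =
      ENNReal.ofReal (Real.sqrt ((2 * Real.pi) ^ 3) * ‖x‖) ^ 2 := by
    rw [gevreyNorm_toV_sq hα _ _ hx, h2, ← ENNReal.ofReal_mul two_pi_cube_pos.le,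
      ← ENNReal.ofReal_pow (by positivity), mul_pow (Real.sqrt _), Real.sq_sqrt two_pi_cube_pos.le]
  exact le_antisymm (ENNReal_le_of_sq_le_sq h3.le) (ENNReal_le_of_sq_le_sq h3.ge)

/-- The field with rescaled coefficients `a t`. -/
def sol {α : ℝ} (hα : 1 / 2 ≤ α) (a : ℝ → ell) (t : ℝ) : H := ⟨field (toV hα (a t)), field_mem_H _⟩

lemma field_sub (p q : V) : field (p - q) = field p - field q := rfl

lemma continuousInDomain_sol {α : ℝ} (hα : 1 / 2 ≤ α) {a : ℝ → ell} (hc : Continuous a)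
    (ha : ∀ t, Adm (a t)) : ContinuousInDomain α (sol hα a) := by
  refine ⟨fun t _ => ?_, fun t _ => ?_⟩
  · change gevreyNorm α 0 (field (toV hα (a t))) < ⊤
    rw [gevreyNorm_toV hα (ha t)]; exact ENNReal.ofReal_lt_top
  · have h1 : ∀ s, gevreyNorm α 0 ((sol hα a s : L2) - (sol hα a t : L2)) =
        ENNReal.ofReal (Real.sqrt ((2 * Real.pi) ^ 3) * ‖a s - a t‖) := fun s => by
      change gevreyNorm α 0 (field (toV hα (a s)) - field (toV hα (a t))) = _
      rw [← field_sub, ← map_sub, gevreyNorm_toV hα (((ha s).sub (ha t) : Adm _))]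
    simp only [h1]
    have h2 : Continuous fun s => ENNReal.ofReal (Real.sqrt ((2 * Real.pi) ^ 3) * ‖a s - a t‖) :=
      ENNReal.continuous_ofReal.comp (by fun_prop)
    have h3 := h2.tendsto t
    rw [sub_self, norm_zero, mul_zero, ENNReal.ofReal_zero] at h3
    exact h3.mono_left nhdsWithin_le_nhds

/-- The mild solution `a` of the truncated problem as a limit of Galerkin approximations. -/
structure Approx {α : ℝ} (hα : 1 / 2 ≤ α) (K δ σ : ℝ) (u₀ : H) (f : ℝ → H) (a : ℝ → ell)
    (A : ℕ → ℝ → ell) : Prop where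
  mild : IsMild hα (radius K α δ σ) (forceSeq α f) (initSeq α u₀) univ a
  galerkin : ∀ n, IsMild hα (radius K α δ σ) (forceSeq α f) (initSeq α u₀) (waveBall n) (A n)
  tendsto : ∀ t, Tendsto (fun n => A n t) atTop (𝓝 (a t))

namespace Setting

variable {K δ lam σ α : ℝ} {u₀ : H} {f : ℝ → H}

lemma exists_approx (S : Setting K δ lam σ α u₀ f) :
    ∃ a A, Approx S.le_α K δ σ u₀ f a A := by
  obtain ⟨a, A, h1, h2, h3⟩ := exists_isMild S.le_α S.radius_pos S.growth (adm_forceSeq α f)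
    (adm_initSeq α u₀)
  exact ⟨a, A, h1, h2, h3⟩

variable {a : ℝ → ell} {A : ℕ → ℝ → ell}

lemma norm_le (S : Setting K δ lam σ α u₀ f) (h : Approx S.le_α K δ σ u₀ f a A) {t : ℝ} (ht : 0 ≤ t) :
    ‖a t‖ ≤ radius K α δ σ :=
  le_of_tendsto (h.tendsto t).norm (Eventually.of_forall fun n => S.galerkin_norm_le (h.galerkin n) ht)

lemma sol_zero (S : Setting K δ lam σ α u₀ f) (h : Approx S.le_α K δ σ u₀ f a A) :
    sol S.le_α a 0 = u₀ := by
  apply Subtype.ext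
  refine eq_of_fourier_eq (mem_trigClosure_of_mem_H (field_mem_H _)) (mem_trigClosure_of_mem_H u₀.2)
    fun k => ?_
  change fourierCoeffVec (field (toV S.le_α (a 0))) k = _
  rw [fourier_toV S.le_α (h.mild.adm 0)]
  by_cases hk : k = 0
  · rw [hk, scale_zero_right, (adm_of_mem_H u₀.2).zero]
  · have h0 : a 0 k = initSeq α u₀ k := by
      rw [h.mild.eq 0 le_rfl k (mem_univ k), duh]; simp
    rw [scale, h0, initSeq, toEll_apply S.init_summable, scale, smul_smul, wt_mul,
      show -2 * α + 2 * α = 0 by ring, wt_zero_left hk, one_smul]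

lemma gevrey_galerkin (S : Setting K δ lam σ α u₀ f) (h : Approx S.le_α K δ σ u₀ f a A) (α' s : ℝ)
    (n : ℕ) (t : ℝ) : ENNReal.ofReal ((2 * Real.pi) ^ 3) * gsum α' s (scale (-2 * α) (A n t)) =
      ENNReal.ofReal (ysum α' s (waveFin n) (scale (-2 * α) (A n t))) := by
  rw [ysum_eq_gsum (J := waveFin n), ← ENNReal.ofReal_mul two_pi_cube_pos.le]; rfl
  intro k hk
  rw [scale, (h.galerkin n).coef_eq_zero t hk, smul_zero]

lemma gevrey_le_liminf (S : Setting K δ lam σ α u₀ f) (h : Approx S.le_α K δ σ u₀ f a A) (α' s t : ℝ) :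
    gevreyNorm α' s (sol S.le_α a t) ^ 2 ≤
      liminf (fun n => ENNReal.ofReal (ysum α' s (waveFin n) (scale (-2 * α) (A n t)))) atTop := by
  have h1 := (lowerSemicontinuous_gsum α' s (-2 * α)).le_liminf (a t)
  change gevreyNorm α' s (field (toV S.le_α (a t))) ^ 2 ≤ _
  rw [gevreyNorm_toV_sq S.le_α _ _ (h.mild.adm t)]
  refine h1.trans ?_
  simp only [← S.gevrey_galerkin h]
  exact (liminf_le_liminf_of_le (h.tendsto t)).trans (le_of_eq rfl)

lemma gevrey_le (S : Setting K δ lam σ α u₀ f) (h : Approx S.le_α K δ σ u₀ f a A) {α' s t C : ℝ}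
    (hC : 0 ≤ C) (hb : ∀ n, ysum α' s (waveFin n) (scale (-2 * α) (A n t)) ≤ C ^ 2) :
    gevreyNorm α' s (sol S.le_α a t) ≤ ENNReal.ofReal C := by
  refine ENNReal_le_of_sq_le_sq ((S.gevrey_le_liminf h α' s t).trans ?_)
  rw [← ENNReal.ofReal_pow hC]
  refine (liminf_le_liminf (Eventually.of_forall fun n => ENNReal.ofReal_le_ofReal (hb n))).trans ?_
  rw [liminf_const]

lemma continuous_ysum (S : Setting K δ lam σ α u₀ f) (h : Approx S.le_α K δ σ u₀ f a A) (α' s : ℝ)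
    (n : ℕ) : Continuous fun t => ysum α' s (waveFin n) (scale (-2 * α) (A n t)) := by
  have hc : ∀ k, Continuous fun t => scale (-2 * α) (A n t) k := fun k =>
      ((continuous_ell_apply k).comp (h.galerkin n).continuous).const_smul (wt (-2 * α) k)
  unfold ysum
  exact continuous_const.mul (continuous_finsetSum _ fun k _ => (continuous_const.mul (hc k).norm).pow 2)

/-- Lower semicontinuity at each time followed by Fatou's lemma in time. -/
lemma lintegral_gevrey_le (S : Setting K δ lam σ α u₀ f) (h : Approx S.le_α K δ σ u₀ f a A)
    {α' s r t C : ℝ} (hrt : r ≤ t)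
    (hb : ∀ n, ∫ τ in r..t, ysum α' s (waveFin n) (scale (-2 * α) (A n τ)) ≤ C) :
    ∫⁻ τ in Icc r t, gevreyNorm α' s (sol S.le_α a τ) ^ 2 ≤ ENNReal.ofReal C := by
  refine (lintegral_mono fun τ => S.gevrey_le_liminf h α' s τ).trans ?_
  refine (lintegral_liminf_le fun n => ?_).trans ?_
  · exact (ENNReal.continuous_ofReal.comp (S.continuous_ysum h α' s n)).measurable
  · refine (liminf_le_liminf (Eventually.of_forall fun n => ?_)).trans
      (liminf_const (f := atTop) (ENNReal.ofReal C)).le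
    rw [← ofReal_integral_eq_lintegral_ofReal]
    · refine ENNReal.ofReal_le_ofReal ?_
      rw [integral_Icc_eq_integral_Ioc, ← intervalIntegral.integral_of_le hrt]
      exact hb n
    · exact (S.continuous_ysum h α' s n).integrableOn_Icc
    · exact Eventually.of_forall fun τ => ysum_nonneg _ _ _ _

lemma gevrey_sol_le (S : Setting K δ lam σ α u₀ f) (h : Approx S.le_α K δ σ u₀ f a A) {t : ℝ}
    (ht : 6 * σ / δ ≤ t) : gevreyNorm α σ (sol S.le_α a t) ≤
      ENNReal.ofReal (Real.sqrt 2 * C0 K α δ σ * Real.exp (-(1 - δ) * t)) := by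
  have hC := S.C0_pos
  refine S.gevrey_le h (by positivity) fun n => (S.galerkin_gevrey (h.galerkin n) ht).trans ?_
  rw [mul_pow (_ * _), mul_pow (Real.sqrt 2), Real.sq_sqrt (by norm_num : (0 : ℝ) ≤ 2),
    ← Real.exp_nat_mul, show ((2 : ℕ) : ℝ) * (-(1 - δ) * t) = -2 * (1 - δ) * t by push_cast; ring]
  refine mul_le_mul_of_nonneg_right ?_ (Real.exp_nonneg _)
  nlinarith

lemma lintegral_gevrey_sol_le (S : Setting K δ lam σ α u₀ f) (h : Approx S.le_α K δ σ u₀ f a A)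
    {t : ℝ} (ht : 6 * σ / δ ≤ t) :
    ∫⁻ τ in Icc t (t + 1), gevreyNorm (α + 1 / 2) σ (sol S.le_α a τ) ^ 2 ≤
      ENNReal.ofReal (3 * C0 K α δ σ ^ 2 / (2 * (1 - δ)) * Real.exp (-2 * (1 - δ) * t)) :=
  S.lintegral_gevrey_le h (by linarith) fun n => S.galerkin_integral (h.galerkin n) ht

/-- The energy estimate from time zero with constant index 0 and μ = 0. Its constant is independent
of n, which puts the limit in 𝒟(A^{α+1/2}) at almost every time; there the trilinear form is given
by `beta`. -/
lemma galerkin_integral_zero (S : Setting K δ lam σ α u₀ f) {T : ℝ} (hT : 0 ≤ T) :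
    ∃ C, ∀ n (B : ℝ → ell),
      IsMild S.le_α (radius K α δ σ) (forceSeq α f) (initSeq α u₀) (waveBall n) B →
      ∫ τ in (0 : ℝ)..T, ysum (α + 1 / 2) 0 (waveFin n) (scale (-2 * α) (B τ)) ≤ C := by
  set D := C0 K α δ σ ^ 2 + (11 / 10 * δ)⁻¹ *
    (C1 K α δ lam σ ^ 2 * ∫ t in (0 : ℝ)..T, Real.exp (-2 * (lam - 0) * t)) with hD
  refine ⟨D / (1 / 10), fun n B hB => ?_⟩
  have hδ := S.δ_pos
  have h := S.energy hB (μ := 0) (s := 0) (η := 0) le_rfl hT le_rfl le_rfl le_rfl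
    (by simpa using S.σ_nonneg) fun r hr => by
      have h1 := S.galerkin_norm_le hB hr.1
      have h2 : ysum α 0 (waveFin n) (scale (-2 * α) (B r)) ≤ (2 * Real.pi) ^ 3 * ‖B r‖ ^ 2 := by
        refine mul_le_mul_of_nonneg_left ?_ two_pi_cube_pos.le
        refine le_trans (le_of_eq (Finset.sum_congr rfl fun k hk => ?_)) (ell_sum_le (B r) (waveFin n))
        rw [scale, norm_smul, Real.norm_of_nonneg (wt_nonneg _ _), ← mul_assoc, gwt, zero_mul,
          Real.exp_zero, mul_one, wt_mul, show 2 * α + -2 * α = 0 by ring,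
          wt_zero_left (waveFin_ne hk), one_mul]
      rw [zero_mul, add_zero, ← radius_sq]
      refine h2.trans (mul_le_mul_of_nonneg_left ?_ two_pi_cube_pos.le)
      exact pow_le_pow_left₀ (norm_nonneg _) h1 2
  simp only [mul_zero, zero_mul, Real.exp_zero, one_mul, add_zero] at h
  have h3 := S.init_ysum hB
  have h4 := ysum_nonneg α 0 (waveFin n) (scale (-2 * α) (B T))
  have h5 : 0 ≤ ∫ τ in (0 : ℝ)..T, ysum (α + 1 / 2) 0 (waveFin n) (scale (-2 * α) (B τ)) :=
    intervalIntegral.integral_nonneg hT fun τ _ => ysum_nonneg _ _ _ _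
  have h6 := mul_le_mul_of_nonneg_right (show (1 / 10 : ℝ) ≤ 2 * (1 - 0) - 0 - 11 / 10 * δ -
    2 * (K ^ α * (Real.sqrt 2 * C0 K α δ σ)) by linarith [S.small, S.δ_lt]) h5
  rw [le_div_iff₀ (by norm_num)]
  linarith

lemma ae_gevrey_lt_top (S : Setting K δ lam σ α u₀ f) (h : Approx S.le_α K δ σ u₀ f a A) :
    ∀ᵐ t ∂(volume.restrict (Ici (0 : ℝ))), gevreyNorm (α + 1 / 2) 0 (sol S.le_α a t) < ⊤ := by
  have h1 : Ici (0 : ℝ) = ⋃ n : ℕ, Icc 0 (n : ℝ) := by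
    ext t
    simp only [mem_Ici, mem_iUnion, mem_Icc]
    exact ⟨fun ht => (exists_nat_ge t).imp fun n hn => ⟨ht, hn⟩, fun ⟨n, hn⟩ => hn.1⟩
  rw [h1, ae_restrict_iUnion_iff]
  intro n
  obtain ⟨C, hC⟩ := S.galerkin_integral_zero (Nat.cast_nonneg n)
  have h2 := S.lintegral_gevrey_le h (Nat.cast_nonneg n) fun m => hC m (A m) (h.galerkin m)
  have h3 : Measurable fun t => gevreyNorm (α + 1 / 2) 0 (sol S.le_α a t) ^ 2 := by
    have h4 := ((lowerSemicontinuous_gsum (α + 1 / 2) 0 (-2 * α)).comp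
      h.mild.continuous).measurable
    refine cast (congrArg _ (funext fun t => ?_)) h4
    exact (gevreyNorm_toV_sq S.le_α (α + 1 / 2) 0 (h.mild.adm t)).symm
  filter_upwards [ae_lt_top h3 (h2.trans_lt ENNReal.ofReal_lt_top).ne] with t ht
  by_contra hc
  rw [not_lt, top_le_iff] at hc
  rw [hc] at ht
  simp at ht

end Setting

/-! ### Linear functionals on `V` -/

/-- The embedding of `V` into `L²` as a continuous linear map. -/
def fieldL : V →L[ℝ] L2 where
  toFun := field
  map_add' _ _ := rfl
  map_smul' _ _ := rfl
  cont := by unfold field; fun_prop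

/-- The gradient as a continuous linear map. -/
def gradL : V →L[ℝ] PiLp 2 (fun _ : Fin 3 => L2) where
  toFun := grad
  map_add' _ _ := rfl
  map_smul' _ _ := rfl
  cont := by unfold grad; fun_prop

lemma abs_inv_bessel_wt_le {α : ℝ} (hα : 1 / 2 ≤ α) (k : Z3) :
    |wt (7 / 4 - 2 * α) k * (bessel k)⁻¹| ≤ 1 := by
  have hb := bessel_pos k
  rw [abs_of_nonneg (mul_nonneg (wt_nonneg _ _) (inv_nonneg.2 hb.le)), ← div_eq_mul_inv, div_le_one hb]
  refine (wt_mono (show 7 / 4 - 2 * α ≤ 1 by linarith) k).trans ?_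
  rw [wt_one]
  exact Real.le_sqrt_of_sq_le (by linarith)

/-- The rescaled coefficients of an element of `V`, dual to those of the nonlinearity. -/
def dualL {α : ℝ} (hα : 1 / 2 ≤ α) : V →L[ℝ] ell :=
  (diag (fun k => wt (7 / 4 - 2 * α) k * (bessel k)⁻¹) 1 (abs_inv_bessel_wt_le hα)).comp fourierV

lemma dualL_apply {α : ℝ} (hα : 1 / 2 ≤ α) (z : V) (k : Z3) :
    dualL hα z k = wt (7 / 4 - 2 * α) k • fourierCoeffVec (field z) k := by
  change diag _ 1 (abs_inv_bessel_wt_le hα) (fourierV z) k = _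
  rw [diag_apply, fourierV_apply, smul_smul, inv_mul_cancel_right₀ (bessel_pos k).ne']

/-- The Riesz representative of Λ has vanishing coefficients, hence vanishing norm. Identities in V'
may therefore be checked on single modes. -/
lemma eq_zero_of_modeV {Λ : VDual} (h : ∀ (k : Z3) (hk : k ≠ 0) (b : C3) (hb : dotZ k b = 0),
    Λ (modeV hk hb) = 0) : Λ = 0 := by
  set p : V := (InnerProductSpace.toDual ℝ V).symm Λ with hp
  have h1 : ∀ z, inner ℝ p z = Λ z := fun z => InnerProductSpace.toDual_symm_apply
  have h2 : ∀ k, fourierCoeffVec (field p) k = 0 := fun k => by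
    by_cases hk : k = 0
    · rw [hk, fourier_field_zero]
    · refine eq_of_inner_eq ((adm_of_mem_H (field_mem_H p)).div k) (dotZ_zero k) fun b hb => ?_
      have h3 := h k hk b hb
      rw [← h1, inner_V, inner_field_modeV, inner_grad_modeV] at h3
      rw [inner_zero_left]
      have h4 : (2 * Real.pi) ^ 3 * (1 + waveLength k ^ 2) *
          inner ℝ (fourierCoeffVec (field p) k) b = 0 := by linarith
      have h5 : (2 * Real.pi) ^ 3 * (1 + waveLength k ^ 2) ≠ 0 :=
        (mul_pos two_pi_cube_pos (by positivity)).ne'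
      exact (mul_eq_zero.1 h4).resolve_left h5
  have h3 := hasSum_inner_V p p
  simp only [h2, smul_zero, inner_zero_left, mul_zero] at h3
  have h4 : inner ℝ p p = (0 : ℝ) := h3.unique hasSum_zero
  have h5 : p = 0 := inner_self_eq_zero.1 h4
  ext z
  rw [← h1, h5, inner_zero_left]; rfl

/-- On fields of finite Gevrey norm the trilinear form is given by `beta`. -/
lemma trilinear_toV {α : ℝ} (hα : 1 / 2 ≤ α) {x : ell} (hx : Adm x)
    (h : gevreyNorm (α + 1 / 2) 0 (field (toV hα x)) < ⊤) (z : V) :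
    trilinear (toV hα x) (toV hα x) z = (2 * Real.pi) ^ 3 * inner ℝ (beta hα x x) (dualL hα z) := by
  rw [gsum_lt_top_iff] at h
  obtain ⟨w, hw⟩ := exists_repr_trilinear
    (summable_norm_of_gsum (by linarith) le_rfl (fourier_field_zero _) h) (toV hα x)
  rw [← hw]
  refine (hasSum_inner_fourier (mem_trigClosure_of_mem_H w.2) (field z)).unique ?_
  have h1 := (lp.hasSum_inner (𝕜 := ℝ) (beta hα x x) (dualL hα z)).mul_left ((2 * Real.pi) ^ 3)
  refine cast (congrArg (fun g => HasSum g _) (funext fun k => ?_)) h1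
  congr 1
  rw [fourier_of_trilinear hw, fourier_toV hα hx, beta_apply, dualL_apply, betaSeq, scale]
  by_cases hk : k = 0
  · simp [hk, fourier_field_zero]
  · rw [real_inner_smul_left, real_inner_smul_right, ← mul_assoc, wt_mul,
      show 2 * α - 7 / 4 + (7 / 4 - 2 * α) = 0 by ring, wt_zero_left hk, one_mul]

/-! ### The time derivative of the solution -/

/-- The time derivative of the solution with rescaled coefficients `a`. -/
def solDeriv {α : ℝ} (hα : 1 / 2 ≤ α) (f : ℝ → H) (a : ℝ → ell) (t : ℝ) : VDual :=
  (innerSL ℝ (f t : L2)).comp fieldL - (innerSL ℝ (grad (toV hα (a t)))).comp gradL -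
    (innerSL ℝ ((2 * Real.pi) ^ 3 • beta hα (a t) (a t))).comp (dualL hα)

lemma solDeriv_apply {α : ℝ} (hα : 1 / 2 ≤ α) (f : ℝ → H) (a : ℝ → ell) (t : ℝ) (v : V) :
    solDeriv hα f a t v = inner ℝ (f t : L2) (field v) - inner ℝ (grad (toV hα (a t))) (grad v) -
      (2 * Real.pi) ^ 3 * inner ℝ (beta hα (a t) (a t)) (dualL hα v) := by
  rw [← real_inner_smul_left]; rfl

lemma memLpLoc_of_continuous {X : Type*} [NormedAddCommGroup X] {g : ℝ → X}
    (hg : Continuous g) (p : ℝ≥0∞) : MemLpLoc p g := by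
  intro T _
  obtain ⟨C, hC⟩ := isCompact_Icc.exists_bound_of_continuousOn (hg.continuousOn (s := Icc 0 T))
  refine MemLp.of_bound (hg.continuousOn.aestronglyMeasurable_of_isCompact isCompact_Icc
    measurableSet_Icc) C ?_
  filter_upwards [self_mem_ae_restrict measurableSet_Icc] with t ht using hC t ht

lemma MemLpLoc.sub {X : Type*} [NormedAddCommGroup X] {p : ℝ≥0∞} {g h : ℝ → X} (hg : MemLpLoc p g)
    (hh : MemLpLoc p h) : MemLpLoc p (fun t => g t - h t) :=
  fun T hT => (hg T hT).sub (hh T hT)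

lemma MemLpLoc.comp_of_norm_le {X Y : Type*} [NormedAddCommGroup X] [NormedAddCommGroup Y] {g : ℝ → X}
    (hg : MemLpLoc ⊤ g) {L : X → Y} (hL : Continuous L) {C : ℝ} (hC : ∀ x, ‖L x‖ ≤ C * ‖x‖)
    (p : ℝ≥0∞) : MemLpLoc p (fun t => L (g t)) := fun T hT =>
  ((hg T hT).of_le_mul (c := C) (hL.comp_aestronglyMeasurable (hg T hT).aestronglyMeasurable)
    (Eventually.of_forall fun t => hC (g t))).mono_exponent le_top

/-- A single vector `I` computes the integrals for all functionals at once, which permits arguing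
with the primitive in V' instead of one test field at a time. -/
lemma MemLpLoc.exists_primitive {X : Type*} [NormedAddCommGroup X] [NormedSpace ℝ X] [CompleteSpace X]
    {g : ℝ → X} (hg : MemLpLoc 1 g) {t T : ℝ} (hT : 0 < T) (ht : t ∈ Icc 0 T) :
    ∃ I : X, ∀ L : X →L[ℝ] ℝ, IntervalIntegrable (fun s => L (g s)) volume 0 T ∧
      L I = ∫ s in (0 : ℝ)..t, L (g s) := by
  have hi : IntervalIntegrable g volume 0 T := by
    rw [intervalIntegrable_iff_integrableOn_Icc_of_le hT.le]
    exact memLp_one_iff_integrable.1 (hg T hT)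
  have hi' : IntervalIntegrable g volume 0 t := by
    refine hi.mono_set ?_
    rw [uIcc_of_le ht.1, uIcc_of_le hT.le]; exact Icc_subset_Icc_right ht.2
  refine ⟨∫ s in (0 : ℝ)..t, g s, fun L => ⟨?_, (L.intervalIntegral_comp_comm hi').symm⟩⟩
  rw [intervalIntegrable_iff] at hi ⊢
  exact L.integrable_comp hi

lemma continuous_innerSL_comp {X Y : Type*} [NormedAddCommGroup X] [InnerProductSpace ℝ X]
    [NormedAddCommGroup Y] [NormedSpace ℝ Y] (L : Y →L[ℝ] X) :
    Continuous fun x : X => (innerSL ℝ x).comp L :=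
  (innerSL ℝ).continuous.clm_comp continuous_const

lemma memLpLoc_solDeriv {α : ℝ} (hα : 1 / 2 ≤ α) {f : ℝ → H} (hf : MemLpLoc ⊤ f) {a : ℝ → ell}
    (ha : Continuous a) (p : ℝ≥0∞) : MemLpLoc p (solDeriv hα f a) := by
  have h2 : Continuous fun t => (innerSL ℝ (grad (toV hα (a t)))).comp gradL :=
    (continuous_innerSL_comp gradL).comp (gradL.continuous.comp ((toV hα).continuous.comp ha))
  have h3 : Continuous fun t =>
      (innerSL ℝ ((2 * Real.pi) ^ 3 • beta hα (a t) (a t))).comp (dualL hα) := by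
    have h0 : Continuous fun t => beta hα (a t) (a t) :=
      ((beta hα).continuous.comp ha).clm_apply ha
    exact (continuous_innerSL_comp (dualL hα)).comp (h0.const_smul ((2 * Real.pi) ^ 3))
  refine MemLpLoc.sub (MemLpLoc.sub ?_ (memLpLoc_of_continuous h2 p)) (memLpLoc_of_continuous h3 p)
  have h4 : Continuous fun w : H => (innerSL ℝ (w : L2)).comp fieldL :=
    (continuous_innerSL_comp fieldL).comp continuous_subtype_val
  refine MemLpLoc.comp_of_norm_le (X := H) (Y := VDual)
    (L := fun w : H => (innerSL ℝ (w : L2)).comp fieldL) hf h4 (C := ‖fieldL‖) (fun w => ?_) p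
  refine (ContinuousLinearMap.opNorm_comp_le _ _).trans ?_
  rw [innerSL_apply_norm, mul_comm]; rfl

lemma IsPrim.const_mul {x z : ℝ → ℝ} {a b : ℝ} (h : IsPrim x z a b) (r : ℝ) :
    IsPrim (fun t => r * x t) (fun t => r * z t) a b :=
  ⟨h.1.const_mul r, fun t ht => by
    simp only [h.2 t ht, intervalIntegral.integral_const_mul]; ring⟩

lemma inner_beta_dualL_modeV {α : ℝ} (hα : 1 / 2 ≤ α) {x : ell} (hx : Adm x) {k : Z3} (hk : k ≠ 0)
    {b : C3} (hb : dotZ k b = 0) : inner ℝ (beta hα x x) (dualL hα (modeV hk hb)) =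
      inner ℝ (convB (scale (-2 * α) x) (scale (-2 * α) x) k) b := by
  rw [lp.inner_eq_tsum]
  simp only [dualL_apply]
  have h := tsum_inner_modeV (adm_betaSeq α hx hx) hk hb (wt (7 / 4 - 2 * α)) (wt_neg _ k)
  refine (show _ = _ from h).trans ?_
  rw [betaSeq, scale, real_inner_smul_left, ← mul_assoc, wt_mul, show 7 / 4 - 2 * α + (2 * α - 7 / 4) = 0 by ring,
    wt_zero_left hk, one_mul]

/-! ### Weak solutions -/

/-- Product rule with the test function on [0, T], where T lies beyond its support; the boundary
terms vanish. -/
lemma hasDistribDeriv_of_isPrim {y z : ℝ → ℝ} (h : ∀ T, 0 < T → IsPrim y z 0 T) :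
    HasDistribDeriv y z := by
  intro φ hφ hc hs
  obtain ⟨T, hT, hsub⟩ : ∃ T, 0 < T ∧ tsupport φ ⊆ Iio T := by
    obtain ⟨M, hM⟩ := hc.isCompact.bddAbove
    exact ⟨max M 0 + 1, by positivity, fun x hx =>
      lt_of_le_of_lt ((hM hx).trans (le_max_left _ _)) (lt_add_one _)⟩
  have hd : Differentiable ℝ φ := hφ.differentiable (by simp)
  have hd' : Continuous (deriv φ) := hφ.continuous_deriv (by simp)
  have h1 : IsPrim φ (deriv φ) 0 T := isPrim_of_hasDerivAt (fun t => (hd t).hasDerivAt) hd'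
  have h2 := (h1.mul hT.le (h T hT)).eq_integral hT.le
  have hz : ∀ t, t ≤ 0 ∨ T ≤ t → φ t = 0 := fun t ht => image_eq_zero_of_notMem_tsupport fun hm => by
    rcases ht with ht | ht
    · exact absurd (hs hm) (not_lt.2 ht)
    · exact absurd (hsub hm) (not_lt.2 ht)
  have hz' : ∀ t, T < t → deriv φ t = 0 := fun t ht => by
    have : φ =ᶠ[𝓝 t] fun _ => 0 := by
      filter_upwards [Ioi_mem_nhds ht] with s hs' using hz s (Or.inr hs'.le)
    rw [this.deriv_eq, deriv_const]
  have hI : ∀ g : ℝ → ℝ, (∀ t, T < t → g t = 0) → ∫ t in Ioi (0 : ℝ), g t = ∫ t in (0 : ℝ)..T, g t := by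
    intro g hg
    rw [intervalIntegral.integral_of_le hT.le]
    refine (setIntegral_eq_of_subset_of_forall_diff_eq_zero measurableSet_Ioi Ioc_subset_Ioi_self
      fun t ht => hg t ?_).trans rfl
    by_contra hc'
    exact ht.2 ⟨ht.1, not_lt.1 hc'⟩
  have hy := h T hT
  have hyc : ContinuousOn y (uIcc 0 T) := by
    have h3 := (IsPrim.ae_hasDerivAt_aux hy.1 (y 0) hT.le).1.continuousOn
    refine h3.congr fun t ht => ?_
    rw [uIcc_of_le hT.le] at ht
    exact hy.2 t ht
  rw [hI _ fun t ht => by rw [hz' t ht, zero_mul], hI _ fun t ht => by rw [hz t (Or.inr ht.le), zero_mul]]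
  rw [hz T (Or.inr le_rfl), hz 0 (Or.inl le_rfl), zero_mul, zero_mul, zero_add,
    intervalIntegral.integral_add] at h2
  · linarith
  · exact (hd'.continuousOn.mul hyc).intervalIntegrable
  · exact hy.1.continuousOn_mul hφ.continuous.continuousOn

namespace Setting

variable {K δ lam σ α : ℝ} {u₀ : H} {f : ℝ → H} {a : ℝ → ell} {A : ℕ → ℝ → ell}

/-- The limit stays in the truncation ball, so the retraction factor is 1 and the true equation
remains. -/
lemma isPrim_modeV (S : Setting K δ lam σ α u₀ f) (h : Approx S.le_α K δ σ u₀ f a A) {k : Z3}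
    (hk : k ≠ 0) {b : C3} (hb : dotZ k b = 0) {T : ℝ} (hT : 0 ≤ T) :
    IsPrim (fun t => inner ℝ (sol S.le_α a t : L2) (field (modeV hk hb)))
      (fun t => solDeriv S.le_α f a t (modeV hk hb)) 0 T := by
  refine ((h.mild.isPrim S.radius_pos S.growth (mem_univ k) b hT).const_mul ((2 * Real.pi) ^ 3)).congr
    (fun t _ => ?_) (fun t ht => ?_) hT
  · change inner ℝ (field (toV S.le_α (a t))) _ = _
    rw [inner_field_modeV, fourier_toV S.le_α (h.mild.adm t), real_inner_comm]
  · rw [solDeriv_apply, inner_field_modeV, inner_grad_modeV, fourier_toV S.le_α (h.mild.adm t),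
      inner_beta_dualL_modeV S.le_α (h.mild.adm t), S.scale_forceSeq ht.1,
      retractFactor_of_le S.radius_pos (S.norm_le h ht.1), one_pow, one_smul, inner_sub_right,
      real_inner_comm b, real_inner_comm b, real_inner_comm b]
    ring

lemma isPrim_sol (S : Setting K δ lam σ α u₀ f) (h : Approx S.le_α K δ σ u₀ f a A) (v : V) {T : ℝ}
    (hT : 0 < T) : IsPrim (fun t => inner ℝ (sol S.le_α a t : L2) (field v))
      (fun t => solDeriv S.le_α f a t v) 0 T := by
  have hprim : ∀ t ∈ Icc 0 T, ∃ I : VDual, ∀ v : V,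
      IntervalIntegrable (fun s => solDeriv S.le_α f a s v) volume 0 T ∧
      I v = ∫ s in (0 : ℝ)..t, solDeriv S.le_α f a s v := fun t ht => by
    obtain ⟨I, hI⟩ := (memLpLoc_solDeriv S.le_α S.memLp h.mild.continuous 1).exists_primitive hT ht
    exact ⟨I, fun v => hI (ContinuousLinearMap.apply ℝ ℝ v)⟩
  refine ⟨((hprim T ⟨hT.le, le_rfl⟩).choose_spec v).1, fun t ht => ?_⟩
  · obtain ⟨I, hI⟩ := hprim t ht
    have happ := fun v => (hI v).2
    -- The increment of the solution and the integral of its derivative agree as functionals on `V`,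
    -- because they agree on modes.
    have h1 : (innerSL ℝ ((sol S.le_α a t : L2) - (sol S.le_α a 0 : L2))).comp fieldL -
        I = 0 := by
      refine eq_zero_of_modeV fun k hk b hb => ?_
      have h2 := (S.isPrim_modeV h hk hb hT.le).2 t ht
      rw [ContinuousLinearMap.sub_apply, happ]
      change inner ℝ ((sol S.le_α a t : L2) - (sol S.le_α a 0 : L2)) (field (modeV hk hb)) - _ = 0
      rw [inner_sub_left, sub_sub, sub_eq_zero]; exact h2
    have h3 := congrArg (fun Λ : VDual => Λ v) h1
    change inner ℝ ((sol S.le_α a t : L2) - (sol S.le_α a 0 : L2)) (field v) -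
      I v = 0 at h3
    rw [happ, inner_sub_left] at h3
    linarith

lemma isWeakSolution (S : Setting K δ lam σ α u₀ f) (h : Approx S.le_α K δ σ u₀ f a A) :
    IsWeakSolution f (sol S.le_α a) fun t => toV S.le_α (a t) := by
  have hU : Continuous fun t => toV S.le_α (a t) := (toV S.le_α).continuous.comp h.mild.continuous
  have hu : Continuous fun t => (sol S.le_α a t : L2) := fieldL.continuous.comp hU
  have hD : ∀ v : V, HasDistribDeriv (fun t => inner ℝ (sol S.le_α a t : L2) (field v))
      (fun t => solDeriv S.le_α f a t v) := fun v =>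
    hasDistribDeriv_of_isPrim fun T hT => S.isPrim_sol h v hT
  refine ⟨fun w => ?_, Eventually.of_forall fun t => rfl, memLpLoc_of_continuous hU 2,
    ⟨solDeriv S.le_α f a, memLpLoc_solDeriv S.le_α S.memLp h.mild.continuous _, hD⟩, fun v => ?_⟩
  · have : Continuous fun t => inner ℝ (sol S.le_α a t : L2) (w : L2) := hu.inner continuous_const
    exact this.continuousOn
  · intro φ h1 h2 h3
    rw [hD v φ h1 h2 h3]
    congr 1
    refine integral_congr_ae ?_
    -- Replacing the pairing with `beta` by the trilinear form requires finite |u(t)|_{α+1/2}, which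
    -- holds for almost every t.
    filter_upwards [ae_restrict_of_ae_restrict_of_subset Ioi_subset_Ici_self (S.ae_gevrey_lt_top h)]
      with t ht
    rw [trilinear_toV S.le_α (h.mild.adm t) ht, solDeriv_apply]

end Setting

/-! ### The energy equality -/

namespace Setting

variable {K δ lam σ α : ℝ} {u₀ : H} {f : ℝ → H} {a : ℝ → ell} {A : ℕ → ℝ → ell}

/-- The density of the energy balance for the rescaled coefficients `x`. -/
def balance {α : ℝ} (hα : 1 / 2 ≤ α) (f : ℝ → H) (t : ℝ) (x : ell) : ℝ :=
  2 * (inner ℝ (f t : L2) (field (toV hα x)) - ‖grad (toV hα x)‖ ^ 2)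

/-- Energy equality: the nonlinear term is a scalar times the vanishing sum of
`sum_inner_convB_eq_zero`, so the truncation leaves no trace. -/
lemma galerkin_energy (S : Setting K δ lam σ α u₀ f) {n : ℕ} {B : ℝ → ell}
    (hB : IsMild S.le_α (radius K α δ σ) (forceSeq α f) (initSeq α u₀) (waveBall n) B) {T : ℝ}
    (hT : 0 ≤ T) : IsPrim (fun t => ‖field (toV S.le_α (B t))‖ ^ 2)
      (fun t => balance S.le_α f t (B t)) 0 T := by
  have hsupp : ∀ t, ∀ k ∉ waveFin n, scale (-2 * α) (B t) k = 0 := fun t k hk => by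
    rw [scale, hB.coef_eq_zero t hk, smul_zero]
  have h1 : IsPrim (fun t => (2 * Real.pi) ^ 3 * ∑ k ∈ waveFin n, ‖scale (-2 * α) (B t) k‖ ^ 2)
      (fun t => (2 * Real.pi) ^ 3 * ∑ k ∈ waveFin n, 2 * inner ℝ (scale (-2 * α) (B t) k)
        (scale (7 / 4 - 2 * α) (forceSeq α f t) k - retractFactor (radius K α δ σ) (B t) ^ 2 •
          convB (scale (-2 * α) (B t)) (scale (-2 * α) (B t)) k -
          waveLength k ^ 2 • scale (-2 * α) (B t) k)) 0 T := by
    refine (IsPrim.sum hT fun k hk => isPrim_norm_sq hT fun e => ?_).const_mul _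
    refine (hB.isPrim S.radius_pos S.growth (waveFin_mem hk) e hT).congr (fun t _ => rfl)
      (fun t _ => ?_) hT
    rw [inner_sub_right _ _ (_ • scale _ _ _), real_inner_smul_right _ (scale _ _ _)]
  refine h1.congr (fun t _ => ?_) (fun t ht => ?_) hT
  · have h2 := hasSum_norm_sq_fourier (mem_trigClosure_of_mem_H (field_mem_H (toV S.le_α (B t))))
    rw [fourier_toV S.le_α (hB.adm t)] at h2
    rw [← h2.tsum_eq, tsum_eq_sum (s := waveFin n) fun k hk => by rw [hsupp t k hk]; simp, Finset.mul_sum]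
  · have hadm : Adm (scale (-2 * α) (B t)) := (hB.adm t).scale _
    have h2 := hasSum_inner_fourier (mem_trigClosure_of_mem_H (f t).2) (field (toV S.le_α (B t)))
    have h3 := hasSum_inner_grad (toV S.le_α (B t)) (toV S.le_α (B t))
    rw [fourier_toV S.le_α (hB.adm t)] at h2 h3
    rw [balance, ← real_inner_self_eq_norm_sq, ← h2.tsum_eq, ← h3.tsum_eq,
      tsum_eq_sum (s := waveFin n) fun k hk => by rw [hsupp t k hk]; simp,
      tsum_eq_sum (s := waveFin n) fun k hk => by rw [hsupp t k hk]; simp, S.scale_forceSeq ht.1,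
      ← Finset.sum_sub_distrib, ← sub_eq_zero, Finset.mul_sum, Finset.mul_sum, ← Finset.sum_sub_distrib]
    have h4 := sum_inner_convB_eq_zero hadm (hsupp t)
    have h5 := congrArg (fun r => 2 * (2 * Real.pi) ^ 3 *
      retractFactor (radius K α δ σ) (B t) ^ 2 * r) h4
    simp only [mul_zero, Finset.mul_sum] at h5
    rw [← h5]
    refine Finset.sum_congr rfl fun k _ => ?_
    rw [inner_sub_right, inner_sub_right, real_inner_smul_right, real_inner_smul_right,
      real_inner_comm (scale (-2 * α) (B t) k) (fourierCoeffVec _ k)]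
    ring

lemma balance_bound {α : ℝ} (hα : 1 / 2 ≤ α) (f : ℝ → H) (t : ℝ) {x : ell} {R : ℝ} (hx : ‖x‖ ≤ R) :
    ‖balance hα f t x‖ ≤ 2 * (‖f t‖ * (‖toV hα‖ * R) + (‖gradL‖ * (‖toV hα‖ * R)) ^ 2) := by
  have hV : ‖toV hα x‖ ≤ ‖toV hα‖ * R := ((toV hα).le_opNorm x).trans (by gcongr)
  have h1 : ‖grad (toV hα x)‖ ≤ ‖gradL‖ * (‖toV hα‖ * R) :=
    (gradL.le_opNorm (toV hα x)).trans (by gcongr)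
  have h2 : ‖field (toV hα x)‖ ≤ ‖toV hα x‖ := by
    refine le_of_sq_le_sq ?_ (norm_nonneg _)
    have h3 := inner_V (toV hα x) (toV hα x)
    rw [real_inner_self_eq_norm_sq, real_inner_self_eq_norm_sq, real_inner_self_eq_norm_sq] at h3
    nlinarith [sq_nonneg ‖grad (toV hα x)‖]
  have h4 : |inner ℝ (f t : L2) (field (toV hα x))| ≤ ‖f t‖ * (‖toV hα‖ * R) :=
    (abs_real_inner_le_norm _ _).trans
      (mul_le_mul_of_nonneg_left (h2.trans hV) (norm_nonneg (f t : L2)))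
  rw [balance, Real.norm_eq_abs, abs_mul, abs_of_pos (by norm_num : (0 : ℝ) < 2)]
  refine mul_le_mul_of_nonneg_left ((abs_sub _ _).trans (add_le_add h4 ?_)) (by norm_num)
  rw [abs_of_nonneg (sq_nonneg _)]
  exact pow_le_pow_left₀ (norm_nonneg _) h1 2

lemma continuous_balance {α : ℝ} (hα : 1 / 2 ≤ α) (f : ℝ → H) (t : ℝ) :
    Continuous (balance hα f t) := by
  have h1 : Continuous fun x => field (toV hα x) := fieldL.continuous.comp (toV hα).continuous
  have h2 : Continuous fun x => grad (toV hα x) := gradL.continuous.comp (toV hα).continuous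
  unfold balance
  exact continuous_const.mul ((continuous_const.inner h1).sub (h2.norm.pow 2))

/-- Convergence in `ell` implies convergence of field and gradient in L², and the ball bound
dominates the balance by ‖f‖. The Galerkin energy equality therefore passes to the limit as an
equality, for every t₀ ≥ 0. -/
lemma energyInequality (S : Setting K δ lam σ α u₀ f) (h : Approx S.le_α K δ σ u₀ f a A) {t₀ : ℝ}
    (ht₀ : 0 ≤ t₀) : EnergyInequality f (sol S.le_α a) (fun t => toV S.le_α (a t)) t₀ := by
  intro t ht
  set T := t + 1
  have hT : 0 < T := by simp only [T]; linarith
  have hU : Continuous fun t => toV S.le_α (a t) := (toV S.le_α).continuous.comp h.mild.continuous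
  have hu : Continuous fun t => field (toV S.le_α (a t)) := fieldL.continuous.comp hU
  have hg : Continuous fun t => grad (toV S.le_α (a t)) := gradL.continuous.comp hU
  have hsub : uIoc t₀ t ⊆ Icc 0 T := by
    rw [uIoc_of_le ht]
    exact fun s hs => ⟨ht₀.trans hs.1.le, hs.2.trans (by simp only [T]; linarith)⟩
  have hf : IntegrableOn f (uIoc t₀ t) volume :=
    (memLp_one_iff_integrable.1 ((S.memLp T hT).mono_exponent le_top)).mono_measure
      (Measure.restrict_mono hsub le_rfl)
  have hfn : IntervalIntegrable (fun s => ‖f s‖) volume t₀ t := by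
    rw [intervalIntegrable_iff]; exact hf.norm
  have hfield : ∀ (x : ell → L2), Continuous x → Tendsto (fun n => ‖x (A n t)‖ ^ 2) atTop
      (𝓝 (‖x (a t)‖ ^ 2)) ∧ Tendsto (fun n => ‖x (A n t₀)‖ ^ 2) atTop (𝓝 (‖x (a t₀)‖ ^ 2)) :=
    fun x hx => ⟨(((hx.tendsto _).comp (h.tendsto t)).norm).pow 2,
      (((hx.tendsto _).comp (h.tendsto t₀)).norm).pow 2⟩
  have hlim := hfield (fun x => field (toV S.le_α x)) (fieldL.continuous.comp (toV S.le_α).continuous)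
  have hprim : ∀ n, IsPrim (fun t => ‖field (toV S.le_α (A n t))‖ ^ 2)
      (fun t => balance S.le_α f t (A n t)) t₀ t := fun n =>
    (S.galerkin_energy (h.galerkin n) hT.le).sub_interval ht₀ ht (by simp only [T]; linarith)
  have hint : Tendsto (fun n => ∫ s in t₀..t, balance S.le_α f s (A n s)) atTop
      (𝓝 (∫ s in t₀..t, balance S.le_α f s (a s))) := by
    refine intervalIntegral.tendsto_integral_filter_of_dominated_convergence
      (fun s => 2 * (‖f s‖ * (‖toV S.le_α‖ * radius K α δ σ) +
        (‖gradL‖ * (‖toV S.le_α‖ * radius K α δ σ)) ^ 2)) (Eventually.of_forall fun n => ?_)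
      (Eventually.of_forall fun n => Eventually.of_forall fun s hs => ?_) ?_
      (Eventually.of_forall fun s _ => ?_)
    · exact (intervalIntegrable_iff.1 (hprim n).1).aestronglyMeasurable
    · exact balance_bound _ _ _ (S.galerkin_norm_le (h.galerkin n) (hsub hs).1)
    · exact ((hfn.mul_const _).add intervalIntegrable_const).const_mul 2
    · exact ((continuous_balance S.le_α f s).tendsto _).comp (h.tendsto s)
  have heq : ‖field (toV S.le_α (a t))‖ ^ 2 = ‖field (toV S.le_α (a t₀))‖ ^ 2 +
      ∫ s in t₀..t, balance S.le_α f s (a s) := by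
    refine tendsto_nhds_unique hlim.1 ((hlim.2.add hint).congr fun n => ?_)
    exact ((hprim n).eq_integral ht).symm
  have hfu : IntervalIntegrable (fun s => inner ℝ (f s : L2) (field (toV S.le_α (a s)))) volume t₀ t := by
    rw [intervalIntegrable_iff] at hfn ⊢
    have hm : AEStronglyMeasurable (fun s => inner ℝ (f s : L2) (field (toV S.le_α (a s))))
        (volume.restrict (uIoc t₀ t)) :=
      (continuous_subtype_val.comp_aestronglyMeasurable hf.aestronglyMeasurable).inner
        hu.aestronglyMeasurable
    obtain ⟨C, hC⟩ := isCompact_Icc.exists_bound_of_continuousOn (hu.continuousOn (s := Icc 0 T))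
    refine (hfn.mul_const C).mono' hm ?_
    filter_upwards [self_mem_ae_restrict measurableSet_uIoc] with s hs
    exact (abs_real_inner_le_norm _ _).trans
      (mul_le_mul_of_nonneg_left (hC s (hsub hs)) (norm_nonneg (f s : L2)))
  have hgi : IntervalIntegrable (fun s => ‖grad (toV S.le_α (a s))‖ ^ 2) volume t₀ t :=
    (hg.norm.pow 2).intervalIntegrable _ _
  simp only [balance] at heq
  rw [intervalIntegral.integral_const_mul, intervalIntegral.integral_sub hfu hgi] at heq
  change 1 / 2 * ‖field (toV S.le_α (a t))‖ ^ 2 + _ ≤ 1 / 2 * ‖field (toV S.le_α (a t₀))‖ ^ 2 +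
    ∫ s in t₀..t, inner ℝ (f s : L2) (field (toV S.le_α (a s)))
  linarith

lemma isLerayHopf (S : Setting K δ lam σ α u₀ f) (h : Approx S.le_α K δ σ u₀ f a A) :
    IsLerayHopf f (sol S.le_α a) := by
  refine ⟨fun t => toV S.le_α (a t), S.isWeakSolution h, S.energyInequality h le_rfl, ?_⟩
  filter_upwards [self_mem_ae_restrict measurableSet_Ioi] with t₀ ht₀
  exact S.energyInequality h (le_of_lt ht₀)

end Setting

/-! ### Distributional derivatives of continuous functions -/

/-- A primitive started to the left of the support vanishes there, and it vanishes to the right of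
the support because the mean is zero. -/
lemma exists_primitive_test {g : ℝ → ℝ} (hg : ContDiff ℝ ((⊤ : ℕ∞) : WithTop ℕ∞) g)
    (hc : HasCompactSupport g) (hs : tsupport g ⊆ Ioi 0) (h0 : ∫ t, g t = 0) :
    ∃ φ : ℝ → ℝ, ContDiff ℝ ((⊤ : ℕ∞) : WithTop ℕ∞) φ ∧ HasCompactSupport φ ∧
      tsupport φ ⊆ Ioi 0 ∧ deriv φ = g := by
  obtain ⟨ε, M, hε, hsub⟩ : ∃ ε M : ℝ, 0 < ε ∧ tsupport g ⊆ Ioc ε M := by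
    rcases (tsupport g).eq_empty_or_nonempty with he | hne
    · exact ⟨1, 2, one_pos, by rw [he]; exact empty_subset _⟩
    · obtain ⟨m, hm⟩ := hc.isCompact.exists_isLeast hne
      obtain ⟨M, hM⟩ := hc.isCompact.bddAbove
      have hm0 : 0 < m := hs hm.1
      exact ⟨m / 2, M, by positivity, fun x hx =>
        ⟨lt_of_lt_of_le (by linarith) (hm.2 hx), hM hx⟩⟩
  have hz : ∀ t, t ∉ Ioc ε M → g t = 0 := fun t ht =>
    image_eq_zero_of_notMem_tsupport fun hm => ht (hsub hm)
  have hgc : Continuous g := hg.continuous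
  set φ : ℝ → ℝ := fun t => ∫ s in ε..t, g s with hφ
  have hd : ∀ t, HasDerivAt φ (g t) t := fun t =>
    intervalIntegral.integral_hasDerivAt_right (hgc.intervalIntegrable _ _)
      (hgc.stronglyMeasurableAtFilter _ _) hgc.continuousAt
  have hderiv : deriv φ = g := funext fun t => (hd t).deriv
  have hφ0 : ∀ t, t ∉ Icc ε M → φ t = 0 := by
    intro t ht
    rcases lt_or_ge t ε with h | h
    · simp only [hφ]
      rw [intervalIntegral.integral_symm, intervalIntegral.integral_of_le h.le,
        setIntegral_eq_zero_of_forall_eq_zero fun s hs' => hz s fun hm => absurd hm.1 (not_lt.2 hs'.2), neg_zero]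
    · have h1 : M < t := by
        by_contra hc'; exact ht ⟨h, not_lt.1 hc'⟩
      simp only [hφ]
      rw [intervalIntegral.integral_eq_integral_of_support_subset, h0]
      intro s hs'
      have := hsub (subset_tsupport g hs')
      exact ⟨this.1, this.2.trans h1.le⟩
  have hts : tsupport φ ⊆ Icc ε M := by
    refine closure_minimal (fun t ht => ?_) isClosed_Icc
    by_contra hc'; exact ht (hφ0 t hc')
  refine ⟨φ, ?_, isCompact_Icc.of_isClosed_subset (isClosed_tsupport φ) hts,
    fun t ht => lt_of_lt_of_le hε (hts ht).1, hderiv⟩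
  rw [contDiff_infty_iff_deriv, hderiv]
  exact ⟨fun t => (hd t).differentiableAt, hg⟩

/-- A continuous function with vanishing distributional derivative is constant. -/
lemma eq_of_forall_integral_deriv_eq_zero {Y : ℝ → ℝ} (hY : Continuous Y)
    (h : ∀ φ : ℝ → ℝ, ContDiff ℝ ((⊤ : ℕ∞) : WithTop ℕ∞) φ → HasCompactSupport φ →
      tsupport φ ⊆ Ioi 0 → ∫ t in Ioi (0 : ℝ), deriv φ t * Y t = 0) {t : ℝ} (ht : 0 ≤ t) :
    Y t = Y 0 := by
  -- A fixed bump of integral one, supported in [1, 3]. Subtracting the right multiple of it gives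
  -- any test function mean zero, hence makes it a derivative.
  let η : ContDiffBump (2 : ℝ) := ⟨1 / 2, 1, by norm_num, by norm_num⟩
  set e : ℝ → ℝ := η.normed volume with he
  have he1 : ContDiff ℝ ((⊤ : ℕ∞) : WithTop ℕ∞) e := η.contDiff_normed
  have he2 : HasCompactSupport e := η.hasCompactSupport_normed
  have he3 : tsupport e ⊆ Ioi 0 := by
    rw [he, η.tsupport_normed_eq]
    intro x hx
    rw [Metric.mem_closedBall, Real.dist_eq] at hx
    have hx' : |x - 2| ≤ 1 := hx
    have := (abs_le.1 hx').1
    exact (by linarith : (0 : ℝ) < x)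
  have he4 : ∫ x, e x = 1 := η.integral_normed
  set c := ∫ t, e t * Y t with hc
  have key : ∀ g : ℝ → ℝ, ContDiff ℝ ((⊤ : ℕ∞) : WithTop ℕ∞) g → HasCompactSupport g →
      tsupport g ⊆ Ioi 0 → ∫ x, g x • (Y x - c) = 0 := by
    intro g hg hgc hgs
    have hgi : Integrable g := hg.continuous.integrable_of_hasCompactSupport hgc
    have hei : Integrable e := he1.continuous.integrable_of_hasCompactSupport he2
    have hgY : Integrable fun x => g x * Y x :=
      (hg.continuous.mul hY).integrable_of_hasCompactSupport hgc.mul_right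
    have heY : Integrable fun x => e x * Y x :=
      (he1.continuous.mul hY).integrable_of_hasCompactSupport he2.mul_right
    set I := ∫ x, g x with hI
    set q : ℝ → ℝ := fun x => g x - I * e x with hq
    have hqs : tsupport q ⊆ tsupport g ∪ tsupport e := by
      refine closure_minimal (fun x hx => ?_) ((isClosed_tsupport g).union (isClosed_tsupport e))
      by_contra hn
      rw [mem_union, not_or] at hn
      refine hx ?_
      simp only [hq]
      rw [image_eq_zero_of_notMem_tsupport hn.1, image_eq_zero_of_notMem_tsupport hn.2]; ring
    obtain ⟨φ, h1, h2, h3, h4⟩ := exists_primitive_test (g := q) (hg.sub (contDiff_const.mul he1))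
      ((hgc.isCompact.union he2.isCompact).of_isClosed_subset (isClosed_tsupport q) hqs)
      (hqs.trans (union_subset hgs he3)) (by
        simp only [hq]
        rw [integral_sub hgi (hei.const_mul I), integral_const_mul, he4]; ring)
    have h5 := h φ h1 h2 h3
    rw [h4, setIntegral_eq_integral_of_forall_compl_eq_zero fun x hx => by
      rw [image_eq_zero_of_notMem_tsupport fun hm => hx ((hqs.trans (union_subset hgs he3)) hm),
        zero_mul]] at h5
    have h6 : ∫ x, q x * Y x = (∫ x, g x * Y x) - I * c := by
      rw [hc, ← integral_const_mul, ← integral_sub hgY (heY.const_mul I)]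
      congr 1; funext x; simp only [hq]; ring
    have h7 : ∫ x, g x • (Y x - c) = (∫ x, g x * Y x) - I * c := by
      rw [hI, ← integral_mul_const, ← integral_sub hgY (hgi.mul_const c)]
      congr 1; funext x; simp only [smul_eq_mul]; ring
    rw [h7, ← h6, h5]
  have hae := isOpen_Ioi.ae_eq_zero_of_integral_contDiff_smul_eq_zero (μ := volume)
    (f := fun x => Y x - c) (U := Ioi (0 : ℝ))
    ((hY.sub continuous_const).locallyIntegrable.locallyIntegrableOn _) key
  have h1 : EqOn Y (fun _ => c) (Ioi 0) := by
    refine Measure.eqOn_open_of_ae_eq (μ := volume) ?_ isOpen_Ioi hY.continuousOn continuousOn_const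
    rw [EventuallyEq, ae_restrict_iff' measurableSet_Ioi]
    filter_upwards [hae] with x hx hm using sub_eq_zero.1 (hx hm)
  have h2 : EqOn Y (fun _ => c) (Ici 0) := by
    have := h1.closure hY continuous_const
    rwa [closure_Ioi] at this
  rw [h2 ht, h2 (show (0 : ℝ) ∈ Ici 0 from self_mem_Ici)]

/-- Subtracting the primitive of z leaves a continuous function with vanishing distributional
derivative, hence a constant. -/
lemma isPrim_of_hasDistribDeriv {y z : ℝ → ℝ} (hy : ContinuousOn y (Ici 0))
    (hz : ∀ T, 0 < T → IntervalIntegrable z volume 0 T) (h : HasDistribDeriv y z) {T : ℝ}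
    (hT : 0 < T) : IsPrim y z 0 T := by
  have hZp : ∀ T, 0 < T → IsPrim (fun t => ∫ s in (0 : ℝ)..t, z s) z 0 T := fun T hT =>
    ⟨hz T hT, fun t _ => by simp⟩
  have hZc : ContinuousOn (fun t => ∫ s in (0 : ℝ)..t, z s) (Ici 0) := by
    intro t ht
    have ht' : (0 : ℝ) ≤ t := ht
    have hc := intervalIntegral.continuousOn_primitive_interval' (hz (t + 1) (by linarith)) left_mem_uIcc
    rw [uIcc_of_le (by linarith)] at hc
    refine (hc t ⟨ht', by linarith⟩).mono_of_mem_nhdsWithin ?_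
    rw [← Ici_inter_Iic]
    exact inter_mem self_mem_nhdsWithin (mem_nhdsWithin_of_mem_nhds (Iic_mem_nhds (by linarith)))
  have hZ := hasDistribDeriv_of_isPrim hZp
  have hm : Continuous fun t : ℝ => max t 0 := by fun_prop
  -- Constant continuation to negative times gives functions continuous on the whole line; test
  -- functions supported in (0, ∞) do not notice.
  have hyc : Continuous fun t => y (max t 0) := hy.comp_continuous hm fun t => mem_Ici.2 (le_max_right _ _)
  have hZc' : Continuous fun t => ∫ s in (0 : ℝ)..max t 0, z s :=
    hZc.comp_continuous hm fun t => mem_Ici.2 (le_max_right _ _)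
  have key : ∀ φ : ℝ → ℝ, ContDiff ℝ ((⊤ : ℕ∞) : WithTop ℕ∞) φ → HasCompactSupport φ →
      tsupport φ ⊆ Ioi 0 →
      ∫ t in Ioi (0 : ℝ), deriv φ t * (y (max t 0) - ∫ s in (0 : ℝ)..max t 0, z s) = 0 := by
    intro φ h1 h2 h3
    have hd : Continuous (deriv φ) := h1.continuous_deriv (by simp)
    have e1 := h φ h1 h2 h3
    have e2 := hZ φ h1 h2 h3
    have i1 : Integrable fun t => deriv φ t * y (max t 0) :=
      (hd.mul hyc).integrable_of_hasCompactSupport h2.deriv.mul_right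
    have i2 : Integrable fun t => deriv φ t * ∫ s in (0 : ℝ)..max t 0, z s :=
      (hd.mul hZc').integrable_of_hasCompactSupport h2.deriv.mul_right
    simp only [mul_sub]
    rw [integral_sub i1.integrableOn i2.integrableOn, sub_eq_zero]
    have c1 : ∫ t in Ioi (0 : ℝ), deriv φ t * y (max t 0) = ∫ t in Ioi (0 : ℝ), deriv φ t * y t :=
      setIntegral_congr_fun measurableSet_Ioi fun t ht => by
        simp only [max_eq_left (le_of_lt (show (0 : ℝ) < t from ht))]
    have c2 : ∫ t in Ioi (0 : ℝ), deriv φ t * (∫ s in (0 : ℝ)..max t 0, z s) =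
        ∫ t in Ioi (0 : ℝ), deriv φ t * ∫ s in (0 : ℝ)..t, z s :=
      setIntegral_congr_fun measurableSet_Ioi fun t ht => by
        simp only [max_eq_left (le_of_lt (show (0 : ℝ) < t from ht))]
    rw [c1, c2, e1, e2]
  refine ⟨hz T hT, fun t ht => ?_⟩
  have h1 : y (max t 0) - (∫ s in (0 : ℝ)..max t 0, z s) =
      y (max 0 0) - ∫ s in (0 : ℝ)..max 0 0, z s :=
    eq_of_forall_integral_deriv_eq_zero (hyc.sub hZc') key ht.1
  rw [max_eq_left ht.1, max_self, intervalIntegral.integral_same] at h1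
  linarith

lemma HasDistribDeriv.congr_ae {y y' z z' : ℝ → ℝ} (h : HasDistribDeriv y z)
    (hy : ∀ t, 0 < t → y' t = y t) (hz : ∀ᵐ t ∂(volume.restrict (Ioi (0 : ℝ))), z' t = z t) :
    HasDistribDeriv y' z' := by
  intro φ h1 h2 h3
  have e1 : ∫ t in Ioi (0 : ℝ), deriv φ t * y' t = ∫ t in Ioi (0 : ℝ), deriv φ t * y t :=
    setIntegral_congr_fun measurableSet_Ioi fun t ht => by simp only [hy t ht]
  rw [e1, h φ h1 h2 h3]
  congr 1
  refine integral_congr_ae ?_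
  filter_upwards [hz] with t ht
  rw [ht]

/-! ### Uniqueness -/

lemma exists_small_duhConst (c : ℝ) : ∃ γ : ℝ, 0 < γ ∧ c * Real.sqrt (duhConst γ) ≤ 1 / 2 := by
  have h1 := (tendsto_duhConst.sqrt).const_mul c
  rw [Real.sqrt_zero, mul_zero] at h1
  obtain ⟨γ, h2, h3⟩ := ((h1.eventually (gt_mem_nhds (show (0 : ℝ) < 1 / 2 by norm_num))).and
    (eventually_gt_atTop 0)).exists
  exact ⟨γ, h3, h2.le⟩

namespace Setting

variable {K δ lam σ α : ℝ} {u₀ : H} {f : ℝ → H}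

lemma intervalIntegrable_sub_beta (S : Setting K δ lam σ α u₀ f) {b : ℝ → ell} (hc : Continuous b)
    (k : Z3) {t : ℝ} (ht : 0 ≤ t) :
    IntervalIntegrable (fun s => (forceSeq α f s - beta S.le_α (b s) (b s) : ell) k) volume 0 t := by
  have h0 : Continuous fun s => beta S.le_α (b s) (b s) :=
    ((beta S.le_α).continuous.comp hc).clm_apply hc
  exact (S.growth.intervalIntegrable k ht).sub
    (((continuous_ell_apply k).comp h0).intervalIntegrable _ _)

/-- Testing with single modes determines the mild form of the equation. -/
lemma mild_of_isPrim (S : Setting K δ lam σ α u₀ f) {b : ℝ → ell} (hc : Continuous b)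
    (hb : ∀ t, Adm (b t)) (hmode : ∀ (k : Z3) (hk : k ≠ 0) (e : C3) (he : dotZ k e = 0) (T : ℝ),
      0 < T → IsPrim (fun t => inner ℝ (sol S.le_α b t : L2) (field (modeV hk he)))
        (fun t => solDeriv S.le_α f b t (modeV hk he)) 0 T) {t : ℝ} (ht : 0 ≤ t) (k : Z3) :
    b t k = Real.exp (-(waveLength k ^ 2 * t)) • b 0 k +
      duh (fun s => (forceSeq α f s - beta S.le_α (b s) (b s) : ell)) t k := by
  by_cases hk : k = 0
  · subst hk
    rw [(hb t).zero, (hb 0).zero, duh_zero_right, smul_zero, add_zero]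
  have hi : IntervalIntegrable (fun s => Real.exp (-(waveLength k ^ 2 * (t - s))) •
      (forceSeq α f s - beta S.le_α (b s) (b s) : ell) k) volume 0 t :=
    (S.intervalIntegrable_sub_beta hc k ht).continuousOn_smul (by fun_prop)
  refine eq_of_inner_eq ((hb t).div k) ?_ fun e he => ?_
  · rw [dotZ_add, dotZ_smul_real, (hb 0).div, mul_zero, zero_add, duh, dotZ_smul_real,
      dotZ_integral _ _ (fun s => ?_) _ hi, mul_zero]
    rw [dotZ_smul_real]
    have := ((adm_forceSeq α f s).sub (adm_betaSeq α (hb s) (hb s))).div k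
    exact mul_eq_zero_of_right _ this
  · have hT : 0 < t + 1 := by linarith
    have hP := two_pi_cube_pos.ne'
    have h1 : IsPrim (fun s => inner ℝ (b s k) e) (fun s => wt (7 / 4) k *
        inner ℝ ((forceSeq α f s - beta S.le_α (b s) (b s) : ell) k) e -
          waveLength k ^ 2 * inner ℝ (b s k) e) 0 (t + 1) := by
      -- The factor (2π)^{-3}|k|^{2α} converts the pairing of the field with a mode back into the
      -- rescaled coefficient.
      refine ((hmode k hk e he _ hT).const_mul (((2 * Real.pi) ^ 3)⁻¹ * wt (2 * α) k)).congr
        (fun s _ => ?_) (fun s hs => ?_) hT.le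
      · change _ = _ * inner ℝ (field (toV S.le_α (b s))) _
        rw [inner_field_modeV, fourier_toV S.le_α (hb s), scale, real_inner_smul_left]
        have h2 : wt (2 * α) k * wt (-2 * α) k = 1 := by
          rw [wt_mul, show 2 * α + -2 * α = 0 by ring, wt_zero_left hk]
        have h6 := inv_mul_cancel₀ hP
        linear_combination -(wt (2 * α) k * wt (-2 * α) k * inner ℝ (b s k) e) * h6 -
          inner ℝ (b s k) e * h2
      · rw [solDeriv_apply, inner_field_modeV, inner_grad_modeV, fourier_toV S.le_α (hb s),
          inner_beta_dualL_modeV S.le_α (hb s), ← S.scale_forceSeq hs.1]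
        have h2 : wt (2 * α) k * wt (-2 * α) k = 1 := by
          rw [wt_mul, show 2 * α + -2 * α = 0 by ring, wt_zero_left hk]
        have h3 : wt (7 / 4) k * wt (2 * α - 7 / 4) k = wt (2 * α) k := by
          rw [wt_mul]; congr 1; ring
        have h4 : wt (2 * α) k * wt (7 / 4 - 2 * α) k = wt (7 / 4) k := by
          rw [wt_mul]; congr 1; ring
        have h5 : inner ℝ ((forceSeq α f s - beta S.le_α (b s) (b s) : ell) k) e =
            inner ℝ (forceSeq α f s k) e - wt (2 * α - 7 / 4) k *
              inner ℝ (convB (scale (-2 * α) (b s)) (scale (-2 * α) (b s)) k) e := by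
          rw [← real_inner_smul_left, ← inner_sub_left]; rfl
        have h6 := inv_mul_cancel₀ hP
        have h7 : inner ℝ (scale (7 / 4 - 2 * α) (forceSeq α f s) k) e =
            wt (7 / 4 - 2 * α) k * inner ℝ (forceSeq α f s k) e := real_inner_smul_left _ _ _
        have h8 : inner ℝ (scale (-2 * α) (b s) k) e = wt (-2 * α) k * inner ℝ (b s k) e :=
          real_inner_smul_left _ _ _
        rw [h5, h7, h8]
        generalize inner ℝ (forceSeq α f s k) e = F
        generalize inner ℝ (convB (scale (-2 * α) (b s)) (scale (-2 * α) (b s)) k) e = N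
        generalize inner ℝ (b s k) e = B
        linear_combination -F * h4 - N * h3 + waveLength k ^ 2 * B * h2 - (wt (2 * α) k *
          (wt (7 / 4 - 2 * α) k * F - waveLength k ^ 2 * (wt (-2 * α) k * B) - N)) * h6
    have h2 := IsPrim.mild hT.le h1 t ⟨ht, by linarith⟩
    rw [h2, inner_add_left, real_inner_smul_left, duh, real_inner_smul_left]
    congr 1
    have h3 : ∫ s in (0 : ℝ)..t, inner ℝ e (Real.exp (-(waveLength k ^ 2 * (t - s))) •
        (forceSeq α f s - beta S.le_α (b s) (b s) : ell) k) = inner ℝ e (∫ s in (0 : ℝ)..t,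
        Real.exp (-(waveLength k ^ 2 * (t - s))) •
        (forceSeq α f s - beta S.le_α (b s) (b s) : ell) k) :=
      (innerSL ℝ e).intervalIntegral_comp_comm hi
    rw [real_inner_comm, ← h3, ← intervalIntegral.integral_const_mul]
    congr 1; funext s
    rw [real_inner_smul_right, real_inner_comm]; ring

/-- On [0, T] both curves are bounded by some R, so truncating at R changes nothing and the
Lipschitz bound applies. The maximum N of e^{-γt}‖a - b‖ then satisfies N ≤ N/2 once γ is large. -/
lemma eq_of_mild (S : Setting K δ lam σ α u₀ f) {a b : ℝ → ell} (ha : Continuous a)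
    (hb : Continuous b) (h0 : a 0 = b 0)
    (hma : ∀ t, 0 ≤ t → ∀ k, a t k = Real.exp (-(waveLength k ^ 2 * t)) • a 0 k +
      duh (fun s => (forceSeq α f s - beta S.le_α (a s) (a s) : ell)) t k)
    (hmb : ∀ t, 0 ≤ t → ∀ k, b t k = Real.exp (-(waveLength k ^ 2 * t)) • b 0 k +
      duh (fun s => (forceSeq α f s - beta S.le_α (b s) (b s) : ell)) t k) {T : ℝ} (hT : 0 ≤ T) :
    a T = b T := by
  obtain ⟨Ra, hRa⟩ := isCompact_Icc.exists_bound_of_continuousOn (ha.continuousOn (s := Icc 0 T))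
  obtain ⟨Rb, hRb⟩ := isCompact_Icc.exists_bound_of_continuousOn (hb.continuousOn (s := Icc 0 T))
  set R := max (max Ra Rb) 1 with hRdef
  have hR : 0 < R := lt_max_of_lt_right one_pos
  obtain ⟨γ, hγ, hγ2⟩ := exists_small_duhConst (4 * betaBound α * R)
  -- Clamping time to [0, T] extends the curves to all times, as the growth estimates require,
  -- without altering them on [0, T].
  let cl : ℝ → ℝ := fun s => max 0 (min s T)
  have hcl : Continuous cl := by fun_prop
  have hcc : ∀ x : ℝ → ell, Continuous x → ContinuousOn (fun s => x (cl s)) (Ici 0) :=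
    fun x hx => (hx.comp hcl).continuousOn
  have hclm : ∀ s, cl s ∈ Icc 0 T := fun s => ⟨le_max_left _ _, max_le hT (min_le_right _ _)⟩
  have hcle : ∀ s ∈ Icc 0 T, cl s = s := fun s hs => by
    simp only [cl]; rw [min_eq_left hs.2, max_eq_right hs.1]
  have hduh : ∀ (x : ℝ → ell), Continuous x → (∀ s ∈ Icc 0 T, ‖x s‖ ≤ R) →
      (∀ t, 0 ≤ t → ∀ k, x t k = Real.exp (-(waveLength k ^ 2 * t)) • x 0 k +
        duh (fun s => (forceSeq α f s - beta S.le_α (x s) (x s) : ell)) t k) → ∀ t ∈ Icc 0 T,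
      x t = heat t (x 0) +
        toEll (duh (fun s => (forceSeq α f s - nonlin S.le_α R (x (cl s)) : ell)) t) := by
    intro x hx hxR hm t ht
    have hG := S.growth.sub_nonlin S.le_α hR hγ (hcc x hx)
    ext1; funext k
    change _ = heat t (x 0) k + toEll _ k
    rw [heat_apply ht.1, toEll_apply (hG.tame hγ ht.1).summable, hm t ht.1 k, duh, duh]
    congr 2
    refine intervalIntegral.integral_congr fun s hs => ?_
    rw [uIcc_of_le ht.1] at hs
    have hs' : s ∈ Icc 0 T := ⟨hs.1, hs.2.trans ht.2⟩
    have e : nonlin S.le_α R (x (cl s)) = beta S.le_α (x s) (x s) := by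
      rw [hcle s hs', nonlin, retract_of_le hR (hxR s hs')]
    simp only [e]
  have ha' := hduh a ha (fun s hs => (hRa s hs).trans
    ((le_max_left _ _).trans (le_max_left _ _))) hma
  have hb' := hduh b hb (fun s hs => (hRb s hs).trans
    ((le_max_right _ _).trans (le_max_left _ _))) hmb
  have hGa := S.growth.sub_nonlin S.le_α hR hγ (hcc a ha)
  have hGb := S.growth.sub_nonlin S.le_α hR hγ (hcc b hb)
  have hcont : ContinuousOn (fun t => Real.exp (-(γ * t)) * ‖a t - b t‖) (Icc 0 T) := by fun_prop
  obtain ⟨t₁, ht₁, hmax⟩ := isCompact_Icc.exists_isMaxOn ⟨0, le_rfl, hT⟩ hcont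
  set N := Real.exp (-(γ * t₁)) * ‖a t₁ - b t₁‖ with hN
  have hN0 : 0 ≤ N := by positivity
  have hle : ∀ s ∈ Icc 0 T, ‖a s - b s‖ ≤ N * Real.exp (γ * s) := fun s hs => by
    have h1 : Real.exp (-(γ * s)) * ‖a s - b s‖ ≤ N := hmax hs
    rwa [Real.exp_neg, inv_mul_le_iff₀ (Real.exp_pos _), mul_comm] at h1
  have hbb := betaBound_nonneg α
  have hD : ∀ s, 0 ≤ s → ‖(forceSeq α f s - nonlin S.le_α R (a (cl s))) -
      (forceSeq α f s - nonlin S.le_α R (b (cl s)))‖ ≤ (4 * betaBound α * R * N) * Real.exp (γ * s) := by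
    intro s hs
    rw [sub_sub_sub_cancel_left, norm_sub_rev, mul_assoc _ N]
    refine (norm_nonlin_sub_le S.le_α hR _ _).trans (mul_le_mul_of_nonneg_left ?_ (by positivity))
    refine (hle _ (hclm s)).trans (mul_le_mul_of_nonneg_left (Real.exp_le_exp.2 ?_) hN0)
    exact mul_le_mul_of_nonneg_left (max_le hs (min_le_left _ _)) hγ.le
  have h1 := (hGa.sub hGb hD).norm_duh_le hγ ht₁.1
  rw [hGa.duh_sub hGb ht₁.1, ← toEll_sub (hGa.tame hγ ht₁.1).summable (hGb.tame hγ ht₁.1).summable] at h1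
  have h2 : ‖a t₁ - b t₁‖ ≤ 4 * betaBound α * R * N * Real.exp (γ * t₁) * Real.sqrt (duhConst γ) := by
    rw [ha' t₁ ht₁, hb' t₁ ht₁, h0, add_sub_add_left_eq_sub]
    exact h1
  have h3 : N ≤ 1 / 2 * N := by
    rw [hN, Real.exp_neg, inv_mul_le_iff₀ (Real.exp_pos _), ← Real.exp_neg, ← hN]
    have h4 := mul_le_mul_of_nonneg_right hγ2 (mul_nonneg hN0 (Real.exp_nonneg (γ * t₁)))
    linarith
  have h5 : N = 0 := by linarith
  have h6 := hle T ⟨hT, le_rfl⟩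
  rw [h5, zero_mul] at h6
  exact sub_eq_zero.1 (norm_le_zero_iff.1 h6)

end Setting

/-! ### Comparison with an arbitrary weak solution -/

/-- The rescaled coefficients of a curve in the domain of `A^α`. -/
def coeffSeq (α : ℝ) (v : ℝ → H) (t : ℝ) : ell :=
  toEll (scale (2 * α) (fourierCoeffVec (v (max t 0) : L2)))

lemma summable_coeffSeq {α : ℝ} {v : ℝ → H} (hv : ContinuousInDomain α v) (t : ℝ) :
    Summable fun k => ‖scale (2 * α) (fourierCoeffVec (v (max t 0) : L2)) k‖ ^ 2 :=
  scale_summable le_rfl le_rfl (hv.1 _ (le_max_right _ _))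

lemma adm_coeffSeq (α : ℝ) (v : ℝ → H) (t : ℝ) : Adm (coeffSeq α v t) :=
  adm_toEll ((adm_of_mem_H (v (max t 0)).2).scale _)

lemma continuous_coeffSeq {α : ℝ} {v : ℝ → H} (hv : ContinuousInDomain α v) :
    Continuous (coeffSeq α v) := by
  have hc : ContinuousOn (fun t => toEll (scale (2 * α) (fourierCoeffVec (v t : L2)))) (Ici 0) := by
    intro t ht
    have ht' : (0 : ℝ) ≤ t := ht
    refine Metric.tendsto_nhds.2 fun ε hε => ?_
    have hε' : (0 : ℝ≥0∞) < ENNReal.ofReal (ε / 2) := ENNReal.ofReal_pos.2 (half_pos hε)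
    have h1 := (hv.2 t ht').eventually (Iic_mem_nhds hε')
    filter_upwards [h1, self_mem_nhdsWithin] with s hs hs0
    have hsum : ∀ r, 0 ≤ r → Summable fun k => ‖scale (2 * α) (fourierCoeffVec (v r : L2)) k‖ ^ 2 :=
      fun r hr => scale_summable le_rfl le_rfl (hv.1 r hr)
    have h2 := norm_toEll_scale_le (s := 2 * α) le_rfl le_rfl (by positivity) hs
    have h3 : scale (2 * α) (fourierCoeffVec ((v s : L2) - (v t : L2))) =
        scale (2 * α) (fourierCoeffVec (v s : L2)) - scale (2 * α) (fourierCoeffVec (v t : L2)) := by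
      funext k
      rw [Pi.sub_apply, scale, scale, scale, fourier_sub, smul_sub]
    rw [h3, ← toEll_sub (hsum s hs0) (hsum t ht')] at h2
    rw [dist_eq_norm]
    refine lt_of_le_of_lt (le_of_sq_le_sq (le_trans ?_ h2) (by positivity)) (half_lt_self hε)
    exact le_mul_of_one_le_left (sq_nonneg _) Setting.one_le_two_pi_cube
  exact hc.comp_continuous (f := fun t : ℝ => max t 0) (by fun_prop) fun t => mem_Ici.2 (le_max_right _ _)

lemma scale_coeffSeq {α : ℝ} {v : ℝ → H} (hv : ContinuousInDomain α v) {t : ℝ} (ht : 0 ≤ t) :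
    scale (-2 * α) (coeffSeq α v t) = fourierCoeffVec (v t : L2) := by
  rw [coeffSeq, coe_toEll (summable_coeffSeq hv t), scale_scale, max_eq_left ht,
    show -2 * α + 2 * α = 0 by ring, scale_zero_left]
  exact (adm_of_mem_H (v t).2).zero

lemma sol_coeffSeq {α : ℝ} (hα : 1 / 2 ≤ α) {v : ℝ → H} (hv : ContinuousInDomain α v) {t : ℝ}
    (ht : 0 ≤ t) : sol hα (coeffSeq α v) t = v t := by
  apply Subtype.ext
  refine eq_of_fourier_eq (mem_trigClosure_of_mem_H (field_mem_H _))
    (mem_trigClosure_of_mem_H (v t).2) fun k => ?_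
  change fourierCoeffVec (field (toV hα (coeffSeq α v t))) k = _
  rw [fourier_toV hα (adm_coeffSeq α v t), scale_coeffSeq hv ht]

namespace Setting

variable {K δ lam σ α : ℝ} {u₀ : H} {f : ℝ → H} {a : ℝ → ell} {A : ℕ → ℝ → ell}

/-- Against a mode, all terms of the weak equation depend only on the coefficients of v(t),
including the trilinear one; no regularity beyond continuity in 𝒟(A^α) is used. Continuity in time
turns the distributional equation into an integral one. -/
lemma isPrim_coeffSeq (S : Setting K δ lam σ α u₀ f) {v : ℝ → H} {W : ℝ → V}
    (hw : IsWeakSolution f v W) (hv : ContinuousInDomain α v) {k : Z3} (hk : k ≠ 0) {e : C3}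
    (he : dotZ k e = 0) {T : ℝ} (hT : 0 < T) :
    IsPrim (fun t => inner ℝ (sol S.le_α (coeffSeq α v) t : L2) (field (modeV hk he)))
      (fun t => solDeriv S.le_α f (coeffSeq α v) t (modeV hk he)) 0 T := by
  have hc := continuous_coeffSeq hv
  refine isPrim_of_hasDistribDeriv ?_ (fun T hT => ?_) ?_ hT
  · have h1 : Continuous fun t => (sol S.le_α (coeffSeq α v) t : L2) :=
      fieldL.continuous.comp ((toV S.le_α).continuous.comp hc)
    exact (h1.inner continuous_const).continuousOn
  · obtain ⟨I, hI⟩ := (memLpLoc_solDeriv S.le_α S.memLp hc 1).exists_primitive hT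
      (left_mem_Icc.2 hT.le)
    exact (hI (ContinuousLinearMap.apply ℝ ℝ (modeV hk he))).1
  · refine (hw.equation (modeV hk he)).congr_ae (fun t ht => by rw [sol_coeffSeq S.le_α hv ht.le]) ?_
    filter_upwards [ae_restrict_of_ae_restrict_of_subset Ioi_subset_Ici_self hw.field_eq,
      self_mem_ae_restrict measurableSet_Ioi] with t ht ht0
    have hadm := adm_coeffSeq α v t
    rw [solDeriv_apply, inner_grad_modeV, inner_grad_modeV, trilinear_modeV, ht,
      inner_beta_dualL_modeV S.le_α hadm, fourier_toV S.le_α hadm, scale_coeffSeq hv (le_of_lt ht0),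
      convB, if_neg hk, inner_leray k _ he]

lemma eq_sol (S : Setting K δ lam σ α u₀ f) (h : Approx S.le_α K δ σ u₀ f a A) {v : ℝ → H}
    {W : ℝ → V} (hw : IsWeakSolution f v W) (hv0 : v 0 = u₀) (hv : ContinuousInDomain α v) {t : ℝ}
    (ht : 0 ≤ t) : v t = sol S.le_α a t := by
  have hc := continuous_coeffSeq hv
  have h0 : coeffSeq α v 0 = a 0 := by
    ext1; funext k
    rw [h.mild.eq 0 le_rfl k (mem_univ k), coeffSeq, max_self, hv0, initSeq, duh]; simp
  have h1 := S.eq_of_mild hc h.mild.continuous h0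
    (fun t ht k => S.mild_of_isPrim hc (adm_coeffSeq α v)
      (fun k hk e he T hT => S.isPrim_coeffSeq hw hv hk he hT) ht k)
    (fun t ht k => S.mild_of_isPrim h.mild.continuous h.mild.adm
      (fun k hk e he T hT => S.isPrim_modeV h hk he hT.le) ht k) ht
  rw [← sol_coeffSeq S.le_α hv ht]
  simp only [sol, h1]

end Setting

end NSE

end

theorem mainTheorem5 :
    (∃ K : ℝ, 1 < K ∧ NSE.BilinearBound K) ∧
    ∀ K : ℝ, 1 < K → NSE.BilinearBound K →
    ∀ δ lam σ α : ℝ, 0 < δ → δ < 1 → 1 - δ < lam → lam ≤ 1 → 0 ≤ σ → 1 / 2 ≤ α →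
    ∀ (u₀ : NSE.H) (f : ℝ → NSE.H),
      NSE.MemLpLoc ⊤ f →
      NSE.gevreyNorm α 0 u₀ ≤ ENNReal.ofReal (NSE.C0 K α δ σ) →
      (∀ t : ℝ, 0 ≤ t → NSE.gevreyNorm (α - 1 / 2) σ (f t) ≤
        ENNReal.ofReal (NSE.C1 K α δ lam σ * Real.exp (-lam * t))) →
      ∃ u : ℝ → NSE.H,
        NSE.IsLerayHopf f u ∧ u 0 = u₀ ∧ NSE.ContinuousInDomain α u ∧
        (∀ (v : ℝ → NSE.H) (W : ℝ → NSE.V), NSE.IsWeakSolution f v W → v 0 = u₀ →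
          NSE.ContinuousInDomain α v → ∀ t : ℝ, 0 ≤ t → v t = u t) ∧
        (∀ t : ℝ, 6 * σ / δ ≤ t → NSE.gevreyNorm α σ (u t) ≤
          ENNReal.ofReal (Real.sqrt 2 * NSE.C0 K α δ σ * Real.exp (-(1 - δ) * t))) ∧
        (∀ t : ℝ, 6 * σ / δ ≤ t →
          ∫⁻ τ in Set.Icc t (t + 1), (NSE.gevreyNorm (α + 1 / 2) σ (u τ)) ^ 2 ≤
            ENNReal.ofReal (3 * NSE.C0 K α δ σ ^ 2 / (2 * (1 - δ)) *
              Real.exp (-2 * (1 - δ) * t))) := by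
  refine ⟨NSE.exists_bilinearBound, fun K hK hKB δ lam σ α h1 h2 h3 h4 h5 h6 u₀ f hf hu₀ hft => ?_⟩
  have S : NSE.Setting K δ lam σ α u₀ f := ⟨hK, hKB, h1, h2, h3, h4, h5, h6, hf, hu₀, hft⟩
  obtain ⟨a, A, h⟩ := S.exists_approx
  exact ⟨NSE.sol S.le_α a, S.isLerayHopf h, S.sol_zero h,
    NSE.continuousInDomain_sol S.le_α h.mild.continuous h.mild.adm,
    fun v W hw hv0 hv t ht => S.eq_sol h hw hv0 hv ht,
    fun t ht => S.gevrey_sol_le h ht, fun t ht => S.lintegral_gevrey_sol_le h ht⟩
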